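/- Let $C$ be a smooth manifold (Hausdorff, $\sigma$-compact, of finite dimension) and $E\to C$ a smooth real vector bundle of finite rank. Let $A=\bigoplus_j A^j$, $A^j=\Gamma(C,\wedge^jE)$, be the graded commutative algebra of smooth sections of the exterior algebra of $E$, and let $B=\Gamma(C,S(E^*))=\bigoplus_q\Gamma(C,S^qE^*)$ be the algebra of smooth functions on $E$ that are polynomial (of bounded degree) along the fibres, concentrated in degree $0$. For a graded commutative $\mathbb R$-algebra $R$, let $\mathrm{Der}(R)=\bigoplus_d\mathrm{Der}^d(R)$ be the graded $R$-module of graded derivations, $D(ab)=D(a)b+(-1)^{d|a|}aD(b)$ for $D\in\mathrm{Der}^d(R)$, and let $S_R(\mathrm{Der}(R)[-1])$ be the graded symmetric algebra over $R$, in which an element of $\mathrm{Der}^d(R)$ has degree $d+1$. Put $\mathcal T(R)=S_R(\mathrm{Der}(R)[-1])[1]$ and let $\deg$ denote the degree in $\mathcal T(R)$. For $R=A$ and $R=B$ there is a unique bilinear bracket making $S_R(\mathrm{Der}(R)[-1])$ a Gerstenhaber algebra, i.e. a graded commutative algebra such that $\mathcal T(R)$ is a graded Lie algebra with bracket of degree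 $0$ satisfying $$[\alpha\beta,\gamma]=\alpha[\beta,\gamma]+(-1)^{(\deg\beta+1)\deg\gamma}[\alpha,\gamma]\beta,$$ and such that $[a,b]=0$, $[D,a]=D(a)$ and $[D,D']=D D'-(-1)^{|D||D'|}D'D$ for $a,b\in R$ and homogeneous derivations $D,D'$. For sections $\psi$ of $E^*$ and $\theta$ of $E$ let $\iota_\psi\in\mathrm{Der}^{-1}(A)$ be inner multiplication by $\psi$, and let $\iota_\theta\in\mathrm{Der}^0(B)$ be the derivation with $\iota_\theta f=0$ for $f\in C^\infty(C)$ and $\iota_\theta\psi=\langle\psi,\theta\rangle$. For a connection $\nabla$ on $E$ and a vector field $\xi$ on $C$ let $\nabla_\xi\in\mathrm{Der}^0(A)$ be the derivation given by $\xi$ on $C^\infty(C)$ and by $\nabla_\xi$ on $\Gamma(C,E)$, and let $\nabla^*_\xi\in\mathrm{Der}^0(B)$ be the derivation given by $\xi$ on $C^\infty(C)$ and by the dual connection on $\Gamma(C,E^*)$. These derivations exist and are unique, and $E$ has a connection. **Theorem (Fourier transform).** For each choice of sign $\varepsilon\in\{1,-1\}$ there is an isomorphism of Gerstenhaber algebras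 $$\Phi\colon S_A(\mathrm{Der}(A)[-1])\to S_B(\mathrm{Der}(B)[-1])$$ such that, for every connection $\nabla$ on $E$, $\Phi$ is the unique homomorphism of $\mathbb R$-algebras with $$f\mapsto f,\qquad \theta\mapsto-\varepsilon\,\iota_\theta,\qquad \iota_\psi\mapsto\varepsilon\,\psi,\qquad \nabla_\xi\mapsto\nabla^*_\xi$$ for all $f\in C^\infty(C)$, $\theta\in\Gamma(C,E)$, $\psi\in\Gamma(C,E^*)$ and all vector fields $\xi$ on $C$. In particular $\Phi$ does not depend on $\nabla$, and it is an isomorphism of graded Lie algebras $\mathcal T(A)\cong\mathcal T(B)$. -/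

import Mathlib

open scoped Manifold ContDiff Bundle Topology

noncomputable section

/-! ### Graded derivations, graded symmetric algebras and Schouten brackets -/

section Algebra

/-- The sign `(-1)^n`, for an integer `n`. -/
def koszul (n : ℤ) : ℝ := ((Int.negOnePow n : ℤ) : ℝ)

/-- The shift `V[n]` of a graded module: `V[n]^j = V^{n+j}`. -/
def shift {V : Type*} [AddCommGroup V] [Module ℝ V] (𝒱 : ℤ → Submodule ℝ V) (n : ℤ) :
    ℤ → Submodule ℝ V :=
  fun j ↦ 𝒱 (n + j)

variable {A : Type*} [Ring A] [Algebra ℝ A] (𝒜 : ℤ → Submodule ℝ A)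

/-- `Der^d(A)`: the linear maps `D : A → A` of degree `d` such that
`D(ab) = D(a)b + (-1)^{d|a|} a D(b)`. -/
def gradedDer (d : ℤ) : Submodule ℝ (A →ₗ[ℝ] A) where
  carrier := {D | (∀ i, ∀ a ∈ 𝒜 i, D a ∈ 𝒜 (d + i)) ∧
    ∀ i, ∀ a ∈ 𝒜 i, ∀ b, D (a * b) = D a * b + koszul (d * i) • (a * D b)}
  add_mem' {D D'} h h' := by
    refine ⟨fun i a ha ↦ add_mem (h.1 i a ha) (h'.1 i a ha), fun i a ha b ↦ ?_⟩
    simp only [LinearMap.add_apply, h.2 i a ha, h'.2 i a ha, add_mul, mul_add, smul_add]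
    abel
  zero_mem' := ⟨fun i a _ ↦ by simp, fun i a _ b ↦ by simp⟩
  smul_mem' r D h := by
    refine ⟨fun i a ha ↦ Submodule.smul_mem _ r (h.1 i a ha), fun i a ha b ↦ ?_⟩
    simp only [LinearMap.smul_apply, h.2 i a ha, smul_add, smul_mul_assoc, mul_smul_comm]
    rw [smul_comm]

/-- The graded commutator `D D' - (-1)^{dd'} D' D`. -/
def gradedCommutator (d d' : ℤ) (D D' : A →ₗ[ℝ] A) : A →ₗ[ℝ] A :=
  D ∘ₗ D' - koszul (d * d') • (D' ∘ₗ D)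

theorem koszul_add (m n : ℤ) : koszul (m + n) = koszul m * koszul n := by
  simp [koszul, Int.negOnePow_add]

theorem koszul_mul_self (n : ℤ) : koszul n * koszul n = 1 := by
  rw [← koszul_add]
  simp [koszul, Int.negOnePow_even (n + n) ⟨n, rfl⟩]

theorem gradedCommutator_mem {d d' : ℤ} {D D' : A →ₗ[ℝ] A}
    (h : D ∈ gradedDer 𝒜 d) (h' : D' ∈ gradedDer 𝒜 d') :
    gradedCommutator d d' D D' ∈ gradedDer 𝒜 (d + d') := by
  refine ⟨fun i a ha ↦ ?_, fun i a ha b ↦ ?_⟩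
  · refine sub_mem ?_ (Submodule.smul_mem _ _ ?_)
    · have := h.1 _ _ (h'.1 i a ha)
      rwa [← add_assoc] at this
    · have := h'.1 _ _ (h.1 i a ha)
      rwa [← add_assoc, add_comm d' d] at this
  · have e1 : koszul (d * (d' + i)) = koszul (d * d') * koszul (d * i) := by
      rw [← koszul_add]; ring_nf
    have e2 : koszul (d' * (d + i)) = koszul (d * d') * koszul (d' * i) := by
      rw [← koszul_add]; ring_nf
    have e3 : koszul ((d + d') * i) = koszul (d * i) * koszul (d' * i) := by
      rw [← koszul_add]; ring_nf
    simp only [gradedCommutator, LinearMap.sub_apply, LinearMap.comp_apply, LinearMap.smul_apply,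
      h.2 i a ha, h'.2 i a ha, map_add, map_smul, h.2 _ _ (h'.1 i a ha), h'.2 _ _ (h.1 i a ha),
      e1, e2, e3, smul_add, sub_mul, mul_sub, smul_sub, smul_mul_assoc, mul_smul_comm, smul_smul]
    have e4 : koszul (d * d') * (koszul (d * d') * koszul (d' * i)) = koszul (d' * i) := by
      rw [← mul_assoc, koszul_mul_self, one_mul]
    have e5 : koszul (d * i) * koszul (d' * i) * koszul (d * d') =
      koszul (d * d') * (koszul (d' * i) * koszul (d * i)) := by ring
    have e6 : koszul (d' * i) * koszul (d * i) = koszul (d * i) * koszul (d' * i) := by ring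
    rw [e4, e5, e6]
    abel

/-! The graded symmetric algebra `S_A(M)` of a graded left module `M = ⊕ M^j` over a graded
commutative algebra `A`. -/

variable {N : Type*} [AddCommGroup N] [Module ℝ N] [Module A N] (ℳ : ℤ → Submodule ℝ N)

/-- Generators of `S_A(M)`: the elements of `A` and the homogeneous elements of `M`. -/
inductive SymGen : Type _
  | coeff (a : A) : SymGen
  | elem (j : ℤ) (m : ℳ j) : SymGen

/-- Relations of `S_A(M)`: `A → S_A(M)` is an algebra morphism, `M → S_A(M)` is linear over `ℝ`
and over `A`, and homogeneous elements commute up to the Koszul sign. -/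
inductive SymRel :
    FreeAlgebra ℝ (SymGen (A := A) ℳ) → FreeAlgebra ℝ (SymGen (A := A) ℳ) → Prop
  | coeff_one : SymRel (FreeAlgebra.ι ℝ (.coeff 1)) 1
  | coeff_add (a b : A) : SymRel (FreeAlgebra.ι ℝ (.coeff (a + b)))
      (FreeAlgebra.ι ℝ (.coeff a) + FreeAlgebra.ι ℝ (.coeff b))
  | coeff_smul (r : ℝ) (a : A) : SymRel (FreeAlgebra.ι ℝ (.coeff (r • a)))
      (r • FreeAlgebra.ι ℝ (.coeff a))
  | coeff_mul (a b : A) : SymRel (FreeAlgebra.ι ℝ (.coeff (a * b)))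
      (FreeAlgebra.ι ℝ (.coeff a) * FreeAlgebra.ι ℝ (.coeff b))
  | elem_add (j : ℤ) (m m' : ℳ j) : SymRel (FreeAlgebra.ι ℝ (.elem j (m + m')))
      (FreeAlgebra.ι ℝ (.elem j m) + FreeAlgebra.ι ℝ (.elem j m'))
  | elem_smul (j : ℤ) (r : ℝ) (m : ℳ j) : SymRel (FreeAlgebra.ι ℝ (.elem j (r • m)))
      (r • FreeAlgebra.ι ℝ (.elem j m))
  | coeff_smul_elem (i j k : ℤ) (hk : k = i + j) (a : A) (_ : a ∈ 𝒜 i) (m : ℳ j) (am : ℳ k)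
      (_ : (am : N) = a • (m : N)) : SymRel (FreeAlgebra.ι ℝ (.elem k am))
      (FreeAlgebra.ι ℝ (.coeff a) * FreeAlgebra.ι ℝ (.elem j m))
  | elem_comm_coeff (i j : ℤ) (a : A) (_ : a ∈ 𝒜 i) (m : ℳ j) :
      SymRel (FreeAlgebra.ι ℝ (.elem j m) * FreeAlgebra.ι ℝ (.coeff a))
      (koszul (j * i) • (FreeAlgebra.ι ℝ (.coeff a) * FreeAlgebra.ι ℝ (.elem j m)))
  | elem_comm_elem (i j : ℤ) (m : ℳ i) (m' : ℳ j) :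
      SymRel (FreeAlgebra.ι ℝ (.elem i m) * FreeAlgebra.ι ℝ (.elem j m'))
      (koszul (i * j) • (FreeAlgebra.ι ℝ (.elem j m') * FreeAlgebra.ι ℝ (.elem i m)))

/-- The graded symmetric algebra `S_A(M)`. -/
abbrev GradedSym := RingQuot (SymRel 𝒜 ℳ)

/-- The class in `S_A(M)` of an element of `A`. -/
def GradedSym.coeff (a : A) : GradedSym 𝒜 ℳ :=
  RingQuot.mkAlgHom ℝ (SymRel 𝒜 ℳ) (FreeAlgebra.ι ℝ (.coeff a))

/-- The class in `S_A(M)` of an element of `M^j`. -/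
def GradedSym.elem (j : ℤ) (m : ℳ j) : GradedSym 𝒜 ℳ :=
  RingQuot.mkAlgHom ℝ (SymRel 𝒜 ℳ) (FreeAlgebra.ι ℝ (.elem j m))

/-- `x` is a product of homogeneous generators whose degrees add up to `k`. -/
inductive GradedSym.IsMonomial : ℤ → GradedSym 𝒜 ℳ → Prop
  | one : IsMonomial 0 1
  | coeff_mul (i k : ℤ) (a : A) (x : GradedSym 𝒜 ℳ) : a ∈ 𝒜 i → IsMonomial k x →
      IsMonomial (i + k) (GradedSym.coeff 𝒜 ℳ a * x)
  | elem_mul (j k : ℤ) (m : ℳ j) (x : GradedSym 𝒜 ℳ) : IsMonomial k x →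
      IsMonomial (j + k) (GradedSym.elem 𝒜 ℳ j m * x)

/-- The component of degree `k` of `S_A(M)`. -/
def GradedSym.grade (k : ℤ) : Submodule ℝ (GradedSym 𝒜 ℳ) :=
  Submodule.span ℝ {x | GradedSym.IsMonomial 𝒜 ℳ k x}

/-- The underlying algebra of `S_A(Der(A)[-1])`. The `A`-module structure on `Der(A)` is
`(aD)(b) = a D(b)`. -/
abbrev MultiDer := GradedSym 𝒜 (shift (gradedDer 𝒜) (-1))

/-- An element of `A`, viewed in `S_A(Der(A)[-1])`. -/
def MultiDer.fn (a : A) : MultiDer 𝒜 := GradedSym.coeff 𝒜 (shift (gradedDer 𝒜) (-1)) a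

/-- A derivation of degree `d`, viewed as an element of degree `d + 1` of
`S_A(Der(A)[-1])`. -/
def MultiDer.der (d : ℤ) (D : A →ₗ[ℝ] A) (hD : D ∈ gradedDer 𝒜 d) : MultiDer 𝒜 :=
  GradedSym.elem 𝒜 (shift (gradedDer 𝒜) (-1)) (d + 1)
    ⟨D, by simpa [shift, add_comm] using hD⟩

/-- The component of degree `k` of `S_A(Der(A)[-1])`. -/
abbrev MultiDer.grade (k : ℤ) : Submodule ℝ (MultiDer 𝒜) :=
  GradedSym.grade 𝒜 (shift (gradedDer 𝒜) (-1)) k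

/-- The component of degree `p` of `T(A) = S_A(Der(A)[-1])[1]`. -/
abbrev MultiDer.lieGrade : ℤ → Submodule ℝ (MultiDer 𝒜) := shift (MultiDer.grade 𝒜) 1

/-- `G = ⊕ G^k` with the bracket `br` is a Gerstenhaber algebra: a graded commutative algebra with
a graded Lie bracket on `T = G[1]` which is compatible with the product. The degrees `p, q, r` are
those of `T`. -/
structure IsGerstenhaber {G : Type*} [Ring G] [Algebra ℝ G] (𝒢 : ℤ → Submodule ℝ G)
    (br : G →ₗ[ℝ] G →ₗ[ℝ] G) : Prop where
  internal : DirectSum.IsInternal 𝒢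
  one_mem : (1 : G) ∈ 𝒢 0
  mul_mem : ∀ i j, ∀ α ∈ 𝒢 i, ∀ β ∈ 𝒢 j, α * β ∈ 𝒢 (i + j)
  mul_comm : ∀ i j, ∀ α ∈ 𝒢 i, ∀ β ∈ 𝒢 j, α * β = koszul (i * j) • (β * α)
  bracket_mem : ∀ p q, ∀ α ∈ shift 𝒢 1 p, ∀ β ∈ shift 𝒢 1 q, br α β ∈ shift 𝒢 1 (p + q)
  antisymm : ∀ p q, ∀ α ∈ shift 𝒢 1 p, ∀ β ∈ shift 𝒢 1 q,
    br α β = -(koszul (p * q) • br β α)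
  jacobi : ∀ p q r, ∀ α ∈ shift 𝒢 1 p, ∀ β ∈ shift 𝒢 1 q, ∀ γ ∈ shift 𝒢 1 r,
    koszul (p * r) • br (br α β) γ + koszul (q * p) • br (br β γ) α +
      koszul (r * q) • br (br γ α) β = 0
  leibniz : ∀ p q r, ∀ α ∈ shift 𝒢 1 p, ∀ β ∈ shift 𝒢 1 q, ∀ γ ∈ shift 𝒢 1 r,
    br (α * β) γ = α * br β γ + koszul ((q + 1) * r) • (br α γ * β)

/-- `br` makes `S_A(Der(A)[-1])` a Gerstenhaber algebra and extends the action of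
derivations on `A` and the graded commutator of derivations. -/
structure IsSchoutenBracket (br : MultiDer 𝒜 →ₗ[ℝ] MultiDer 𝒜 →ₗ[ℝ] MultiDer 𝒜) : Prop where
  gerstenhaber : IsGerstenhaber (MultiDer.grade 𝒜) br
  fn_fn : ∀ a b, br (MultiDer.fn 𝒜 a) (MultiDer.fn 𝒜 b) = 0
  der_fn : ∀ d D (hD : D ∈ gradedDer 𝒜 d) a,
    br (MultiDer.der 𝒜 d D hD) (MultiDer.fn 𝒜 a) = MultiDer.fn 𝒜 (D a)
  der_der : ∀ d d' D D' (hD : D ∈ gradedDer 𝒜 d) (hD' : D' ∈ gradedDer 𝒜 d'),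
    br (MultiDer.der 𝒜 d D hD) (MultiDer.der 𝒜 d' D' hD') =
      MultiDer.der 𝒜 (d + d') (gradedCommutator d d' D D') (gradedCommutator_mem 𝒜 hD hD')

/-- `Φ` is an isomorphism of Gerstenhaber algebras. -/
structure IsGerstenhaberIso {G G' : Type*} [Ring G] [Algebra ℝ G] [Ring G'] [Algebra ℝ G']
    (𝒢 : ℤ → Submodule ℝ G) (br : G →ₗ[ℝ] G →ₗ[ℝ] G)
    (𝒢' : ℤ → Submodule ℝ G') (br' : G' →ₗ[ℝ] G' →ₗ[ℝ] G') (Φ : G ≃ₐ[ℝ] G') : Prop where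
  map_grade : ∀ k, (𝒢 k).map Φ.toLinearMap = 𝒢' k
  map_bracket : ∀ α β, Φ (br α β) = br' (Φ α) (Φ β)

/-- `Ψ` is an isomorphism of graded Lie algebras. -/
structure IsGradedLieIso {L L' : Type*} [AddCommGroup L] [Module ℝ L] [AddCommGroup L'] [Module ℝ L']
    (ℒ : ℤ → Submodule ℝ L) (br : L →ₗ[ℝ] L →ₗ[ℝ] L)
    (ℒ' : ℤ → Submodule ℝ L') (br' : L' →ₗ[ℝ] L' →ₗ[ℝ] L') (Ψ : L ≃ₗ[ℝ] L') : Prop where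
  map_grade : ∀ k, (ℒ k).map Ψ.toLinearMap = ℒ' k
  map_bracket : ∀ α β, Ψ (br α β) = br' (Ψ α) (Ψ β)

end Algebra

/-! ### Smooth sections of `⋀E`, of `E*` and of `S(E*)` -/

section Bundle

variable {n : ℕ} {C : Type*} [TopologicalSpace C] [ChartedSpace (EuclideanSpace ℝ (Fin n)) C]

/-- Near `x₀`, the function `g` is a smooth function with values in a finite-dimensional subspace
of `W`. -/
def SmoothCoeffAt {W : Type*} [AddCommGroup W] [Module ℝ W] (g : C → W) (x₀ : C) : Prop :=
  ∃ (k : ℕ) (w : Fin k → W) (c : Fin k → C → ℝ),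
    (∀ i, ContMDiffAt (𝓡 n) 𝓘(ℝ, ℝ) ∞ (c i) x₀) ∧ ∀ᶠ y in 𝓝 x₀, g y = ∑ i, c i y • w i

namespace SmoothCoeffAt

section
variable {W : Type*} [AddCommGroup W] [Module ℝ W] {g g' : C → W} {x₀ : C}

theorem const_smul_fun (w : W) {f : C → ℝ} (hf : ContMDiffAt (𝓡 n) 𝓘(ℝ, ℝ) ∞ f x₀) :
    SmoothCoeffAt (n := n) (fun y ↦ f y • w) x₀ :=
  ⟨1, fun _ ↦ w, fun _ ↦ f, fun _ ↦ hf, by simp⟩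

theorem add (h : SmoothCoeffAt (n := n) g x₀) (h' : SmoothCoeffAt (n := n) g' x₀) :
    SmoothCoeffAt (n := n) (fun y ↦ g y + g' y) x₀ := by
  obtain ⟨k, w, c, hc, e⟩ := h
  obtain ⟨k', w', c', hc', e'⟩ := h'
  refine ⟨k + k', Fin.append w w', Fin.append c c', fun i ↦ ?_, ?_⟩
  · refine Fin.addCases (fun i ↦ ?_) (fun i ↦ ?_) i
    · simpa using hc i
    · simpa using hc' i
  · filter_upwards [e, e'] with y hy hy'
    simp [Fin.sum_univ_add, hy, hy']

theorem congr (h : SmoothCoeffAt (n := n) g x₀) (e : ∀ᶠ y in 𝓝 x₀, g' y = g y) :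
    SmoothCoeffAt (n := n) g' x₀ := by
  obtain ⟨k, w, c, hc, e'⟩ := h
  refine ⟨k, w, c, hc, ?_⟩
  filter_upwards [e, e'] with y hy hy'
  rw [hy, hy']

theorem sum {ι : Type*} (s : Finset ι) {G : ι → C → W}
    (h : ∀ i ∈ s, SmoothCoeffAt (n := n) (G i) x₀) :
    SmoothCoeffAt (n := n) (fun y ↦ ∑ i ∈ s, G i y) x₀ := by
  classical
  induction s using Finset.induction_on with
  | empty => exact ⟨0, Fin.elim0, Fin.elim0, fun i ↦ i.elim0, by simp⟩
  | insert i s hi ih =>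
    simp only [Finset.sum_insert hi]
    exact (h i (by simp)).add (ih fun j hj ↦ h j (by simp [hj]))

theorem map {W' : Type*} [AddCommGroup W'] [Module ℝ W'] (L : W →ₗ[ℝ] W')
    (h : SmoothCoeffAt (n := n) g x₀) : SmoothCoeffAt (n := n) (fun y ↦ L (g y)) x₀ := by
  obtain ⟨k, w, c, hc, e⟩ := h
  refine ⟨k, fun i ↦ L (w i), c, hc, ?_⟩
  filter_upwards [e] with y hy
  simp [hy]

end

theorem mul {W : Type*} [Ring W] [Algebra ℝ W] {g g' : C → W} {x₀ : C}
    (h : SmoothCoeffAt (n := n) g x₀) (h' : SmoothCoeffAt (n := n) g' x₀) :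
    SmoothCoeffAt (n := n) (fun y ↦ g y * g' y) x₀ := by
  obtain ⟨k, w, c, hc, e⟩ := h
  obtain ⟨k', w', c', hc', e'⟩ := h'
  have key : SmoothCoeffAt (n := n)
      (fun y ↦ ∑ i, ∑ j, (c i y * c' j y) • (w i * w' j)) x₀ :=
    sum _ fun i _ ↦ sum _ fun j _ ↦ const_smul_fun _ ((hc i).mul (hc' j))
  refine key.congr ?_
  filter_upwards [e, e'] with y hy hy'
  rw [hy, hy', Finset.sum_mul_sum]
  exact Finset.sum_congr rfl fun i _ ↦ Finset.sum_congr rfl fun j _ ↦ smul_mul_smul_comm ..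

end SmoothCoeffAt

variable (F : Type*) [NormedAddCommGroup F] [NormedSpace ℝ F]
  (E : C → Type*) [∀ x, AddCommGroup (E x)] [∀ x, Module ℝ (E x)] [∀ x, TopologicalSpace (E x)]
  [TopologicalSpace (Bundle.TotalSpace F E)] [FiberBundle F E] [VectorBundle ℝ F E]

/-- The map `⋀E_y → ⋀F` induced by the local trivialization of `E` at `x₀`. -/
def extTriv (x₀ y : C) : ExteriorAlgebra ℝ (E y) →ₐ[ℝ] ExteriorAlgebra ℝ F :=
  ExteriorAlgebra.map ((trivializationAt F E x₀).linearMapAt ℝ y)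

/-- The map `E_y* → F*` induced by the local trivialization of `E` at `x₀`. -/
def dualTriv (x₀ y : C) : Module.Dual ℝ (E y) →ₗ[ℝ] Module.Dual ℝ F :=
  ((trivializationAt F E x₀).symmₗ ℝ y).dualMap

/-- The map `S(E_y*) → S(F*)` induced by the local trivialization of `E` at `x₀`. -/
def symTriv (x₀ y : C) :
    SymmetricAlgebra ℝ (Module.Dual ℝ (E y)) →ₐ[ℝ] SymmetricAlgebra ℝ (Module.Dual ℝ F) :=
  SymmetricAlgebra.lift (SymmetricAlgebra.ι ℝ (Module.Dual ℝ F) ∘ₗ dualTriv F E x₀ y)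

variable (n)

/-- The algebra `A = Γ(C, ⋀E)`. -/
def extSections : Subalgebra ℝ (Π x : C, ExteriorAlgebra ℝ (E x)) where
  carrier := {s | ∀ x₀, SmoothCoeffAt (n := n) (fun y ↦ extTriv F E x₀ y (s y)) x₀}
  mul_mem' h h' x₀ := by simpa using (h x₀).mul (h' x₀)
  add_mem' h h' x₀ := by simpa using (h x₀).add (h' x₀)
  algebraMap_mem' r x₀ := by
    simpa [Algebra.algebraMap_eq_smul_one] using
      SmoothCoeffAt.const_smul_fun (n := n) (1 : ExteriorAlgebra ℝ F) (x₀ := x₀)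
        (f := fun _ : C ↦ r) contMDiffAt_const

/-- The elements of degree at most `d` of the symmetric algebra `S(V)`. -/
def symDegreeLE (V : Type*) [AddCommGroup V] [Module ℝ V] (d : ℕ) :
    Submodule ℝ (SymmetricAlgebra ℝ V) :=
  (1 ⊔ LinearMap.range (SymmetricAlgebra.ι ℝ V)) ^ d

theorem symDegreeLE_mono {V : Type*} [AddCommGroup V] [Module ℝ V] {d d' : ℕ} (h : d ≤ d') :
    symDegreeLE V d ≤ symDegreeLE V d' :=
  pow_le_pow_right₀ le_sup_left h

/-- The algebra `B = Γ(C, S(E*)) = ⊕ Γ(C, S^q(E*))` of smooth functions on `E` which are polynomial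
(of bounded degree) along the fibres. -/
def symSections : Subalgebra ℝ (Π x : C, SymmetricAlgebra ℝ (Module.Dual ℝ (E x))) where
  carrier := {s | (∀ x₀, SmoothCoeffAt (n := n) (fun y ↦ symTriv F E x₀ y (s y)) x₀) ∧
    ∃ d, ∀ x, s x ∈ symDegreeLE (Module.Dual ℝ (E x)) d}
  mul_mem' {s t} h h' := by
    refine ⟨fun x₀ ↦ by simpa using (h.1 x₀).mul (h'.1 x₀), ?_⟩
    obtain ⟨d, hd⟩ := h.2
    obtain ⟨d', hd'⟩ := h'.2
    refine ⟨d + d', fun x ↦ ?_⟩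
    rw [symDegreeLE, pow_add]
    exact Submodule.mul_mem_mul (hd x) (hd' x)
  add_mem' {s t} h h' := by
    refine ⟨fun x₀ ↦ by simpa using (h.1 x₀).add (h'.1 x₀), ?_⟩
    obtain ⟨d, hd⟩ := h.2
    obtain ⟨d', hd'⟩ := h'.2
    exact ⟨max d d', fun x ↦ add_mem (symDegreeLE_mono (le_max_left _ _) (hd x))
      (symDegreeLE_mono (le_max_right _ _) (hd' x))⟩
  algebraMap_mem' r := by
    refine ⟨fun x₀ ↦ ?_, 0, fun x ↦ ?_⟩
    · simpa [Algebra.algebraMap_eq_smul_one] using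
        SmoothCoeffAt.const_smul_fun (n := n)
          (1 : SymmetricAlgebra ℝ (Module.Dual ℝ F)) (x₀ := x₀)
          (f := fun _ : C ↦ r) contMDiffAt_const
    · rw [symDegreeLE, pow_zero]
      exact ⟨r, (Algebra.algebraMap_eq_smul_one r).symm⟩

/-- The grading `A^j = Γ(C, ⋀^j E)`. -/
def extGrade : ℤ → Submodule ℝ (extSections n F E)
  | .ofNat j =>
    { carrier := {a | ∀ x, (a : Π x, ExteriorAlgebra ℝ (E x)) x ∈ ⋀[ℝ]^j (E x)}
      add_mem' := fun h h' x ↦ add_mem (h x) (h' x)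
      zero_mem' := fun _ ↦ zero_mem _
      smul_mem' := fun r _ h x ↦ Submodule.smul_mem _ r (h x) }
  | .negSucc _ => ⊥

/-- The grading of `B`, concentrated in degree zero. -/
def symGrade (j : ℤ) : Submodule ℝ (symSections n F E) := if j = 0 then ⊤ else ⊥

/-- The vector space `Γ(C, E*)`. -/
structure DualSection where
  toFun : Π x : C, Module.Dual ℝ (E x)
  smooth : ∀ x₀, SmoothCoeffAt (n := n) (fun y ↦ dualTriv F E x₀ y (toFun y)) x₀

variable {F E}

/-- A smooth function on `C` as an element of `A`. -/
def extOfFun (f : C^∞⟮𝓡 n, C; 𝓘(ℝ, ℝ), ℝ⟯) : extSections n F E :=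
  ⟨fun x ↦ algebraMap ℝ _ (f x), fun x₀ ↦ by
    simpa [Algebra.algebraMap_eq_smul_one] using
      SmoothCoeffAt.const_smul_fun (n := n) (1 : ExteriorAlgebra ℝ F) (f.contMDiff x₀)⟩

/-- A smooth function on `C` as an element of `B`. -/
def symOfFun (f : C^∞⟮𝓡 n, C; 𝓘(ℝ, ℝ), ℝ⟯) : symSections n F E :=
  ⟨fun x ↦ algebraMap ℝ _ (f x), fun x₀ ↦ by
    simpa [Algebra.algebraMap_eq_smul_one] using
      SmoothCoeffAt.const_smul_fun (n := n)
        (1 : SymmetricAlgebra ℝ (Module.Dual ℝ F)) (f.contMDiff x₀),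
    0, fun x ↦ by
      rw [symDegreeLE, pow_zero]
      exact ⟨f x, (Algebra.algebraMap_eq_smul_one (f x)).symm⟩⟩

/-- A section of `E*` as an element of `B` (a fibrewise linear function on `E`). -/
def symOfDual (ψ : DualSection n F E) : symSections n F E :=
  ⟨fun x ↦ SymmetricAlgebra.ι ℝ _ (ψ.toFun x), fun x₀ ↦ by
    simpa [symTriv] using (ψ.smooth x₀).map (SymmetricAlgebra.ι ℝ (Module.Dual ℝ F)),
    1, fun x ↦ by
      rw [symDegreeLE, pow_one]
      exact Submodule.mem_sup_right ⟨_, rfl⟩⟩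

/-- A section of `E` as an element of `A`. -/
def extOfSection [FiniteDimensional ℝ F] (θ : Cₛ^∞⟮𝓡 n; F, E⟯) : extSections n F E :=
  ⟨fun x ↦ ExteriorAlgebra.ι ℝ (θ x), fun x₀ ↦ by
    have h : ContMDiffAt (𝓡 n) 𝓘(ℝ, F) ∞
        (fun y ↦ (trivializationAt F E x₀ ⟨y, θ y⟩).2) x₀ :=
      (Bundle.contMDiffAt_section x₀).1 (θ.contMDiff x₀)
    let b := Module.finBasis ℝ F
    have key : SmoothCoeffAt (n := n) (fun y ↦ ∑ i,
        (LinearMap.toContinuousLinearMap (b.coord i)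
          (trivializationAt F E x₀ ⟨y, θ y⟩).2) • ExteriorAlgebra.ι ℝ (b i)) x₀ :=
      SmoothCoeffAt.sum _ fun i _ ↦ SmoothCoeffAt.const_smul_fun _
        ((LinearMap.toContinuousLinearMap (b.coord i)).contMDiff.contMDiffAt.comp x₀ h)
    refine key.congr ?_
    filter_upwards [(trivializationAt F E x₀).open_baseSet.mem_nhds
      (FiberBundle.mem_baseSet_trivializationAt F E x₀)] with y hy
    have e : (trivializationAt F E x₀).linearMapAt ℝ y (θ y) =
        (trivializationAt F E x₀ ⟨y, θ y⟩).2 := by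
      rw [Bundle.Trivialization.coe_linearMapAt_of_mem _ hy]
    simp only [extTriv, ExteriorAlgebra.map_apply_ι, e]
    conv_lhs => rw [← b.sum_repr (trivializationAt F E x₀ ⟨y, θ y⟩).2]
    simp only [map_sum, map_smul]
    rfl⟩

variable {n}

/-- `D` is the inner multiplication `ι_ψ`, a derivation of `A` of degree `-1`. -/
structure IsExtContraction (ψ : DualSection n F E)
    (D : extSections n F E →ₗ[ℝ] extSections n F E) : Prop where
  mem : D ∈ gradedDer (extGrade n F E) (-1)
  apply : ∀ a x, (D a).1 x = CliffordAlgebra.contractLeft (Q := 0) (ψ.toFun x) (a.1 x)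

/-- `D` is the inner multiplication `ι_θ`, the derivation of `B` along the fibres with
`ι_θ(f) = 0` and `ι_θ(ψ) = ⟨ψ, θ⟩` for functions `f` on `C` and sections `ψ` of `E*`. -/
structure IsSymContraction (θ : Cₛ^∞⟮𝓡 n; F, E⟯)
    (D : symSections n F E →ₗ[ℝ] symSections n F E) : Prop where
  mem : D ∈ gradedDer (symGrade n F E) 0
  map_fun : ∀ f, D (symOfFun n f) = 0
  map_dual : ∀ ψ x, (D (symOfDual n ψ)).1 x = algebraMap ℝ _ (ψ.toFun x (θ x))

section Connection

variable [IsManifold (𝓡 n) ∞ C] [∀ x, IsTopologicalAddGroup (E x)] [∀ x, ContinuousSMul ℝ (E x)]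
  [FiniteDimensional ℝ F]

/-- `D` is the derivation `∇_ξ` of `A` of degree `0` induced by a connection on `E`: it is given by
`ξ` on functions and by `∇_ξ` on sections of `E`. -/
structure IsExtCovariant (cov : CovariantDerivative (𝓡 n) F E)
    (ξ : Cₛ^∞⟮𝓡 n; EuclideanSpace ℝ (Fin n), (TangentSpace (𝓡 n) : C → Type _)⟯)
    (D : extSections n F E →ₗ[ℝ] extSections n F E) : Prop where
  mem : D ∈ gradedDer (extGrade n F E) 0
  map_fun : ∀ f x, (D (extOfFun n f)).1 x =
    algebraMap ℝ _ (mvfderiv (𝓡 n) (fun y ↦ f y) x (ξ x))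
  map_section : ∀ θ x, (D (extOfSection n θ)).1 x = ExteriorAlgebra.ι ℝ (cov (fun y ↦ θ y) x (ξ x))

/-- `D` is the derivation `∇*_ξ` of `B` induced by a connection on `E`: it is given by `ξ` on
functions and by the dual connection
`⟨∇*_ξ ψ, θ⟩ = ξ⟨ψ, θ⟩ - ⟨ψ, ∇_ξ θ⟩` on sections of `E*`. -/
structure IsSymCovariant (cov : CovariantDerivative (𝓡 n) F E)
    (ξ : Cₛ^∞⟮𝓡 n; EuclideanSpace ℝ (Fin n), (TangentSpace (𝓡 n) : C → Type _)⟯)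
    (D : symSections n F E →ₗ[ℝ] symSections n F E) : Prop where
  mem : D ∈ gradedDer (symGrade n F E) 0
  map_fun : ∀ f x, (D (symOfFun n f)).1 x =
    algebraMap ℝ _ (mvfderiv (𝓡 n) (fun y ↦ f y) x (ξ x))
  map_dual : ∀ ψ, ∃ ψ' : DualSection n F E, D (symOfDual n ψ) = symOfDual n ψ' ∧
    ∀ (θ : Cₛ^∞⟮𝓡 n; F, E⟯) x, ψ'.toFun x (θ x) =
      mvfderiv (𝓡 n) (fun y ↦ ψ.toFun y (θ y)) x (ξ x) - ψ.toFun x (cov (fun y ↦ θ y) x (ξ x))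

/-- The Fourier transform rules, for the connection `cov` and the sign `ε`: functions on `C` are
fixed, `θ ↦ -ε ι_θ` for sections `θ` of `E`, `ι_ψ ↦ ε ψ` for sections `ψ` of `E*`, and
`∇_ξ ↦ ∇*_ξ` for vector fields `ξ` on `C`. -/
structure IsFourier (ε : ℤˣ) (cov : CovariantDerivative (𝓡 n) F E)
    (Φ : MultiDer (extGrade n F E) →ₐ[ℝ] MultiDer (symGrade n F E)) : Prop where
  map_fun : ∀ f, Φ (MultiDer.fn (extGrade n F E) (extOfFun n f)) = MultiDer.fn (symGrade n F E) (symOfFun n f)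
  map_theta : ∀ θ D (hD : IsSymContraction θ D),
    Φ (MultiDer.fn (extGrade n F E) (extOfSection n θ)) = -(ε • MultiDer.der (symGrade n F E) 0 D hD.mem)
  map_psi : ∀ ψ D (hD : IsExtContraction ψ D),
    Φ (MultiDer.der (extGrade n F E) (-1) D hD.mem) = ε • MultiDer.fn (symGrade n F E) (symOfDual n ψ)
  map_nabla : ∀ ξ D D' (hD : IsExtCovariant cov ξ D) (hD' : IsSymCovariant cov ξ D'),
    Φ (MultiDer.der (extGrade n F E) 0 D hD.mem) = MultiDer.der (symGrade n F E) 0 D' hD'.mem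

end Connection

end Bundle

end

/-! Write `R` for the smooth functions on the base. Locally, multiderivations of `A` are built over
`R` from coordinates `θ` of degree 1, their partial derivatives `ι_ψ` and lifts `∇_ξ` of vector
fields; multiderivations of `B` from coordinates `ψ` of degree 0, their partial derivatives `ι_θ`
and lifts `∇*_ξ`. The shift by one puts `ι_ψ` in degree 0, `ι_θ` in degree 1 and both kinds of lifts
in degree 1. Both sides are thus the same graded commutative algebra, with coordinates and momenta
interchanged. The bracket is canonical: `[ι_ψ, θ] = ⟨ψ, θ⟩`, while `[ψ, ι_θ] = -[ι_θ, ψ] = -⟨ψ, θ⟩`.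
The exchange respects it exactly when the product of the two signs is `-1`, whence `-ε` and `ε`.

No gluing is used. A partition into `n + 1` families of small open sets (`exists_finite_coloring`)
gives finite global frames even when the base is not compact: sections `θ i`, `ψ i` with `∑ ψ_i(v)
θ_i = v` (`exists_finite_frame`), and functions `h j`, vector fields `ξ j` with `∑ dh_j ⊗ ξ_j = id`
(`exists_finite_tangent_frame`). The matrix `q = (⟨ψ_i, θ_j⟩)` is idempotent; `A` is generated over
`R` by the `θ i` with relations given by `q`, and `B` by the `ψ i` with relations given by its
transpose. `FrameAlgebra` records what is needed of such an algebra, with the frame in a degree `e`;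
the pair has `e + e' = 1`, and all later algebra treats `A` and `B` symmetrically.

In a frame algebra every derivation is `∑ D(h_j) ∇_j + ∑ D(g_k) ι_k` (`der_eq_sum`), because
derivations of smooth functions at a point are tangent vectors. The coefficients are linear in `D`
over the whole algebra, so the rules of the transform on frames define a morphism on all of
`S_A(Der(A)[-1])` (`exists_fourier`); the same construction with the roles exchanged is its inverse.

Independence of the connection comes from `IsDualPair`: derivations `D` of `A` and `D'` of `B` over
the same vector field are paired if they satisfy the Leibniz rule for `⟨ψ, θ⟩`. The transform maps
`D` to `D'` for every dual pair (`IsFourier.map_isDualPair`), and `∇_ξ`, `∇*_ξ` form one for every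
smooth connection. Dual pairs are closed under commutators, so curvature is respected as well, and
the comparison of brackets reduces to a short table on generators.

The Schouten bracket is built from generators too. Derivations of `S_A(M)` are prescribed by their
values on `A` and `M`; this gives `[a, ·]` and `[D, ·]`, then `[γ, ·]` for all `γ` by antisymmetry.
Antisymmetry and the Jacobi identity extend from generators (`isGerstenhaber_of_generators`). -/

noncomputable section

/-! ### Signs and graded algebras given by generators -/

section GradedGenerators

theorem koszul_eq (n : ℤ) : koszul n = if Even n then 1 else -1 := by
  split_ifs with h
  · simp [koszul, Int.negOnePow_even n h]
  · simp [koszul, Int.negOnePow_odd n (Int.not_even_iff_odd.1 h)]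

theorem koszul_zero : koszul 0 = 1 := by simp [koszul_eq]

theorem koszul_one : koszul 1 = -1 := by simp [koszul_eq]

variable {V W : Type*} [AddCommGroup V] [Module ℝ V] [AddCommGroup W] [Module ℝ W]

/-- The derivations needed below are characterized by their values on generators rather than given
by a formula; uniqueness makes their dependence on the data linear. -/
theorem exists_linearMap_of_unique (P : V → W → Prop)
    (add : ∀ v v' w w', P v w → P v' w' → P (v + v') (w + w'))
    (smul : ∀ (r : ℝ) v w, P v w → P (r • v) (r • w))
    (ex : ∀ v, ∃ w, P v w) (uniq : ∀ v w w', P v w → P v w' → w = w') :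
    ∃ L : V →ₗ[ℝ] W, ∀ v, P v (L v) := by
  choose f hf using ex
  exact ⟨{ toFun := f
           map_add' := fun v v' ↦ uniq _ _ _ (hf _) (add _ _ _ _ (hf _) (hf _))
           map_smul' := fun r v ↦ uniq _ _ _ (hf _) (smul _ _ _ (hf _)) }, hf⟩

/-- The relation may depend on the degree because it carries Koszul signs, so the map is found on
each component and extended to the direct sum. -/
theorem exists_linearMap_of_graded (𝒱 : ℤ → Submodule ℝ V) [DirectSum.Decomposition 𝒱]
    (P : ℤ → V → W → Prop)
    (add : ∀ k v v' w w', P k v w → P k v' w' → P k (v + v') (w + w'))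
    (smul : ∀ k (r : ℝ) v w, P k v w → P k (r • v) (r • w))
    (ex : ∀ k, ∀ v ∈ 𝒱 k, ∃ w, P k v w) (uniq : ∀ k v w w', P k v w → P k v w' → w = w') :
    ∃ L : V →ₗ[ℝ] W, ∀ k, ∀ v ∈ 𝒱 k, P k v (L v) := by
  classical
  have h (k : ℤ) : ∃ L : 𝒱 k →ₗ[ℝ] W, ∀ v : 𝒱 k, P k v (L v) :=
    exists_linearMap_of_unique (fun (v : 𝒱 k) w ↦ P k v w) (fun _ _ _ _ ↦ add _ _ _ _ _)
      (fun _ _ _ ↦ smul _ _ _ _) (fun v ↦ ex k v v.2) (fun _ _ _ ↦ uniq _ _ _ _)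
  choose L hL using h
  refine ⟨DirectSum.toModule ℝ ℤ W L ∘ₗ (DirectSum.decomposeLinearEquiv 𝒱).toLinearMap,
    fun k v hv ↦ ?_⟩
  have : (DirectSum.decomposeLinearEquiv 𝒱) v = DirectSum.lof ℝ ℤ (fun i ↦ 𝒱 i) k ⟨v, hv⟩ :=
    DirectSum.decompose_of_mem 𝒱 hv
  simpa [this] using hL k ⟨v, hv⟩

theorem exists_signMap (𝒱 : ℤ → Submodule ℝ V) [DirectSum.Decomposition 𝒱] (r : ℤ) :
    ∃ σ : V →ₗ[ℝ] V, ∀ k, ∀ v ∈ 𝒱 k, σ v = koszul (r * k) • v :=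
  exists_linearMap_of_graded 𝒱 (fun k v w ↦ w = koszul (r * k) • v)
    (by rintro k v v' _ _ rfl rfl; rw [smul_add]) (by rintro k c v _ rfl; rw [smul_comm])
    (fun k v _ ↦ ⟨_, rfl⟩) (by rintro k v _ _ rfl rfl; rfl)

/-- The linear map which is multiplication by `(-1)^{rk}` in degree `k`. -/
def signMap (𝒱 : ℤ → Submodule ℝ V) [DirectSum.Decomposition 𝒱] (r : ℤ) : V →ₗ[ℝ] V :=
  (exists_signMap 𝒱 r).choose

theorem signMap_of_mem {𝒱 : ℤ → Submodule ℝ V} [DirectSum.Decomposition 𝒱] (r : ℤ) {k : ℤ} {v : V}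
    (hv : v ∈ 𝒱 k) : signMap 𝒱 r v = koszul (r * k) • v :=
  (exists_signMap 𝒱 r).choose_spec k v hv

theorem LinearMap.ext_of_graded (𝒱 : ℤ → Submodule ℝ V) [DirectSum.Decomposition 𝒱]
    {L L' : V →ₗ[ℝ] W} (h : ∀ k, ∀ v ∈ 𝒱 k, L v = L' v) : L = L' := by
  ext v
  refine DirectSum.Decomposition.inductionOn 𝒱 (by simp) (fun m ↦ h _ _ m.2) ?_ v
  intro m m' e e'
  simp [e, e']

variable {S : Type*} [Ring S] [Algebra ℝ S]

/-- Induction on homogeneous elements of a graded algebra with homogeneous generators. -/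
theorem homogeneous_induction (𝒢 : ℤ → Submodule ℝ S) [GradedAlgebra 𝒢] {X : ℤ → Set S}
    (hX : ∀ k, ∀ x ∈ X k, x ∈ 𝒢 k) (hgen : Algebra.adjoin ℝ (⋃ k, X k) = ⊤) {P : ℤ → S → Prop}
    (one : P 0 1) (zero : ∀ k, P k 0)
    (add : ∀ k x y, x ∈ 𝒢 k → y ∈ 𝒢 k → P k x → P k y → P k (x + y))
    (smul : ∀ k (r : ℝ) x, P k x → P k (r • x))
    (mul : ∀ i k x y, x ∈ X i → y ∈ 𝒢 k → P k y → P (i + k) (x * y)) :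
    ∀ k, ∀ x ∈ 𝒢 k, P k x := by
  classical
  -- Partial sums of words in the generators need not be homogeneous, so the induction proves `P`
  -- for all components of an arbitrary element.
  have key (x : S) : ∀ k, P k (DirectSum.decompose 𝒢 x k : S) := by
    have hx : x ∈ Submodule.span ℝ (Submonoid.closure (⋃ k, X k) : Set S) := by
      rw [← Algebra.adjoin_eq_span, hgen]; trivial
    induction hx using Submodule.span_induction with
    | mem x hx =>
      have : ∃ i, x ∈ 𝒢 i ∧ P i x := by
        induction hx using Submonoid.closure_induction_left with
        | one => exact ⟨0, SetLike.one_mem_graded 𝒢, one⟩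
        | mul_left x hx y _ ih =>
          obtain ⟨i, hx⟩ := Set.mem_iUnion.1 hx
          obtain ⟨k, hk, hP⟩ := ih
          exact ⟨i + k, SetLike.mul_mem_graded (hX i x hx) hk, mul i k x y hx hk hP⟩
      obtain ⟨i, hi, hP⟩ := this
      intro k
      by_cases h : i = k
      · subst h; rwa [DirectSum.decompose_of_mem_same 𝒢 hi]
      · rw [DirectSum.decompose_of_mem_ne 𝒢 hi h]; exact zero k
    | zero => intro k; simpa using zero k
    | add x y _ _ hx hy =>
      intro k
      rw [DirectSum.decompose_add, DirectSum.add_apply, Submodule.coe_add]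
      exact add _ _ _ (Subtype.mem _) (Subtype.mem _) (hx k) (hy k)
    | smul r x _ hx =>
      intro k
      rw [DirectSum.decompose_smul, DirectSum.smul_apply, Submodule.coe_smul]
      exact smul _ _ _ (hx k)
  intro k x hx
  have := key x k
  rwa [DirectSum.decompose_of_mem_same 𝒢 hx] at this

/-- The elements of `𝒢` commute up to the Koszul sign. -/
def IsGradedComm (𝒢 : ℤ → Submodule ℝ S) : Prop :=
  ∀ i j, ∀ α ∈ 𝒢 i, ∀ β ∈ 𝒢 j, α * β = koszul (i * j) • (β * α)

theorem isGradedComm_of_generators (𝒢 : ℤ → Submodule ℝ S) [GradedAlgebra 𝒢] {X : ℤ → Set S}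
    (hX : ∀ k, ∀ x ∈ X k, x ∈ 𝒢 k) (hgen : Algebra.adjoin ℝ (⋃ k, X k) = ⊤)
    (h : ∀ i j, ∀ α ∈ X i, ∀ β ∈ X j, α * β = koszul (i * j) • (β * α)) :
    IsGradedComm 𝒢 := by
  have h1 : ∀ j, ∀ β ∈ X j, ∀ i, ∀ α ∈ 𝒢 i, α * β = koszul (i * j) • (β * α) := by
    intro j β hβ
    refine homogeneous_induction 𝒢 hX hgen (by simp [koszul_zero]) (by simp) ?_ ?_ ?_
    · intro k x y _ _ hx hy
      rw [add_mul, hx, hy, mul_add, smul_add]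
    · intro k r x hx
      rw [smul_mul_assoc, hx, mul_smul_comm, smul_comm]
    · intro i k x y hx hk hy
      rw [mul_assoc, hy, mul_smul_comm, ← mul_assoc, h i j x hx β hβ, smul_mul_assoc,
        smul_smul, mul_assoc, add_mul, koszul_add, mul_comm (koszul _)]
  intro i j α hα
  refine homogeneous_induction 𝒢 hX hgen (P := fun j β ↦ α * β = koszul (i * j) • (β * α))
    (by simp [koszul_zero]) (by simp) ?_ ?_ ?_ j
  · intro k x y _ _ hx hy
    rw [mul_add, hx, hy, add_mul, smul_add]
  · intro k r x hx
    rw [smul_mul_assoc, mul_smul_comm, hx, smul_comm]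
  · intro k l x y hx hl hy
    rw [← mul_assoc, h1 k x hx i α hα, smul_mul_assoc, mul_assoc, hy, mul_smul_comm, smul_smul,
      mul_assoc, mul_add, koszul_add]

theorem IsGradedComm.commute {𝒢 : ℤ → Submodule ℝ S} [GradedAlgebra 𝒢] (h : IsGradedComm 𝒢) {a : S}
    (ha : a ∈ 𝒢 0) (b : S) : a * b = b * a := by
  have : LinearMap.mulLeft ℝ a = LinearMap.mulRight ℝ a :=
    LinearMap.ext_of_graded 𝒢 fun k v hv ↦ by simpa [koszul_zero] using h 0 k a ha v hv
  exact LinearMap.congr_fun this b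

theorem gradedDer_one {𝒢 : ℤ → Submodule ℝ S} [GradedAlgebra 𝒢] {d : ℤ} {D : S →ₗ[ℝ] S}
    (hD : D ∈ gradedDer 𝒢 d) : D 1 = 0 := by
  have := hD.2 0 1 (SetLike.one_mem_graded 𝒢) 1
  simpa [koszul_zero] using this

/-- Graded derivations which agree on homogeneous generators are equal. -/
theorem gradedDer_ext {𝒢 : ℤ → Submodule ℝ S} [GradedAlgebra 𝒢] {X : ℤ → Set S}
    (hX : ∀ k, ∀ x ∈ X k, x ∈ 𝒢 k) (hgen : Algebra.adjoin ℝ (⋃ k, X k) = ⊤) {d : ℤ} {D D' : S →ₗ[ℝ] S}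
    (hD : D ∈ gradedDer 𝒢 d) (hD' : D' ∈ gradedDer 𝒢 d) (h : ∀ k, ∀ x ∈ X k, D x = D' x) : D = D' := by
  refine LinearMap.ext_of_graded 𝒢 (homogeneous_induction 𝒢 hX hgen ?_ (by simp) ?_ ?_ ?_)
  · rw [gradedDer_one hD, gradedDer_one hD']
  · intro k x y _ _ hx hy
    rw [map_add, map_add, hx, hy]
  · intro k r x hx
    rw [map_smul, map_smul, hx]
  · intro i k x y hx _ hy
    rw [hD.2 i x (hX i x hx), hD'.2 i x (hX i x hx), h i x hx, hy]

/-- An algebra morphism to `2 × 2` matrices which is `x ↦ (±x, y; 0, x)` on homogeneous generators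
gives a graded derivation with `x ↦ y`. -/
theorem exists_gradedDer_of_algHom {𝒢 : ℤ → Submodule ℝ S} [GradedAlgebra 𝒢] {X : ℤ → Set S}
    (hX : ∀ k, ∀ x ∈ X k, x ∈ 𝒢 k) (hgen : Algebra.adjoin ℝ (⋃ k, X k) = ⊤) {d : ℤ}
    (Λ : S →ₐ[ℝ] Matrix (Fin 2) (Fin 2) S)
    (h : ∀ k, ∀ x ∈ X k, Λ x 0 0 = koszul (d * k) • x ∧ Λ x 0 1 ∈ 𝒢 (d + k) ∧
      Λ x 1 0 = 0 ∧ Λ x 1 1 = x) :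
    ∃ D ∈ gradedDer 𝒢 d, ∀ x, D x = Λ x 0 1 := by
  have key : ∀ k, ∀ x ∈ 𝒢 k, Λ x 0 0 = koszul (d * k) • x ∧ Λ x 0 1 ∈ 𝒢 (d + k) ∧
      Λ x 1 0 = 0 ∧ Λ x 1 1 = x := by
    refine homogeneous_induction 𝒢 hX hgen ?_ ?_ ?_ ?_ ?_
    · simp [koszul_zero]
    · simp
    · rintro k x y _ _ ⟨h1, h2, h3, h4⟩ ⟨h1', h2', h3', h4'⟩
      simp only [map_add, Matrix.add_apply, h1, h3, h4, h1', h3', h4', smul_add, add_zero, true_and,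
        and_true]
      exact add_mem h2 h2'
    · rintro k r x ⟨h1, h2, h3, h4⟩
      simp only [map_smul, Matrix.smul_apply, h1, h3, h4, smul_zero, smul_comm r, true_and,
        and_true]
      exact Submodule.smul_mem _ r h2
    · rintro i k x y hx hk ⟨h1, h2, h3, h4⟩
      obtain ⟨g1, g2, g3, g4⟩ := h i x hx
      simp only [map_mul, Matrix.mul_apply, Fin.sum_univ_two, h1, h3, h4, g1, g3, g4, mul_zero,
        zero_mul, add_zero, zero_add, smul_mul_smul_comm, mul_add, koszul_add, true_and,
        and_true]
      refine add_mem ?_ ?_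
      · have := SetLike.mul_mem_graded (Submodule.smul_mem _ (koszul (d * i)) (hX i x hx)) h2
        rwa [show d + (i + k) = i + (d + k) by ring]
      · have := SetLike.mul_mem_graded g2 hk
        rwa [← add_assoc]
  let D : S →ₗ[ℝ] S :=
    { toFun := fun x ↦ Λ x 0 1
      map_add' := fun x y ↦ by simp
      map_smul' := fun r x ↦ by simp }
  -- In the Leibniz rule only the first factor is homogeneous, so the lower right entry is needed
  -- for arbitrary `b`.
  have h11 : ∀ b, Λ b 1 1 = b := by
    let f : S →ₗ[ℝ] S :=
      { toFun := fun x ↦ Λ x 1 1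
        map_add' := fun x y ↦ by simp
        map_smul' := fun r x ↦ by simp }
    have : f = LinearMap.id := LinearMap.ext_of_graded 𝒢 fun k v hv ↦ (key k v hv).2.2.2
    exact fun b ↦ LinearMap.congr_fun this b
  refine ⟨D, ⟨fun i a ha ↦ (key i a ha).2.1, fun i a ha b ↦ ?_⟩, fun x ↦ rfl⟩
  change Λ (a * b) 0 1 = Λ a 0 1 * b + koszul (d * i) • (a * Λ b 0 1)
  rw [map_mul, Matrix.mul_apply, Fin.sum_univ_two, (key i a ha).1, h11, smul_mul_assoc, add_comm]

end GradedGenerators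

end

noncomputable section

/-! ### The graded symmetric algebra -/

namespace GradedSym

variable {A : Type*} [Ring A] [Algebra ℝ A] (𝒜 : ℤ → Submodule ℝ A)
  {N : Type*} [AddCommGroup N] [Module ℝ N] [Module A N] (ℳ : ℤ → Submodule ℝ N)

/-- The algebra morphism `A → S_A(M)`. -/
def coeffHom : A →ₐ[ℝ] GradedSym 𝒜 ℳ :=
  AlgHom.ofLinearMap
    { toFun := coeff 𝒜 ℳ
      map_add' := fun a b ↦ by
        simpa [coeff] using RingQuot.mkAlgHom_rel ℝ (SymRel.coeff_add (𝒜 := 𝒜) (ℳ := ℳ) a b)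
      map_smul' := fun r a ↦ by
        simpa [coeff] using RingQuot.mkAlgHom_rel ℝ (SymRel.coeff_smul (𝒜 := 𝒜) (ℳ := ℳ) r a) }
    (by simpa [coeff] using RingQuot.mkAlgHom_rel ℝ (SymRel.coeff_one (𝒜 := 𝒜) (ℳ := ℳ)))
    (fun a b ↦ by
      simpa [coeff] using RingQuot.mkAlgHom_rel ℝ (SymRel.coeff_mul (𝒜 := 𝒜) (ℳ := ℳ) a b))

theorem coeffHom_apply (a : A) : coeffHom 𝒜 ℳ a = coeff 𝒜 ℳ a := rfl

/-- The linear map `M^j → S_A(M)`. -/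
def elemLin (j : ℤ) : ℳ j →ₗ[ℝ] GradedSym 𝒜 ℳ where
  toFun := elem 𝒜 ℳ j
  map_add' := fun m m' ↦ by
    simpa [elem] using RingQuot.mkAlgHom_rel ℝ (SymRel.elem_add (𝒜 := 𝒜) (ℳ := ℳ) j m m')
  map_smul' := fun r m ↦ by
    simpa [elem] using RingQuot.mkAlgHom_rel ℝ (SymRel.elem_smul (𝒜 := 𝒜) (ℳ := ℳ) j r m)

variable {𝒜 ℳ}

theorem elem_smul_eq {i j k : ℤ} (hk : k = i + j) {a : A} (ha : a ∈ 𝒜 i) {m : ℳ j} {am : ℳ k}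
    (h : (am : N) = a • (m : N)) : elem 𝒜 ℳ k am = coeff 𝒜 ℳ a * elem 𝒜 ℳ j m := by
  simpa [coeff, elem] using
    RingQuot.mkAlgHom_rel ℝ (SymRel.coeff_smul_elem (𝒜 := 𝒜) (ℳ := ℳ) i j k hk a ha m am h)

theorem elem_congr {j k : ℤ} (hk : j = k) {m : ℳ j} {m' : ℳ k} (h : (m : N) = m') :
    elem 𝒜 ℳ j m = elem 𝒜 ℳ k m' := by
  subst hk
  rw [Subtype.ext h]

theorem elem_mul_coeff {i j : ℤ} {a : A} (ha : a ∈ 𝒜 i) (m : ℳ j) :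
    elem 𝒜 ℳ j m * coeff 𝒜 ℳ a = koszul (j * i) • (coeff 𝒜 ℳ a * elem 𝒜 ℳ j m) := by
  simpa [coeff, elem] using
    RingQuot.mkAlgHom_rel ℝ (SymRel.elem_comm_coeff (𝒜 := 𝒜) (ℳ := ℳ) i j a ha m)

theorem elem_mul_elem {i j : ℤ} (m : ℳ i) (m' : ℳ j) :
    elem 𝒜 ℳ i m * elem 𝒜 ℳ j m' = koszul (i * j) • (elem 𝒜 ℳ j m' * elem 𝒜 ℳ i m) := by
  simpa [coeff, elem] using
    RingQuot.mkAlgHom_rel ℝ (SymRel.elem_comm_elem (𝒜 := 𝒜) (ℳ := ℳ) i j m m')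

/-- The universal property of `S_A(M)`. -/
theorem exists_lift {T : Type*} [Semiring T] [Algebra ℝ T] (φ : A →ₐ[ℝ] T) (v : ∀ j, ℳ j →ₗ[ℝ] T)
    (hsmul : ∀ i j k, k = i + j → ∀ a ∈ 𝒜 i, ∀ (m : ℳ j) (am : ℳ k), (am : N) = a • (m : N) →
      v k am = φ a * v j m)
    (hcoeff : ∀ i j, ∀ a ∈ 𝒜 i, ∀ m : ℳ j, v j m * φ a = koszul (j * i) • (φ a * v j m))
    (helem : ∀ i j, ∀ (m : ℳ i) (m' : ℳ j),
      v i m * v j m' = koszul (i * j) • (v j m' * v i m)) :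
    ∃ Λ : GradedSym 𝒜 ℳ →ₐ[ℝ] T, (∀ a, Λ (coeff 𝒜 ℳ a) = φ a) ∧
      ∀ j m, Λ (elem 𝒜 ℳ j m) = v j m := by
  let g : SymGen (A := A) ℳ → T := fun x ↦ match x with
    | .coeff a => φ a
    | .elem j m => v j m
  refine ⟨RingQuot.liftAlgHom ℝ ⟨FreeAlgebra.lift ℝ g, ?_⟩, fun a ↦ ?_, fun j m ↦ ?_⟩
  · intro x y h
    induction h with
    | coeff_one => simp [g]
    | coeff_add a b => simp [g]
    | coeff_smul r a => simp [g]
    | coeff_mul a b => simp [g]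
    | elem_add j m m' => simp [g]
    | elem_smul j r m => simp [g]
    | coeff_smul_elem i j k hk a ha m am h => simpa [g] using hsmul i j k hk a ha m am h
    | elem_comm_coeff i j a ha m => simpa [g] using hcoeff i j a ha m
    | elem_comm_elem i j m m' => simpa [g] using helem i j m m'
  · simp [coeff, g]
  · simp [elem, g]

theorem isMonomial_mem {k : ℤ} {x : GradedSym 𝒜 ℳ} (h : IsMonomial 𝒜 ℳ k x) : x ∈ grade 𝒜 ℳ k :=
  Submodule.subset_span h

theorem coeff_mem {i : ℤ} {a : A} (ha : a ∈ 𝒜 i) : coeff 𝒜 ℳ a ∈ grade 𝒜 ℳ i := by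
  simpa using isMonomial_mem (IsMonomial.coeff_mul (ℳ := ℳ) i 0 a 1 ha .one)

theorem elem_mem {j : ℤ} (m : ℳ j) : elem 𝒜 ℳ j m ∈ grade 𝒜 ℳ j := by
  simpa using isMonomial_mem (IsMonomial.elem_mul (𝒜 := 𝒜) j 0 m 1 .one)

theorem coeff_mul_mem {i k : ℤ} {a : A} (ha : a ∈ 𝒜 i) {x : GradedSym 𝒜 ℳ}
    (hx : x ∈ grade 𝒜 ℳ k) : coeff 𝒜 ℳ a * x ∈ grade 𝒜 ℳ (i + k) := by
  induction hx using Submodule.span_induction with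
  | mem x hx => exact isMonomial_mem (.coeff_mul i k a x ha hx)
  | zero => simp
  | add x y _ _ hx hy => rw [mul_add]; exact add_mem hx hy
  | smul r x _ hx => rw [mul_smul_comm]; exact Submodule.smul_mem _ r hx

theorem elem_mul_mem {j k : ℤ} (m : ℳ j) {x : GradedSym 𝒜 ℳ}
    (hx : x ∈ grade 𝒜 ℳ k) : elem 𝒜 ℳ j m * x ∈ grade 𝒜 ℳ (j + k) := by
  induction hx using Submodule.span_induction with
  | mem x hx => exact isMonomial_mem (.elem_mul j k m x hx)
  | zero => simp
  | add x y _ _ hx hy => rw [mul_add]; exact add_mem hx hy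
  | smul r x _ hx => rw [mul_smul_comm]; exact Submodule.smul_mem _ r hx

instance gradedMonoid : SetLike.GradedMonoid (grade 𝒜 ℳ) where
  one_mem := isMonomial_mem .one
  mul_mem i j x y hx hy := by
    induction hx using Submodule.span_induction with
    | mem x hx =>
      induction hx with
      | one => simpa using hy
      | coeff_mul i k a x ha _ ih => rw [mul_assoc, add_assoc]; exact coeff_mul_mem ha ih
      | elem_mul i k m x _ ih => rw [mul_assoc, add_assoc]; exact elem_mul_mem m ih
    | zero => simp
    | add x x' _ _ hx hx' => rw [add_mul]; exact add_mem hx hx'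
    | smul r x _ hx => rw [smul_mul_assoc]; exact Submodule.smul_mem _ r hx

variable (𝒜 ℳ) in
/-- The generators of degree `k` of `S_A(M)`. -/
def generators (k : ℤ) : Set (GradedSym 𝒜 ℳ) :=
  {x | (∃ a ∈ 𝒜 k, x = coeff 𝒜 ℳ a) ∨ ∃ m, x = elem 𝒜 ℳ k m}

theorem mem_of_generators : ∀ k, ∀ x ∈ generators 𝒜 ℳ k, x ∈ grade 𝒜 ℳ k := by
  rintro k _ (⟨a, ha, rfl⟩ | ⟨m, rfl⟩)
  exacts [coeff_mem ha, elem_mem m]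

variable [GradedAlgebra 𝒜]

theorem adjoin_generators : Algebra.adjoin ℝ (⋃ k, generators 𝒜 ℳ k) = ⊤ := by
  rw [eq_top_iff, ← (AlgHom.range_eq_top _).2 (RingQuot.mkAlgHom_surjective ℝ (SymRel 𝒜 ℳ)),
    ← Algebra.map_top, ← FreeAlgebra.adjoin_range_ι, AlgHom.map_adjoin]
  refine Algebra.adjoin_le ?_
  rintro _ ⟨_, ⟨g, rfl⟩, rfl⟩
  cases g with
  | coeff a =>
    change coeffHom 𝒜 ℳ a ∈ _
    induction a using DirectSum.Decomposition.inductionOn 𝒜 with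
    | zero => rw [map_zero]; exact zero_mem _
    | @homogeneous i a => exact Algebra.subset_adjoin (Set.mem_iUnion.2 ⟨i, Or.inl ⟨a, a.2, rfl⟩⟩)
    | add a b ha hb => rw [map_add]; exact add_mem ha hb
  | elem j m => exact Algebra.subset_adjoin (Set.mem_iUnion.2 ⟨j, Or.inr ⟨m, rfl⟩⟩)

theorem lift_ext {T : Type*} [Ring T] [Algebra ℝ T] {Λ Λ' : GradedSym 𝒜 ℳ →ₐ[ℝ] T}
    (hc : ∀ i, ∀ a ∈ 𝒜 i, Λ (coeff 𝒜 ℳ a) = Λ' (coeff 𝒜 ℳ a))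
    (he : ∀ j m, Λ (elem 𝒜 ℳ j m) = Λ' (elem 𝒜 ℳ j m)) : Λ = Λ' := by
  refine AlgHom.ext_of_adjoin_eq_top adjoin_generators fun x hx ↦ ?_
  obtain ⟨j, ⟨a, ha, rfl⟩ | ⟨m, rfl⟩⟩ := Set.mem_iUnion.1 hx
  exacts [hc j a ha, he j m]

theorem directSum_of_congr {V : Type*} [AddCommGroup V] [Module ℝ V] {𝒱 : ℤ → Submodule ℝ V}
    {i j : ℤ} (h : i = j) {x : 𝒱 i} {y : 𝒱 j} (e : (x : V) = y) :
    DirectSum.of (fun i ↦ 𝒱 i) i x = DirectSum.of (fun i ↦ 𝒱 i) j y := by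
  subst h
  rw [Subtype.ext e]

/-- All relations of `S_A(M)` are homogeneous once coefficients are decomposed in `A`, so sending
each generator to itself, placed in its own degree, is well defined. This morphism will be the
decomposition of the grading. -/
theorem exists_decomposition : ∃ Λ : GradedSym 𝒜 ℳ →ₐ[ℝ] DirectSum ℤ fun k ↦ grade 𝒜 ℳ k,
    (∀ i a, (ha : a ∈ 𝒜 i) → Λ (coeff 𝒜 ℳ a) = DirectSum.of _ i ⟨coeff 𝒜 ℳ a, coeff_mem ha⟩) ∧
    ∀ j m, Λ (elem 𝒜 ℳ j m) = DirectSum.of _ j ⟨elem 𝒜 ℳ j m, elem_mem m⟩ := by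
  let T := DirectSum ℤ fun k ↦ grade 𝒜 ℳ k
  let c (i : ℤ) : 𝒜 i →ₗ[ℝ] T := DirectSum.lof ℝ ℤ (fun k ↦ grade 𝒜 ℳ k) i ∘ₗ
    ((coeffHom 𝒜 ℳ).toLinearMap.restrict (p := 𝒜 i) (q := grade 𝒜 ℳ i) fun a ha ↦ coeff_mem ha)
  have hc (i : ℤ) (a : 𝒜 i) : c i a = DirectSum.of _ i ⟨coeff 𝒜 ℳ a, coeff_mem a.2⟩ := rfl
  let ψ : (DirectSum ℤ fun i ↦ 𝒜 i) →ₐ[ℝ] T := DirectSum.toAlgebra ℝ (fun i ↦ 𝒜 i) c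
    (directSum_of_congr rfl (map_one (coeffHom 𝒜 ℳ))) (fun {i j} a b ↦ by
      rw [hc, hc, hc, DirectSum.of_mul_of]
      exact directSum_of_congr rfl (map_mul (coeffHom 𝒜 ℳ) _ _))
  let φ : A →ₐ[ℝ] T := ψ.comp (DirectSum.decomposeAlgEquiv 𝒜).toAlgHom
  have hφ (i : ℤ) (a : A) (ha : a ∈ 𝒜 i) : φ a = DirectSum.of _ i ⟨coeff 𝒜 ℳ a, coeff_mem ha⟩ := by
    have : (DirectSum.decomposeAlgEquiv 𝒜) a = DirectSum.of (fun i ↦ 𝒜 i) i ⟨a, ha⟩ :=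
      DirectSum.decompose_of_mem 𝒜 ha
    change ψ ((DirectSum.decomposeAlgEquiv 𝒜) a) = _
    rw [this, ← hc i ⟨a, ha⟩]
    exact DirectSum.toAddMonoid_of (fun i ↦ (c i).toAddMonoidHom) i ⟨a, ha⟩
  let v (j : ℤ) : ℳ j →ₗ[ℝ] T := DirectSum.lof ℝ ℤ (fun k ↦ grade 𝒜 ℳ k) j ∘ₗ
    (elemLin 𝒜 ℳ j).codRestrict (grade 𝒜 ℳ j) elem_mem
  have hv (j : ℤ) (m : ℳ j) : v j m = DirectSum.of _ j ⟨elem 𝒜 ℳ j m, elem_mem m⟩ := rfl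
  have hs (r : ℝ) (k : ℤ) (x : grade 𝒜 ℳ k) :
      r • DirectSum.of (fun k ↦ grade 𝒜 ℳ k) k x = DirectSum.of (fun k ↦ grade 𝒜 ℳ k) k (r • x) :=
    (map_smul (DirectSum.lof ℝ ℤ (fun k ↦ grade 𝒜 ℳ k) k) r x).symm
  suffices ∃ Λ : GradedSym 𝒜 ℳ →ₐ[ℝ] T, (∀ a, Λ (coeff 𝒜 ℳ a) = φ a) ∧
      ∀ j m, Λ (elem 𝒜 ℳ j m) = v j m by
    obtain ⟨Λ, h1, h2⟩ := this
    exact ⟨Λ, fun i a ha ↦ (h1 a).trans (hφ i a ha), fun j m ↦ (h2 j m).trans (hv j m)⟩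
  refine exists_lift φ v ?_ ?_ ?_
  · intro i j k hk a ha m am h
    rw [hφ i a ha, hv, hv, DirectSum.of_mul_of]
    exact directSum_of_congr hk (elem_smul_eq hk ha h)
  · intro i j a ha m
    rw [hφ i a ha, hv, DirectSum.of_mul_of, DirectSum.of_mul_of, hs]
    exact directSum_of_congr (add_comm _ _) (elem_mul_coeff ha m)
  · intro i j m m'
    rw [hv, hv, DirectSum.of_mul_of, DirectSum.of_mul_of, hs]
    exact directSum_of_congr (add_comm _ _) (elem_mul_elem m m')

instance gradedAlgebra : GradedAlgebra (grade 𝒜 ℳ) :=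
  GradedAlgebra.ofAlgHom (grade 𝒜 ℳ) (exists_decomposition (𝒜 := 𝒜) (ℳ := ℳ)).choose
    (by
      obtain ⟨h1, h2⟩ := (exists_decomposition (𝒜 := 𝒜) (ℳ := ℳ)).choose_spec
      refine lift_ext (fun i a ha ↦ ?_) fun j m ↦ ?_
      · rw [AlgHom.comp_apply, h1 i a ha, DirectSum.coeAlgHom_of]; rfl
      · rw [AlgHom.comp_apply, h2 j m, DirectSum.coeAlgHom_of]; rfl)
    (by
      obtain ⟨h1, h2⟩ := (exists_decomposition (𝒜 := 𝒜) (ℳ := ℳ)).choose_spec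
      rintro i ⟨x, hx⟩
      generalize (exists_decomposition (𝒜 := 𝒜) (ℳ := ℳ)).choose = Λ at h1 h2 ⊢
      have key : ∀ hx : x ∈ grade 𝒜 ℳ i, Λ x = DirectSum.of (fun k ↦ grade 𝒜 ℳ k) i ⟨x, hx⟩ := by
        induction hx using Submodule.span_induction with
        | mem x hx =>
          induction hx with
          | one => intro hx; rw [map_one]; rfl
          | coeff_mul i k a x ha hx ih =>
            intro _
            rw [map_mul, h1 i a ha, ih (isMonomial_mem hx), DirectSum.of_mul_of]; rfl
          | elem_mul i k m x hx ih =>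
            intro _
            rw [map_mul, h2, ih (isMonomial_mem hx), DirectSum.of_mul_of]; rfl
        | zero => intro hx; rw [map_zero]; exact (map_zero (DirectSum.of _ i)).symm
        | add x y hx hy ex ey =>
          intro _
          rw [map_add, ex hx, ey hy, ← map_add]; rfl
        | smul r x hx ex =>
          intro _
          rw [map_smul, ex hx]
          exact (map_smul (DirectSum.lof ℝ ℤ (fun k ↦ grade 𝒜 ℳ k) i) r _).symm
      exact key hx)

theorem isGradedComm (h : IsGradedComm 𝒜) : IsGradedComm (grade 𝒜 ℳ) := by
  refine isGradedComm_of_generators _ mem_of_generators adjoin_generators ?_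
  rintro i j _ (⟨a, ha, rfl⟩ | ⟨m, rfl⟩) _ (⟨b, hb, rfl⟩ | ⟨m', rfl⟩)
  · simp only [← coeffHom_apply, ← map_mul, ← map_smul]
    rw [h i j a ha b hb]
  · rw [elem_mul_coeff ha, mul_comm i j, smul_smul, koszul_mul_self, one_smul]
  · exact elem_mul_coeff hb m
  · exact elem_mul_elem m m'

end GradedSym

end

noncomputable section

/-! ### Derivations of the graded symmetric algebra -/

section TriangularMatrix

variable {S : Type*} [Ring S]

/-- The upper triangular `2 × 2` matrix with the given entries. -/
def upperTri (x y z : S) : Matrix (Fin 2) (Fin 2) S := !![x, y; 0, z]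

theorem upperTri_mul (x y z x' y' z' : S) :
    upperTri x y z * upperTri x' y' z' = upperTri (x * x') (x * y' + y * z') (z * z') := by
  simp [upperTri]

theorem upperTri_add (x y z x' y' z' : S) :
    upperTri x y z + upperTri x' y' z' = upperTri (x + x') (y + y') (z + z') := by
  ext i j; fin_cases i <;> fin_cases j <;> simp [upperTri]

theorem upperTri_smul [Algebra ℝ S] (r : ℝ) (x y z : S) :
    r • upperTri x y z = upperTri (r • x) (r • y) (r • z) := by
  ext i j; fin_cases i <;> fin_cases j <;> simp [upperTri]

theorem upperTri_one : upperTri (1 : S) 0 1 = 1 := by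
  ext i j; fin_cases i <;> fin_cases j <;> simp [upperTri]

theorem upperTri_zero : upperTri (0 : S) 0 0 = 0 := by
  ext i j; fin_cases i <;> fin_cases j <;> simp [upperTri]

end TriangularMatrix

theorem signMap_mul {A : Type*} [Ring A] [Algebra ℝ A] (𝒜 : ℤ → Submodule ℝ A) [GradedAlgebra 𝒜]
    (r : ℤ) (a b : A) : signMap 𝒜 r (a * b) = signMap 𝒜 r a * signMap 𝒜 r b := by
  have h1 : signMap 𝒜 r ∘ₗ LinearMap.mulRight ℝ b =
      LinearMap.mulRight ℝ (signMap 𝒜 r b) ∘ₗ signMap 𝒜 r := by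
    refine LinearMap.ext_of_graded 𝒜 fun i a ha ↦ ?_
    have h2 : signMap 𝒜 r ∘ₗ LinearMap.mulLeft ℝ a =
        LinearMap.mulLeft ℝ (signMap 𝒜 r a) ∘ₗ signMap 𝒜 r := by
      refine LinearMap.ext_of_graded 𝒜 fun j b hb ↦ ?_
      simp only [LinearMap.comp_apply, LinearMap.mulLeft_apply, signMap_of_mem r ha,
        signMap_of_mem r hb, signMap_of_mem r (SetLike.mul_mem_graded ha hb), smul_mul_smul_comm,
        mul_add, koszul_add]
    exact LinearMap.congr_fun h2 b
  exact LinearMap.congr_fun h1 a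

theorem signMap_one {A : Type*} [Ring A] [Algebra ℝ A] (𝒜 : ℤ → Submodule ℝ A) [GradedAlgebra 𝒜]
    (r : ℤ) : signMap 𝒜 r 1 = 1 := by
  simp [signMap_of_mem r (SetLike.one_mem_graded 𝒜), koszul_zero]

namespace GradedSym

variable {A : Type*} [Ring A] [Algebra ℝ A] {𝒜 : ℤ → Submodule ℝ A} [GradedAlgebra 𝒜]
  {N : Type*} [AddCommGroup N] [Module ℝ N] [Module A N] {ℳ : ℤ → Submodule ℝ N}

theorem der_ext {r : ℤ} {D D' : GradedSym 𝒜 ℳ →ₗ[ℝ] GradedSym 𝒜 ℳ}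
    (hD : D ∈ gradedDer (grade 𝒜 ℳ) r) (hD' : D' ∈ gradedDer (grade 𝒜 ℳ) r)
    (hc : ∀ i, ∀ a ∈ 𝒜 i, D (coeff 𝒜 ℳ a) = D' (coeff 𝒜 ℳ a))
    (he : ∀ j m, D (elem 𝒜 ℳ j m) = D' (elem 𝒜 ℳ j m)) : D = D' := by
  refine gradedDer_ext mem_of_generators adjoin_generators hD hD' ?_
  rintro j _ (⟨a, ha, rfl⟩ | ⟨m, rfl⟩)
  exacts [hc j a ha, he j m]

/-- Derivations of `S_A(M)` are obtained from their values on `A` and `M`. -/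
theorem exists_der (hcomm : IsGradedComm 𝒜) (r : ℤ) (u : A →ₗ[ℝ] GradedSym 𝒜 ℳ)
    (v : ∀ j, ℳ j →ₗ[ℝ] GradedSym 𝒜 ℳ)
    (hu : ∀ i, ∀ a ∈ 𝒜 i, u a ∈ grade 𝒜 ℳ (r + i)) (hv : ∀ j m, v j m ∈ grade 𝒜 ℳ (r + j))
    (hu_mul : ∀ i, ∀ a ∈ 𝒜 i, ∀ b, u (a * b) =
      u a * coeff 𝒜 ℳ b + koszul (r * i) • (coeff 𝒜 ℳ a * u b))
    (hv_smul : ∀ i j k, k = i + j → ∀ a ∈ 𝒜 i, ∀ (m : ℳ j) (am : ℳ k), (am : N) = a • (m : N) →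
      v k am = u a * elem 𝒜 ℳ j m + koszul (r * i) • (coeff 𝒜 ℳ a * v j m)) :
    ∃ D ∈ gradedDer (grade 𝒜 ℳ) r, (∀ a, D (coeff 𝒜 ℳ a) = u a) ∧
      ∀ j m, D (elem 𝒜 ℳ j m) = v j m := by
  have hS := isGradedComm (ℳ := ℳ) hcomm
  have hu1 : u 1 = 0 := by
    have := hu_mul 0 1 (SetLike.one_mem_graded 𝒜) 1
    simpa [koszul_zero, ← coeffHom_apply] using this
  -- Multiplicativity of the matrix with diagonal `(σ a, a)` and corner `u a` is the graded Leibniz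
  -- rule for `u`, where `σ` is the sign `(-1)^{ri}` in degree `i`.
  let φ : A →ₐ[ℝ] Matrix (Fin 2) (Fin 2) (GradedSym 𝒜 ℳ) := AlgHom.ofLinearMap
    { toFun := fun a ↦ upperTri (coeffHom 𝒜 ℳ (signMap 𝒜 r a)) (u a) (coeffHom 𝒜 ℳ a)
      map_add' := fun a b ↦ by simp only [map_add, upperTri_add]
      map_smul' := fun c a ↦ by simp only [map_smul, upperTri_smul, RingHom.id_apply] }
    (by simp only [LinearMap.coe_mk, AddHom.coe_mk, signMap_one, map_one, hu1, upperTri_one])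
    (fun a b ↦ by
      have key : u ∘ₗ LinearMap.mulRight ℝ b =
          LinearMap.mulRight ℝ (u b) ∘ₗ (coeffHom 𝒜 ℳ).toLinearMap ∘ₗ signMap 𝒜 r +
            LinearMap.mulRight ℝ (coeff 𝒜 ℳ b) ∘ₗ u := by
        refine LinearMap.ext_of_graded 𝒜 fun i a ha ↦ ?_
        simp [hu_mul i a ha, signMap_of_mem r ha, coeffHom_apply, add_comm]
      have := LinearMap.congr_fun key a
      simp only [LinearMap.comp_apply, LinearMap.add_apply, LinearMap.mulRight_apply] at this
      simp only [LinearMap.coe_mk, AddHom.coe_mk, upperTri_mul, signMap_mul, map_mul, this,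
        ← coeffHom_apply, AlgHom.toLinearMap_apply])
  have hφ (a : A) : φ a = upperTri (coeffHom 𝒜 ℳ (signMap 𝒜 r a)) (u a) (coeffHom 𝒜 ℳ a) := rfl
  have hφ' (i : ℤ) (a : A) (ha : a ∈ 𝒜 i) :
      φ a = upperTri (koszul (r * i) • coeff 𝒜 ℳ a) (u a) (coeff 𝒜 ℳ a) := by
    rw [hφ, signMap_of_mem r ha, map_smul]; rfl
  let w (j : ℤ) : ℳ j →ₗ[ℝ] Matrix (Fin 2) (Fin 2) (GradedSym 𝒜 ℳ) :=
    { toFun := fun m ↦ upperTri (koszul (r * j) • elemLin 𝒜 ℳ j m) (v j m) (elemLin 𝒜 ℳ j m)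
      map_add' := fun a b ↦ by simp only [map_add, smul_add, upperTri_add]
      map_smul' := fun c a ↦ by
        simp only [map_smul, upperTri_smul, RingHom.id_apply, smul_comm c] }
  have hw (j : ℤ) (m : ℳ j) :
      w j m = upperTri (koszul (r * j) • elem 𝒜 ℳ j m) (v j m) (elem 𝒜 ℳ j m) := rfl
  obtain ⟨Λ, h1, h2⟩ : ∃ Λ : GradedSym 𝒜 ℳ →ₐ[ℝ] Matrix (Fin 2) (Fin 2) (GradedSym 𝒜 ℳ),
      (∀ a, Λ (coeff 𝒜 ℳ a) = φ a) ∧ ∀ j m, Λ (elem 𝒜 ℳ j m) = w j m := by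
    -- The corner of the product is `(-1)^{ri} x y' + x' y`. Exchanging the factors costs
    -- `(-1)^{i(r+j)}` and `(-1)^{(r+i)j}`; the signs on the diagonals turn both into the common
    -- sign `(-1)^{ij}`.
    have hmul : ∀ {i j : ℤ} {x y x' y' : GradedSym 𝒜 ℳ}, x ∈ grade 𝒜 ℳ i → y ∈ grade 𝒜 ℳ j →
        x' ∈ grade 𝒜 ℳ (r + i) → y' ∈ grade 𝒜 ℳ (r + j) →
        upperTri (koszul (r * i) • x) x' x * upperTri (koszul (r * j) • y) y' y =
        koszul (i * j) • (upperTri (koszul (r * j) • y) y' y * upperTri (koszul (r * i) • x) x' x) := by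
      intro i j x y x' y' hx hy hx' hy'
      rw [upperTri_mul, upperTri_mul, upperTri_smul, hS _ _ x hx y hy]
      congr 1
      · simp only [smul_mul_smul_comm, hS _ _ x hx y hy, smul_smul]
        congr 1; ring
      · rw [smul_mul_assoc, smul_mul_assoc, hS _ _ x hx y' hy', hS _ _ x' hx' y hy, add_comm,
          smul_add, smul_smul, smul_smul]
        congr 1
        · congr 1; rw [← koszul_add]; ring_nf
        · congr 1
          rw [mul_add, koszul_add, ← mul_assoc, mul_comm i r, koszul_mul_self, one_mul]
    refine exists_lift φ w ?_ ?_ ?_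
    · intro i j k hk a ha m am h
      rw [hφ' i a ha, hw, hw, upperTri_mul, hv_smul i j k hk a ha m am h, elem_smul_eq hk ha h]
      congr 1
      · rw [smul_mul_smul_comm, hk, mul_add, koszul_add]
      · rw [smul_mul_assoc, add_comm]
    · intro i j a ha m
      rw [hφ' i a ha, hw]
      exact hmul (elem_mem m) (coeff_mem ha) (hv j m) (hu i a ha)
    · intro i j m m'
      rw [hw, hw]
      exact hmul (elem_mem m) (elem_mem m') (hv i m) (hv j m')
  have hgen : ∀ k, ∀ x ∈ generators 𝒜 ℳ k, Λ x 0 0 = koszul (r * k) • x ∧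
      Λ x 0 1 ∈ grade 𝒜 ℳ (r + k) ∧ Λ x 1 0 = 0 ∧ Λ x 1 1 = x := by
    rintro k _ (⟨a, ha, rfl⟩ | ⟨m, rfl⟩)
    · rw [h1, hφ' k a ha]
      exact ⟨rfl, hu k a ha, rfl, rfl⟩
    · rw [h2, hw]
      exact ⟨rfl, hv k m, rfl, rfl⟩
  obtain ⟨D, hD, hD'⟩ := exists_gradedDer_of_algHom mem_of_generators adjoin_generators Λ hgen
  refine ⟨D, hD, fun a ↦ ?_, fun j m ↦ ?_⟩
  · rw [hD', h1, hφ]; rfl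
  · rw [hD', h2, hw]; rfl

end GradedSym

end

noncomputable section

/-! ### Gerstenhaber algebras given by generators -/

section Gerstenhaber

variable {S : Type*} [Ring S] [Algebra ℝ S] {𝒢 : ℤ → Submodule ℝ S} [GradedAlgebra 𝒢]

theorem mulLeft_comp_mem_gradedDer (hcomm : IsGradedComm 𝒢) {i d : ℤ} {a : S} (ha : a ∈ 𝒢 i)
    {D : S →ₗ[ℝ] S} (hD : D ∈ gradedDer 𝒢 d) :
    LinearMap.mulLeft ℝ a ∘ₗ D ∈ gradedDer 𝒢 (i + d) := by
  refine ⟨fun j b hb ↦ ?_, fun j b hb c ↦ ?_⟩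
  · rw [add_assoc]
    exact SetLike.mul_mem_graded ha (hD.1 j b hb)
  · simp only [LinearMap.comp_apply, LinearMap.mulLeft_apply, hD.2 j b hb, mul_add,
      mul_smul_comm, ← mul_assoc, hcomm i j a ha b hb, add_mul, koszul_add, smul_mul_assoc,
      smul_smul]
    rw [mul_comm (koszul (i * j))]

/-- A bracket by derivations which is antisymmetric and satisfies the Jacobi identity on generators
defines a Gerstenhaber algebra. -/
theorem isGerstenhaber_of_generators (hcomm : IsGradedComm 𝒢) {X : ℤ → Set S}
    (hX : ∀ k, ∀ x ∈ X k, x ∈ 𝒢 k) (hgen : Algebra.adjoin ℝ (⋃ k, X k) = ⊤)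
    (br : S →ₗ[ℝ] S →ₗ[ℝ] S) (hder : ∀ k, ∀ γ ∈ 𝒢 k, br γ ∈ gradedDer 𝒢 (k - 1))
    (hanti : ∀ k i, ∀ γ ∈ 𝒢 k, ∀ x ∈ X i, br γ x = -(koszul ((k - 1) * (i - 1)) • br x γ))
    (hjac : ∀ i j k, ∀ x ∈ X i, ∀ y ∈ X j, ∀ z ∈ X k,
      br (br x y) z = br x (br y z) - koszul ((i - 1) * (j - 1)) • br y (br x z)) :
    IsGerstenhaber 𝒢 br := by
  -- Both sides are derivations of the second argument, so it suffices to test generators `x`; there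
  -- antisymmetry turns the claim into the Leibniz rule of `br x`.
  have hprod : ∀ a b, ∀ α ∈ 𝒢 a, ∀ β ∈ 𝒢 b, br (α * β) =
      LinearMap.mulLeft ℝ α ∘ₗ br β + koszul (a * b) • (LinearMap.mulLeft ℝ β ∘ₗ br α) := by
    intro a b α hα β hβ
    refine gradedDer_ext hX hgen (hder _ _ (SetLike.mul_mem_graded hα hβ)) (add_mem ?_
      (Submodule.smul_mem _ _ ?_)) fun i x hx ↦ ?_
    · have := mulLeft_comp_mem_gradedDer hcomm hα (hder b β hβ)
      rwa [← add_sub_assoc] at this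
    · have := mulLeft_comp_mem_gradedDer hcomm hβ (hder a α hα)
      rwa [← add_sub_assoc, add_comm b a] at this
    · have hxd := hder i x (hX i x hx)
      simp only [LinearMap.add_apply, LinearMap.smul_apply, LinearMap.comp_apply,
        LinearMap.mulLeft_apply]
      rw [hanti _ i _ (SetLike.mul_mem_graded hα hβ) x hx, hanti b i β hβ x hx,
        hanti a i α hα x hx, hxd.2 a α hα, hcomm _ _ _ (hxd.1 a α hα) β hβ]
      -- Koszul signs depend only on parities, so sign identities are checked in eight cases, here
      -- and below.
      by_cases h1 : Even a <;> by_cases h2 : Even b <;> by_cases h3 : Even i <;>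
        simp only [koszul_eq, Int.even_add, Int.even_sub, Int.even_mul, Int.not_even_one, h1, h2, h3,
          iff_false, iff_true, not_true_eq_false, not_false_eq_true, or_true, true_or, or_false,
          false_or, or_self, true_iff, false_iff, if_true, if_false, one_smul, neg_smul] <;>
        simp only [neg_neg, mul_neg, neg_mul, smul_neg, neg_add, mul_smul_comm, smul_add] <;> abel
  have hone : br 1 = 0 := by
    have := hprod 0 0 1 (SetLike.one_mem_graded 𝒢) 1 (SetLike.one_mem_graded 𝒢)
    simpa [koszul_zero, LinearMap.mulLeft_one] using this
  have hskew : ∀ c, ∀ γ ∈ 𝒢 c, ∀ k, ∀ α ∈ 𝒢 k,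
      br α γ = -(koszul ((k - 1) * (c - 1)) • br γ α) := by
    intro c γ hγ
    refine homogeneous_induction 𝒢 hX hgen ?_ (by simp) ?_ ?_ ?_
    · rw [hone, gradedDer_one (hder c γ hγ)]; simp
    · intro k x y _ _ hx hy
      rw [map_add, LinearMap.add_apply, hx, hy, map_add, smul_add]; abel
    · intro k r x hx
      rw [map_smul, LinearMap.smul_apply, hx, map_smul, smul_comm, smul_neg]
    · intro i k x y hx hy h
      have hxi := hX i x hx
      rw [hprod i k x hxi y hy, (hder c γ hγ).2 i x hxi, hanti c i γ hγ x hx]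
      simp only [LinearMap.add_apply, LinearMap.smul_apply, LinearMap.comp_apply,
        LinearMap.mulLeft_apply]
      rw [h, hcomm k _ y hy _ ((hder i x hxi).1 c γ hγ)]
      by_cases h1 : Even i <;> by_cases h2 : Even k <;> by_cases h3 : Even c <;>
        simp only [koszul_eq, Int.even_add, Int.even_sub, Int.even_mul, Int.not_even_one, h1, h2, h3,
          iff_false, iff_true, not_true_eq_false, not_false_eq_true, or_true, true_or, or_false,
          false_or, or_self, true_iff, false_iff, if_true, if_false, one_smul, neg_smul] <;>
        simp only [neg_neg, mul_neg, neg_mul, smul_neg, neg_add, mul_smul_comm, smul_add] <;> abel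
  -- By antisymmetry the Jacobi identity is invariant under cyclic rotation of its three arguments.
  have hjac' : ∀ a b c, ∀ α ∈ 𝒢 a, ∀ β ∈ 𝒢 b, ∀ γ ∈ 𝒢 c,
      (br (br α β) γ = br α (br β γ) - koszul ((a - 1) * (b - 1)) • br β (br α γ)) →
      br (br β γ) α = br β (br γ α) - koszul ((b - 1) * (c - 1)) • br γ (br β α) := by
    intro a b c α hα β hβ γ hγ h
    rw [hskew _ _ hα _ _ ((hder b β hβ).1 c γ hγ), hskew _ _ hα c γ hγ, hskew _ _ hα b β hβ]
    simp only [map_neg, map_smul]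
    rw [hskew _ _ ((hder a α hα).1 b β hβ) c γ hγ, h]
    by_cases h1 : Even a <;> by_cases h2 : Even b <;> by_cases h3 : Even c <;>
        simp only [koszul_eq, Int.even_add, Int.even_sub, Int.even_mul, Int.not_even_one, h1, h2, h3,
          iff_false, iff_true, not_true_eq_false, not_false_eq_true, or_true, true_or, or_false,
          false_or, or_self, true_iff, false_iff, if_true, if_false, one_smul, neg_smul] <;>
        simp only [neg_neg, mul_neg, neg_mul, smul_neg, neg_add, mul_smul_comm, smul_add] <;> abel
  -- As functions of `γ` both sides are derivations of the same degree, so the last argument may be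
  -- restricted to generators.
  have hext : ∀ a b, ∀ α ∈ 𝒢 a, ∀ β ∈ 𝒢 b,
      (∀ i, ∀ x ∈ X i, br (br α β) x =
        br α (br β x) - koszul ((a - 1) * (b - 1)) • br β (br α x)) →
      ∀ γ, br (br α β) γ = br α (br β γ) - koszul ((a - 1) * (b - 1)) • br β (br α γ) := by
    intro a b α hα β hβ h γ
    have h1 := hder _ _ ((hder a α hα).1 b β hβ)
    rw [show a - 1 + b - 1 = (a - 1) + (b - 1) by ring] at h1
    have := gradedDer_ext hX hgen h1 (gradedCommutator_mem 𝒢 (hder a α hα) (hder b β hβ)) h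
    exact LinearMap.congr_fun this γ
  -- Starting from three generators, the last slot is made arbitrary and the arguments are rotated,
  -- until all three slots are arbitrary.
  have hjac1 : ∀ a b c, ∀ α ∈ 𝒢 a, ∀ β ∈ 𝒢 b, ∀ γ ∈ 𝒢 c,
      br (br α β) γ = br α (br β γ) - koszul ((a - 1) * (b - 1)) • br β (br α γ) := by
    intro a b c α hα β hβ γ hγ
    refine hext a b α hα β hβ (fun k z hz ↦ ?_) γ
    refine hjac' k a b z (hX k z hz) α hα β hβ (hext k a z (hX k z hz) α hα (fun j y hy ↦ ?_) β)
    refine hjac' j k a y (hX j y hy) z (hX k z hz) α hα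
      (hext j k y (hX j y hy) z (hX k z hz) (fun i x hx ↦ ?_) α)
    exact hjac j k i y hy z hz x hx
  refine ⟨DirectSum.Decomposition.isInternal 𝒢, SetLike.one_mem_graded 𝒢,
    fun i j α hα β hβ ↦ SetLike.mul_mem_graded hα hβ, hcomm, ?_, ?_, ?_, ?_⟩
  · intro p q α hα β hβ
    have := (hder _ α hα).1 _ β hβ
    rwa [show 1 + p - 1 + (1 + q) = 1 + (p + q) by ring] at this
  · intro p q α hα β hβ
    have := hskew _ β hβ _ α hα
    rwa [add_sub_cancel_left, add_sub_cancel_left] at this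
  · intro p q r α hα β hβ γ hγ
    have h1 := hjac1 _ _ _ α hα β hβ γ hγ
    have hβγ := (hder _ β hβ).1 _ γ hγ
    have hαγ := (hder _ α hα).1 _ γ hγ
    rw [h1, hskew _ α hα _ _ hβγ, hskew _ α hα _ γ hγ, map_neg, map_smul, LinearMap.neg_apply,
      LinearMap.smul_apply, hskew _ β hβ _ _ hαγ]
    by_cases h1 : Even p <;> by_cases h2 : Even q <;> by_cases h3 : Even r <;>
        simp only [koszul_eq, Int.even_add, Int.even_sub, Int.even_mul, Int.not_even_one, h1, h2, h3,
          iff_false, iff_true, not_true_eq_false, not_false_eq_true, or_true, true_or, or_false,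
          false_or, or_self, true_iff, false_iff, if_true, if_false, one_smul, neg_smul] <;>
        simp only [neg_neg, mul_neg, neg_mul, smul_neg, neg_add, mul_smul_comm, smul_add] <;> abel
  · intro p q r α hα β hβ γ hγ
    rw [hprod _ _ α hα β hβ]
    simp only [LinearMap.add_apply, LinearMap.smul_apply, LinearMap.comp_apply,
        LinearMap.mulLeft_apply]
    rw [hcomm _ _ β hβ _ ((hder _ α hα).1 _ γ hγ)]
    by_cases h1 : Even p <;> by_cases h2 : Even q <;> by_cases h3 : Even r <;>
        simp only [koszul_eq, Int.even_add, Int.even_sub, Int.even_mul, Int.not_even_one, h1, h2, h3,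
          iff_false, iff_true, not_true_eq_false, not_false_eq_true, or_true, true_or, or_false,
          false_or, or_self, true_iff, false_iff, if_true, if_false, one_smul, neg_smul] <;>
        simp only [neg_neg, mul_neg, neg_mul, smul_neg, neg_add, mul_smul_comm, smul_add] <;> abel

/-- An algebra morphism of Gerstenhaber algebras which preserves degrees, and the brackets of
generators, preserves the bracket. -/
theorem IsGerstenhaber.map_bracket_of_generators {S' : Type*} [Ring S'] [Algebra ℝ S']
    {𝒢' : ℤ → Submodule ℝ S'} {br : S →ₗ[ℝ] S →ₗ[ℝ] S} {br' : S' →ₗ[ℝ] S' →ₗ[ℝ] S'}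
    (h : IsGerstenhaber 𝒢 br) (h' : IsGerstenhaber 𝒢' br') (Φ : S →ₐ[ℝ] S') {X : ℤ → Set S}
    (hX : ∀ k, ∀ x ∈ X k, x ∈ 𝒢 k) (hgen : Algebra.adjoin ℝ (⋃ k, X k) = ⊤)
    (hΦ : ∀ k, ∀ x ∈ 𝒢 k, Φ x ∈ 𝒢' k)
    (hbr : ∀ i j, ∀ x ∈ X i, ∀ y ∈ X j,
      Φ (br x y) = br' (Φ x) (Φ y) ∨ Φ (br y x) = br' (Φ y) (Φ x)) (α β : S) :
    Φ (br α β) = br' (Φ α) (Φ β) := by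
  have hs {k : ℤ} {x : S} : x ∈ 𝒢 k ↔ x ∈ shift 𝒢 1 (k - 1) := by simp [shift]
  have hs' {k : ℤ} {x : S'} : x ∈ 𝒢' k ↔ x ∈ shift 𝒢' 1 (k - 1) := by simp [shift]
  have hswap : ∀ i j, ∀ x ∈ 𝒢 i, ∀ y ∈ 𝒢 j, Φ (br x y) = br' (Φ x) (Φ y) →
      Φ (br y x) = br' (Φ y) (Φ x) := by
    intro i j x hx y hy e
    rw [h.antisymm (j - 1) (i - 1) y (hs.1 hy) x (hs.1 hx), map_neg, map_smul, e,
      h'.antisymm (j - 1) (i - 1) _ (hs'.1 (hΦ j y hy)) _ (hs'.1 (hΦ i x hx))]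
  have hone (γ : S) : br 1 γ = 0 := by
    have : br 1 = 0 := LinearMap.ext_of_graded 𝒢 fun k v hv ↦ by
      have := h.leibniz (-1) (-1) (k - 1) 1 h.one_mem 1 h.one_mem v (hs.1 hv)
      simpa [koszul_zero] using this
    rw [this]; rfl
  have hone' (k : ℤ) (γ : S') (hγ : γ ∈ 𝒢' k) : br' 1 γ = 0 := by
    have := h'.leibniz (-1) (-1) (k - 1) 1 h'.one_mem 1 h'.one_mem γ (hs'.1 hγ)
    simpa [koszul_zero] using this
  -- The Leibniz rule frees the first slot only; the second is freed afterwards by antisymmetry.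
  have step : ∀ c, ∀ γ ∈ 𝒢 c, (∀ i, ∀ x ∈ X i, Φ (br x γ) = br' (Φ x) (Φ γ)) →
      ∀ k, ∀ α ∈ 𝒢 k, Φ (br α γ) = br' (Φ α) (Φ γ) := by
    intro c γ hγ hx
    refine homogeneous_induction 𝒢 hX hgen ?_ (by simp) ?_ ?_ ?_
    · rw [hone, map_one, hone' c _ (hΦ c γ hγ), map_zero]
    · intro k x y _ _ hx hy
      simp only [map_add, LinearMap.add_apply, hx, hy]
    · intro k r x hx
      simp only [map_smul, LinearMap.smul_apply, hx]
    · intro i k x y hxi hy e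
      have hx' := hX i x hxi
      rw [h.leibniz _ _ _ x (hs.1 hx') y (hs.1 hy) γ (hs.1 hγ), map_add, map_smul, map_mul, map_mul,
        map_mul, e, hx i x hxi, h'.leibniz _ _ _ _ (hs'.1 (hΦ i x hx')) _ (hs'.1 (hΦ k y hy)) _
        (hs'.1 (hΦ c γ hγ))]
  have h1 : ∀ j, ∀ y ∈ X j, ∀ k, ∀ α ∈ 𝒢 k, Φ (br α y) = br' (Φ α) (Φ y) := by
    intro j y hy
    refine step j y (hX j y hy) fun i x hx ↦ ?_
    rcases hbr i j x hx y hy with e | e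
    · exact e
    · exact hswap j i y (hX j y hy) x (hX i x hx) e
  have h2 : ∀ c, ∀ γ ∈ 𝒢 c, ∀ k, ∀ α ∈ 𝒢 k, Φ (br α γ) = br' (Φ α) (Φ γ) := by
    intro c γ hγ
    exact step c γ hγ fun i x hx ↦ hswap c i γ hγ x (hX i x hx) (h1 i x hx c γ hγ)
  have h3 : br.compr₂ Φ.toLinearMap = br'.compl₁₂ Φ.toLinearMap Φ.toLinearMap :=
    LinearMap.ext_of_graded 𝒢 fun k α hα ↦ LinearMap.ext_of_graded 𝒢 fun c γ hγ ↦ h2 c γ hγ k α hα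
  exact LinearMap.congr_fun₂ h3 α β

end Gerstenhaber

end

noncomputable section

/-! ### The Schouten bracket -/

namespace MultiDer

variable {A : Type*} [Ring A] [Algebra ℝ A] {𝒜 : ℤ → Submodule ℝ A}

theorem mem_shift_iff {d : ℤ} {D : A →ₗ[ℝ] A} :
    D ∈ shift (gradedDer 𝒜) (-1) (d + 1) ↔ D ∈ gradedDer 𝒜 d := by
  simp [shift, add_comm]

theorem mem_gradedDer {j : ℤ} (m : shift (gradedDer 𝒜) (-1) j) : m.1 ∈ gradedDer 𝒜 (j - 1) := by
  rw [← mem_shift_iff, sub_add_cancel]; exact m.2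

variable (𝒜) in
/-- The inclusion of `A` as an algebra morphism. -/
def fnHom : A →ₐ[ℝ] MultiDer 𝒜 := GradedSym.coeffHom 𝒜 _

theorem fnHom_apply (a : A) : fnHom 𝒜 a = fn 𝒜 a := rfl

theorem der_congr {d d' : ℤ} {D D' : A →ₗ[ℝ] A} (hD : D ∈ gradedDer 𝒜 d) (hd : d = d')
    (h : D = D') : der 𝒜 d D hD = der 𝒜 d' D' (hd ▸ h ▸ hD) := by
  subst hd h; rfl

theorem elem_eq_der (j : ℤ) (m : shift (gradedDer 𝒜) (-1) j) :
    GradedSym.elem 𝒜 _ j m = der 𝒜 (j - 1) m.1 (mem_gradedDer m) :=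
  GradedSym.elem_congr (sub_add_cancel j 1).symm rfl

theorem fn_mem {i : ℤ} {a : A} (ha : a ∈ 𝒜 i) : fn 𝒜 a ∈ grade 𝒜 i := GradedSym.coeff_mem ha

theorem der_mem {d : ℤ} {D : A →ₗ[ℝ] A} (hD : D ∈ gradedDer 𝒜 d) :
    der 𝒜 d D hD ∈ grade 𝒜 (d + 1) := GradedSym.elem_mem _

variable (𝒜) in
/-- The inclusion of `Der^d(A)` as a linear map. -/
def derLin (d : ℤ) : gradedDer 𝒜 d →ₗ[ℝ] MultiDer 𝒜 where
  toFun D := der 𝒜 d D.1 D.2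
  map_add' D D' := map_add (GradedSym.elemLin 𝒜 (shift (gradedDer 𝒜) (-1)) (d + 1))
    ⟨D, mem_shift_iff.2 D.2⟩ ⟨D', mem_shift_iff.2 D'.2⟩
  map_smul' r D := map_smul (GradedSym.elemLin 𝒜 (shift (gradedDer 𝒜) (-1)) (d + 1)) r
    ⟨D, mem_shift_iff.2 D.2⟩

theorem derLin_apply {d : ℤ} {D : A →ₗ[ℝ] A} (hD : D ∈ gradedDer 𝒜 d) :
    derLin 𝒜 d ⟨D, hD⟩ = der 𝒜 d D hD := rfl

variable [GradedAlgebra 𝒜]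

theorem fn_mul_der (hcomm : IsGradedComm 𝒜) {i d : ℤ} {a : A} (ha : a ∈ 𝒜 i) {D : A →ₗ[ℝ] A}
    (hD : D ∈ gradedDer 𝒜 d) : fn 𝒜 a * der 𝒜 d D hD =
      der 𝒜 (i + d) (LinearMap.mulLeft ℝ a ∘ₗ D) (mulLeft_comp_mem_gradedDer hcomm ha hD) :=
  (GradedSym.elem_smul_eq (add_assoc i d 1) ha rfl).symm

theorem ext_der {r : ℤ} {D D' : MultiDer 𝒜 →ₗ[ℝ] MultiDer 𝒜}
    (hD : D ∈ gradedDer (grade 𝒜) r) (hD' : D' ∈ gradedDer (grade 𝒜) r)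
    (hf : ∀ i, ∀ a ∈ 𝒜 i, D (fn 𝒜 a) = D' (fn 𝒜 a))
    (hd : ∀ d E hE, D (der 𝒜 d E hE) = D' (der 𝒜 d E hE)) : D = D' :=
  GradedSym.der_ext hD hD' hf fun j m ↦ by rw [elem_eq_der]; exact hd _ _ _

variable (𝒜) in
/-- Homogeneous generators of degree `k`. -/
def gens (k : ℤ) : Set (MultiDer 𝒜) :=
  {x | (∃ a ∈ 𝒜 k, x = fn 𝒜 a) ∨ ∃ D hD, x = der 𝒜 (k - 1) D hD}

theorem gens_eq (k : ℤ) : gens 𝒜 k = GradedSym.generators 𝒜 (shift (gradedDer 𝒜) (-1)) k := by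
  ext x
  refine or_congr Iff.rfl ⟨?_, ?_⟩
  · rintro ⟨D, hD, rfl⟩
    exact ⟨⟨D, by simpa using mem_shift_iff.2 hD⟩, by rw [elem_eq_der]⟩
  · rintro ⟨m, rfl⟩
    exact ⟨m.1, mem_gradedDer m, elem_eq_der k m⟩

theorem mem_of_gens (k : ℤ) (x) (hx : x ∈ gens 𝒜 k) : x ∈ grade 𝒜 k :=
  GradedSym.mem_of_generators k x (by rwa [← gens_eq])

theorem adjoin_gens : Algebra.adjoin ℝ (⋃ k, gens 𝒜 k) = ⊤ := by
  simp only [gens_eq, GradedSym.adjoin_generators]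

/-- The values are forced by antisymmetry: `[a, D] = -(-1)^{(i-1)d} D(a)` for `a` of degree `i`,
hence of degree `i - 1` in `T`. They depend linearly over `A` on `D` up to sign, so they extend to a
derivation; its uniqueness gives linearity in `a`. -/
theorem exists_ad_fn (hcomm : IsGradedComm 𝒜) : ∃ X : A →ₗ[ℝ] MultiDer 𝒜 →ₗ[ℝ] MultiDer 𝒜,
    ∀ i, ∀ a ∈ 𝒜 i, X a ∈ gradedDer (grade 𝒜) (i - 1) ∧ (∀ b, X a (fn 𝒜 b) = 0) ∧
      ∀ d D hD, X a (der 𝒜 d D hD) = -(koszul ((i - 1) * d) • fn 𝒜 (D a)) := by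
  refine exists_linearMap_of_graded 𝒜 (fun i a (X : MultiDer 𝒜 →ₗ[ℝ] MultiDer 𝒜) ↦
    a ∈ 𝒜 i ∧ X ∈ gradedDer (grade 𝒜) (i - 1) ∧ (∀ b, X (fn 𝒜 b) = 0) ∧
      ∀ d D hD, X (der 𝒜 d D hD) = -(koszul ((i - 1) * d) • fn 𝒜 (D a))) ?_ ?_ ?_ ?_ |>.imp
      fun X h i a ha ↦ (h i a ha).2
  · rintro i a a' X X' ⟨h0, h1, h2, h3⟩ ⟨h0', h1', h2', h3'⟩
    refine ⟨add_mem h0 h0', add_mem h1 h1', fun b ↦ ?_, fun d D hD ↦ ?_⟩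
    · rw [LinearMap.add_apply, h2, h2', add_zero]
    · rw [LinearMap.add_apply, h3, h3', map_add, ← fnHom_apply, ← fnHom_apply, ← fnHom_apply,
        map_add, smul_add, neg_add]
  · rintro i r a X ⟨h0, h1, h2, h3⟩
    refine ⟨Submodule.smul_mem _ r h0, Submodule.smul_mem _ r h1, fun b ↦ ?_, fun d D hD ↦ ?_⟩
    · rw [LinearMap.smul_apply, h2, smul_zero]
    · rw [LinearMap.smul_apply, h3, map_smul, ← fnHom_apply, ← fnHom_apply,
        map_smul, smul_neg, smul_comm]
  · intro i a ha
    let v (j : ℤ) : shift (gradedDer 𝒜) (-1) j →ₗ[ℝ] MultiDer 𝒜 :=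
      -(koszul ((i - 1) * (j - 1)) • ((fnHom 𝒜).toLinearMap ∘ₗ LinearMap.applyₗ a ∘ₗ
        (shift (gradedDer 𝒜) (-1) j).subtype))
    have hv (j : ℤ) (m : shift (gradedDer 𝒜) (-1) j) :
      v j m = -(koszul ((i - 1) * (j - 1)) • fnHom 𝒜 (m.1 a)) := rfl
    obtain ⟨D, hD, h1, h2⟩ := GradedSym.exists_der hcomm (i - 1) 0 v (by simp) (fun j m ↦ by
      rw [hv]
      refine neg_mem (Submodule.smul_mem _ _ ?_)
      have := (mem_gradedDer m).1 i a ha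
      rw [show i - 1 + j = j - 1 + i by ring]
      exact fn_mem this) (by simp) (by
        intro i' j k hk b hb m bm h
        have hneg (x y : MultiDer 𝒜) : x * -y = -(x * y) := mul_neg x y
        have h' : bm.1 a = b * m.1 a := by rw [h]; rfl
        rw [hv, hv, h', map_mul, hk, add_sub_assoc, mul_add, koszul_add, LinearMap.zero_apply,
          zero_mul, zero_add, hneg, smul_neg, mul_smul_comm, smul_smul]
        rfl)
    refine ⟨D, ha, hD, h1, fun d E hE ↦ ?_⟩
    have := h2 (d + 1) ⟨E, mem_shift_iff.2 hE⟩
    rw [hv, add_sub_cancel_right] at this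
    exact this
  · rintro i a X X' ⟨h0, h1, h2, h3⟩ ⟨h0', h1', h2', h3'⟩
    exact ext_der h1 h1' (fun _ b _ ↦ by rw [h2, h2']) fun d E hE ↦ by rw [h3, h3']

/-- The prescribed values extend to a derivation because graded commutators satisfy `[D, aE] = D(a)
E + (-1)^{di} a [D, E]`, which is compatibility with the `A`-module structure of the derivations. -/
theorem exists_ad_der (hcomm : IsGradedComm 𝒜) (d : ℤ) :
    ∃ X : gradedDer 𝒜 d →ₗ[ℝ] MultiDer 𝒜 →ₗ[ℝ] MultiDer 𝒜,
    ∀ D, X D ∈ gradedDer (grade 𝒜) d ∧ (∀ b, X D (fn 𝒜 b) = fn 𝒜 (D.1 b)) ∧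
      ∀ d' D' (hD' : D' ∈ gradedDer 𝒜 d'), X D (der 𝒜 d' D' hD') =
        der 𝒜 (d + d') (gradedCommutator d d' D.1 D') (gradedCommutator_mem 𝒜 D.2 hD') := by
  refine exists_linearMap_of_unique (fun (D : gradedDer 𝒜 d) (X : MultiDer 𝒜 →ₗ[ℝ] MultiDer 𝒜) ↦
    X ∈ gradedDer (grade 𝒜) d ∧ (∀ b, X (fn 𝒜 b) = fn 𝒜 (D.1 b)) ∧
      ∀ d' D' (hD' : D' ∈ gradedDer 𝒜 d'), X (der 𝒜 d' D' hD') =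
        der 𝒜 (d + d') (gradedCommutator d d' D.1 D') (gradedCommutator_mem 𝒜 D.2 hD')) ?_ ?_ ?_ ?_
  · rintro D E X Y ⟨h1, h2, h3⟩ ⟨h1', h2', h3'⟩
    refine ⟨add_mem h1 h1', fun b ↦ ?_, fun d' D' hD' ↦ ?_⟩
    · rw [LinearMap.add_apply, h2, h2']
      exact (map_add (fnHom 𝒜) _ _).symm
    · rw [LinearMap.add_apply, h3, h3', ← derLin_apply, ← derLin_apply, ← derLin_apply, ← map_add]
      congr 1
      ext x
      simp [gradedCommutator]
      abel
  · rintro r D X ⟨h1, h2, h3⟩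
    refine ⟨Submodule.smul_mem _ r h1, fun b ↦ ?_, fun d' D' hD' ↦ ?_⟩
    · rw [LinearMap.smul_apply, h2]
      exact (map_smul (fnHom 𝒜) _ _).symm
    · rw [LinearMap.smul_apply, h3, ← derLin_apply, ← derLin_apply, ← map_smul]
      congr 1
      ext x
      simp [gradedCommutator, smul_sub, smul_comm r]
  · rintro ⟨D, hD⟩
    let v (j : ℤ) : shift (gradedDer 𝒜) (-1) j →ₗ[ℝ] MultiDer 𝒜 := derLin 𝒜 (d + (j - 1)) ∘ₗ
      { toFun := fun m ↦ ⟨gradedCommutator d (j - 1) D m.1,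
          gradedCommutator_mem 𝒜 hD (mem_gradedDer m)⟩
        map_add' := fun m m' ↦ by
          ext x
          simp [gradedCommutator]
          abel
        map_smul' := fun r m ↦ by
          ext x
          simp [gradedCommutator, smul_sub, smul_comm r] }
    have hv (j : ℤ) (m : shift (gradedDer 𝒜) (-1) j) : v j m = der 𝒜 (d + (j - 1))
      (gradedCommutator d (j - 1) D m.1) (gradedCommutator_mem 𝒜 hD (mem_gradedDer m)) := rfl
    obtain ⟨X, hX, h1, h2⟩ := GradedSym.exists_der hcomm d ((fnHom 𝒜).toLinearMap ∘ₗ D) v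
      (fun i a ha ↦ fn_mem (hD.1 i a ha)) (fun j m ↦ by
        have := der_mem (gradedCommutator_mem 𝒜 hD (mem_gradedDer m))
        rwa [← hv, add_assoc, sub_add_cancel] at this) (fun i a ha b ↦ by
        change fnHom 𝒜 (D (a * b)) = fnHom 𝒜 (D a) * fnHom 𝒜 b +
          koszul (d * i) • (fnHom 𝒜 a * fnHom 𝒜 (D b))
        rw [hD.2 i a ha b]
        simp only [map_add, map_mul, map_smul]) (by
        intro i j k hk a ha m am h
        subst hk
        have e1 := fn_mul_der hcomm (hD.1 i a ha) (mem_gradedDer m)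
        have e2 := fn_mul_der hcomm ha (gradedCommutator_mem 𝒜 hD (mem_gradedDer m))
        have e3 := GradedSym.elem_congr (ℳ := shift (gradedDer 𝒜) (-1)) (𝒜 := 𝒜)
          (sub_add_cancel j 1).symm (m := m) (m' := ⟨m.1, mem_shift_iff.2 (mem_gradedDer m)⟩) rfl
        have e4 : koszul (d * i) * koszul (d * (j - 1)) = koszul (d * (i + j - 1)) := by
          rw [← koszul_add]; ring_nf
        rw [hv, hv, elem_eq_der]
        refine Eq.trans ?_ (congrArg₂ (fun x y ↦ x + koszul (d * i) • y) e1.symm e2.symm)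
        rw [der_congr _ (show i + (d + (j - 1)) = d + i + (j - 1) by ring) rfl]
        rw [der_congr _ (show d + (i + j - 1) = d + i + (j - 1) by ring) rfl]
        rw [← derLin_apply, ← derLin_apply, ← derLin_apply, ← map_smul, ← map_add]
        congr 1
        ext x
        have h' (x : A) : am.1 x = a * m.1 x := by rw [h]; rfl
        simp only [gradedCommutator, LinearMap.sub_apply, LinearMap.comp_apply,
          LinearMap.smul_apply, Submodule.coe_add, Submodule.coe_smul, LinearMap.add_apply,
          LinearMap.mulLeft_apply, h', hD.2 i a ha, mul_sub a, smul_sub, mul_smul_comm, smul_smul, e4]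
        abel)
    refine ⟨X, hX, h1, fun d' D' hD' ↦ ?_⟩
    refine (h2 (d' + 1) ⟨D', mem_shift_iff.2 hD'⟩).trans ?_
    rw [hv]
    exact der_congr _ (by ring) (by rw [add_sub_cancel_right])
  · rintro D X X' ⟨h1, h2, h3⟩ ⟨h1', h2', h3'⟩
    exact ext_der h1 h1' (fun _ b _ ↦ by rw [h2, h2']) fun d E hE ↦ by rw [h3, h3']

end MultiDer

end

/-! ### Brackets with generators, and the bracket they determine -/

noncomputable section

namespace MultiDer

variable {A : Type*} [Ring A] [Algebra ℝ A] {𝒜 : ℤ → Submodule ℝ A} [GradedAlgebra 𝒜]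

theorem mul_neg_eq (x y : MultiDer 𝒜) : x * -y = -(x * y) := mul_neg x y

theorem neg_mul_eq (x y : MultiDer 𝒜) : -x * y = -(x * y) := neg_mul x y

theorem neg_smul_eq (r : ℝ) (x : MultiDer 𝒜) : (-r) • x = -(r • x) := neg_smul r x

theorem fn_linear_ext {W : Type*} [AddCommGroup W] [Module ℝ W] {L L' : MultiDer 𝒜 →ₗ[ℝ] W}
    (h : ∀ i, ∀ a ∈ 𝒜 i, L (fn 𝒜 a) = L' (fn 𝒜 a)) (a : A) : L (fn 𝒜 a) = L' (fn 𝒜 a) := by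
  have : L ∘ₗ (fnHom 𝒜).toLinearMap = L' ∘ₗ (fnHom 𝒜).toLinearMap :=
    LinearMap.ext_of_graded 𝒜 h
  exact LinearMap.congr_fun this a

theorem gradedComm (hcomm : IsGradedComm 𝒜) : IsGradedComm (grade 𝒜) :=
  GradedSym.isGradedComm hcomm

variable (hcomm : IsGradedComm 𝒜)

/-- The derivation `[a, ·]` for `a ∈ A`. -/
def adFn : A →ₗ[ℝ] MultiDer 𝒜 →ₗ[ℝ] MultiDer 𝒜 := (exists_ad_fn hcomm).choose

/-- The derivation `[D, ·]` for `D ∈ Der^d(A)`. -/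
def adDer (d : ℤ) : gradedDer 𝒜 d →ₗ[ℝ] MultiDer 𝒜 →ₗ[ℝ] MultiDer 𝒜 :=
  (exists_ad_der hcomm d).choose

theorem adFn_mem {i : ℤ} {a : A} (ha : a ∈ 𝒜 i) : adFn hcomm a ∈ gradedDer (grade 𝒜) (i - 1) :=
  ((exists_ad_fn hcomm).choose_spec i a ha).1

theorem adFn_fn (a b : A) : adFn hcomm a (fn 𝒜 b) = 0 := by
  have : (adFn hcomm).flip (fn 𝒜 b) = 0 :=
    LinearMap.ext_of_graded 𝒜 fun i a ha ↦ ((exists_ad_fn hcomm).choose_spec i a ha).2.1 b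
  exact LinearMap.congr_fun this a

theorem adFn_der {i : ℤ} {a : A} (ha : a ∈ 𝒜 i) (d : ℤ) (D) (hD : D ∈ gradedDer 𝒜 d) :
    adFn hcomm a (der 𝒜 d D hD) = -(koszul ((i - 1) * d) • fn 𝒜 (D a)) :=
  ((exists_ad_fn hcomm).choose_spec i a ha).2.2 d D hD

theorem adDer_mem {d : ℤ} (D : gradedDer 𝒜 d) : adDer hcomm d D ∈ gradedDer (grade 𝒜) d :=
  ((exists_ad_der hcomm d).choose_spec D).1

theorem adDer_fn {d : ℤ} (D : gradedDer 𝒜 d) (b : A) :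
    adDer hcomm d D (fn 𝒜 b) = fn 𝒜 (D.1 b) :=
  ((exists_ad_der hcomm d).choose_spec D).2.1 b

theorem adDer_der {d : ℤ} (D : gradedDer 𝒜 d) (d' : ℤ) (D') (hD' : D' ∈ gradedDer 𝒜 d') :
    adDer hcomm d D (der 𝒜 d' D' hD') =
      der 𝒜 (d + d') (gradedCommutator d d' D.1 D') (gradedCommutator_mem 𝒜 D.2 hD') :=
  ((exists_ad_der hcomm d).choose_spec D).2.2 d' D' hD'


theorem mul_ad_mem (hcomm : IsGradedComm 𝒜) {i j : ℤ} {x : MultiDer 𝒜} (hx : x ∈ grade 𝒜 i)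
    {D : MultiDer 𝒜 →ₗ[ℝ] MultiDer 𝒜} (hD : D ∈ gradedDer (grade 𝒜) (j - 1)) :
    LinearMap.mulLeft ℝ x ∘ₗ D ∈ gradedDer (grade 𝒜) (i + j - 1) := by
  have := mulLeft_comp_mem_gradedDer (gradedComm hcomm) hx hD
  rwa [← add_sub_assoc] at this

/-- Two derivations are compared on generators. This Leibniz rule in the first slot makes `a ↦ ±[a,
γ]` a derivation on `A` in `exists_bracket`. -/
theorem adFn_mul {i j : ℤ} {a b : A} (ha : a ∈ 𝒜 i) (hb : b ∈ 𝒜 j) :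
    adFn hcomm (a * b) = LinearMap.mulLeft ℝ (fn 𝒜 a) ∘ₗ adFn hcomm b +
      koszul (i * j) • (LinearMap.mulLeft ℝ (fn 𝒜 b) ∘ₗ adFn hcomm a) := by
  refine ext_der (adFn_mem hcomm (SetLike.mul_mem_graded ha hb))
    (add_mem (mul_ad_mem hcomm (fn_mem ha) (adFn_mem hcomm hb)) (Submodule.smul_mem _ _ (by
      rw [add_comm i j]; exact mul_ad_mem hcomm (fn_mem hb) (adFn_mem hcomm ha))))
    (fun k c hc ↦ ?_) (fun d D hD ↦ ?_)
  · simp [adFn_fn]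
  · rw [adFn_der hcomm (SetLike.mul_mem_graded ha hb), hD.2 i a ha]
    simp only [LinearMap.add_apply, LinearMap.smul_apply, LinearMap.comp_apply,
      LinearMap.mulLeft_apply]
    rw [adFn_der hcomm ha, adFn_der hcomm hb]
    have e := gradedComm hcomm _ _ _ (fn_mem (𝒜 := 𝒜) (hD.1 i a ha)) _ (fn_mem hb)
    simp only [← fnHom_apply] at e ⊢
    rw [map_add, map_smul, map_mul, map_mul, e]
    by_cases h1 : Even i <;> by_cases h2 : Even j <;> by_cases h3 : Even d <;>
      simp only [koszul_eq, Int.even_add, Int.even_sub, Int.even_mul, Int.not_even_one, h1, h2, h3,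
          iff_false, iff_true, not_true_eq_false, not_false_eq_true, or_true, true_or, or_false,
          false_or, or_self, true_iff, false_iff, if_true, if_false, one_smul, neg_smul_eq] <;>
      simp only [neg_neg, mul_neg_eq, smul_neg, neg_add, mul_smul_comm, smul_add] <;> abel

/-- The counterpart of `adFn_mul` for a product of a function and a derivation: it shows that `D ↦
±[D, γ]` respects the module relations of `S_A(M)`. -/
theorem adDer_smul {i d : ℤ} {a : A} (ha : a ∈ 𝒜 i) {D : A →ₗ[ℝ] A} (hD : D ∈ gradedDer 𝒜 d)
    {k : ℤ} (hk : k = i + d) {aD : A →ₗ[ℝ] A} (haD : aD ∈ gradedDer 𝒜 k)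
    (h : ∀ x, aD x = a * D x) :
    adDer hcomm k ⟨aD, haD⟩ = LinearMap.mulLeft ℝ (fn 𝒜 a) ∘ₗ adDer hcomm d ⟨D, hD⟩ +
      koszul (i * (d + 1)) • (LinearMap.mulLeft ℝ (der 𝒜 d D hD) ∘ₗ adFn hcomm a) := by
  subst hk
  refine ext_der (adDer_mem hcomm _) (add_mem (mulLeft_comp_mem_gradedDer (gradedComm hcomm)
      (fn_mem ha) (adDer_mem hcomm ⟨D, hD⟩)) (Submodule.smul_mem _ _ ?_))
    (fun k c hc ↦ ?_) (fun d' D' hD' ↦ ?_)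
  · have := mul_ad_mem hcomm (der_mem hD) (adFn_mem hcomm ha)
    rwa [show d + 1 + i - 1 = i + d by ring] at this
  · rw [adDer_fn]
    simp only [LinearMap.add_apply, LinearMap.smul_apply, LinearMap.comp_apply,
      LinearMap.mulLeft_apply, adFn_fn, adDer_fn, h]
    simp [← fnHom_apply]
  · rw [adDer_der]
    simp only [LinearMap.add_apply, LinearMap.smul_apply, LinearMap.comp_apply,
      LinearMap.mulLeft_apply]
    rw [adFn_der hcomm ha, adDer_der]
    have e := gradedComm hcomm _ _ _ (der_mem hD) _ (fn_mem (𝒜 := 𝒜) (hD'.1 i a ha))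
    rw [mul_neg_eq, mul_smul_comm, e, fn_mul_der hcomm (hD'.1 i a ha) hD,
      fn_mul_der hcomm ha (gradedCommutator_mem 𝒜 hD hD')]
    rw [der_congr _ (show i + (d + d') = i + d + d' by ring) rfl,
      der_congr _ (show d' + i + d = i + d + d' by ring) rfl, ← derLin_apply, ← derLin_apply,
      ← derLin_apply, smul_neg, ← map_smul, ← map_smul, ← map_smul, ← map_neg, ← map_add]
    congr 1
    ext x
    simp only [gradedCommutator, LinearMap.sub_apply, LinearMap.comp_apply,
      LinearMap.smul_apply, Submodule.coe_add, Submodule.coe_smul, LinearMap.add_apply,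
      LinearMap.mulLeft_apply, h, hD'.2 i a ha, mul_sub a, smul_sub, mul_smul_comm, smul_smul,
      smul_add, Submodule.coe_neg, LinearMap.neg_apply]
    by_cases h1 : Even i <;> by_cases h2 : Even d' <;> by_cases h3 : Even d <;>
      simp only [koszul_eq, Int.even_add, Int.even_sub, Int.even_mul, Int.not_even_one, h1, h2, h3,
          iff_false, iff_true, not_true_eq_false, not_false_eq_true, or_true, true_or, or_false,
          false_or, or_self, true_iff, false_iff, if_true, if_false, one_smul, neg_smul, one_mul,
          mul_one, neg_mul, neg_neg, mul_neg] <;> abel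

/-- For fixed `γ`, antisymmetry dictates the values of `[γ, ·]` on generators in terms of the
derivations `[a, ·]` and `[D, ·]` already constructed. All signs use degrees in `T`, one less than
those of the algebra. -/
theorem exists_bracket : ∃ br : MultiDer 𝒜 →ₗ[ℝ] MultiDer 𝒜 →ₗ[ℝ] MultiDer 𝒜,
    ∀ k, ∀ γ ∈ grade 𝒜 k, br γ ∈ gradedDer (grade 𝒜) (k - 1) ∧
      (∀ i, ∀ a ∈ 𝒜 i, br γ (fn 𝒜 a) = -(koszul ((k - 1) * (i - 1)) • adFn hcomm a γ)) ∧
      ∀ d D (hD : D ∈ gradedDer 𝒜 d),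
        br γ (der 𝒜 d D hD) = -(koszul ((k - 1) * d) • adDer hcomm d ⟨D, hD⟩ γ) := by
  refine exists_linearMap_of_graded (grade 𝒜) (fun k γ (Z : MultiDer 𝒜 →ₗ[ℝ] MultiDer 𝒜) ↦
    γ ∈ grade 𝒜 k ∧ Z ∈ gradedDer (grade 𝒜) (k - 1) ∧
      (∀ i, ∀ a ∈ 𝒜 i, Z (fn 𝒜 a) = -(koszul ((k - 1) * (i - 1)) • adFn hcomm a γ)) ∧
      ∀ d D (hD : D ∈ gradedDer 𝒜 d),
        Z (der 𝒜 d D hD) = -(koszul ((k - 1) * d) • adDer hcomm d ⟨D, hD⟩ γ)) ?_ ?_ ?_ ?_ |>.imp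
      fun X h i a ha ↦ (h i a ha).2
  · rintro k γ γ' Z Z' ⟨h0, h1, h2, h3⟩ ⟨h0', h1', h2', h3'⟩
    refine ⟨add_mem h0 h0', add_mem h1 h1', fun i a ha ↦ ?_, fun d D hD ↦ ?_⟩
    · rw [LinearMap.add_apply, h2 i a ha, h2' i a ha, map_add, smul_add, neg_add]
    · rw [LinearMap.add_apply, h3, h3', map_add, smul_add, neg_add]
  · rintro k r γ Z ⟨h0, h1, h2, h3⟩
    refine ⟨Submodule.smul_mem _ r h0, Submodule.smul_mem _ r h1, fun i a ha ↦ ?_, fun d D hD ↦ ?_⟩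
    · rw [LinearMap.smul_apply, h2 i a ha, map_smul, smul_neg, smul_comm]
    · rw [LinearMap.smul_apply, h3, map_smul, smul_neg, smul_comm]
  · intro k γ hγ
    -- The required sign `(-1)^{(k-1)(i-1)}` varies with the degree `i` of `a`; it is split into the
    -- constant `(-1)^{k-1}` and the sign map `(-1)^{(k-1)i}`.
    let u : A →ₗ[ℝ] MultiDer 𝒜 :=
      (-koszul (k - 1)) • ((adFn hcomm).flip γ ∘ₗ signMap 𝒜 (k - 1))
    have hu (i : ℤ) (a : A) (ha : a ∈ 𝒜 i) :
        u a = -(koszul ((k - 1) * (i - 1)) • adFn hcomm a γ) := by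
      change (-koszul (k - 1)) • adFn hcomm (signMap 𝒜 (k - 1) a) γ = _
      rw [signMap_of_mem _ ha, map_smul, LinearMap.smul_apply, neg_smul_eq, smul_smul, ← koszul_add]
      congr 2
      simp only [koszul_eq, Int.even_add, Int.even_sub, Int.even_mul, Int.not_even_one]
      congr 1
      by_cases h1 : Even i <;> by_cases h2 : Even k <;> simp [h1, h2]
    let v (j : ℤ) : shift (gradedDer 𝒜) (-1) j →ₗ[ℝ] MultiDer 𝒜 :=
      (-koszul ((k - 1) * (j - 1))) • ((adDer hcomm (j - 1)).flip γ ∘ₗ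
        { toFun := fun m ↦ ⟨m.1, mem_gradedDer m⟩
          map_add' := fun _ _ ↦ rfl
          map_smul' := fun _ _ ↦ rfl })
    have hv (j : ℤ) (m : shift (gradedDer 𝒜) (-1) j) :
        v j m = -(koszul ((k - 1) * (j - 1)) • adDer hcomm (j - 1) ⟨m.1, mem_gradedDer m⟩ γ) :=
      neg_smul_eq (koszul ((k - 1) * (j - 1))) (adDer hcomm (j - 1) ⟨m.1, mem_gradedDer m⟩ γ)
    obtain ⟨D, hD, h1, h2⟩ := GradedSym.exists_der hcomm (k - 1) u v (fun i a ha ↦ by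
      rw [hu i a ha]
      refine neg_mem (Submodule.smul_mem _ _ ?_)
      have := (adFn_mem hcomm ha).1 k γ hγ
      rwa [show i - 1 + k = k - 1 + i by ring] at this) (fun j m ↦ by
      rw [hv]
      refine neg_mem (Submodule.smul_mem _ _ ?_)
      have := (adDer_mem hcomm ⟨m.1, mem_gradedDer m⟩).1 k γ hγ
      rwa [show j - 1 + k = k - 1 + j by ring] at this) (fun i a ha b ↦ by
        have key : u ∘ₗ LinearMap.mulLeft ℝ a = LinearMap.mulLeft ℝ (u a) ∘ₗ
            (fnHom 𝒜).toLinearMap + koszul ((k - 1) * i) • (LinearMap.mulLeft ℝ (fn 𝒜 a) ∘ₗ u) := by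
          refine LinearMap.ext_of_graded 𝒜 fun j b hb ↦ ?_
          simp only [LinearMap.add_apply, LinearMap.smul_apply, LinearMap.comp_apply,
            LinearMap.mulLeft_apply]
          rw [hu _ _ (SetLike.mul_mem_graded ha hb), hu i a ha, hu j b hb, adFn_mul hcomm ha hb]
          simp only [LinearMap.add_apply, LinearMap.smul_apply, LinearMap.comp_apply,
            LinearMap.mulLeft_apply, AlgHom.toLinearMap_apply, fnHom_apply]
          rw [gradedComm hcomm _ _ _ (fn_mem hb) _ ((adFn_mem hcomm ha).1 k γ hγ)]
          by_cases h1 : Even i <;> by_cases h2 : Even j <;> by_cases h3 : Even k <;>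
            simp only [koszul_eq, Int.even_add, Int.even_sub, Int.even_mul, Int.not_even_one, h1,
              h2, h3, iff_false, iff_true, not_true_eq_false, not_false_eq_true, or_true, true_or,
              or_false, false_or, or_self, true_iff, false_iff, if_true, if_false, one_smul,
              neg_smul_eq] <;>
            simp only [neg_neg, mul_neg_eq, neg_mul_eq, smul_neg, neg_add, mul_smul_comm, smul_add] <;> abel
        exact LinearMap.congr_fun key b) (by
        intro i j l hl a ha m am h
        have h' (x : A) : am.1 x = a * m.1 x := by rw [h]; rfl
        have hl' : l - 1 = i + (j - 1) := by rw [hl]; ring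
        have e := adDer_smul hcomm ha (mem_gradedDer m) hl' (mem_gradedDer am) h'
        rw [hv, hv, e, hu i a ha, elem_eq_der]
        simp only [LinearMap.add_apply, LinearMap.smul_apply, LinearMap.comp_apply,
            LinearMap.mulLeft_apply]
        rw [gradedComm hcomm _ _ _ (der_mem (mem_gradedDer m)) _ ((adFn_mem hcomm ha).1 k γ hγ)]
        change _ = _ + koszul ((k - 1) * i) • (fn 𝒜 a * _)
        subst hl
        by_cases h1 : Even i <;> by_cases h2 : Even j <;> by_cases h3 : Even k <;>
            simp only [koszul_eq, Int.even_add, Int.even_sub, Int.even_mul, Int.not_even_one, h1,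
              h2, h3, iff_false, iff_true, not_true_eq_false, not_false_eq_true, or_true, true_or,
              or_false, false_or, or_self, true_iff, false_iff, if_true, if_false, one_smul,
              neg_smul_eq] <;>
            simp only [neg_neg, mul_neg_eq, neg_mul_eq, smul_neg, neg_add, mul_smul_comm, smul_add] <;> abel)
    refine ⟨D, hγ, hD, fun i a ha ↦ (h1 a).trans (hu i a ha), fun d E hE ↦ ?_⟩
    refine (h2 (d + 1) ⟨E, mem_shift_iff.2 hE⟩).trans ?_
    rw [hv]
    have : ∀ d' (hd : d' = d) (hE' : E ∈ gradedDer 𝒜 d'), -(koszul ((k - 1) * d') •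
        adDer hcomm d' ⟨E, hE'⟩ γ) = -(koszul ((k - 1) * d) • adDer hcomm d ⟨E, hE⟩ γ) := by
      rintro d' rfl hE'; rfl
    exact this _ (add_sub_cancel_right d 1) _
  · rintro k γ Z Z' ⟨h0, h1, h2, h3⟩ ⟨h0', h1', h2', h3'⟩
    exact ext_der h1 h1' (fun i a ha ↦ by rw [h2 i a ha, h2' i a ha]) fun d E hE ↦ by rw [h3, h3']

end MultiDer

end

/-! ### Existence and uniqueness of the Schouten bracket -/

noncomputable section

namespace MultiDer

variable {A : Type*} [Ring A] [Algebra ℝ A] {𝒜 : ℤ → Submodule ℝ A} [GradedAlgebra 𝒜]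

theorem gradedCommutator_symm (d d' : ℤ) (D D' : A →ₗ[ℝ] A) :
    -(koszul (d * d') • gradedCommutator d' d D' D) = gradedCommutator d d' D D' := by
  rw [gradedCommutator, gradedCommutator, smul_sub, smul_smul, mul_comm d' d, koszul_mul_self,
    one_smul, neg_sub]

/-- The Schouten bracket exists. -/
theorem exists_isSchoutenBracket (hcomm : IsGradedComm 𝒜) : ∃ br, IsSchoutenBracket 𝒜 br := by
  obtain ⟨br, hbr⟩ := exists_bracket hcomm
  -- The bracket was prescribed through its second slot. On pairs of generators the prescription is
  -- itself antisymmetric, so in the first slot it returns the derivations `[a, ·]` and `[D, ·]`.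
  have hfn (i : ℤ) (a : A) (ha : a ∈ 𝒜 i) : br (fn 𝒜 a) = adFn hcomm a := by
    obtain ⟨h1, h2, h3⟩ := hbr i _ (fn_mem ha)
    refine ext_der h1 (adFn_mem hcomm ha) (fun j b hb ↦ ?_) fun d D hD ↦ ?_
    · rw [h2 j b hb, adFn_fn, adFn_fn]; simp
    · rw [h3, adDer_fn, adFn_der hcomm ha]
  have hdr (d : ℤ) (D : A →ₗ[ℝ] A) (hD : D ∈ gradedDer 𝒜 d) :
      br (der 𝒜 d D hD) = adDer hcomm d ⟨D, hD⟩ := by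
    obtain ⟨h1, h2, h3⟩ := hbr (d + 1) _ (der_mem hD)
    rw [add_sub_cancel_right] at h1 h2 h3
    refine ext_der h1 (adDer_mem hcomm _) (fun j b hb ↦ ?_) fun d' D' hD' ↦ ?_
    · rw [h2 j b hb, adFn_der hcomm hb, adDer_fn, mul_comm d (j - 1), smul_neg, smul_smul,
        koszul_mul_self, one_smul, neg_neg]
    · rw [h3, adDer_der, adDer_der,
        der_congr (d' := d + d') _ (add_comm d' d) rfl,
        ← derLin_apply, ← derLin_apply, ← map_smul, ← map_neg]
      congr 1
      exact Subtype.ext (gradedCommutator_symm d d' D D')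
  refine ⟨br, isGerstenhaber_of_generators (gradedComm hcomm) mem_of_gens adjoin_gens br
    (fun k γ hγ ↦ (hbr k γ hγ).1) ?_ ?_, ?_, ?_, ?_⟩
  · rintro k i γ hγ _ (⟨a, ha, rfl⟩ | ⟨D, hD, rfl⟩)
    · rw [(hbr k γ hγ).2.1 i a ha, hfn i a ha]
    · rw [(hbr k γ hγ).2.2 (i - 1) D hD, hdr]
  -- The Jacobi identity on generators is trivial with at most one derivation. With two derivations
  -- and a function it unfolds the definition of the commutator, and with three it is the Jacobi
  -- identity for graded commutators.
  · rintro i j k _ (⟨a, ha, rfl⟩ | ⟨D, hD, rfl⟩) _ (⟨b, hb, rfl⟩ | ⟨D', hD', rfl⟩) _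
      (⟨c, hc, rfl⟩ | ⟨D'', hD'', rfl⟩)
    · simp only [hfn i a ha, hfn j b hb, adFn_fn, map_zero, LinearMap.zero_apply, smul_zero,
        sub_zero]
    · simp only [hfn i a ha, hfn j b hb, adFn_fn, map_zero, LinearMap.zero_apply, smul_zero,
        sub_zero, adFn_der hcomm ha, adFn_der hcomm hb, map_neg, map_smul, neg_zero]
    · simp only [hfn i a ha, hdr, adFn_fn, map_zero, LinearMap.zero_apply, smul_zero,
        sub_zero, adFn_der hcomm ha, adDer_fn, map_neg, map_smul, neg_zero, LinearMap.neg_apply,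
        LinearMap.smul_apply, hfn _ _ (hD'.1 i a ha)]
    · simp only [hfn i a ha, hdr, adDer_fn, map_neg, map_smul, LinearMap.neg_apply,
        LinearMap.smul_apply, hfn _ _ (hD'.1 i a ha), adFn_der hcomm ha,
        adFn_der hcomm (hD'.1 i a ha), adDer_der, gradedCommutator, LinearMap.sub_apply,
        LinearMap.comp_apply]
      simp only [← fnHom_apply, map_sub, map_smul]
      by_cases h1 : Even i <;> by_cases h2 : Even j <;> by_cases h3 : Even k <;>
        simp only [koszul_eq, Int.even_add, Int.even_sub, Int.even_mul, Int.not_even_one, h1,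
          h2, h3, iff_false, iff_true, not_true_eq_false, not_false_eq_true, or_true, true_or,
          or_false, false_or, or_self, true_iff, false_iff, if_true, if_false, one_smul,
          neg_smul_eq] <;>
        abel
    · simp only [hfn j b hb, hdr, adFn_fn, map_zero, LinearMap.zero_apply, smul_zero,
        sub_zero, adDer_fn, hfn _ _ (hD.1 j b hb)]
    · simp only [hfn j b hb, hdr, adDer_fn, map_neg, map_smul, LinearMap.neg_apply,
        LinearMap.smul_apply, hfn _ _ (hD.1 j b hb), adFn_der hcomm hb,
        adFn_der hcomm (hD.1 j b hb), adDer_der, gradedCommutator, LinearMap.sub_apply,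
        LinearMap.comp_apply]
      simp only [← fnHom_apply, map_sub, map_smul]
      by_cases h1 : Even i <;> by_cases h2 : Even j <;> by_cases h3 : Even k <;>
        simp only [koszul_eq, Int.even_add, Int.even_sub, Int.even_mul, Int.not_even_one, h1,
          h2, h3, iff_false, iff_true, not_true_eq_false, not_false_eq_true, or_true, true_or,
          or_false, false_or, or_self, true_iff, false_iff, if_true, if_false, one_smul,
          neg_smul_eq] <;>
        abel
    · simp only [hdr, adDer_der, adDer_fn, gradedCommutator, LinearMap.sub_apply,
        LinearMap.comp_apply, LinearMap.smul_apply]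
      simp only [← fnHom_apply, map_sub, map_smul]
    · simp only [hdr, adDer_der]
      have e1 : i - 1 + (j - 1 + (k - 1)) = i - 1 + (j - 1) + (k - 1) := by ring
      have e2 : j - 1 + (i - 1 + (k - 1)) = i - 1 + (j - 1) + (k - 1) := by ring
      rw [der_congr _ e1 rfl, der_congr _ e2 rfl, ← derLin_apply, ← derLin_apply, ← derLin_apply,
        ← map_smul, ← map_sub]
      congr 1
      ext x
      simp only [gradedCommutator, LinearMap.sub_apply, LinearMap.comp_apply,
        LinearMap.smul_apply, Submodule.coe_sub, Submodule.coe_smul, map_sub, map_smul]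
      by_cases h1 : Even i <;> by_cases h2 : Even j <;> by_cases h3 : Even k <;>
        simp only [koszul_eq, Int.even_add, Int.even_sub, Int.even_mul, Int.not_even_one, h1,
          h2, h3, iff_false, iff_true, not_true_eq_false, not_false_eq_true, or_true, true_or,
          or_false, false_or, or_self, true_iff, false_iff, if_true, if_false, one_smul,
          neg_smul] <;>
        abel
  · intro a b
    have h1 (i : ℤ) (a : A) (ha : a ∈ 𝒜 i) : br (fn 𝒜 a) (fn 𝒜 b) = 0 := by
      rw [hfn i a ha, adFn_fn]
    exact fn_linear_ext (L := br.flip (fn 𝒜 b)) (L' := 0) h1 a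
  · intro d D hD a
    rw [hdr, adDer_fn]
  · intro d d' D D' hD hD'
    rw [hdr, adDer_der]

/-- The Schouten bracket is unique. -/
theorem _root_.IsSchoutenBracket.unique
    {br br' : MultiDer 𝒜 →ₗ[ℝ] MultiDer 𝒜 →ₗ[ℝ] MultiDer 𝒜}
    (h : IsSchoutenBracket 𝒜 br) (h' : IsSchoutenBracket 𝒜 br') : br = br' := by
  ext α β
  refine h.gerstenhaber.map_bracket_of_generators h'.gerstenhaber (AlgHom.id ℝ _) mem_of_gens
    adjoin_gens (fun k x hx ↦ hx) ?_ α β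
  rintro i j _ (⟨a, ha, rfl⟩ | ⟨D, hD, rfl⟩) _ (⟨b, hb, rfl⟩ | ⟨D', hD', rfl⟩)
  · exact .inl ((h.fn_fn a b).trans (h'.fn_fn a b).symm)
  · exact .inr ((h.der_fn _ _ hD' a).trans (h'.der_fn _ _ hD' a).symm)
  · exact .inl ((h.der_fn _ _ hD b).trans (h'.der_fn _ _ hD b).symm)
  · exact .inl ((h.der_der _ _ _ _ hD hD').trans (h'.der_der _ _ _ _ hD hD').symm)

end MultiDer

end

noncomputable section

/-! ### Algebras with a frame of generators -/

universe u

section Idempotent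

variable {R : Type*} [CommRing R] [Algebra ℝ R] {I : Type*} [Fintype I] {q : Matrix I I R}

theorem sum_mul_of_idempotent (hq : q * q = q) (i l : I) : ∑ k, q i k * q k l = q i l := by
  conv_rhs => rw [← hq]
  rfl

theorem derivation_apply_of_idempotent (hq : q * q = q) (X : Derivation ℝ R R) (i l : I) :
    X (q i l) = ∑ k, (X (q i k) * q k l + q i k * X (q k l)) := by
  rw [← sum_mul_of_idempotent hq i l, map_sum]
  refine Finset.sum_congr rfl fun k _ ↦ ?_
  rw [X.leibniz]
  simp only [smul_eq_mul]
  ring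

/-- Multiplying `X(q) = X(q) q + q X(q)` by `q` on the left and cancelling `q X(q)` leaves `q X(q) q
= 0`. -/
theorem sum_derivation_of_idempotent (hq : q * q = q) (X : Derivation ℝ R R) (i l : I) :
    ∑ k, ∑ m, q i k * X (q k m) * q m l = 0 := by
  have h1 : ∑ k, q i k * X (q k l) =
      ∑ k, q i k * X (q k l) + ∑ k, ∑ m, q i k * X (q k m) * q m l := by
    conv_lhs =>
      enter [2, k]
      rw [derivation_apply_of_idempotent hq X k l, Finset.mul_sum]
    simp only [mul_add, Finset.sum_add_distrib]
    rw [add_comm]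
    congr 1
    · rw [Finset.sum_comm]
      refine Finset.sum_congr rfl fun m _ ↦ ?_
      simp only [← mul_assoc, ← Finset.sum_mul, sum_mul_of_idempotent hq]
    · simp only [mul_assoc]
  exact left_eq_add.1 h1

end Idempotent

section Frame

variable {R : Type*} [CommRing R] [Algebra ℝ R] {I J : Type*} [Fintype I] [Fintype J]

/-- The graded algebra `𝒜` is generated over the algebra `R` of degree zero by elements `g i` of
degree `e`, subject only to the relations `g j = ∑ i, q i j * g i` given by an idempotent matrix and
to graded commutativity; derivations on `R` are combinations of the derivations `X j`. -/
structure FrameAlgebra {A : Type u} [Ring A] [Algebra ℝ A] (𝒜 : ℤ → Submodule ℝ A) (e : ℤ)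
    (q : Matrix I I R) (X : J → Derivation ℝ R R) (h : J → R) where
  f : R →ₐ[ℝ] A
  g : I → A
  f_mem : ∀ r, f r ∈ 𝒜 0
  g_mem : ∀ i, g i ∈ 𝒜 e
  g_eq : ∀ j, g j = ∑ i, f (q i j) * g i
  q_mul : q * q = q
  adjoin_eq : Algebra.adjoin ℝ (Set.range f ∪ Set.range g) = ⊤
  comm : IsGradedComm 𝒜
  -- The `t i` need not satisfy the relations of the frame, since their projection by `q` is used.
  -- The targets will be matrices over `A` and the multiderivations of the other algebra, which lie
  -- in the same universe.
  lift : ∀ (S : Type u) [Ring S] [Algebra ℝ S] (φ : R →ₐ[ℝ] S) (t : I → S),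
    (∀ r i, φ r * t i = t i * φ r) → (∀ i j, t i * t j = koszul e • (t j * t i)) →
    ∃ Λ : A →ₐ[ℝ] S, (∀ r, Λ (f r) = φ r) ∧ ∀ j, Λ (g j) = ∑ i, φ (q i j) * t i
  der_eq : ∀ d, ∀ D ∈ gradedDer 𝒜 d, ∀ r, D (f r) = ∑ j, D (f (h j)) * f (X j r)

namespace FrameAlgebra

variable {A : Type u} [Ring A] [Algebra ℝ A] {𝒜 : ℤ → Submodule ℝ A} {e : ℤ}
    {q : Matrix I I R} {X : J → Derivation ℝ R R} {h : J → R} (F : FrameAlgebra 𝒜 e q X h)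

/-- The generators of degree `k`. -/
def gens (k : ℤ) : Set A :=
  {x | (k = 0 ∧ x ∈ Set.range F.f) ∨ (k = e ∧ x ∈ Set.range F.g)}

theorem mem_of_gens (k : ℤ) (x) (hx : x ∈ F.gens k) : x ∈ 𝒜 k := by
  rcases hx with ⟨rfl, r, rfl⟩ | ⟨rfl, i, rfl⟩
  exacts [F.f_mem r, F.g_mem i]

theorem adjoin_gens : Algebra.adjoin ℝ (⋃ k, F.gens k) = ⊤ := by
  rw [eq_top_iff, ← F.adjoin_eq]
  refine Algebra.adjoin_mono ?_
  rintro x (hx | hx)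
  exacts [Set.mem_iUnion.2 ⟨0, .inl ⟨rfl, hx⟩⟩, Set.mem_iUnion.2 ⟨e, .inr ⟨rfl, hx⟩⟩]

variable [GradedAlgebra 𝒜]

theorem f_comm (r : R) (a : A) : F.f r * a = a * F.f r := F.comm.commute (F.f_mem r) a

theorem ext {d : ℤ} {D D' : A →ₗ[ℝ] A} (hD : D ∈ gradedDer 𝒜 d) (hD' : D' ∈ gradedDer 𝒜 d)
    (hf : ∀ r, D (F.f r) = D' (F.f r)) (hg : ∀ i, D (F.g i) = D' (F.g i)) : D = D' := by
  refine gradedDer_ext F.mem_of_gens F.adjoin_gens hD hD' ?_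
  rintro k _ (⟨rfl, r, rfl⟩ | ⟨rfl, i, rfl⟩)
  exacts [hf r, hg i]

/-- Derivations with prescribed values. -/
theorem exists_der (d : ℤ) (v : R →ₗ[ℝ] A) (hv : ∀ r, v r ∈ 𝒜 d)
    (hv_mul : ∀ r s, v (r * s) = v r * F.f s + F.f r * v s) (y : I → A)
    (hy : ∀ i, y i ∈ 𝒜 (d + e)) :
    ∃ D ∈ gradedDer 𝒜 d, (∀ r, D (F.f r) = v r) ∧
      ∀ j, D (F.g j) = ∑ i, (v (q i j) * F.g i + F.f (q i j) * y i) := by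
  have hv1 : v 1 = 0 := by simpa using hv_mul 1 1
  let φ : R →ₐ[ℝ] Matrix (Fin 2) (Fin 2) A := AlgHom.ofLinearMap
    { toFun := fun r ↦ upperTri (F.f r) (v r) (F.f r)
      map_add' := fun a b ↦ by simp only [map_add, upperTri_add]
      map_smul' := fun c a ↦ by simp only [map_smul, upperTri_smul, RingHom.id_apply] }
    (by simp only [LinearMap.coe_mk, AddHom.coe_mk, map_one, hv1, upperTri_one])
    (fun a b ↦ by
      simp only [LinearMap.coe_mk, AddHom.coe_mk, upperTri_mul, map_mul, hv_mul]
      rw [add_comm])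
  have hφ (r : R) : φ r = upperTri (F.f r) (v r) (F.f r) := rfl
  obtain ⟨Λ, h1, h2⟩ := F.lift (Matrix (Fin 2) (Fin 2) A) φ
    (fun i ↦ upperTri (koszul (d * e) • F.g i) (y i) (F.g i))
    (fun r i ↦ by
      simp only [hφ, upperTri_mul, mul_smul_comm, smul_mul_assoc, ← F.f_comm r]
      rw [F.comm _ _ _ (F.g_mem i) _ (hv r), smul_smul, mul_comm e d, koszul_mul_self, one_smul,
        add_comm])
    (fun i j ↦ by
      have hee : koszul (e * e) = koszul e := by
        by_cases h1 : Even e <;> simp [koszul_eq, h1, Int.even_mul]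
      have e1 := F.comm _ _ _ (F.g_mem i) _ (F.g_mem j)
      have e2 := F.comm _ _ _ (F.g_mem i) _ (hy j)
      have e3 := F.comm _ _ _ (hy i) _ (F.g_mem j)
      rw [hee] at e1
      simp only [upperTri_mul, upperTri_smul, mul_smul_comm, smul_mul_assoc, e1, e2, e3, smul_add,
        smul_smul]
      congr 1
      · congr 1; ring
      · rw [add_comm]
        congr 2
        · by_cases h1 : Even e <;> by_cases h2 : Even d <;>
            simp [koszul_eq, h1, h2, Int.even_mul, Int.even_add]
        · by_cases h1 : Even e <;> by_cases h2 : Even d <;>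
            simp [koszul_eq, h1, h2, Int.even_mul, Int.even_add])
  have h2' (j : I) : Λ (F.g j) = upperTri (koszul (d * e) • F.g j)
      (∑ i, (v (q i j) * F.g i + F.f (q i j) * y i)) (F.g j) := by
    rw [h2]
    have hsum (s : Finset I) : ∑ i ∈ s, φ (q i j) * upperTri (koszul (d * e) • F.g i) (y i) (F.g i) =
        upperTri (koszul (d * e) • ∑ i ∈ s, F.f (q i j) * F.g i)
        (∑ i ∈ s, (v (q i j) * F.g i + F.f (q i j) * y i)) (∑ i ∈ s, F.f (q i j) * F.g i) := by
      classical
      induction s using Finset.induction_on with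
      | empty => simp [upperTri_zero]
      | insert i s hi ih =>
        rw [Finset.sum_insert hi, Finset.sum_insert hi, Finset.sum_insert hi, ih, hφ, upperTri_mul,
          upperTri_add, smul_add, mul_smul_comm, add_comm (F.f (q i j) * y i)]
    rw [hsum, ← F.g_eq]
  obtain ⟨D, hD, hD'⟩ := exists_gradedDer_of_algHom F.mem_of_gens F.adjoin_gens (d := d) Λ (by
    rintro k _ (⟨rfl, r, rfl⟩ | ⟨rfl, i, rfl⟩)
    · rw [h1, hφ, mul_zero, koszul_zero, one_smul, add_zero]
      exact ⟨rfl, hv r, rfl, rfl⟩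
    · rw [h2']
      refine ⟨rfl, sum_mem fun l _ ↦ add_mem (SetLike.mul_mem_graded (hv _) (F.g_mem l)) ?_, rfl, rfl⟩
      have := SetLike.mul_mem_graded (F.f_mem (q l i)) (hy l)
      rwa [zero_add] at this)
  refine ⟨D, hD, fun r ↦ ?_, fun j ↦ ?_⟩
  · rw [hD', h1]; rfl
  · rw [hD', h2']; rfl

/-- The choice `y = 0` is the connection obtained by projecting, with `q`, the trivial connection of
the trivial bundle of which the frame is a summand. -/
theorem exists_nabla (j : J) : ∃ D ∈ gradedDer 𝒜 0, (∀ r, D (F.f r) = F.f (X j r)) ∧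
    ∀ l, D (F.g l) = ∑ i, F.f (X j (q i l)) * F.g i := by
  obtain ⟨D, hD, h1, h2⟩ := F.exists_der 0 (F.f.toLinearMap ∘ₗ (X j).toLinearMap)
    (fun r ↦ F.f_mem _) (fun r s ↦ by
      change F.f (X j (r * s)) = F.f (X j r) * F.f s + F.f r * F.f (X j s)
      rw [(X j).leibniz]
      simp only [smul_eq_mul, map_add, map_mul]
      rw [add_comm, F.f_comm s]) (fun _ ↦ 0) (fun i ↦ zero_mem _)
  refine ⟨D, hD, h1, fun l ↦ (h2 l).trans ?_⟩
  simp only [mul_zero, add_zero]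
  rfl

/-- The choice `y i = q k i` is consistent with the relations of the frame because `q` is
idempotent. -/
theorem exists_contr (k : I) : ∃ D ∈ gradedDer 𝒜 (-e), (∀ r, D (F.f r) = 0) ∧
    ∀ l, D (F.g l) = F.f (q k l) := by
  obtain ⟨D, hD, h1, h2⟩ := F.exists_der (-e) 0 (fun r ↦ zero_mem _) (by simp)
    (fun i ↦ F.f (q k i)) (fun i ↦ by rw [neg_add_cancel]; exact F.f_mem _)
  refine ⟨D, hD, h1, fun l ↦ (h2 l).trans ?_⟩
  simp only [LinearMap.zero_apply, zero_mul, zero_add, ← map_mul, ← map_sum]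
  rw [← sum_mul_of_idempotent F.q_mul k l]
  exact congr_arg F.f (Finset.sum_congr rfl fun i _ ↦ mul_comm _ _)

/-- The derivation over `X j` given by the connection of the frame. -/
def nabla (j : J) : A →ₗ[ℝ] A := (F.exists_nabla j).choose

/-- The contraction with the `k`-th element of the dual frame. -/
def contr (k : I) : A →ₗ[ℝ] A := (F.exists_contr k).choose

theorem nabla_mem (j : J) : F.nabla j ∈ gradedDer 𝒜 0 := (F.exists_nabla j).choose_spec.1

theorem nabla_f (j : J) (r : R) : F.nabla j (F.f r) = F.f (X j r) :=
  (F.exists_nabla j).choose_spec.2.1 r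

theorem nabla_g (j : J) (l : I) : F.nabla j (F.g l) = ∑ i, F.f (X j (q i l)) * F.g i :=
  (F.exists_nabla j).choose_spec.2.2 l

theorem contr_mem (k : I) : F.contr k ∈ gradedDer 𝒜 (-e) := (F.exists_contr k).choose_spec.1

theorem contr_f (k : I) (r : R) : F.contr k (F.f r) = 0 := (F.exists_contr k).choose_spec.2.1 r

theorem contr_g (k l : I) : F.contr k (F.g l) = F.f (q k l) :=
  (F.exists_contr k).choose_spec.2.2 l

theorem der_f_mul {d : ℤ} {D : A →ₗ[ℝ] A} (hD : D ∈ gradedDer 𝒜 d) (r : R) (a : A) :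
    D (F.f r * a) = D (F.f r) * a + F.f r * D a := by
  rw [hD.2 0 _ (F.f_mem r), mul_zero, koszul_zero, one_smul]

/-- Derivations are combinations of the `nabla j` and the `contr k`. -/
theorem eq_sum {d : ℤ} {D : A →ₗ[ℝ] A} (hD : D ∈ gradedDer 𝒜 d) :
    D = ∑ j, LinearMap.mulLeft ℝ (D (F.f (h j))) ∘ₗ F.nabla j +
      ∑ k, LinearMap.mulLeft ℝ (D (F.g k)) ∘ₗ F.contr k := by
  refine F.ext hD (add_mem (sum_mem fun j _ ↦ ?_) (sum_mem fun k _ ↦ ?_)) (fun r ↦ ?_) fun l ↦ ?_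
  · have := mulLeft_comp_mem_gradedDer F.comm (hD.1 _ _ (F.f_mem (h j))) (F.nabla_mem j)
    rwa [add_zero, add_zero] at this
  · have := mulLeft_comp_mem_gradedDer F.comm (hD.1 _ _ (F.g_mem k)) (F.contr_mem k)
    rwa [add_neg_cancel_right] at this
  · simp only [LinearMap.add_apply, LinearMap.sum_apply, LinearMap.comp_apply,
      LinearMap.mulLeft_apply, nabla_f, contr_f, mul_zero, Finset.sum_const_zero, add_zero]
    exact F.der_eq d D hD r
  · simp only [LinearMap.add_apply, LinearMap.sum_apply, LinearMap.comp_apply,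
      LinearMap.mulLeft_apply, nabla_g, contr_g]
    -- Applying `D` to `g l = ∑ q_il g_i` separates the derivatives of the coefficients, which the
    -- `nabla j` account for, from those of the frame, which the `contr k` account for.
    conv_lhs => rw [F.g_eq l, map_sum]
    simp only [F.der_f_mul hD, Finset.sum_add_distrib, ← F.f_comm]
    congr 1
    simp only [Finset.mul_sum]
    rw [Finset.sum_comm]
    refine Finset.sum_congr rfl fun i _ ↦ ?_
    rw [F.der_eq d D hD (q i l), Finset.sum_mul]
    simp only [mul_assoc]

theorem fn_f_comm (r : R) (x : MultiDer 𝒜) :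
    MultiDer.fn 𝒜 (F.f r) * x = x * MultiDer.fn 𝒜 (F.f r) :=
  (MultiDer.gradedComm F.comm).commute (MultiDer.fn_mem (F.f_mem r)) x

theorem der_eq_sum {d : ℤ} {D : A →ₗ[ℝ] A} (hD : D ∈ gradedDer 𝒜 d) :
    MultiDer.der 𝒜 d D hD =
      ∑ j, MultiDer.fn 𝒜 (D (F.f (h j))) * MultiDer.der 𝒜 0 (F.nabla j) (F.nabla_mem j) +
      ∑ k, MultiDer.fn 𝒜 (D (F.g k)) * MultiDer.der 𝒜 (-e) (F.contr k) (F.contr_mem k) := by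
  have h1 (j : J) := MultiDer.fn_mul_der F.comm (hD.1 _ _ (F.f_mem (h j))) (F.nabla_mem j)
  have h2 (k : I) := MultiDer.fn_mul_der F.comm (hD.1 _ _ (F.g_mem k)) (F.contr_mem k)
  have e1 (j : J) := MultiDer.der_congr (mulLeft_comp_mem_gradedDer F.comm
    (hD.1 _ _ (F.f_mem (h j))) (F.nabla_mem j)) (show d + 0 + 0 = d by ring) rfl
  have e2 (k : I) := MultiDer.der_congr (mulLeft_comp_mem_gradedDer F.comm
    (hD.1 _ _ (F.g_mem k)) (F.contr_mem k)) (show d + e + -e = d by ring) rfl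
  rw [Finset.sum_congr rfl fun j _ ↦ (h1 j).trans (e1 j),
    Finset.sum_congr rfl fun k _ ↦ (h2 k).trans (e2 k)]
  simp only [← MultiDer.derLin_apply, ← map_sum, ← map_add]
  congr 1
  refine Subtype.ext ?_
  simp only [Submodule.coe_add, Submodule.coe_sum]
  exact F.eq_sum hD

/-- The generators of degree `k` of the algebra of multiderivations. -/
def multiGens (k : ℤ) : Set (MultiDer 𝒜) :=
  {x | (k = 0 ∧ ∃ r, x = MultiDer.fn 𝒜 (F.f r)) ∨ (k = e ∧ ∃ i, x = MultiDer.fn 𝒜 (F.g i)) ∨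
    (k = 1 - e ∧ ∃ i, x = MultiDer.der 𝒜 (-e) (F.contr i) (F.contr_mem i)) ∨
    (k = 1 ∧ ∃ j, x = MultiDer.der 𝒜 0 (F.nabla j) (F.nabla_mem j))}

theorem mem_of_multiGens (k : ℤ) (x) (hx : x ∈ F.multiGens k) : x ∈ MultiDer.grade 𝒜 k := by
  rcases hx with ⟨rfl, r, rfl⟩ | ⟨rfl, i, rfl⟩ | ⟨rfl, i, rfl⟩ | ⟨rfl, j, rfl⟩
  · exact MultiDer.fn_mem (F.f_mem r)
  · exact MultiDer.fn_mem (F.g_mem i)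
  · rw [sub_eq_neg_add]; exact MultiDer.der_mem (F.contr_mem i)
  · exact MultiDer.der_mem (F.nabla_mem j)

theorem adjoin_multiGens : Algebra.adjoin ℝ (⋃ k, F.multiGens k) = ⊤ := by
  rw [eq_top_iff, ← MultiDer.adjoin_gens]
  have hsub (k : ℤ) : F.multiGens k ⊆ Algebra.adjoin ℝ (⋃ k, F.multiGens k) :=
    (Set.subset_iUnion _ k).trans Algebra.subset_adjoin
  have hfn (a : A) : MultiDer.fn 𝒜 a ∈ Algebra.adjoin ℝ (⋃ k, F.multiGens k) := by
    have ha : a ∈ Algebra.adjoin ℝ (Set.range F.f ∪ Set.range F.g) := by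
      rw [F.adjoin_eq]; trivial
    have h1 : Algebra.adjoin ℝ (Set.range F.f ∪ Set.range F.g) ≤
        (Algebra.adjoin ℝ (⋃ k, F.multiGens k)).comap (MultiDer.fnHom 𝒜) := by
      refine Algebra.adjoin_le ?_
      rintro _ (⟨r, rfl⟩ | ⟨i, rfl⟩)
      · exact hsub 0 (.inl ⟨rfl, r, rfl⟩)
      · exact hsub e (.inr (.inl ⟨rfl, i, rfl⟩))
    exact h1 ha
  refine Algebra.adjoin_le (Set.iUnion_subset fun k ↦ ?_)
  rintro _ (⟨a, ha, rfl⟩ | ⟨D, hD, rfl⟩)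
  · exact hfn a
  · rw [F.der_eq_sum hD]
    refine add_mem (sum_mem fun j _ ↦ mul_mem (hfn _) ?_) (sum_mem fun j _ ↦ mul_mem (hfn _) ?_)
    · exact hsub 1 (.inr (.inr (.inr ⟨rfl, j, rfl⟩)))
    · exact hsub (1 - e) (.inr (.inr (.inl ⟨rfl, j, rfl⟩)))

theorem algHom_ext {T : Type*} [Ring T] [Algebra ℝ T] {Φ Φ' : MultiDer 𝒜 →ₐ[ℝ] T}
    (hf : ∀ r, Φ (MultiDer.fn 𝒜 (F.f r)) = Φ' (MultiDer.fn 𝒜 (F.f r)))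
    (hg : ∀ i, Φ (MultiDer.fn 𝒜 (F.g i)) = Φ' (MultiDer.fn 𝒜 (F.g i)))
    (hc : ∀ i, Φ (MultiDer.der 𝒜 (-e) (F.contr i) (F.contr_mem i)) =
      Φ' (MultiDer.der 𝒜 (-e) (F.contr i) (F.contr_mem i)))
    (hn : ∀ j, Φ (MultiDer.der 𝒜 0 (F.nabla j) (F.nabla_mem j)) =
      Φ' (MultiDer.der 𝒜 0 (F.nabla j) (F.nabla_mem j))) : Φ = Φ' := by
  refine AlgHom.ext_of_adjoin_eq_top F.adjoin_multiGens fun x hx ↦ ?_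
  obtain ⟨k, hx⟩ := Set.mem_iUnion.1 hx
  rcases hx with ⟨rfl, r, rfl⟩ | ⟨rfl, i, rfl⟩ | ⟨rfl, i, rfl⟩ | ⟨rfl, j, rfl⟩
  exacts [hf r, hg i, hc i, hn j]

end FrameAlgebra

end Frame

end

noncomputable section

universe u

/-! ### The Fourier transform of an algebra with a frame -/

namespace FrameAlgebra

open MultiDer

variable {R : Type*} [CommRing R] [Algebra ℝ R] {I J : Type*} [Fintype I] [Fintype J]
  {q q' : Matrix I I R} {X : J → Derivation ℝ R R} {h : J → R} {e e' : ℤ}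
  {A : Type u} [Ring A] [Algebra ℝ A] {𝒜 : ℤ → Submodule ℝ A} [GradedAlgebra 𝒜]
  {B : Type u} [Ring B] [Algebra ℝ B] {ℬ : ℤ → Submodule ℝ B} [GradedAlgebra ℬ]
  (FA : FrameAlgebra 𝒜 e q X h) (FB : FrameAlgebra ℬ e' q' X h)

theorem sum_fn_f_mul_contr (k : I) :
    ∑ i, fn ℬ (FB.f (q' k i)) * der ℬ (-e') (FB.contr i) (FB.contr_mem i) =
      der ℬ (-e') (FB.contr k) (FB.contr_mem k) := by
  conv_rhs => rw [FB.der_eq_sum (FB.contr_mem k)]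
  simp only [contr_f, contr_g, ← fnHom_apply, map_zero, zero_mul, Finset.sum_const_zero, zero_add]

theorem sum_fn_f_mul_g (k : I) : ∑ i, fn ℬ (FB.f (q' i k)) * fn ℬ (FB.g i) = fn ℬ (FB.g k) := by
  conv_rhs => rw [FB.g_eq k]
  simp only [← fnHom_apply, map_sum, map_mul]

/-- One of `e`, `e'` is even, so a frame element and a contraction on the same side commute without
sign. -/
theorem koszul_mul_of_add_eq_one (he : e + e' = 1) : koszul (e * e') = 1 := by
  obtain rfl : e' = 1 - e := by omega
  by_cases h1 : Even e
  · simp [koszul_eq, Int.even_mul, h1]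
  · simp [koszul_eq, Int.even_mul, h1, Int.even_sub]

/-- The shift raises the degree `-e'` of a contraction to `1 - e' = e`, the degree of the frame of
the other algebra. This match allows frames and contractions to be exchanged. -/
theorem contr_grade (he : e + e' = 1) (k : I) :
    der ℬ (-e') (FB.contr k) (FB.contr_mem k) ∈ grade ℬ e := by
  have := der_mem (FB.contr_mem k)
  rwa [show -e' + 1 = e by omega] at this

/-- The Fourier transform on functions. -/
theorem exists_fourier_fn (hq : ∀ i j, q' i j = q j i) (he : e + e' = 1) (s : ℝ) :
    ∃ Λ : A →ₐ[ℝ] MultiDer ℬ, (∀ r, Λ (FA.f r) = fn ℬ (FB.f r)) ∧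
      (∀ l, Λ (FA.g l) = s • der ℬ (-e') (FB.contr l) (FB.contr_mem l)) ∧
      ∀ k, ∀ a ∈ 𝒜 k, Λ a ∈ grade ℬ k := by
  have hB := gradedComm FB.comm
  have hee : koszul (e * e) = koszul e := by
    by_cases h1 : Even e <;> simp [koszul_eq, h1, Int.even_mul]
  obtain ⟨Λ, h1, h2⟩ := FA.lift (MultiDer ℬ) ((fnHom ℬ).comp FB.f)
    (fun i ↦ s • der ℬ (-e') (FB.contr i) (FB.contr_mem i))
    (fun r i ↦ hB.commute (fn_mem (FB.f_mem r)) _)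
    (fun i j ↦ by
      rw [hB e e _ (Submodule.smul_mem _ s (FB.contr_grade he i)) _
        (Submodule.smul_mem _ s (FB.contr_grade he j)), hee])
  have h2' (l : I) : Λ (FA.g l) = s • der ℬ (-e') (FB.contr l) (FB.contr_mem l) := by
    rw [h2, ← FB.sum_fn_f_mul_contr l, Finset.smul_sum]
    refine Finset.sum_congr rfl fun i _ ↦ ?_
    rw [mul_smul_comm, hq]
    rfl
  refine ⟨Λ, h1, h2', ?_⟩
  refine homogeneous_induction 𝒜 FA.mem_of_gens FA.adjoin_gens ?_ ?_ ?_ ?_ ?_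
  · rw [map_one]; exact SetLike.one_mem_graded _
  · intro k; rw [map_zero]; exact zero_mem _
  · intro k x y _ _ hx hy; rw [map_add]; exact add_mem hx hy
  · intro k r x hx; rw [map_smul]; exact Submodule.smul_mem _ r hx
  · rintro i k x y hx _ hy
    rw [map_mul]
    refine SetLike.mul_mem_graded ?_ hy
    rcases hx with ⟨rfl, r, rfl⟩ | ⟨rfl, i, rfl⟩
    · rw [h1]; exact fn_mem (FB.f_mem r)
    · rw [h2']; exact Submodule.smul_mem _ s (FB.contr_grade he i)

/-- The Fourier transform as a homomorphism of graded algebras. -/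
theorem exists_fourier (hq : ∀ i j, q' i j = q j i) (he : e + e' = 1) (s s' : ℝ) :
    ∃ Φ : MultiDer 𝒜 →ₐ[ℝ] MultiDer ℬ,
      (∀ k, ∀ x ∈ grade 𝒜 k, Φ x ∈ grade ℬ k) ∧
      (∀ r, Φ (fn 𝒜 (FA.f r)) = fn ℬ (FB.f r)) ∧
      (∀ l, Φ (fn 𝒜 (FA.g l)) = s • der ℬ (-e') (FB.contr l) (FB.contr_mem l)) ∧
      ∀ d D (hD : D ∈ gradedDer 𝒜 d), Φ (der 𝒜 d D hD) =
        ∑ j, Φ (fn 𝒜 (D (FA.f (h j)))) * der ℬ 0 (FB.nabla j) (FB.nabla_mem j) +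
        ∑ k, Φ (fn 𝒜 (D (FA.g k))) * (s' • fn ℬ (FB.g k)) := by
  have hB := gradedComm FB.comm
  obtain ⟨Λ, h1, h2, h3⟩ := exists_fourier_fn FA FB hq he s
  -- The value imposed by the rules on the expansion `der_eq_sum` of `D`. The coefficients `D(h_j)`,
  -- `D(g_k)` are linear in `D` over `A`, so no choice of expansion intervenes.
  let v : (A →ₗ[ℝ] A) →ₗ[ℝ] MultiDer ℬ :=
    { toFun := fun D ↦ ∑ j, Λ (D (FA.f (h j))) * der ℬ 0 (FB.nabla j) (FB.nabla_mem j) +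
        ∑ k, Λ (D (FA.g k)) * (s' • fn ℬ (FB.g k))
      map_add' := fun D D' ↦ by
        simp only [LinearMap.add_apply, map_add, add_mul, Finset.sum_add_distrib]
        abel
      map_smul' := fun r D ↦ by
        simp only [LinearMap.smul_apply, map_smul, smul_mul_assoc, ← Finset.smul_sum, smul_add,
          RingHom.id_apply] }
  have hv (D : A →ₗ[ℝ] A) : v D = ∑ j, Λ (D (FA.f (h j))) * der ℬ 0 (FB.nabla j) (FB.nabla_mem j) +
        ∑ k, Λ (D (FA.g k)) * (s' • fn ℬ (FB.g k)) := rfl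
  have hvg (j : ℤ) (m : shift (gradedDer 𝒜) (-1) j) : v m.1 ∈ grade ℬ j := by
    have hm := mem_gradedDer m
    refine add_mem (sum_mem fun i _ ↦ ?_) (sum_mem fun i _ ↦ ?_)
    · have := SetLike.mul_mem_graded (h3 _ _ (hm.1 _ _ (FA.f_mem (h i))))
        (der_mem (FB.nabla_mem i))
      rwa [show j - 1 + 0 + (0 + 1) = j by ring] at this
    · have := SetLike.mul_mem_graded (h3 _ _ (hm.1 _ _ (FA.g_mem i)))
        (Submodule.smul_mem _ s' (fn_mem (FB.g_mem i)))
      rwa [show j - 1 + e + e' = j by omega] at this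
  obtain ⟨Φ, hc, hd⟩ := GradedSym.exists_lift (𝒜 := 𝒜) (ℳ := shift (gradedDer 𝒜) (-1)) Λ
    (fun j ↦ v ∘ₗ Submodule.subtype _)
    (fun i j k hk a ha m am ham ↦ by
      change v am.1 = Λ a * v m.1
      have ham' (x : A) : am.1 x = a * m.1 x := by rw [ham]; rfl
      simp only [hv, ham', map_mul, mul_add, Finset.mul_sum, mul_assoc])
    (fun i j a ha m ↦ hB _ _ _ (hvg j m) _ (h3 _ _ ha))
    (fun i j m m' ↦ hB _ _ _ (hvg i m) _ (hvg j m'))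
  have hfn (a : A) : Φ (fn 𝒜 a) = Λ a := hc a
  have hder (d D) (hD : D ∈ gradedDer 𝒜 d) : Φ (der 𝒜 d D hD) = v D := hd _ _
  refine ⟨Φ, ?_, fun r ↦ (hfn _).trans (h1 r), fun l ↦ (hfn _).trans (h2 l), fun d D hD ↦ ?_⟩
  · refine homogeneous_induction (grade 𝒜) MultiDer.mem_of_gens MultiDer.adjoin_gens ?_ ?_ ?_ ?_ ?_
    · rw [map_one]; exact SetLike.one_mem_graded _
    · intro k; rw [map_zero]; exact zero_mem _
    · intro k x y _ _ hx hy; rw [map_add]; exact add_mem hx hy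
    · intro k r x hx; rw [map_smul]; exact Submodule.smul_mem _ r hx
    · rintro i k x y hx _ hy
      rw [map_mul]
      refine SetLike.mul_mem_graded ?_ hy
      rcases hx with ⟨a, ha, rfl⟩ | ⟨D, hD, rfl⟩
      · rw [hfn]; exact h3 _ _ ha
      · rw [hder]; exact hvg i ⟨D, by have := mem_shift_iff.2 hD; rwa [sub_add_cancel] at this⟩
  · rw [hder, hv]
    simp only [hfn]

/-- The derivations `D` and `D'` extend the derivation `Y` on functions and the pairing of the
frames is compatible with them. -/
structure IsDualPair (Y : Derivation ℝ R R) (D : A →ₗ[ℝ] A) (D' : B →ₗ[ℝ] B) : Prop where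
  left_mem : D ∈ gradedDer 𝒜 0
  right_mem : D' ∈ gradedDer ℬ 0
  left_f : ∀ r, D (FA.f r) = FA.f (Y r)
  right_f : ∀ r, D' (FB.f r) = FB.f (Y r)
  -- Since `q k l = ⟨ψ_k, θ_l⟩`, the matrix identity reads `⟨D' ψ_k, θ_l⟩ + ⟨ψ_k, D θ_l⟩ = Y ⟨ψ_k,
  -- θ_l⟩`.
  exists_matrix : ∃ n m : Matrix I I R, (∀ l, D (FA.g l) = ∑ k, FA.f (n k l) * FA.g k) ∧
    (∀ l, D' (FB.g l) = ∑ k, FB.f (m k l) * FB.g k) ∧ m.transpose * q + q * n = q.map Y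

theorem map_mul_derivation (Y : Derivation ℝ R R) (M N : Matrix I I R) :
    (M * N).map Y = M.map Y * N + M * N.map Y := by
  ext i j
  simp only [Matrix.map_apply, Matrix.add_apply, Matrix.mul_apply, map_sum, Y.leibniz,
    smul_eq_mul, ← Finset.sum_add_distrib]
  refine Finset.sum_congr rfl fun k _ ↦ ?_
  ring

variable {FA FB}

/-- Differentiating the duality identity of each pair along the other vector field and subtracting
gives the identity for `⁅Y, Y'⁆`; equivalently, the curvatures of dual connections are dual. The new
matrices are the usual `Y(n₁) - Y'(n) + [n, n₁]`. -/
theorem IsDualPair.commutator {Y Y' : Derivation ℝ R R} {D D₁ : A →ₗ[ℝ] A} {D' D₁' : B →ₗ[ℝ] B}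
    (hp : IsDualPair FA FB Y D D') (hp₁ : IsDualPair FA FB Y' D₁ D₁') :
    IsDualPair FA FB ⁅Y, Y'⁆ (gradedCommutator 0 0 D D₁) (gradedCommutator 0 0 D' D₁') := by
  have hco {G : Type u} [Ring G] [Algebra ℝ G] (T T' : G →ₗ[ℝ] G) (x : G) :
      gradedCommutator 0 0 T T' x = T (T' x) - T' (T x) := by
    simp [gradedCommutator, koszul_zero]
  obtain ⟨n, m, hn, hm, hnm⟩ := hp.exists_matrix
  obtain ⟨n₁, m₁, hn₁, hm₁, hnm₁⟩ := hp₁.exists_matrix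
  refine ⟨gradedCommutator_mem 𝒜 hp.left_mem hp₁.left_mem,
    gradedCommutator_mem ℬ hp.right_mem hp₁.right_mem, fun r ↦ ?_, fun r ↦ ?_,
    n₁.map Y - n.map Y' + (n * n₁ - n₁ * n), m₁.map Y - m.map Y' + (m * m₁ - m₁ * m),
    fun l ↦ ?_, fun l ↦ ?_, ?_⟩
  · rw [hco, hp₁.left_f, hp.left_f, hp.left_f, hp₁.left_f, Derivation.commutator_apply, map_sub]
  · rw [hco, hp₁.right_f, hp.right_f, hp.right_f, hp₁.right_f, Derivation.commutator_apply, map_sub]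
  · rw [hco, hn, hn₁]
    simp only [map_sum, FA.der_f_mul hp.left_mem, FA.der_f_mul hp₁.left_mem, hp.left_f, hp₁.left_f,
      hn, hn₁, Matrix.add_apply, Matrix.sub_apply, Matrix.map_apply, Matrix.mul_apply, map_sub,
      map_add, add_mul, sub_mul, Finset.sum_add_distrib, Finset.sum_sub_distrib, map_mul,
      Finset.mul_sum, Finset.sum_mul, mul_assoc]
    rw [Finset.sum_comm (f := fun i j ↦ FA.f (n₁ i l) * (FA.f (n j i) * FA.g j)),
      Finset.sum_comm (f := fun i j ↦ FA.f (n i l) * (FA.f (n₁ j i) * FA.g j))]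
    simp only [← mul_assoc, ← map_mul, mul_comm]
    abel
  · rw [hco, hm, hm₁]
    simp only [map_sum, FB.der_f_mul hp.right_mem, FB.der_f_mul hp₁.right_mem, hp.right_f,
      hp₁.right_f,
      hm, hm₁, Matrix.add_apply, Matrix.sub_apply, Matrix.map_apply, Matrix.mul_apply, map_sub,
      map_add, add_mul, sub_mul, Finset.sum_add_distrib, Finset.sum_sub_distrib, map_mul,
      Finset.mul_sum, Finset.sum_mul, mul_assoc]
    rw [Finset.sum_comm (f := fun i j ↦ FB.f (m₁ i l) * (FB.f (m j i) * FB.g j)),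
      Finset.sum_comm (f := fun i j ↦ FB.f (m i l) * (FB.f (m₁ j i) * FB.g j))]
    simp only [← mul_assoc, ← map_mul, mul_comm]
    abel
  · have e1 : q.map (⁅Y, Y'⁆ : Derivation ℝ R R) = (q.map Y').map Y - (q.map Y).map Y' := by
      ext i j
      simp [Derivation.commutator_apply]
    have e2 : (m₁.map Y).transpose = m₁.transpose.map Y := rfl
    have e3 : (m.map Y').transpose = m.transpose.map Y' := rfl
    have hadd (Z : Derivation ℝ R R) (M N : Matrix I I R) : (M + N).map Z = M.map Z + N.map Z := by
      ext i j; simp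
    rw [e1, ← hnm₁, ← hnm, hadd, hadd, map_mul_derivation, map_mul_derivation, map_mul_derivation,
      map_mul_derivation, ← hnm, ← hnm₁]
    simp only [Matrix.transpose_add, Matrix.transpose_sub, Matrix.transpose_mul, e2, e3]
    noncomm_ring

variable (FA FB)

theorem isDualPair_nabla (hq : ∀ i j, q' i j = q j i) (j : J) :
    IsDualPair FA FB (X j) (FA.nabla j) (FB.nabla j) where
  left_mem := FA.nabla_mem j
  right_mem := FB.nabla_mem j
  left_f := FA.nabla_f j
  right_f := FB.nabla_f j
  exists_matrix := by
    refine ⟨q.map (X j), q'.map (X j), FA.nabla_g j, FB.nabla_g j, ?_⟩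
    have : (q'.map (X j)).transpose = q.map (X j) := by
      ext i k
      simp [hq]
    rw [this, ← map_mul_derivation, FA.q_mul]

end FrameAlgebra

end

/-! ### The transform of dual pairs, and the inverse transform -/

noncomputable section

universe u

namespace FrameAlgebra

open MultiDer

variable {R : Type*} [CommRing R] [Algebra ℝ R] {I J : Type*} [Fintype I] [Fintype J]
  {q q' : Matrix I I R} {X : J → Derivation ℝ R R} {h : J → R} {e e' : ℤ}
  {A : Type u} [Ring A] [Algebra ℝ A] {𝒜 : ℤ → Submodule ℝ A} [GradedAlgebra 𝒜]
  {B : Type u} [Ring B] [Algebra ℝ B] {ℬ : ℤ → Submodule ℝ B} [GradedAlgebra ℬ]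
  (FA : FrameAlgebra 𝒜 e q X h) (FB : FrameAlgebra ℬ e' q' X h)

/-- `Φ` is the Fourier transform with signs `s` and `s'`. -/
structure IsFourier (s s' : ℝ) (Φ : MultiDer 𝒜 →ₐ[ℝ] MultiDer ℬ) : Prop where
  map_grade : ∀ k, ∀ x ∈ grade 𝒜 k, Φ x ∈ grade ℬ k
  map_f : ∀ r, Φ (fn 𝒜 (FA.f r)) = fn ℬ (FB.f r)
  map_g : ∀ l, Φ (fn 𝒜 (FA.g l)) = s • der ℬ (-e') (FB.contr l) (FB.contr_mem l)
  map_der : ∀ d D (hD : D ∈ gradedDer 𝒜 d), Φ (der 𝒜 d D hD) =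
    ∑ j, Φ (fn 𝒜 (D (FA.f (h j)))) * der ℬ 0 (FB.nabla j) (FB.nabla_mem j) +
    ∑ k, Φ (fn 𝒜 (D (FA.g k))) * (s' • fn ℬ (FB.g k))

variable {FA FB} {s s' : ℝ} {Φ : MultiDer 𝒜 →ₐ[ℝ] MultiDer ℬ}

theorem IsFourier.map_contr (hΦ : IsFourier FA FB s s' Φ) (hq : ∀ i j, q' i j = q j i) (k : I) :
    Φ (der 𝒜 (-e) (FA.contr k) (FA.contr_mem k)) = s' • fn ℬ (FB.g k) := by
  rw [hΦ.map_der]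
  simp only [contr_f, contr_g, hΦ.map_f]
  simp only [← fnHom_apply, map_zero, zero_mul, Finset.sum_const_zero, zero_add]
  simp only [fnHom_apply, mul_smul_comm, ← Finset.smul_sum, ← hq, sum_fn_f_mul_g]

theorem fn_g_mul_contr (he : e + e' = 1) (k l : I) :
    fn ℬ (FB.g k) * der ℬ (-e') (FB.contr l) (FB.contr_mem l) =
      der ℬ (-e') (FB.contr l) (FB.contr_mem l) * fn ℬ (FB.g k) := by
  rw [gradedComm FB.comm _ _ _ (fn_mem (FB.g_mem k)) _ (FB.contr_grade he l), mul_comm,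
    koszul_mul_of_add_eq_one he, one_smul]

variable (FB) in
/-- A product of a frame element and a contraction is unchanged when its matrix of coefficients is
multiplied by the idempotent on both sides. -/
theorem sum_mul_g_mul_contr (hq : ∀ i j, q' i j = q j i) (M : Matrix I I R) :
    ∑ k, ∑ l, fn ℬ (FB.f (M k l)) * (fn ℬ (FB.g l) * der ℬ (-e') (FB.contr k) (FB.contr_mem k)) =
    ∑ k, ∑ l, fn ℬ (FB.f ((q * M * q) k l)) *
      (fn ℬ (FB.g l) * der ℬ (-e') (FB.contr k) (FB.contr_mem k)) := by
  have hB (r : R) (x : MultiDer ℬ) := FB.fn_f_comm r x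
  have e1 (k l : I) : fn ℬ (FB.g l) * der ℬ (-e') (FB.contr k) (FB.contr_mem k) =
      ∑ i, ∑ j, fn ℬ (FB.f (q i k * q l j)) *
        (fn ℬ (FB.g j) * der ℬ (-e') (FB.contr i) (FB.contr_mem i)) := by
    conv_lhs => rw [← FB.sum_fn_f_mul_contr k, ← FB.sum_fn_f_mul_g l]
    rw [Finset.mul_sum]
    refine Finset.sum_congr rfl fun i _ ↦ ?_
    rw [Finset.sum_mul]
    refine Finset.sum_congr rfl fun j _ ↦ ?_
    rw [← mul_assoc (fn ℬ (FB.f _) * _), mul_assoc (fn ℬ (FB.f _)), ← hB, hq, hq]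
    simp only [← fnHom_apply, map_mul, mul_assoc]
    rw [← mul_assoc, ← map_mul, ← map_mul, mul_comm, map_mul, map_mul, mul_assoc]
  conv_lhs =>
    enter [2, k, 2, l]
    rw [e1, Finset.mul_sum]
    enter [2, i]
    rw [Finset.mul_sum]
    enter [2, j]
    rw [← mul_assoc, ← fnHom_apply, ← fnHom_apply, ← map_mul, ← map_mul]
  conv_rhs =>
    enter [2, i, 2, j]
    rw [← fnHom_apply]
  calc _ = ∑ k, ∑ i, ∑ l, ∑ j, fnHom ℬ (FB.f (M k l * (q i k * q l j))) *
        (fn ℬ (FB.g j) * der ℬ (-e') (FB.contr i) (FB.contr_mem i)) :=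
        Finset.sum_congr rfl fun k _ ↦ Finset.sum_comm
    _ = ∑ i, ∑ k, ∑ j, ∑ l, fnHom ℬ (FB.f (M k l * (q i k * q l j))) *
        (fn ℬ (FB.g j) * der ℬ (-e') (FB.contr i) (FB.contr_mem i)) := by
        rw [Finset.sum_comm]
        exact Finset.sum_congr rfl fun i _ ↦ Finset.sum_congr rfl fun k _ ↦ Finset.sum_comm
    _ = ∑ i, ∑ j, ∑ k, ∑ l, fnHom ℬ (FB.f (M k l * (q i k * q l j))) *
        (fn ℬ (FB.g j) * der ℬ (-e') (FB.contr i) (FB.contr_mem i)) :=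
        Finset.sum_congr rfl fun i _ ↦ Finset.sum_comm
    _ = _ := by
        refine Finset.sum_congr rfl fun i _ ↦ Finset.sum_congr rfl fun j _ ↦ ?_
        simp only [← Finset.sum_mul, ← map_sum]
        congr 3
        rw [mul_assoc, Matrix.mul_apply]
        refine Finset.sum_congr rfl fun k _ ↦ ?_
        rw [Matrix.mul_apply, Finset.mul_sum]
        refine Finset.sum_congr rfl fun l _ ↦ ?_
        ring

/-- Both sides have the same components along the `nabla j`. The rest are combinations of products
`g_l contr_k` with coefficient matrices `s s' n = -n` and `mᵀ`. Such a combination only sees `q M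
q`, and the duality identity gives `q (mᵀ + n) q = q Y(q) q = 0`. The matrices of `D` and `D'` are
otherwise irrelevant, which is why no connection is preferred. -/
theorem IsFourier.map_isDualPair (hΦ : IsFourier FA FB s s' Φ) (hq : ∀ i j, q' i j = q j i)
    (he : e + e' = 1) (hss : s * s' = -1)
    {Y : Derivation ℝ R R} {D : A →ₗ[ℝ] A} {D' : B →ₗ[ℝ] B} (hp : IsDualPair FA FB Y D D') :
    Φ (der 𝒜 0 D hp.left_mem) = der ℬ 0 D' hp.right_mem := by
  obtain ⟨n, m, hn, hm, hnm⟩ := hp.exists_matrix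
  rw [hΦ.map_der, FB.der_eq_sum hp.right_mem]
  simp only [hp.left_f, hp.right_f, hΦ.map_f]
  congr 1
  have e1 : ∑ k, Φ (fn 𝒜 (D (FA.g k))) * (s' • fn ℬ (FB.g k)) =
      (s * s') • ∑ k, ∑ l, fn ℬ (FB.f (n k l)) *
        (fn ℬ (FB.g l) * der ℬ (-e') (FB.contr k) (FB.contr_mem k)) := by
    rw [Finset.sum_comm, Finset.smul_sum]
    refine Finset.sum_congr rfl fun l _ ↦ ?_
    rw [hn, ← fnHom_apply, map_sum, map_sum, Finset.sum_mul, Finset.smul_sum]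
    refine Finset.sum_congr rfl fun k _ ↦ ?_
    rw [map_mul, map_mul, fnHom_apply, fnHom_apply, hΦ.map_f, hΦ.map_g, fn_g_mul_contr he]
    simp only [mul_smul_comm, smul_mul_assoc, smul_smul, mul_assoc]
    rw [mul_comm s']
  have e2 : ∑ k, fn ℬ (D' (FB.g k)) * der ℬ (-e') (FB.contr k) (FB.contr_mem k) =
      ∑ k, ∑ l, fn ℬ (FB.f (m.transpose k l)) *
        (fn ℬ (FB.g l) * der ℬ (-e') (FB.contr k) (FB.contr_mem k)) := by
    refine Finset.sum_congr rfl fun k _ ↦ ?_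
    rw [hm, ← fnHom_apply, map_sum, Finset.sum_mul]
    refine Finset.sum_congr rfl fun l _ ↦ ?_
    rw [map_mul, mul_assoc]
    rfl
  rw [e1, e2, hss, FB.sum_mul_g_mul_contr hq n, FB.sum_mul_g_mul_contr hq m.transpose,
    neg_smul_eq, one_smul, eq_comm, eq_neg_iff_add_eq_zero]
  -- The duality identity, multiplied by `q` on both sides.
  have e3 : q * m.transpose * q + q * n * q = 0 := by
    have e4 : q * q.map Y * q = 0 := by
      ext i l
      refine Eq.trans ?_ (sum_derivation_of_idempotent FA.q_mul Y i l)
      rw [Finset.sum_comm]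
      simp only [Matrix.mul_apply, Matrix.map_apply, Finset.sum_mul]
    rw [← hnm, mul_add, add_mul] at e4
    simpa only [mul_assoc, FA.q_mul, ← mul_assoc q q] using e4
  simp only [← Finset.sum_add_distrib, ← add_mul]
  refine Finset.sum_eq_zero fun k _ ↦ Finset.sum_eq_zero fun l _ ↦ ?_
  rw [← fnHom_apply, ← fnHom_apply, ← map_add, ← map_add, ← Matrix.add_apply, e3,
    Matrix.zero_apply, map_zero, map_zero, zero_mul]

/-- The round trip multiplies frame elements by `s * s` and contractions by `s' * s'`, and fixes
each `nabla j` because its two versions form a dual pair in either order. -/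
theorem IsFourier.comp_eq_id {Ψ : MultiDer ℬ →ₐ[ℝ] MultiDer 𝒜} (hΦ : IsFourier FA FB s s' Φ)
    (hΨ : IsFourier FB FA s' s Ψ) (hq : ∀ i j, q' i j = q j i) (he : e + e' = 1)
    (hs : s * s = 1) (hs' : s' * s' = 1) (hss : s * s' = -1) :
    Ψ.comp Φ = AlgHom.id ℝ (MultiDer 𝒜) := by
  refine FA.algHom_ext (fun r ↦ ?_) (fun i ↦ ?_) (fun i ↦ ?_) fun j ↦ ?_
  · rw [AlgHom.comp_apply, hΦ.map_f, hΨ.map_f]; rfl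
  · rw [AlgHom.comp_apply, hΦ.map_g, map_smul, hΨ.map_contr fun i j ↦ (hq j i).symm, smul_smul, hs,
      one_smul]
    rfl
  · rw [AlgHom.comp_apply, hΦ.map_contr hq, map_smul, hΨ.map_g, smul_smul, hs', one_smul]
    rfl
  · have h1 := hΦ.map_isDualPair hq he hss (isDualPair_nabla FA FB hq j)
    have h2 := hΨ.map_isDualPair (fun i j ↦ (hq j i).symm) (by omega) (by rw [mul_comm, hss])
      (isDualPair_nabla FB FA (fun i j ↦ (hq j i).symm) j)
    rw [AlgHom.comp_apply, h1, h2]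
    rfl

end FrameAlgebra

end

/-! ### Compatibility of the transform with the brackets -/

noncomputable section

universe u

namespace FrameAlgebra

open MultiDer

variable {R : Type*} [CommRing R] [Algebra ℝ R] {I J : Type*} [Fintype I] [Fintype J]
  {q q' : Matrix I I R} {X : J → Derivation ℝ R R} {h : J → R} {e e' : ℤ}
  {A : Type u} [Ring A] [Algebra ℝ A] {𝒜 : ℤ → Submodule ℝ A} [GradedAlgebra 𝒜]
  {B : Type u} [Ring B] [Algebra ℝ B] {ℬ : ℤ → Submodule ℝ B} [GradedAlgebra ℬ]
  (FA : FrameAlgebra 𝒜 e q X h) (FB : FrameAlgebra ℬ e' q' X h)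

theorem gradedCommutator_contr (k l : I) :
    gradedCommutator (-e) (-e) (FA.contr k) (FA.contr l) = 0 := by
  refine FA.ext (gradedCommutator_mem 𝒜 (FA.contr_mem k) (FA.contr_mem l)) (zero_mem _)
    (fun r ↦ ?_) fun i ↦ ?_ <;>
  simp [gradedCommutator, contr_f, contr_g]

/-- The bracket of `nabla j` and `contr l`, in terms of the contractions. -/
theorem der_gradedCommutator_nabla_contr (j : J) (l : I)
    (hm : gradedCommutator 0 (-e) (FA.nabla j) (FA.contr l) ∈ gradedDer 𝒜 (0 + -e)) :
    der 𝒜 (0 + -e) (gradedCommutator 0 (-e) (FA.nabla j) (FA.contr l)) hm =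
      ∑ a, fn 𝒜 (FA.f (X j (q l a))) * der 𝒜 (-e) (FA.contr a) (FA.contr_mem a) := by
  have hf (r : R) : gradedCommutator 0 (-e) (FA.nabla j) (FA.contr l) (FA.f r) = 0 := by
    simp [gradedCommutator, contr_f, nabla_f]
  have hg (i : I) : gradedCommutator 0 (-e) (FA.nabla j) (FA.contr l) (FA.g i) =
      ∑ a, FA.f (X j (q l a) * q a i) := by
    have hc := FA.der_f_mul (FA.contr_mem l)
    simp only [gradedCommutator, LinearMap.sub_apply, LinearMap.comp_apply, LinearMap.smul_apply,
      contr_g, nabla_f, nabla_g, map_sum, zero_mul, koszul_zero, one_smul, hc, contr_f, zero_add,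
      ← map_mul]
    rw [derivation_apply_of_idempotent FA.q_mul (X j) l i, sub_eq_iff_eq_add, map_sum,
      ← Finset.sum_add_distrib]
    refine Finset.sum_congr rfl fun a _ ↦ ?_
    rw [← map_add, mul_comm (q l a)]
  rw [FA.der_eq_sum]
  simp only [hf, hg]
  simp only [← fnHom_apply, map_zero, zero_mul, Finset.sum_const_zero, zero_add, map_sum, map_mul,
    Finset.sum_mul, mul_assoc]
  rw [Finset.sum_comm]
  refine Finset.sum_congr rfl fun a _ ↦ ?_
  rw [← Finset.mul_sum]
  congr 1
  exact FA.sum_fn_f_mul_contr a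

variable {FA FB} {s s' : ℝ} {Φ : MultiDer 𝒜 →ₐ[ℝ] MultiDer ℬ}

/-- A table of brackets of the generators `f`, `g`, `contr`, `nabla` suffices. Two frame elements
bracket to zero, as do two contractions; brackets with `nabla j` express that `nabla` differentiates
frame and dual frame by the same matrix `X_j(q)` up to transposition. -/
theorem IsFourier.map_bracket (hΦ : IsFourier FA FB s s' Φ) (hq : ∀ i j, q' i j = q j i)
    (he : e + e' = 1) (hss : s * s' = -1)
    {brA : MultiDer 𝒜 →ₗ[ℝ] MultiDer 𝒜 →ₗ[ℝ] MultiDer 𝒜} (hA : IsSchoutenBracket 𝒜 brA)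
    {brB : MultiDer ℬ →ₗ[ℝ] MultiDer ℬ →ₗ[ℝ] MultiDer ℬ} (hB : IsSchoutenBracket ℬ brB)
    (α β : MultiDer 𝒜) : Φ (brA α β) = brB (Φ α) (Φ β) := by
  have hff (a b : A) : Φ (brA (fn 𝒜 a) (fn 𝒜 b)) = 0 := by rw [hA.fn_fn, map_zero]
  have hcc (k l : I) : der ℬ (-e' + -e') (gradedCommutator (-e') (-e') (FB.contr k) (FB.contr l))
      (gradedCommutator_mem ℬ (FB.contr_mem k) (FB.contr_mem l)) = 0 := by
    rw [der_congr _ rfl (FB.gradedCommutator_contr k l), ← derLin_apply]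
    exact map_zero _
  have hcc' (k l : I) : der 𝒜 (-e + -e) (gradedCommutator (-e) (-e) (FA.contr k) (FA.contr l))
      (gradedCommutator_mem 𝒜 (FA.contr_mem k) (FA.contr_mem l)) = 0 := by
    rw [der_congr _ rfl (FA.gradedCommutator_contr k l), ← derLin_apply]
    exact map_zero _
  have hgf (l : I) (r : R) : Φ (brA (fn 𝒜 (FA.g l)) (fn 𝒜 (FA.f r))) =
      brB (Φ (fn 𝒜 (FA.g l))) (Φ (fn 𝒜 (FA.f r))) := by
    rw [hff, hΦ.map_g, hΦ.map_f, map_smul, LinearMap.smul_apply, hB.der_fn, FB.contr_f,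
      ← fnHom_apply, map_zero, smul_zero]
  have hcf (l : I) (r : R) :
      Φ (brA (der 𝒜 (-e) (FA.contr l) (FA.contr_mem l)) (fn 𝒜 (FA.f r))) =
      brB (Φ (der 𝒜 (-e) (FA.contr l) (FA.contr_mem l))) (Φ (fn 𝒜 (FA.f r))) := by
    rw [hA.der_fn, hΦ.map_contr hq, hΦ.map_f, map_smul, LinearMap.smul_apply, hB.fn_fn, FA.contr_f,
      ← fnHom_apply, map_zero, map_zero, smul_zero]
  have hnf (j : J) (r : R) :
      Φ (brA (der 𝒜 0 (FA.nabla j) (FA.nabla_mem j)) (fn 𝒜 (FA.f r))) =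
      brB (Φ (der 𝒜 0 (FA.nabla j) (FA.nabla_mem j))) (Φ (fn 𝒜 (FA.f r))) := by
    rw [hA.der_fn, hΦ.map_isDualPair hq he hss (isDualPair_nabla FA FB hq j), hΦ.map_f, hB.der_fn,
      FA.nabla_f, FB.nabla_f, hΦ.map_f]
  -- The only entry that constrains the signs: moving the frame element of `B` past its contraction
  -- in the bracket gives `-1`, which `s * s' = -1` compensates.
  have hcg (k l : I) :
      Φ (brA (der 𝒜 (-e) (FA.contr k) (FA.contr_mem k)) (fn 𝒜 (FA.g l))) =
      brB (Φ (der 𝒜 (-e) (FA.contr k) (FA.contr_mem k))) (Φ (fn 𝒜 (FA.g l))) := by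
    have h1 : fn ℬ (FB.g k) ∈ shift (grade ℬ) 1 (e' - 1) := by
      rw [shift, add_sub_cancel]; exact fn_mem (FB.g_mem k)
    have h2 : der ℬ (-e') (FB.contr l) (FB.contr_mem l) ∈ shift (grade ℬ) 1 (-e') := by
      rw [shift, add_comm]; exact der_mem (FB.contr_mem l)
    have h3 : koszul ((e' - 1) * -e') = 1 := by
      rw [← koszul_mul_of_add_eq_one he]; congr 1; obtain rfl : e = 1 - e' := by omega
      ring
    rw [hA.der_fn, hΦ.map_contr hq, hΦ.map_g, FA.contr_g, hΦ.map_f, map_smul, map_smul,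
      LinearMap.smul_apply, smul_smul, hss, hB.gerstenhaber.antisymm _ _ _ h1 _ h2, h3, one_smul,
      hB.der_fn, FB.contr_g, hq, neg_smul_eq, one_smul, neg_neg]
  have hng (j : J) (l : I) :
      Φ (brA (der 𝒜 0 (FA.nabla j) (FA.nabla_mem j)) (fn 𝒜 (FA.g l))) =
      brB (Φ (der 𝒜 0 (FA.nabla j) (FA.nabla_mem j))) (Φ (fn 𝒜 (FA.g l))) := by
    rw [hA.der_fn, hΦ.map_isDualPair hq he hss (isDualPair_nabla FA FB hq j), hΦ.map_g, map_smul,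
      hB.der_der, FB.der_gradedCommutator_nabla_contr, FA.nabla_g, ← fnHom_apply, map_sum, map_sum,
      Finset.smul_sum]
    refine Finset.sum_congr rfl fun a _ ↦ ?_
    rw [map_mul, map_mul, fnHom_apply, fnHom_apply, hΦ.map_f, hΦ.map_g, mul_smul_comm, hq]
  have hnc (j : J) (k : I) :
      Φ (brA (der 𝒜 0 (FA.nabla j) (FA.nabla_mem j)) (der 𝒜 (-e) (FA.contr k) (FA.contr_mem k))) =
      brB (Φ (der 𝒜 0 (FA.nabla j) (FA.nabla_mem j)))
        (Φ (der 𝒜 (-e) (FA.contr k) (FA.contr_mem k))) := by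
    rw [hA.der_der, FA.der_gradedCommutator_nabla_contr, hΦ.map_contr hq,
      hΦ.map_isDualPair hq he hss (isDualPair_nabla FA FB hq j), map_smul, hB.der_fn, FB.nabla_g,
      ← fnHom_apply, map_sum, map_sum, Finset.smul_sum]
    refine Finset.sum_congr rfl fun a _ ↦ ?_
    rw [map_mul, map_mul, fnHom_apply, fnHom_apply, hΦ.map_f, hΦ.map_contr hq, mul_smul_comm, hq]
  refine hA.gerstenhaber.map_bracket_of_generators hB.gerstenhaber Φ FA.mem_of_multiGens
    FA.adjoin_multiGens hΦ.map_grade ?_ α β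
  rintro i j _ (⟨-, r, rfl⟩ | ⟨-, k, rfl⟩ | ⟨-, k, rfl⟩ | ⟨-, j, rfl⟩) _
    (⟨-, r', rfl⟩ | ⟨-, k', rfl⟩ | ⟨-, k', rfl⟩ | ⟨-, j', rfl⟩)
  · exact .inl (by rw [hff, hΦ.map_f, hΦ.map_f, hB.fn_fn])
  · exact .inr (hgf _ _)
  · exact .inr (hcf _ _)
  · exact .inr (hnf _ _)
  · exact .inl (hgf _ _)
  · exact .inl (by
      rw [hff, hΦ.map_g, hΦ.map_g, map_smul, map_smul, LinearMap.smul_apply, hB.der_der, hcc,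
        smul_zero, smul_zero])
  · exact .inr (hcg _ _)
  · exact .inr (hng _ _)
  · exact .inl (hcf _ _)
  · exact .inl (hcg _ _)
  · exact .inl (by
      rw [hA.der_der, hcc', map_zero, hΦ.map_contr hq, hΦ.map_contr hq, map_smul, map_smul,
        LinearMap.smul_apply, hB.fn_fn, smul_zero, smul_zero])
  · exact .inr (hnc _ _)
  · exact .inl (hnf _ _)
  · exact .inl (hng _ _)
  · exact .inl (hnc _ _)
  -- The commutator of two `nabla`s is in general not a combination of `nabla`s, but the commutators
  -- on the two sides again form a dual pair.
  · have hp := isDualPair_nabla FA FB hq j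
    have hp' := isDualPair_nabla FA FB hq j'
    exact .inl (by
      rw [hA.der_der, hΦ.map_isDualPair hq he hss hp, hΦ.map_isDualPair hq he hss hp', hB.der_der]
      exact hΦ.map_isDualPair hq he hss (hp.commutator hp'))

variable (FA FB) in
/-- The Fourier transform is an isomorphism of Gerstenhaber algebras. -/
theorem exists_fourierEquiv (hq : ∀ i j, q' i j = q j i) (he : e + e' = 1)
    (hs : s * s = 1) (hs' : s' * s' = 1) (hss : s * s' = -1)
    {brA : MultiDer 𝒜 →ₗ[ℝ] MultiDer 𝒜 →ₗ[ℝ] MultiDer 𝒜} (hA : IsSchoutenBracket 𝒜 brA)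
    {brB : MultiDer ℬ →ₗ[ℝ] MultiDer ℬ →ₗ[ℝ] MultiDer ℬ} (hB : IsSchoutenBracket ℬ brB) :
    ∃ Φ : MultiDer 𝒜 ≃ₐ[ℝ] MultiDer ℬ, IsGerstenhaberIso (grade 𝒜) brA (grade ℬ) brB Φ ∧
      IsFourier FA FB s s' (Φ : MultiDer 𝒜 →ₐ[ℝ] MultiDer ℬ) := by
  have hq' (i j : I) : q i j = q' j i := (hq j i).symm
  have hss' : s' * s = -1 := by rw [mul_comm, hss]
  obtain ⟨Φ, h1, h2, h3, h4⟩ := exists_fourier FA FB hq he s s'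
  obtain ⟨Ψ, k1, k2, k3, k4⟩ := exists_fourier FB FA hq' (by omega) s' s
  have hΦ : IsFourier FA FB s s' Φ := ⟨h1, h2, h3, h4⟩
  have hΨ : IsFourier FB FA s' s Ψ := ⟨k1, k2, k3, k4⟩
  have e1 := hΦ.comp_eq_id hΨ hq he hs hs' hss
  have e2 := hΨ.comp_eq_id hΦ hq' (by omega) hs' hs hss'
  refine ⟨AlgEquiv.ofAlgHom Φ Ψ e2 e1, ⟨fun k ↦ le_antisymm ?_ ?_, ?_⟩, hΦ⟩
  · rintro _ ⟨x, hx, rfl⟩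
    exact h1 k x hx
  · exact fun x hx ↦ ⟨Ψ x, k1 k x hx, AlgHom.congr_fun e2 x⟩
  · exact hΦ.map_bracket hq he hss hA hB

end FrameAlgebra

end

noncomputable section

/-! ### Coverings of a manifold by finitely many disjoint unions of small open sets -/

section Coloring

variable {n : ℕ} {C : Type*} [TopologicalSpace C] [T2Space C] [SigmaCompactSpace C]
  [ChartedSpace (EuclideanSpace ℝ (Fin n)) C] [IsManifold (𝓡 n) ∞ C]

/-- By σ-compactness countably many charts suffice, and in each of them the map is locally
Lipschitz, hence does not raise the Hausdorff dimension above `n`. -/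
theorem dimH_range_le_of_contMDiff {G : Type*} [NormedAddCommGroup G] [NormedSpace ℝ G]
    {g : C → G} (hg : ContMDiff (𝓡 n) 𝓘(ℝ, G) ∞ g) : dimH (Set.range g) ≤ n := by
  obtain ⟨s, hs, hs'⟩ := countable_cover_nhds_of_sigmaCompact
    (fun x : C ↦ chart_source_mem_nhds (EuclideanSpace ℝ (Fin n)) x)
  have : Countable s := hs.to_subtype
  have hcov : Set.range g ⊆ ⋃ x : s, (g ∘ (chartAt (EuclideanSpace ℝ (Fin n)) x.1).symm) ''
      (chartAt (EuclideanSpace ℝ (Fin n)) x.1).target := by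
    rintro _ ⟨y, rfl⟩
    have hy : y ∈ ⋃ x ∈ s, (chartAt (EuclideanSpace ℝ (Fin n)) x).source := by rw [hs']; trivial
    simp only [Set.mem_iUnion] at hy
    obtain ⟨x, hx, hy⟩ := hy
    refine Set.mem_iUnion.2 ⟨⟨x, hx⟩, chartAt (EuclideanSpace ℝ (Fin n)) x y,
      OpenPartialHomeomorph.map_source _ hy, ?_⟩
    simp [OpenPartialHomeomorph.left_inv _ hy]
  refine (dimH_mono hcov).trans ?_
  rw [dimH_iUnion]
  refine iSup_le fun x ↦ ?_
  have hsm : ContDiffOn ℝ ∞ (g ∘ (chartAt (EuclideanSpace ℝ (Fin n)) x.1).symm)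
      (chartAt (EuclideanSpace ℝ (Fin n)) x.1).target := by
    rw [← contMDiffOn_iff_contDiffOn]
    exact hg.comp_contMDiffOn (contMDiffOn_chart_symm (I := 𝓡 n))
  refine (dimH_image_le_of_locally_lipschitzOn fun y hy ↦ ?_).trans ?_
  · have h1 := (hsm.contDiffAt ((chartAt (EuclideanSpace ℝ (Fin n)) x.1).open_target.mem_nhds hy))
    obtain ⟨K, t, ht, hK⟩ := (h1.of_le (m := 1) (by simp)).exists_lipschitzOnWith
    exact ⟨K, t, mem_nhdsWithin_of_mem_nhds ht, hK⟩
  · refine (dimH_mono (Set.subset_univ _)).trans ?_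
    rw [Real.dimH_univ_eq_finrank]
    simp

/-- A generic level of countably many functions on a manifold of dimension `n` is attained by at
most `n` of them at a time. -/
theorem exists_generic_levels {ι : Type*} [Countable ι] {f : ι → C → ℝ}
    (hf : ∀ i, ContMDiff (𝓡 n) 𝓘(ℝ, ℝ) ∞ (f i)) :
    ∃ c : ι → ℝ, (∀ i, 1 / 2 < c i ∧ c i < 1) ∧
      ∀ s : Finset ι, n < s.card → ∀ x, ∃ i ∈ s, f i x ≠ c i := by
  classical
  letI : TopologicalSpace ι := ⊥
  haveI : DiscreteTopology ι := ⟨rfl⟩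
  -- The levels are sought among bounded functions on the discrete space `ι`, a complete space in
  -- which Baire's theorem applies.
  let ev (s : Finset ι) : BoundedContinuousFunction ι ℝ →L[ℝ] (s → ℝ) :=
    ContinuousLinearMap.pi fun i ↦ BoundedContinuousFunction.evalCLM ℝ i.1
  let F (s : Finset ι) (x : C) : s → ℝ := fun i ↦ f i.1 x
  have hF (s : Finset ι) : ContMDiff (𝓡 n) 𝓘(ℝ, s → ℝ) ∞ (F s) :=
    contMDiff_pi_space.2 fun i ↦ hf i.1
  have hsurj (s : Finset ι) : Function.Surjective (ev s) := by
    intro v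
    obtain ⟨M, hM⟩ : ∃ M, ∀ i, ‖(fun i ↦ if h : i ∈ s then v ⟨i, h⟩ else 0 : ι → ℝ) i‖ ≤ M := by
      refine ⟨‖v‖, fun i ↦ ?_⟩
      by_cases h : i ∈ s
      · simpa [h] using norm_le_pi_norm v ⟨i, h⟩
      · simp [h]
    refine ⟨BoundedContinuousFunction.ofNormedAddCommGroup _ continuous_of_discreteTopology M hM, ?_⟩
    ext i
    simp [ev]
  let T := {s : Finset ι // n < s.card}
  -- For more than `n` indices, the joint values on a compact set form a closed set of dimension at
  -- most `n` in a space of larger dimension, so avoiding them is an open dense condition. There are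
  -- countably many finite sets and countably many compact sets in the exhaustion.
  have hd : Dense (⋂ z : T × ℕ, (ev z.1.1) ⁻¹' (F z.1.1 '' compactCovering C z.2)ᶜ) := by
    refine dense_iInter_of_isOpen (fun z ↦ ?_) fun z ↦ ?_
    · exact (((isCompact_compactCovering C z.2).image (hF _).continuous).isClosed.isOpen_compl).preimage
        (ev z.1.1).continuous
    · refine Dense.preimage ?_ ((ev z.1.1).isOpenMap (hsurj _))
      refine dense_compl_of_dimH_lt_finrank (lt_of_le_of_lt ((dimH_mono
        (Set.image_subset_range _ _)).trans (dimH_range_le_of_contMDiff (hF z.1.1))) ?_)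
      rw [Module.finrank_fintype_fun_eq_card, Fintype.card_coe]
      exact_mod_cast z.1.2
  -- The ball of radius `1/4` about the constant `3/4` places every level in `(1/2, 1)`.
  obtain ⟨c, hc, hc'⟩ := hd.inter_open_nonempty (Metric.ball (BoundedContinuousFunction.const ι (3 / 4)) (1 / 4))
    Metric.isOpen_ball ⟨_, Metric.mem_ball_self (by norm_num)⟩
  refine ⟨c, fun i ↦ ?_, fun s hs x ↦ ?_⟩
  · have := (BoundedContinuousFunction.dist_coe_le_dist i).trans_lt (Metric.mem_ball.1 hc)
    rw [BoundedContinuousFunction.const_apply, Real.dist_eq, abs_lt] at this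
    constructor <;> linarith [this.1, this.2]
  · by_contra! hcon
    have hx : x ∈ ⋃ m, compactCovering C m := by rw [iUnion_compactCovering]; trivial
    obtain ⟨m, hm⟩ := Set.mem_iUnion.1 hx
    refine Set.mem_iInter.1 hc' (⟨s, hs⟩, m) ⟨x, hm, ?_⟩
    ext i
    exact hcon i.1 i.2

/-- An open covering of a manifold of dimension `n` can be refined by `n + 1` open sets, each a
disjoint union of open sets which are contained in members of the covering. -/
theorem exists_finite_coloring (U : C → Set C) (hU : ∀ x, U x ∈ 𝓝 x) :
    ∃ (V : Fin (n + 1) → Set C) (p : Fin (n + 1) → C → C), (∀ k, IsOpen (V k)) ∧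
      (∀ x, ∃ k, x ∈ V k) ∧ ∀ k, ∀ x ∈ V k, ∀ᶠ z in 𝓝 x, p k z = p k x ∧ z ∈ U (p k x) := by
  classical
  obtain ⟨ι, f, hfU⟩ := SmoothBumpCovering.exists_isSubordinate (𝓡 n) (s := (Set.univ : Set C))
    isClosed_univ (U := U) (fun x _ ↦ hU x)
  have hlf := f.locallyFinite
  have hne (i : ι) : (Function.support (f i)).Nonempty := (f i).nonempty_support
  haveI : Countable ι := Set.countable_univ_iff.1 (hlf.countable_univ hne)
  obtain ⟨c, hc, hgen⟩ := exists_generic_levels (fun i ↦ (f i).contMDiff)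
  have hsub (i : ι) (x : C) (hx : f i x ≠ 0) : x ∈ U (f.c i) := hfU.support_subset i hx
  have hcont (i : ι) : Continuous (f i) := (f i).continuous
  have hfin (x : C) : ∃ T : Finset ι, ∀ᶠ z in 𝓝 x, ∀ j ∉ T, f j z = 0 := by
    obtain ⟨t, ht, ht'⟩ := hlf x
    refine ⟨ht'.toFinset, Filter.mem_of_superset ht fun z hz j hj ↦ ?_⟩
    by_contra h0
    exact hj (ht'.mem_toFinset.2 ⟨z, h0, hz⟩)
  let d (i : ι) (x : C) : ℝ := |f i x - c i|
  have hdc (i : ι) : Continuous (d i) := ((hcont i).sub continuous_const).abs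
  -- Colour 0 consists of the points on no level, sorted by the set `s` of functions exceeding their
  -- level. Colour `k > 0` is a neighbourhood of the points on exactly `k` levels: `s` collects the
  -- `k` indices whose functions are closest to their levels.
  let W (k : ℕ) (s : Finset ι) : Set C := if k = 0 then
      {x | (∀ i, f i x ≠ c i) ∧ ∀ i, i ∈ s ↔ c i < f i x}
    else {x | s.card = k ∧ ∀ i ∈ s, d i x < 1 / 4 ∧ ∀ j ∉ s, d i x < d j x}
  -- On `W k s` the bumps indexed by `s` do not vanish, so `W k s` lies in the set `U` of any of
  -- their centres. Colour 0 has `s` nonempty since some bump equals `1 > c i`; in the other colours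
  -- a vanishing bump would be at distance `c i > 1/2` from its level, not less than `1/4`.
  have hW0 (k : ℕ) (s : Finset ι) (x : C) (hx : x ∈ W k s) : ∃ i ∈ s, ∀ i ∈ s, f i x ≠ 0 := by
    by_cases hk : k = 0
    · simp only [W, if_pos hk] at hx
      refine ⟨f.ind x (Set.mem_univ x), (hx.2 _).2 ?_, fun i hi ↦ ?_⟩
      · rw [f.apply_ind]; exact (hc _).2
      · have := (hx.2 i).1 hi
        linarith [(hc i).1]
    · simp only [W, if_neg hk] at hx
      obtain ⟨i, hi⟩ := Finset.card_pos.1 (hx.1 ▸ Nat.pos_of_ne_zero hk)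
      refine ⟨i, hi, fun i hi h0 ↦ ?_⟩
      have := (hx.2 i hi).1
      simp only [d, h0, zero_sub, abs_neg] at this
      linarith [le_abs_self (c i), (hc i).1]
  have hWo (k : ℕ) (s : Finset ι) : IsOpen (W k s) := by
    rw [isOpen_iff_mem_nhds]
    intro x hx
    obtain ⟨T, hT⟩ := hfin x
    by_cases hk : k = 0
    · simp only [W, if_pos hk] at hx ⊢
      have h1 : ∀ᶠ z in 𝓝 x, ∀ i ∈ T, f i z ≠ c i ∧ (i ∈ s ↔ c i < f i z) := by
        rw [Filter.eventually_all_finset]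
        intro i _
        rcases lt_or_gt_of_ne (hx.1 i) with h | h
        · filter_upwards [(isOpen_lt (hcont i) continuous_const).mem_nhds h] with z hz
          have hz : f i z < c i := hz
          exact ⟨hz.ne, by rw [hx.2 i]; exact ⟨fun h' ↦ absurd h' h.not_gt, fun h' ↦ absurd h' hz.not_gt⟩⟩
        · filter_upwards [(isOpen_lt continuous_const (hcont i)).mem_nhds h] with z hz
          have hz : c i < f i z := hz
          exact ⟨hz.ne', by rw [hx.2 i]; exact ⟨fun _ ↦ hz, fun _ ↦ h⟩⟩
      have h2 (i : ι) (hi : i ∉ T) : i ∉ s := by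
        rw [hx.2 i, hT.self_of_nhds i hi]
        linarith [(hc i).1]
      filter_upwards [h1, hT] with z hz hz'
      refine ⟨fun i ↦ ?_, fun i ↦ ?_⟩ <;> by_cases hi : i ∈ T
      · exact (hz i hi).1
      · rw [hz' i hi]; linarith [(hc i).1]
      · exact (hz i hi).2
      · rw [hz' i hi]
        exact ⟨fun h ↦ absurd h (h2 i hi), fun h ↦ by linarith [(hc i).1]⟩
    · simp only [W, if_neg hk] at hx ⊢
      have h1 : ∀ᶠ z in 𝓝 x, ∀ i ∈ s, d i z < 1 / 4 ∧ ∀ j ∈ T, j ∉ s → d i z < d j z := by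
        rw [Filter.eventually_all_finset]
        intro i hi
        refine Filter.Eventually.and
          ((isOpen_lt (hdc i) continuous_const).mem_nhds (hx.2 i hi).1) ?_
        rw [Filter.eventually_all_finset]
        intro j _
        by_cases hj : j ∈ s
        · exact Filter.Eventually.of_forall fun z h ↦ absurd hj h
        · filter_upwards [(isOpen_lt (hdc i) (hdc j)).mem_nhds ((hx.2 i hi).2 j hj)] with z hz _
          exact hz
      filter_upwards [h1, hT] with z hz hz'
      refine ⟨hx.1, fun i hi ↦ ⟨(hz i hi).1, fun j hj ↦ ?_⟩⟩
      by_cases hjT : j ∈ T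
      · exact (hz i hi).2 j hjT hj
      · have h2 := (hz i hi).1
        have h3 : d j z = |c j| := by simp only [d, hz' j hjT, zero_sub, abs_neg]
        rw [h3]
        linarith [le_abs_self (c j), (hc j).1]
  -- Two distinct sets of the same size cannot both consist of the indices strictly closest to their
  -- levels.
  have hWd (k : ℕ) (s t : Finset ι) (x : C) (hs : x ∈ W k s) (ht : x ∈ W k t) : s = t := by
    by_cases hk : k = 0
    · simp only [W, if_pos hk] at hs ht
      ext i
      rw [hs.2, ht.2]
    · simp only [W, if_neg hk] at hs ht
      refine Finset.eq_of_subset_of_card_le (fun i hi ↦ ?_) (by rw [hs.1, ht.1])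
      by_contra hit
      obtain ⟨j, hj, hjs⟩ : ∃ j ∈ t, j ∉ s := by
        by_contra! hcon
        have := Finset.eq_of_subset_of_card_le hcon (by rw [hs.1, ht.1])
        exact hit (this ▸ hi)
      exact lt_asymm ((hs.2 i hi).2 j hjs) ((ht.2 j hj).2 i hit)
  -- Genericity bounds the number of levels through `x` by `n`, so the colours `0, …, n` cover.
  have hWc (x : C) : ∃ k ≤ n, ∃ s, x ∈ W k s := by
    obtain ⟨T, hT⟩ := hfin x
    have hT := hT.self_of_nhds
    by_cases h0 : ∀ i, f i x ≠ c i
    · refine ⟨0, Nat.zero_le _, T.filter fun i ↦ c i < f i x, ?_⟩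
      simp only [W, if_true]
      refine ⟨h0, fun i ↦ ?_⟩
      rw [Finset.mem_filter, and_iff_right_iff_imp]
      intro h
      by_contra hi
      rw [hT i hi] at h
      linarith [(hc i).1]
    · push Not at h0
      obtain ⟨i₀, hi₀⟩ := h0
      have hmem (i : ι) (hi : f i x = c i) : i ∈ T := by
        by_contra hi'
        rw [hT i hi'] at hi
        linarith [(hc i).1]
      let s := T.filter fun i ↦ f i x = c i
      have hs : s.card ≠ 0 :=
        (Finset.card_pos.2 ⟨i₀, Finset.mem_filter.2 ⟨hmem _ hi₀, hi₀⟩⟩).ne'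
      refine ⟨s.card, ?_, s, ?_⟩
      · by_contra! hcard
        obtain ⟨i, hi, hne⟩ := hgen s hcard x
        exact hne (Finset.mem_filter.1 hi).2
      · simp only [W, if_neg hs, true_and, Set.mem_setOf_eq]
        intro i hi
        have h0 : d i x = 0 := by simp [d, (Finset.mem_filter.1 hi).2]
        refine ⟨by rw [h0]; norm_num, fun j hj ↦ ?_⟩
        rw [h0, abs_pos, sub_ne_zero]
        exact fun h ↦ hj (Finset.mem_filter.2 ⟨hmem j h, h⟩)
  have hex (k : ℕ) (x : C) : ∃ s, (∃ s, x ∈ W k s) → x ∈ W k s := by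
    by_cases h : ∃ s, x ∈ W k s
    · exact ⟨h.choose, fun _ ↦ h.choose_spec⟩
    · exact ⟨∅, fun h' ↦ absurd h' h⟩
  choose σ hσ using hex
  let y (s : Finset ι) (x : C) : C := if h : s.Nonempty then f.c h.choose else x
  refine ⟨fun k ↦ ⋃ s, W k s, fun k x ↦ y (σ k x) x, fun k ↦ isOpen_iUnion fun s ↦ hWo k s,
    fun x ↦ ?_, fun k x hx ↦ ?_⟩
  · obtain ⟨k, hk, s, hs⟩ := hWc x
    exact ⟨⟨k, Nat.lt_succ_of_le hk⟩, Set.mem_iUnion.2 ⟨s, hs⟩⟩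
  · obtain ⟨s, hs⟩ := Set.mem_iUnion.1 hx
    have hσs (z : C) (hz : z ∈ W k s) : σ k z = s := hWd k _ _ z (hσ k z ⟨s, hz⟩) hz
    have hsne : s.Nonempty := let ⟨i, hi, _⟩ := hW0 k s x hs; ⟨i, hi⟩
    filter_upwards [(hWo k s).mem_nhds hs] with z hz
    simp only [hσs z hz, hσs x hs, y, dif_pos hsne, true_and]
    obtain ⟨-, -, h⟩ := hW0 k s z hz
    exact hsub _ z (h _ hsne.choose_spec)

end Coloring

end

noncomputable section

/-! ### Hadamard's lemma and point derivations -/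

section Hadamard

open MeasureTheory

variable {V : Type*} [NormedAddCommGroup V] [NormedSpace ℝ V] [FiniteDimensional ℝ V]

/-- `G y` is the integral of `df` along the segment from `x` to `y`. Smoothness in `y` is deduced
from that of convolutions depending on a parameter. -/
theorem exists_hadamard {f : V → ℝ} (hf : ContDiff ℝ ∞ f) (x : V) :
    ∃ G : V → V →L[ℝ] ℝ, ContDiff ℝ ∞ G ∧ G x = fderiv ℝ f x ∧
      ∀ y, f y = f x + G y (y - x) := by
  have hf' : ContDiff ℝ ∞ (fderiv ℝ f) := hf.fderiv_right (by simp)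
  let b : ContDiffBump (0 : ℝ) := ⟨1, 2, one_pos, one_lt_two⟩
  let u : ℝ → ℝ := Set.indicator (Set.Ioc 0 1) 1
  -- The integral over `(0, 1]` is the convolution of the indicator `u` with `g p`, evaluated at 0;
  -- this reverses the sign of `s`. The bump `b` is 1 on `[-1, 1]` and gives the compact support
  -- that smoothness requires.
  let g (p : V) (s : ℝ) : V →L[ℝ] ℝ := b s • fderiv ℝ f (x - s • (p - x))
  have hg : ContDiff ℝ ∞ ↿g := by
    refine (b.contDiff.comp contDiff_snd).smul (hf'.comp ?_)
    exact contDiff_const.sub (contDiff_snd.smul (contDiff_fst.sub contDiff_const))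
  have hu : LocallyIntegrable u volume :=
    ((integrable_indicator_iff measurableSet_Ioc).2
      (integrableOn_const (C := (1 : ℝ)) measure_Ioc_lt_top.ne)).locallyIntegrable
  have hG := contDiffOn_convolution_right_with_param_comp (μ := volume) (n := ⊤)
    (ContinuousLinearMap.lsmul ℝ ℝ) (s := Set.univ) (v := fun _ : V ↦ (0 : ℝ))
    (k := Metric.closedBall 0 2) (g := g) contDiffOn_const isOpen_univ (isCompact_closedBall 0 2)
    (fun p s _ hs ↦ by
      have : b s = 0 := b.zero_of_le_dist (by
        rw [Metric.mem_closedBall, not_le] at hs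
        exact hs.le)
      simp [g, this]) hu hg.contDiffOn
  have hGeq (y : V) : MeasureTheory.convolution u (g y) (ContinuousLinearMap.lsmul ℝ ℝ) volume 0 =
      ∫ t in (0 : ℝ)..1, fderiv ℝ f (x + t • (y - x)) := by
    rw [intervalIntegral.integral_of_le zero_le_one, ← integral_indicator measurableSet_Ioc,
      MeasureTheory.convolution]
    refine integral_congr_ae (Filter.Eventually.of_forall fun t ↦ ?_)
    by_cases ht : t ∈ Set.Ioc (0 : ℝ) 1
    · have hb : b (-t) = 1 := b.one_of_mem_closedBall (by
        rw [Metric.mem_closedBall, dist_zero_right, norm_neg, Real.norm_eq_abs, abs_of_pos ht.1]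
        exact ht.2)
      simp [u, g, ht, hb]
    · simp [u, ht]
  refine ⟨_, contDiffOn_univ.1 hG, ?_, fun y ↦ ?_⟩
  · rw [hGeq]; simp
  · have hcont : Continuous fun t : ℝ ↦ fderiv ℝ f (x + t • (y - x)) :=
      hf'.continuous.comp (by fun_prop)
    rw [hGeq, ContinuousLinearMap.intervalIntegral_apply (hcont.intervalIntegrable _ _)]
    have hd (t : ℝ) : HasDerivAt (fun t : ℝ ↦ f (x + t • (y - x)))
        (fderiv ℝ f (x + t • (y - x)) (y - x)) t := by
      have h1 : HasDerivAt (fun t : ℝ ↦ x + t • (y - x)) (y - x) t := by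
        simpa using ((hasDerivAt_id t).smul_const (y - x)).const_add x
      exact (hf.differentiable (by simp) _).hasFDerivAt.comp_hasDerivAt t h1
    rw [intervalIntegral.integral_eq_sub_of_hasDerivAt (fun t _ ↦ hd t)
      ((hcont.clm_apply continuous_const).intervalIntegrable _ _)]
    simp

end Hadamard

section PointDerivation

variable {n : ℕ} {C : Type*} [TopologicalSpace C] [T2Space C]
  [ChartedSpace (EuclideanSpace ℝ (Fin n)) C] [IsManifold (𝓡 n) ∞ C]
  {W : Type*} [AddCommGroup W] [Module ℝ W]

/-- Point derivations are local: a bump `B` supported where `f` vanishes has `B * f = 0` and `B x =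
1`. -/
theorem pointDerivation_eq_zero_of_eventuallyEq {x : C}
    {δ : C^∞⟮𝓡 n, C; 𝓘(ℝ, ℝ), ℝ⟯ →ₗ[ℝ] W} (hδ : ∀ f g, δ (f * g) = f x • δ g + g x • δ f)
    {f : C^∞⟮𝓡 n, C; 𝓘(ℝ, ℝ), ℝ⟯} (hf : ∀ᶠ y in 𝓝 x, f y = 0) : δ f = 0 := by
  obtain ⟨b, -, hb⟩ := (SmoothBumpFunction.nhds_basis_tsupport (I := 𝓡 n) x).mem_iff.1 hf
  let B : C^∞⟮𝓡 n, C; 𝓘(ℝ, ℝ), ℝ⟯ := ⟨b, b.contMDiff⟩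
  have hB : B * f = 0 := by
    ext y
    by_cases hy : b y = 0
    · change b y * f y = 0
      rw [hy, zero_mul]
    · have : f y = 0 := hb (subset_tsupport _ hy)
      change b y * f y = 0
      rw [this, mul_zero]
  have h1 := hδ B f
  have hBx : B x = 1 := b.eq_one
  rw [hB, map_zero, hBx, hf.self_of_nhds, zero_smul, one_smul, add_zero] at h1
  exact h1.symm

/-- A derivation of the algebra of smooth functions at a point is given by tangent vectors. -/
theorem exists_pointDerivation_eq_sum {x : C}
    {δ : C^∞⟮𝓡 n, C; 𝓘(ℝ, ℝ), ℝ⟯ →ₗ[ℝ] W} (hδ : ∀ f g, δ (f * g) = f x • δ g + g x • δ f) :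
    ∃ w : Fin n → W, ∀ f : C^∞⟮𝓡 n, C; 𝓘(ℝ, ℝ), ℝ⟯, δ f =
      ∑ a, (mvfderiv (𝓡 n) (fun y ↦ f y) x (EuclideanSpace.single a (1 : ℝ))) • w a := by
  let φ := chartAt (EuclideanSpace ℝ (Fin n)) x
  have hφ : ContMDiffOn (𝓡 n) 𝓘(ℝ, EuclideanSpace ℝ (Fin n)) ∞ φ φ.source :=
    contMDiffOn_chart (I := 𝓡 n)
  have hx : x ∈ φ.source := mem_chart_source _ x
  obtain ⟨b, -, hb⟩ := (SmoothBumpFunction.nhds_basis_tsupport (I := 𝓡 n) x).mem_iff.1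
    (φ.open_source.mem_nhds hx)
  have hcoord {g : EuclideanSpace ℝ (Fin n) → ℝ} (hg : ContDiff ℝ ∞ g) :
      ContMDiff (𝓡 n) 𝓘(ℝ, ℝ) ∞ fun y ↦ b y * g (φ y) :=
    b.contMDiff_smul (hg.contMDiff.comp_contMDiffOn hφ)
  have hproj (a : Fin n) : ContDiff ℝ ∞ fun v : EuclideanSpace ℝ (Fin n) ↦ (v - φ x) a :=
    ((EuclideanSpace.proj a).contDiff (𝕜 := ℝ)).comp (contDiff_id.sub contDiff_const)
  -- Coordinates centred at `x`, cut off to be global functions; the sought vectors are the values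
  -- of `δ` on them.
  let Y (a : Fin n) : C^∞⟮𝓡 n, C; 𝓘(ℝ, ℝ), ℝ⟯ := ⟨_, hcoord (hproj a)⟩
  refine ⟨fun a ↦ δ (Y a), fun f ↦ ?_⟩
  have hfs : ContDiffOn ℝ ∞ (f ∘ φ.symm) φ.target := by
    rw [← contMDiffOn_iff_contDiffOn]
    exact f.contMDiff.comp_contMDiffOn (contMDiffOn_chart_symm (I := 𝓡 n))
  obtain ⟨β, hβ⟩ : ∃ β : ContDiffBump (φ x), tsupport β ⊆ φ.target := by
    obtain ⟨ε, hε, hball⟩ := Metric.nhds_basis_closedBall.mem_iff.1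
      (φ.open_target.mem_nhds (φ.map_source hx))
    refine ⟨⟨ε / 2, ε, half_pos hε, half_lt_self hε⟩, ?_⟩
    rw [ContDiffBump.tsupport_eq]
    exact hball
  -- Hadamard's lemma needs a function on the whole model space, so `f` is cut off in the chart and
  -- extended by zero.
  have hF : ContDiff ℝ ∞ fun v ↦ β v * f (φ.symm v) := by
    rw [contDiff_iff_contDiffAt]
    intro v
    by_cases hv : v ∈ φ.target
    · exact β.contDiff.contDiffAt.mul (hfs.contDiffAt (φ.open_target.mem_nhds hv))
    · have : ∀ᶠ w in 𝓝 v, β w * f (φ.symm w) = 0 := by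
        filter_upwards [(isClosed_tsupport β).isOpen_compl.mem_nhds fun h ↦ hv (hβ h)] with w hw
        rw [image_eq_zero_of_notMem_tsupport hw, zero_mul]
      exact (contDiffAt_const (c := (0 : ℝ))).congr_of_eventuallyEq this
  obtain ⟨G, hG, hGx, hGy⟩ := exists_hadamard hF (φ x)
  have hFe : (fun v ↦ β v * f (φ.symm v)) =ᶠ[𝓝 (φ x)] f ∘ φ.symm := by
    filter_upwards [β.eventuallyEq_one] with v hv
    simp [hv]
  have hderiv (a : Fin n) : mvfderiv (𝓡 n) (fun y ↦ f y) x (EuclideanSpace.single a (1 : ℝ)) =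
      G (φ x) (EuclideanSpace.single a 1) := by
    rw [hGx, hFe.fderiv_eq]
    have hmd : MDifferentiableAt (𝓡 n) 𝓘(ℝ, ℝ) (fun y ↦ f y) x :=
      f.contMDiff.mdifferentiableAt (by simp)
    simp only [mvfderiv, mfderiv, hmd, if_true, ContinuousLinearMap.comp_apply]
    simp [writtenInExtChartAt, φ, Function.comp_def]
    rfl
  let g (a : Fin n) : C^∞⟮𝓡 n, C; 𝓘(ℝ, ℝ), ℝ⟯ :=
    ⟨_, hcoord (g := fun v ↦ G v (EuclideanSpace.single a 1)) (hG.clm_apply contDiff_const)⟩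
  have hone : δ 1 = 0 := by simpa using hδ 1 1
  have hYx (a : Fin n) : Y a x = 0 := by
    change b x * (φ x - φ x) a = 0
    simp
  have hgx (a : Fin n) : g a x = G (φ x) (EuclideanSpace.single a 1) := by
    change b x * G (φ x) (EuclideanSpace.single a 1) = _
    rw [b.eq_one, one_mul]
  -- Near `x` all cutoffs equal 1 and Hadamard's formula reads `f = f x + ∑ Y_a g_a`; locality makes
  -- this enough for `δ`.
  have hloc : δ (f - (f x • 1 + ∑ a, Y a * g a)) = 0 := by
    refine pointDerivation_eq_zero_of_eventuallyEq hδ ?_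
    filter_upwards [b.eventuallyEq_one, φ.open_source.mem_nhds hx,
      (φ.continuousAt hx).eventually β.eventuallyEq_one] with y hy hys hβy
    have e1 := hGy (φ y)
    have hβx : β (φ x) = 1 := β.eventuallyEq_one.eq_of_nhds
    have hβy' : β (φ y) = 1 := hβy
    rw [hβx, hβy', φ.left_inv hys, φ.left_inv hx, one_mul, one_mul] at e1
    have e2 : φ y - φ x = ∑ a, ((φ y - φ x) a) • EuclideanSpace.single a (1 : ℝ) := by
      ext i
      simp [Pi.single_apply]
    have hy' : b y = 1 := hy
    have e3 : (∑ a, Y a * g a) y = ∑ a, Y a y * g a y := by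
      have := map_sum (ContMDiffMap.evalRingHom (n := ∞) (I := 𝓡 n) (R := ℝ) y) (fun a ↦ Y a * g a) Finset.univ
      exact this
    have e4 (a : Fin n) : Y a y * g a y =
        (φ y - φ x) a * G (φ y) (EuclideanSpace.single a (1 : ℝ)) := by
      change (b y * (φ y - φ x) a) * (b y * G (φ y) (EuclideanSpace.single a (1 : ℝ))) = _
      rw [hy', one_mul, one_mul]
    rw [e2, map_sum] at e1
    change f y - (f x * 1 + (∑ a, Y a * g a) y) = 0
    rw [e3, e1, mul_one, sub_eq_zero]
    congr 1
    refine Finset.sum_congr rfl fun a _ ↦ ?_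
    rw [e4, map_smul, smul_eq_mul]
  rw [map_sub, sub_eq_zero] at hloc
  rw [hloc, map_add, map_smul, hone, smul_zero, zero_add, map_sum]
  refine Finset.sum_congr rfl fun a _ ↦ ?_
  rw [hδ, hYx, zero_smul, zero_add, hgx, hderiv]

end PointDerivation

end

noncomputable section

/-! ### Finite frames -/

section Partition

variable {n : ℕ} {C : Type*} [TopologicalSpace C] [T2Space C] [SigmaCompactSpace C]
  [ChartedSpace (EuclideanSpace ℝ (Fin n)) C] [IsManifold (𝓡 n) ∞ C]

/-- Near `x`, either the function `μ` vanishes or `p` is constant and `U (p x)` is a neighbourhood. -/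
def IsCutoff (U : C → Set C) (μ : C → ℝ) (p : C → C) : Prop :=
  ∀ x, (∀ᶠ z in 𝓝 x, μ z = 0) ∨ ∀ᶠ z in 𝓝 x, p z = p x ∧ z ∈ U (p x)

/-- The squares sum to 1 because each cutoff enters a frame twice, in a section and in its dual. A
partition of unity subordinate to the colours is divided by the root of its sum of squares. -/
theorem exists_finite_partition (U : C → Set C) (hU : ∀ x, U x ∈ 𝓝 x) :
    ∃ (μ : Fin (n + 1) → C^∞⟮𝓡 n, C; 𝓘(ℝ, ℝ), ℝ⟯) (p : Fin (n + 1) → C → C),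
      (∀ x, ∑ k, μ k x ^ 2 = 1) ∧ ∀ k, IsCutoff U (μ k) (p k) := by
  obtain ⟨V, p, hV, hcov, hp⟩ := exists_finite_coloring (n := n) U hU
  obtain ⟨χ, hχ⟩ := SmoothPartitionOfUnity.exists_isSubordinate (𝓡 n) isClosed_univ V hV
    (fun x _ ↦ Set.mem_iUnion.2 (hcov x))
  have hpos (x : C) : 0 < ∑ k, χ k x ^ 2 := by
    obtain ⟨k, hk⟩ := χ.exists_pos_of_mem (Set.mem_univ x)
    exact Finset.sum_pos' (fun _ _ ↦ sq_nonneg _) ⟨k, Finset.mem_univ _, pow_pos hk 2⟩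
  have hsum : ContMDiff (𝓡 n) 𝓘(ℝ, ℝ) ∞ fun x ↦ ∑ k, χ k x ^ 2 :=
    contMDiff_finsetSum fun k _ ↦ (χ k).contMDiff.pow 2
  have hinv : ContMDiff (𝓡 n) 𝓘(ℝ, ℝ) ∞ fun x ↦ (Real.sqrt (∑ k, χ k x ^ 2))⁻¹ := by
    intro x
    have h1 : ContDiffAt ℝ ∞ (fun t : ℝ ↦ (Real.sqrt t)⁻¹) (∑ k, χ k x ^ 2) :=
      (Real.contDiffAt_sqrt (hpos x).ne').inv (Real.sqrt_pos.2 (hpos x)).ne'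
    exact ContMDiffAt.comp (g := fun t : ℝ ↦ (Real.sqrt t)⁻¹) (f := fun x ↦ ∑ k, χ k x ^ 2) x
      h1.contMDiffAt (hsum x)
  refine ⟨fun k ↦ ⟨fun x ↦ χ k x * (Real.sqrt (∑ k, χ k x ^ 2))⁻¹, (χ k).contMDiff.mul hinv⟩, p,
    fun x ↦ ?_, fun k x ↦ ?_⟩
  · change ∑ k, (χ k x * (Real.sqrt (∑ k, χ k x ^ 2))⁻¹) ^ 2 = 1
    simp only [mul_pow, ← Finset.sum_mul, inv_pow, Real.sq_sqrt (hpos x).le]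
    exact mul_inv_cancel₀ (hpos x).ne'
  · by_cases hx : x ∈ tsupport (χ k)
    · exact .inr (hp k x (hχ k hx))
    · left
      filter_upwards [(isClosed_tsupport (χ k)).isOpen_compl.mem_nhds hx] with z hz
      change χ k z * _ = 0
      rw [image_eq_zero_of_notMem_tsupport hz, zero_mul]

end Partition

section Sections

variable {n : ℕ} {C : Type*} [TopologicalSpace C]
  [ChartedSpace (EuclideanSpace ℝ (Fin n)) C]
  {F : Type*} [NormedAddCommGroup F] [NormedSpace ℝ F]
  {E : C → Type*} [∀ x, AddCommGroup (E x)] [∀ x, Module ℝ (E x)] [∀ x, TopologicalSpace (E x)]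
  [TopologicalSpace (Bundle.TotalSpace F E)] [FiberBundle F E] [VectorBundle ℝ F E]

theorem contMDiffAt_linearMapAt_section [IsManifold (𝓡 n) ∞ C] [ContMDiffVectorBundle ∞ F E (𝓡 n)]
    {s : Π x, E x} {x₀ y₀ : C}
    (hx : x₀ ∈ (trivializationAt F E y₀).baseSet)
    (hs : ContMDiffAt (𝓡 n) ((𝓡 n).prod 𝓘(ℝ, F)) ∞ (fun x ↦ Bundle.TotalSpace.mk' F x (s x)) x₀) :
    ContMDiffAt (𝓡 n) 𝓘(ℝ, F) ∞ (fun y ↦ (trivializationAt F E y₀).linearMapAt ℝ y (s y)) x₀ := by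
  have h := ((trivializationAt F E y₀).contMDiffAt_section_iff (IB := 𝓡 n) (n := ∞) hx).1 hs
  refine h.congr_of_eventuallyEq ?_
  filter_upwards [(trivializationAt F E y₀).open_baseSet.mem_nhds hx] with y hy
  rw [Bundle.Trivialization.coe_linearMapAt_of_mem _ hy]

theorem contMDiffAt_symm_section [IsManifold (𝓡 n) ∞ C] [ContMDiffVectorBundle ∞ F E (𝓡 n)]
    {x₀ y₀ : C} (hx : x₀ ∈ (trivializationAt F E y₀).baseSet) (v : F) :
    ContMDiffAt (𝓡 n) ((𝓡 n).prod 𝓘(ℝ, F)) ∞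
      (fun x ↦ Bundle.TotalSpace.mk' F x ((trivializationAt F E y₀).symmₗ ℝ x v)) x₀ := by
  rw [(trivializationAt F E y₀).contMDiffAt_section_iff (IB := 𝓡 n) (n := ∞) hx]
  refine (contMDiffAt_const (c := v)).congr_of_eventuallyEq ?_
  filter_upwards [(trivializationAt F E y₀).open_baseSet.mem_nhds hx] with y hy
  have := (trivializationAt F E y₀).linearMapAt_symmₗ (R := ℝ) hy v
  rwa [Bundle.Trivialization.coe_linearMapAt_of_mem _ hy] at this

/-- The trivialization used at `x` changes with `p x`, but `p` is locally constant wherever the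
cutoff is not locally zero. -/
theorem contMDiff_cutoff_section [IsManifold (𝓡 n) ∞ C] [ContMDiffVectorBundle ∞ F E (𝓡 n)]
    {μ : C → ℝ} {p : C → C} (hμ : ContMDiff (𝓡 n) 𝓘(ℝ, ℝ) ∞ μ)
    (hp : IsCutoff (fun y ↦ (trivializationAt F E y).baseSet) μ p) (v : F) :
    ContMDiff (𝓡 n) ((𝓡 n).prod 𝓘(ℝ, F)) ∞
      (fun x ↦ Bundle.TotalSpace.mk' F x (μ x • (trivializationAt F E (p x)).symmₗ ℝ x v)) := by
  intro x
  rcases hp x with h | h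
  · refine (Bundle.contMDiff_zeroSection ℝ E x).congr_of_eventuallyEq ?_
    filter_upwards [h] with z hz
    rw [hz, zero_smul]
    rfl
  · have hx : x ∈ (trivializationAt F E (p x)).baseSet := h.self_of_nhds.2
    refine ((hμ x).smul_section (contMDiffAt_symm_section hx v)).congr_of_eventuallyEq ?_
    filter_upwards [h] with z hz
    rw [hz.1]
    rfl

theorem smoothCoeffAt_dualTriv [FiniteDimensional ℝ F] {ψ : Π x, Module.Dual ℝ (E x)} {x₀ : C}
    (h : ∀ v, ContMDiffAt (𝓡 n) 𝓘(ℝ, ℝ) ∞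
      (fun y ↦ ψ y ((trivializationAt F E x₀).symmₗ ℝ y v)) x₀) :
    SmoothCoeffAt (n := n) (fun y ↦ dualTriv F E x₀ y (ψ y)) x₀ := by
  let b := Module.finBasis ℝ F
  refine (SmoothCoeffAt.sum Finset.univ fun i _ ↦
    SmoothCoeffAt.const_smul_fun (b.coord i) (h (b i))).congr (Filter.Eventually.of_forall fun y ↦ ?_)
  refine b.ext fun i ↦ ?_
  simp [dualTriv, Finsupp.single_apply, Finset.sum_ite_eq]

theorem contMDiffAt_dual_apply [FiniteDimensional ℝ F] [IsManifold (𝓡 n) ∞ C]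
    [ContMDiffVectorBundle ∞ F E (𝓡 n)] {ψ : Π x, Module.Dual ℝ (E x)} {s : Π x, E x} {x₀ : C}
    (hψ : SmoothCoeffAt (n := n) (fun y ↦ dualTriv F E x₀ y (ψ y)) x₀)
    (hs : ContMDiffAt (𝓡 n) ((𝓡 n).prod 𝓘(ℝ, F)) ∞ (fun x ↦ Bundle.TotalSpace.mk' F x (s x)) x₀) :
    ContMDiffAt (𝓡 n) 𝓘(ℝ, ℝ) ∞ (fun y ↦ ψ y (s y)) x₀ := by
  obtain ⟨k, w, c, hc, e⟩ := hψ
  have hx := FiberBundle.mem_baseSet_trivializationAt F E x₀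
  have hs' := contMDiffAt_linearMapAt_section hx hs
  have h1 : ContMDiffAt (𝓡 n) 𝓘(ℝ, ℝ) ∞ (fun y ↦ ∑ i, c i y *
      LinearMap.toContinuousLinearMap (w i) ((trivializationAt F E x₀).linearMapAt ℝ y (s y))) x₀ :=
    contMDiffAt_finsetSum fun i _ ↦ (hc i).mul
      ((LinearMap.toContinuousLinearMap (w i)).contMDiff.contMDiffAt.comp x₀ hs')
  refine h1.congr_of_eventuallyEq ?_
  filter_upwards [e, (trivializationAt F E x₀).open_baseSet.mem_nhds hx] with y hy hyb
  have := LinearMap.congr_fun hy ((trivializationAt F E x₀).linearMapAt ℝ y (s y))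
  simp only [dualTriv, LinearMap.dualMap_apply, (trivializationAt F E x₀).symmₗ_linearMapAt hyb,
    LinearMap.sum_apply, LinearMap.smul_apply, smul_eq_mul] at this
  exact this

theorem smooth_cutoff_dual [FiniteDimensional ℝ F] [IsManifold (𝓡 n) ∞ C]
    [ContMDiffVectorBundle ∞ F E (𝓡 n)] {μ : C → ℝ} {p : C → C}
    (hμ : ContMDiff (𝓡 n) 𝓘(ℝ, ℝ) ∞ μ)
    (hp : IsCutoff (fun y ↦ (trivializationAt F E y).baseSet) μ p) (w : Module.Dual ℝ F) (x₀ : C) :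
    SmoothCoeffAt (n := n) (fun y ↦ dualTriv F E x₀ y
      (μ y • (w ∘ₗ (trivializationAt F E (p y)).linearMapAt ℝ y))) x₀ := by
  refine smoothCoeffAt_dualTriv fun v ↦ ?_
  rcases hp x₀ with h | h
  · refine (contMDiffAt_const (c := (0 : ℝ))).congr_of_eventuallyEq ?_
    filter_upwards [h] with z hz
    simp [hz]
  · have h1 := contMDiffAt_linearMapAt_section (n := n) h.self_of_nhds.2 (contMDiffAt_symm_section
      (n := n) (FiberBundle.mem_baseSet_trivializationAt F E x₀) v)
    refine ((hμ x₀).mul ((LinearMap.toContinuousLinearMap w).contMDiff.contMDiffAt.comp x₀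
      h1)).congr_of_eventuallyEq ?_
    filter_upwards [h] with z hz
    rw [hz.1]
    rfl

end Sections

section Frames

variable {n : ℕ} {C : Type*} [TopologicalSpace C] [T2Space C] [SigmaCompactSpace C]
  [ChartedSpace (EuclideanSpace ℝ (Fin n)) C] [IsManifold (𝓡 n) ∞ C]

/-- For each colour `k`, the basis and the coordinates of a local trivialization, both multiplied by
`μ k`, contribute `μ_k² v`; these sum to `v`. The frame has `n + 1` times the rank many members. -/
theorem exists_finite_frame (F : Type*) [NormedAddCommGroup F] [NormedSpace ℝ F]
    [FiniteDimensional ℝ F]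
    (E : C → Type*) [∀ x, AddCommGroup (E x)] [∀ x, Module ℝ (E x)] [∀ x, TopologicalSpace (E x)]
    [TopologicalSpace (Bundle.TotalSpace F E)] [FiberBundle F E] [VectorBundle ℝ F E]
    [ContMDiffVectorBundle ∞ F E (𝓡 n)] :
    ∃ (N : ℕ) (θ : Fin N → Cₛ^∞⟮𝓡 n; F, E⟯) (ψ : Fin N → DualSection n F E),
      ∀ x (v : E x), ∑ i, (ψ i).toFun x v • θ i x = v := by
  obtain ⟨μ, p, hμ, hp⟩ := exists_finite_partition (n := n) (C := C)
    (fun y ↦ (trivializationAt F E y).baseSet)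
    (fun y ↦ (trivializationAt F E y).open_baseSet.mem_nhds
      (FiberBundle.mem_baseSet_trivializationAt F E y))
  let b := Module.finBasis ℝ F
  let σ := Fintype.equivFin (Fin (n + 1) × Fin (Module.finrank ℝ F))
  refine ⟨_, fun i ↦ ⟨fun x ↦ μ (σ.symm i).1 x •
      (trivializationAt F E (p (σ.symm i).1 x)).symmₗ ℝ x (b (σ.symm i).2),
      contMDiff_cutoff_section (μ _).contMDiff (hp _) _⟩,
    fun i ↦ ⟨fun x ↦ μ (σ.symm i).1 x • (b.coord (σ.symm i).2 ∘ₗ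
      (trivializationAt F E (p (σ.symm i).1 x)).linearMapAt ℝ x),
      smooth_cutoff_dual (μ _).contMDiff (hp _) _⟩, fun x v ↦ ?_⟩
  change ∑ i, (μ (σ.symm i).1 x • b.coord (σ.symm i).2
    ((trivializationAt F E (p (σ.symm i).1 x)).linearMapAt ℝ x v)) •
      (μ (σ.symm i).1 x • (trivializationAt F E (p (σ.symm i).1 x)).symmₗ ℝ x (b (σ.symm i).2)) = v
  rw [σ.symm.sum_comp (fun i ↦ (μ i.1 x • b.coord i.2
    ((trivializationAt F E (p i.1 x)).linearMapAt ℝ x v)) •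
      (μ i.1 x • (trivializationAt F E (p i.1 x)).symmₗ ℝ x (b i.2))), Fintype.sum_prod_type]
  have h1 (k : Fin (n + 1)) : ∑ a, (μ k x • b.coord a
      ((trivializationAt F E (p k x)).linearMapAt ℝ x v)) •
      (μ k x • (trivializationAt F E (p k x)).symmₗ ℝ x (b a)) = (μ k x ^ 2) • v := by
    rcases hp k x with h | h
    · simp [h.self_of_nhds]
    · conv_rhs => rw [← (trivializationAt F E (p k x)).symmₗ_linearMapAt (R := ℝ) h.self_of_nhds.2 v,
        ← b.sum_repr ((trivializationAt F E (p k x)).linearMapAt ℝ x v), map_sum, Finset.smul_sum]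
      refine Finset.sum_congr rfl fun a _ ↦ ?_
      simp only [map_smul, smul_smul, smul_eq_mul, Module.Basis.coord_apply]
      congr 1
      ring
  simp only [h1, ← Finset.sum_smul, hμ, one_smul]

end Frames

end

noncomputable section

/-! ### Vector fields as derivations -/

section VectorField

variable {n : ℕ} {C : Type*} [TopologicalSpace C]
  [ChartedSpace (EuclideanSpace ℝ (Fin n)) C] [IsManifold (𝓡 n) ∞ C]

theorem mvfderiv_congr {g g' : C → ℝ} {x : C} (h : g =ᶠ[𝓝 x] g') :
    mvfderiv (𝓡 n) g x = mvfderiv (𝓡 n) g' x := by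
  simp only [mvfderiv, h.mfderiv_eq]
  rfl

theorem contMDiff_mvfderiv_apply {g : C → ℝ} (hg : ContMDiff (𝓡 n) 𝓘(ℝ, ℝ) ∞ g)
    (ξ : Cₛ^∞⟮𝓡 n; EuclideanSpace ℝ (Fin n), (TangentSpace (𝓡 n) : C → Type _)⟯) :
    ContMDiff (𝓡 n) 𝓘(ℝ, ℝ) ∞ fun x ↦ mvfderiv (𝓡 n) g x (ξ x) :=
  (contMDiff_snd_tangentBundle_modelSpace ℝ 𝓘(ℝ, ℝ)).comp
    ((hg.contMDiff_tangentMap (m := ∞) (by simp)).comp ξ.contMDiff)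

/-- The derivation of the algebra of smooth functions given by a vector field. -/
def vectorFieldDerivation
    (ξ : Cₛ^∞⟮𝓡 n; EuclideanSpace ℝ (Fin n), (TangentSpace (𝓡 n) : C → Type _)⟯) :
    Derivation ℝ C^∞⟮𝓡 n, C; 𝓘(ℝ, ℝ), ℝ⟯ C^∞⟮𝓡 n, C; 𝓘(ℝ, ℝ), ℝ⟯ :=
  Derivation.mk'
    { toFun := fun f ↦ ⟨fun x ↦ mvfderiv (𝓡 n) (fun y ↦ f y) x (ξ x),
        contMDiff_mvfderiv_apply f.contMDiff ξ⟩
      map_add' := fun f g ↦ by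
        ext x
        have := mvfderiv_add (f.contMDiff.mdifferentiableAt (x := x) (by simp))
          (g.contMDiff.mdifferentiableAt (x := x) (by simp))
        exact congr($this (ξ x))
      map_smul' := fun r f ↦ by
        ext x
        have := mvfderiv_smul (a := fun _ : C ↦ r) (x := x) (I := 𝓡 n) mdifferentiableAt_const
          (f.contMDiff.mdifferentiableAt (x := x) (by simp))
        rw [mvfderiv_const] at this
        have h2 := congr($this (ξ x))
        simpa using! h2 }
    fun f g ↦ by
      ext x
      have := mvfderiv_mul (f.contMDiff.mdifferentiableAt (x := x) (by simp))
          (g.contMDiff.mdifferentiableAt (x := x) (by simp))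
      exact congr($this (ξ x))

end VectorField

section TangentFrame

variable {n : ℕ} {C : Type*} [TopologicalSpace C] [T2Space C] [SigmaCompactSpace C]
  [ChartedSpace (EuclideanSpace ℝ (Fin n)) C] [IsManifold (𝓡 n) ∞ C]

/-- The differentials of the chart coordinates are the coordinates of the standard trivialization of
the tangent bundle. -/
theorem mvfderiv_chart_apply {x y : C} (hx : x ∈ (chartAt (EuclideanSpace ℝ (Fin n)) y).source)
    (a : Fin n) (v : TangentSpace (𝓡 n) x) :
    MDifferentiableAt (𝓡 n) 𝓘(ℝ, ℝ) (fun z ↦ chartAt (EuclideanSpace ℝ (Fin n)) y z a) x ∧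
    mvfderiv (𝓡 n) (fun z ↦ chartAt (EuclideanSpace ℝ (Fin n)) y z a) x v =
      ((trivializationAt (EuclideanSpace ℝ (Fin n)) (TangentSpace (𝓡 n)) y).linearMapAt ℝ x v) a := by
  have h1 : MDifferentiableAt (𝓡 n) 𝓘(ℝ, EuclideanSpace ℝ (Fin n)) (extChartAt (𝓡 n) y) x :=
    mdifferentiableAt_extChartAt hx
  have h2 : MDifferentiableAt 𝓘(ℝ, EuclideanSpace ℝ (Fin n)) 𝓘(ℝ, ℝ)
      (EuclideanSpace.proj (𝕜 := ℝ) a) (extChartAt (𝓡 n) y x) :=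
    (EuclideanSpace.proj (𝕜 := ℝ) a).contMDiff.mdifferentiableAt (n := 1) (by simp)
  refine ⟨h2.comp x h1, ?_⟩
  have h3 := mfderiv_comp x h2 h1
  have h4 := TangentBundle.continuousLinearMapAt_trivializationAt (I := 𝓡 n) (𝕜 := ℝ) hx
  rw [← h4] at h3
  have h5 := congr($h3 v)
  rw [ContinuousLinearMap.mfderiv_eq] at h5
  exact h5

/-- There are functions `h j` and vector fields `ξ j` such that `∑ j, dh j ⊗ ξ j` is the identity of
the tangent bundle. -/
theorem exists_finite_tangent_frame :
    ∃ (J : Type) (_ : Fintype J) (h : J → C^∞⟮𝓡 n, C; 𝓘(ℝ, ℝ), ℝ⟯)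
      (ξ : J → Cₛ^∞⟮𝓡 n; EuclideanSpace ℝ (Fin n), (TangentSpace (𝓡 n) : C → Type _)⟯),
      ∀ x (v : TangentSpace (𝓡 n) x), ∑ j, mvfderiv (𝓡 n) (fun y ↦ h j y) x v • ξ j x = v := by
  let T (y : C) := trivializationAt (EuclideanSpace ℝ (Fin n)) (TangentSpace (𝓡 n) : C → Type _) y
  have hT (y : C) : (T y).baseSet = (chartAt (EuclideanSpace ℝ (Fin n)) y).source :=
    TangentBundle.trivializationAt_baseSet y
  obtain ⟨μ, p, hμ, hp⟩ := exists_finite_partition (n := n) (C := C)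
    (fun y ↦ (T y).baseSet)
    (fun y ↦ (T y).open_baseSet.mem_nhds
      (FiberBundle.mem_baseSet_trivializationAt _ _ y))
  have hsm (k : Fin (n + 1)) (a : Fin n) : ContMDiff (𝓡 n) 𝓘(ℝ, ℝ) ∞
      fun z ↦ μ k z * chartAt (EuclideanSpace ℝ (Fin n)) (p k z) z a := by
    intro x
    rcases hp k x with h | h
    · refine (contMDiffAt_const (c := (0 : ℝ))).congr_of_eventuallyEq ?_
      filter_upwards [h] with z hz
      rw [hz, zero_mul]
    · have hx : x ∈ (T (p k x)).baseSet := h.self_of_nhds.2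
      rw [hT] at hx
      have h1 : ContMDiffAt (𝓡 n) 𝓘(ℝ, ℝ) ∞
          (fun z ↦ chartAt (EuclideanSpace ℝ (Fin n)) (p k x) z a) x :=
        (EuclideanSpace.proj (𝕜 := ℝ) a).contMDiff.contMDiffAt.comp x
          (contMDiffAt_extChartAt' (I := 𝓡 n) hx)
      refine ((μ k).contMDiff x |>.mul h1).congr_of_eventuallyEq ?_
      filter_upwards [h] with z hz
      rw [hz.1]
      rfl
  let H (k : Fin (n + 1)) (a : Fin n) : C^∞⟮𝓡 n, C; 𝓘(ℝ, ℝ), ℝ⟯ := ⟨_, hsm k a⟩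
  have hH (k : Fin (n + 1)) (a : Fin n) : IsCutoff (fun y ↦ (T y).baseSet) (H k a) (p k) := by
    intro x
    refine (hp k x).imp_left fun h ↦ ?_
    filter_upwards [h] with z hz
    change μ k z * _ = 0
    rw [hz, zero_mul]
  let e (a : Fin n) : EuclideanSpace ℝ (Fin n) := EuclideanSpace.single a 1
  -- The differential of the cut off coordinate `μ φ^a` is `μ dφ^a + φ^a dμ`. The second family,
  -- with functions `μ` and fields `-μ φ^a ∂_a`, cancels the unwanted term and leaves `μ² dφ^a ⊗
  -- ∂_a`.
  refine ⟨(Fin (n + 1) × Fin n) ⊕ (Fin (n + 1) × Fin n), inferInstance,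
    Sum.elim (fun i ↦ H i.1 i.2) (fun i ↦ μ i.1),
    Sum.elim (fun i ↦ ⟨fun x ↦ μ i.1 x • (T (p i.1 x)).symmₗ ℝ x (e i.2),
        contMDiff_cutoff_section (μ i.1).contMDiff (hp i.1) _⟩)
      (fun i ↦ -⟨fun x ↦ H i.1 i.2 x • (T (p i.1 x)).symmₗ ℝ x (e i.2),
        contMDiff_cutoff_section (H i.1 i.2).contMDiff (hH i.1 i.2) _⟩), fun x v ↦ ?_⟩
  rw [Fintype.sum_sum_type, Fintype.sum_prod_type, Fintype.sum_prod_type, ← Finset.sum_add_distrib]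
  have key (k : Fin (n + 1)) :
      ∑ a, mvfderiv (𝓡 n) (fun y ↦ H k a y) x v • (μ k x • (T (p k x)).symmₗ ℝ x (e a)) +
      ∑ a, mvfderiv (𝓡 n) (fun y ↦ μ k y) x v • -(H k a x • (T (p k x)).symmₗ ℝ x (e a)) =
      (μ k x ^ 2) • v := by
    rcases hp k x with h | h
    · have h1 : (fun y ↦ μ k y) =ᶠ[𝓝 x] fun _ ↦ 0 := h
      have h2 : mvfderiv (𝓡 n) (fun y ↦ μ k y) x v = 0 := by
        rw [mvfderiv_congr h1, mvfderiv_const]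
        rfl
      simp [h2, h.self_of_nhds]
    · have hx : x ∈ (T (p k x)).baseSet := h.self_of_nhds.2
      have hx' := hx
      rw [hT] at hx'
      let φ := chartAt (EuclideanSpace ℝ (Fin n)) (p k x)
      have hd (a : Fin n) : mvfderiv (𝓡 n) (fun y ↦ H k a y) x v =
          μ k x * ((T (p k x)).linearMapAt ℝ x v) a + φ x a * mvfderiv (𝓡 n) (fun y ↦ μ k y) x v := by
        obtain ⟨h3, h4⟩ := mvfderiv_chart_apply hx' a v
        have h5 : (fun y ↦ H k a y) =ᶠ[𝓝 x] (fun y ↦ μ k y) * fun y ↦ φ y a := by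
          filter_upwards [h] with z hz
          change μ k z * _ = μ k z * _
          rw [hz.1]
        rw [mvfderiv_congr h5, mvfderiv_mul ((μ k).contMDiff.mdifferentiableAt (by simp)) h3, ← h4]
        rfl
      have hv : v = ∑ a, ((T (p k x)).linearMapAt ℝ x v) a • (T (p k x)).symmₗ ℝ x (e a) := by
        conv_lhs => rw [← (T (p k x)).symmₗ_linearMapAt (R := ℝ) hx v]
        have : (T (p k x)).linearMapAt ℝ x v =
            ∑ a, ((T (p k x)).linearMapAt ℝ x v) a • e a := by
          ext i
          simp [e, Pi.single_apply]
        conv_lhs => rw [this, map_sum]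
        simp only [map_smul]
      conv_rhs => rw [hv, Finset.smul_sum]
      rw [← Finset.sum_add_distrib]
      refine Finset.sum_congr rfl fun a _ ↦ ?_
      rw [hd, smul_neg, smul_smul, smul_smul, smul_smul, ← sub_eq_add_neg, ← sub_smul]
      congr 1
      change _ - _ * (μ k x * φ x a) = _
      ring
  refine (Finset.sum_congr rfl fun k _ ↦ key k).trans ?_
  rw [← Finset.sum_smul, hμ, one_smul]

end TangentFrame

section PointDerivation

variable {n : ℕ} {C : Type*} [TopologicalSpace C] [T2Space C]
  [ChartedSpace (EuclideanSpace ℝ (Fin n)) C] [IsManifold (𝓡 n) ∞ C]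
  {W : Type*} [AddCommGroup W] [Module ℝ W]

/-- Point derivations are determined by their values on the functions of a tangent frame. -/
theorem pointDerivation_eq_sum_frame {J : Type*} [Fintype J]
    {h : J → C^∞⟮𝓡 n, C; 𝓘(ℝ, ℝ), ℝ⟯}
    {ξ : J → Cₛ^∞⟮𝓡 n; EuclideanSpace ℝ (Fin n), (TangentSpace (𝓡 n) : C → Type _)⟯}
    (hξ : ∀ x (v : TangentSpace (𝓡 n) x), ∑ j, mvfderiv (𝓡 n) (fun y ↦ h j y) x v • ξ j x = v)
    {x : C} {δ : C^∞⟮𝓡 n, C; 𝓘(ℝ, ℝ), ℝ⟯ →ₗ[ℝ] W}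
    (hδ : ∀ f g, δ (f * g) = f x • δ g + g x • δ f) (f : C^∞⟮𝓡 n, C; 𝓘(ℝ, ℝ), ℝ⟯) :
    δ f = ∑ j, vectorFieldDerivation (ξ j) f x • δ (h j) := by
  obtain ⟨w, hw⟩ := exists_pointDerivation_eq_sum hδ
  simp only [hw, Finset.smul_sum, smul_smul]
  rw [Finset.sum_comm]
  refine Finset.sum_congr rfl fun a _ ↦ ?_
  rw [← Finset.sum_smul]
  congr 1
  conv_lhs => rw [← hξ x (EuclideanSpace.single a (1 : ℝ)), map_sum]
  refine Finset.sum_congr rfl fun j _ ↦ ?_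
  rw [map_smul, smul_eq_mul, mul_comm]
  rfl

end PointDerivation

end

noncomputable section

universe u

/-! ### Free algebras on commuting or anticommuting generators -/

section Free

variable {I : Type*} [Fintype I]

/-- `P` is the algebra freely generated by elements `ε i` with `ε i * ε j = s • (ε j * ε i)`. -/
structure IsFreeOn {P : Type*} [Ring P] [Algebra ℝ P] (ε : I → P) (s : ℝ) : Prop where
  adjoin_eq : Algebra.adjoin ℝ (Set.range ε) = ⊤
  lift : ∀ (S : Type u) [Ring S] [Algebra ℝ S] (t : I → S),
    (∀ i j, t i * t j = s • (t j * t i)) → ∃ T : P →ₐ[ℝ] S, ∀ i, T (ε i) = t i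

theorem pi_eq_sum_single [DecidableEq I] (v : I → ℝ) : v = ∑ i, v i • Pi.single i (1 : ℝ) := by
  ext j
  simp [Pi.single_apply]

theorem exteriorAlgebra_isFreeOn [DecidableEq I] :
    IsFreeOn.{u} (fun i ↦ ExteriorAlgebra.ι ℝ (Pi.single i (1 : ℝ) : I → ℝ)) (koszul 1) where
  adjoin_eq := by
    rw [eq_top_iff]
    intro x _
    induction x using ExteriorAlgebra.induction with
    | algebraMap r => exact Subalgebra.algebraMap_mem _ r
    | ι v =>
      rw [pi_eq_sum_single v, map_sum]
      refine sum_mem fun i _ ↦ ?_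
      rw [map_smul]
      exact Subalgebra.smul_mem _ (Algebra.subset_adjoin (Set.mem_range_self i)) _
    | mul a b ha hb => exact mul_mem (ha trivial) (hb trivial)
    | add a b ha hb => exact add_mem (ha trivial) (hb trivial)
  lift S _ _ t ht := by
    let L : (I → ℝ) →ₗ[ℝ] S := (Pi.basisFun ℝ I).constr ℝ t
    have hL (v : I → ℝ) : L v = ∑ i, v i • t i := by
      simp [L, Module.Basis.constr_apply_fintype]
    -- Anticommutation, including the case `i = j`, makes the square equal to its own negative.
    have hsq (v : I → ℝ) : L v * L v = 0 := by
      have h1 : L v * L v = -(L v * L v) := by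
        conv_lhs => rw [hL, Finset.sum_mul_sum]
        conv_rhs => rw [hL, Finset.sum_mul_sum, Finset.sum_comm, ← Finset.sum_neg_distrib]
        refine Finset.sum_congr rfl fun i _ ↦ ?_
        rw [← Finset.sum_neg_distrib]
        refine Finset.sum_congr rfl fun j _ ↦ ?_
        rw [smul_mul_smul_comm, smul_mul_smul_comm, ht i j, koszul_one, neg_smul, one_smul,
          smul_neg, mul_comm (v i)]
      have h2 : (2 : ℝ) • (L v * L v) = 0 := by
        rw [two_smul]
        nth_rewrite 1 [h1]
        exact neg_add_cancel _
      exact (smul_eq_zero_iff_right two_ne_zero).1 h2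
    refine ⟨ExteriorAlgebra.lift ℝ ⟨L, hsq⟩, fun i ↦ ?_⟩
    rw [ExteriorAlgebra.lift_ι_apply, hL]
    simp [Pi.single_apply]

theorem symmetricAlgebra_isFreeOn [DecidableEq I] :
    IsFreeOn.{u} (fun i ↦ SymmetricAlgebra.ι ℝ (I → ℝ) (Pi.single i (1 : ℝ))) (koszul 0) where
  adjoin_eq := by
    rw [eq_top_iff]
    intro x _
    induction x using SymmetricAlgebra.induction with
    | algebraMap r => exact Subalgebra.algebraMap_mem _ r
    | ι v =>
      rw [pi_eq_sum_single v, map_sum]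
      refine sum_mem fun i _ ↦ ?_
      rw [map_smul]
      exact Subalgebra.smul_mem _ (Algebra.subset_adjoin (Set.mem_range_self i)) _
    | mul a b ha hb => exact mul_mem (ha trivial) (hb trivial)
    | add a b ha hb => exact add_mem (ha trivial) (hb trivial)
  lift S _ _ t ht := by
    have hcomm : ∀ a ∈ Set.range t, ∀ b ∈ Set.range t, a * b = b * a := by
      rintro _ ⟨i, rfl⟩ _ ⟨j, rfl⟩
      rw [ht i j, koszul_zero, one_smul]
    -- The target need not be commutative, but the subalgebra generated by the `t i` is, and the
    -- symmetric algebra maps to it.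
    letI : CommRing (Algebra.adjoin ℝ (Set.range t)) := Algebra.adjoinCommRingOfComm ℝ hcomm
    let t' (i : I) : Algebra.adjoin ℝ (Set.range t) := ⟨t i, Algebra.subset_adjoin ⟨i, rfl⟩⟩
    let T : SymmetricAlgebra ℝ (I → ℝ) →ₐ[ℝ] Algebra.adjoin ℝ (Set.range t) :=
      SymmetricAlgebra.lift ((Pi.basisFun ℝ I).constr ℝ t')
    refine ⟨(Subalgebra.val _).comp T, fun i ↦ ?_⟩
    have : T (SymmetricAlgebra.ι ℝ (I → ℝ) (Pi.single i (1 : ℝ))) = t' i := by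
      rw [SymmetricAlgebra.lift_ι_apply, ← Pi.basisFun_apply, Module.Basis.constr_basis]
    rw [AlgHom.comp_apply, this]
    rfl

end Free

section Smooth

open TensorProduct

variable {n : ℕ} {C : Type*} [TopologicalSpace C]
  [ChartedSpace (EuclideanSpace ℝ (Fin n)) C]

variable (n C) in
/-- Smooth functions, as functions with scalar values in `P`. -/
def constCoeff (P : Type*) [Ring P] [Algebra ℝ P] :
    C^∞⟮𝓡 n, C; 𝓘(ℝ, ℝ), ℝ⟯ →ₐ[ℝ] (C → P) where
  toFun r x := algebraMap ℝ P (r x)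
  map_one' := by ext x; exact map_one _
  map_mul' r s := by ext x; exact map_mul _ _ _
  map_zero' := by ext x; exact map_zero _
  map_add' r s := by ext x; exact map_add _ _ _
  commutes' _ := rfl

variable (n C) in
/-- Smooth functions with coefficients in `P`, as functions with values in `P`. -/
def evalTensor (P : Type*) [Ring P] [Algebra ℝ P] :
    C^∞⟮𝓡 n, C; 𝓘(ℝ, ℝ), ℝ⟯ ⊗[ℝ] P →ₐ[ℝ] (C → P) :=
  Algebra.TensorProduct.lift (constCoeff n C P) (Pi.constAlgHom ℝ C P)
    (fun r p ↦ show Commute _ _ from funext fun _ ↦ Algebra.commutes _ _)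

variable {P : Type*} [Ring P] [Algebra ℝ P]

theorem evalTensor_tmul (r : C^∞⟮𝓡 n, C; 𝓘(ℝ, ℝ), ℝ⟯) (p : P) (x : C) :
    evalTensor n C P (r ⊗ₜ p) x = r x • p := by
  rw [Algebra.smul_def]
  exact congr_fun (Algebra.TensorProduct.lift_tmul (constCoeff n C P) (Pi.constAlgHom ℝ C P)
    _ r p) x

/-- In a basis of `P` the coefficients of a tensor are smooth functions, recovered pointwise from
its values. -/
theorem evalTensor_injective : Function.Injective (evalTensor n C P) := by
  classical
  rw [injective_iff_map_eq_zero]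
  intro z hz
  let b := Module.Basis.ofVectorSpace ℝ P
  obtain ⟨c, rfl⟩ := (TensorProduct.equivFinsuppOfBasisRight b).symm.surjective z
  suffices c = 0 by rw [this, map_zero]
  ext i x
  have hx := congr_fun hz x
  rw [TensorProduct.equivFinsuppOfBasisRight_symm_apply] at hx
  have h1 : b.repr (∑ j ∈ c.support, c j x • b j) i = 0 := by
    have : ∑ j ∈ c.support, c j x • b j = 0 := by
      refine Eq.trans ?_ hx
      rw [Finsupp.sum, map_sum, Finset.sum_apply]
      simp only [evalTensor_tmul]
    rw [this, map_zero, Finsupp.zero_apply]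
  simp only [map_sum, map_smul, Module.Basis.repr_self, Finsupp.smul_single, smul_eq_mul, mul_one,
    Finsupp.coe_finsetSum, Finset.sum_apply, Finsupp.single_apply] at h1
  rw [Finset.sum_ite_eq'] at h1
  by_cases hi : i ∈ c.support
  · rw [if_pos hi] at h1
    exact h1
  · rw [Finsupp.notMem_support_iff.1 hi]
    rfl

/-- The coordinates of a basis of `Q`, extended to `P`, give smooth coefficient functions. A single
finite-dimensional `Q` for all points is needed, since tensors have finitely many terms. -/
theorem mem_range_evalTensor {g : C → P} (hg : ∀ x, SmoothCoeffAt (n := n) g x)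
    (Q : Submodule ℝ P) [FiniteDimensional ℝ Q] (hQ : ∀ x, g x ∈ Q) :
    g ∈ (evalTensor n C P).range := by
  let b := Module.finBasis ℝ Q
  have hc (i) : ∃ L : P →ₗ[ℝ] ℝ, L ∘ₗ Q.subtype = b.coord i := LinearMap.exists_extend _
  choose L hL using hc
  have hsm (i) : ContMDiff (𝓡 n) 𝓘(ℝ, ℝ) ∞ fun x ↦ L i (g x) := by
    intro x
    obtain ⟨k, w, c, hc, e⟩ := (hg x).map (L i)
    refine (contMDiffAt_finsetSum fun j (_ : j ∈ Finset.univ) ↦ (hc j).mul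
      (contMDiffAt_const (c := w j))).congr_of_eventuallyEq e
  let c (i) : C^∞⟮𝓡 n, C; 𝓘(ℝ, ℝ), ℝ⟯ := ⟨_, hsm i⟩
  refine ⟨∑ i, c i ⊗ₜ[ℝ] (b i : P), ?_⟩
  ext x
  change evalTensor n C P _ x = _
  rw [map_sum, Finset.sum_apply]
  simp only [evalTensor_tmul]
  have h1 := congr_arg (Submodule.subtype Q) (b.sum_repr ⟨g x, hQ x⟩)
  rw [map_sum] at h1
  simp only [map_smul, Submodule.subtype_apply] at h1
  conv_rhs => rw [← h1]
  refine Finset.sum_congr rfl fun i _ ↦ ?_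
  congr 1
  exact LinearMap.congr_fun (hL i) ⟨g x, hQ x⟩

end Smooth

/-! ### Algebras of sections with a frame -/

section Model

open TensorProduct

variable {n : ℕ} {C : Type*} [TopologicalSpace C]
  [ChartedSpace (EuclideanSpace ℝ (Fin n)) C] {I : Type*} [Fintype I]

/-- The algebra `A` of sections of a bundle of algebras `W` is a retract of the algebra of smooth
functions with coefficients in the free algebra `P`. -/
structure SectionModel {P : Type*} [Ring P] [Algebra ℝ P] (ε : I → P)
    {A : Type u} [Ring A] [Algebra ℝ A] (f : C^∞⟮𝓡 n, C; 𝓘(ℝ, ℝ), ℝ⟯ →ₐ[ℝ] A) (g : I → A)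
    (q : Matrix I I C^∞⟮𝓡 n, C; 𝓘(ℝ, ℝ), ℝ⟯)
    (W : C → Type*) [∀ x, Ring (W x)] [∀ x, Algebra ℝ (W x)] where
  ev : ∀ x, A →ₐ[ℝ] W x
  ev_inj : ∀ a b, (∀ x, ev x a = ev x b) → a = b
  ev_f : ∀ x r, ev x (f r) = algebraMap ℝ (W x) (r x)
  incl : ∀ x, W x →ₐ[ℝ] P
  proj : ∀ x, P →ₐ[ℝ] W x
  proj_incl : ∀ x w, proj x (incl x w) = w
  ev_g : ∀ x i, ev x (g i) = proj x (ε i)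
  incl_g : ∀ x j, incl x (ev x (g j)) = ∑ i, q i j x • ε i
  smooth : ∀ a x, SmoothCoeffAt (n := n) (fun y ↦ incl y (ev y a)) x
  finite : ∀ a, ∃ Q : Submodule ℝ P, FiniteDimensional ℝ Q ∧ ∀ y, incl y (ev y a) ∈ Q

namespace SectionModel

variable {P : Type*} [Ring P] [Algebra ℝ P] {ε : I → P}
    {A : Type u} [Ring A] [Algebra ℝ A] {f : C^∞⟮𝓡 n, C; 𝓘(ℝ, ℝ), ℝ⟯ →ₐ[ℝ] A} {g : I → A}
    {q : Matrix I I C^∞⟮𝓡 n, C; 𝓘(ℝ, ℝ), ℝ⟯}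
    {W : C → Type*} [∀ x, Ring (W x)] [∀ x, Algebra ℝ (W x)]

/-- A section of `W`, included in the trivial bundle with fibre `P`, has smooth coefficients;
injectivity of the evaluation makes passing to them an algebra morphism. -/
theorem exists_coeff (M : SectionModel ε f g q W) : ∃ κ : A →ₐ[ℝ] C^∞⟮𝓡 n, C; 𝓘(ℝ, ℝ), ℝ⟯ ⊗[ℝ] P,
    ∀ a x, evalTensor n C P (κ a) x = M.incl x (M.ev x a) := by
  let j : A →ₐ[ℝ] (C → P) := Pi.algHom ℝ _ fun x ↦ (M.incl x).comp (M.ev x)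
  have hj (a : A) : j a ∈ (evalTensor n C P).range := by
    obtain ⟨Q, hQ, hQ'⟩ := M.finite a
    exact mem_range_evalTensor (M.smooth a) Q hQ'
  refine ⟨(AlgEquiv.ofInjective (evalTensor n C P) evalTensor_injective).symm.toAlgHom.comp
    (j.codRestrict _ hj), fun a x ↦ ?_⟩
  have := AlgEquiv.apply_symm_apply (AlgEquiv.ofInjective (evalTensor n C P) evalTensor_injective)
    (j.codRestrict _ hj a)
  exact congr_fun (congr_arg Subtype.val this) x

theorem f_comm (M : SectionModel ε f g q W) (r : C^∞⟮𝓡 n, C; 𝓘(ℝ, ℝ), ℝ⟯) (a : A) :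
    f r * a = a * f r := by
  refine M.ev_inj _ _ fun x ↦ ?_
  rw [map_mul, map_mul, M.ev_f, Algebra.commutes]

/-- The morphism is the composite of `κ` with the map `φ ⊗ T` on smooth functions with coefficients
in `P`. The factor `q` arises since `κ (g j) = ∑ q_ij ⊗ ε_i`. -/
theorem exists_lift (M : SectionModel ε f g q W) {s : ℝ} (hε : IsFreeOn.{u} ε s) (S : Type u)
    [Ring S] [Algebra ℝ S]
    (φ : C^∞⟮𝓡 n, C; 𝓘(ℝ, ℝ), ℝ⟯ →ₐ[ℝ] S) (t : I → S) (hφ : ∀ r i, φ r * t i = t i * φ r)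
    (ht : ∀ i j, t i * t j = s • (t j * t i)) :
    ∃ Λ : A →ₐ[ℝ] S, (∀ r, Λ (f r) = φ r) ∧ ∀ j, Λ (g j) = ∑ i, φ (q i j) * t i := by
  obtain ⟨κ, hκ⟩ := M.exists_coeff
  obtain ⟨T, hT⟩ := hε.lift S t ht
  have hcomm (r : C^∞⟮𝓡 n, C; 𝓘(ℝ, ℝ), ℝ⟯) (p : P) : Commute (φ r) (T p) := by
    have hp : p ∈ Algebra.adjoin ℝ (Set.range ε) := by rw [hε.adjoin_eq]; trivial
    induction hp using Algebra.adjoin_induction with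
    | mem x hx =>
      obtain ⟨i, rfl⟩ := hx
      rw [hT]
      exact hφ r i
    | algebraMap r => rw [AlgHom.commutes]; exact Algebra.commute_algebraMap_right _ _
    | add x y _ _ hx hy => rw [map_add]; exact hx.add_right hy
    | mul x y _ _ hx hy => rw [map_mul]; exact hx.mul_right hy
  have hκf (r) : κ (f r) = r ⊗ₜ 1 := by
    refine evalTensor_injective (funext fun x ↦ ?_)
    rw [hκ, M.ev_f, AlgHom.commutes, evalTensor_tmul, Algebra.algebraMap_eq_smul_one]
  have hκg (j) : κ (g j) = ∑ i, q i j ⊗ₜ ε i := by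
    refine evalTensor_injective (funext fun x ↦ ?_)
    rw [hκ, M.incl_g, map_sum, Finset.sum_apply]
    simp only [evalTensor_tmul]
  refine ⟨(Algebra.TensorProduct.lift φ T hcomm).comp κ, fun r ↦ ?_, fun j ↦ ?_⟩
  · rw [AlgHom.comp_apply, hκf, Algebra.TensorProduct.lift_tmul, map_one, mul_one]
  · rw [AlgHom.comp_apply, hκg, map_sum]
    simp only [Algebra.TensorProduct.lift_tmul, hT]

/-- The map `r ⊗ p ↦ f r * T p` is a left inverse of `κ`, as fibrewise `proj` is of `incl`, and it
takes values in the subalgebra generated by `f` and `g`. -/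
theorem adjoin_eq (M : SectionModel ε f g q W) {s : ℝ} (hε : IsFreeOn.{u} ε s)
    (hg : ∀ i j, g i * g j = s • (g j * g i)) :
    Algebra.adjoin ℝ (Set.range f ∪ Set.range g) = ⊤ := by
  obtain ⟨κ, hκ⟩ := M.exists_coeff
  obtain ⟨T, hT⟩ := hε.lift A g hg
  have hTp (x : C) (p : P) : M.ev x (T p) = M.proj x p := by
    have : (M.ev x).comp T = M.proj x := by
      refine AlgHom.ext_of_adjoin_eq_top hε.adjoin_eq ?_
      rintro _ ⟨i, rfl⟩
      rw [AlgHom.comp_apply, hT, M.ev_g]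
    exact AlgHom.congr_fun this p
  let Φ : C^∞⟮𝓡 n, C; 𝓘(ℝ, ℝ), ℝ⟯ ⊗[ℝ] P →ₐ[ℝ] A :=
    Algebra.TensorProduct.lift f T fun r p ↦ show Commute _ _ from M.f_comm r _
  have hΦt (r p) : Φ (r ⊗ₜ p) = f r * T p := Algebra.TensorProduct.lift_tmul _ _ _ _ _
  have hΦ (z) (x : C) : M.ev x (Φ z) = M.proj x (evalTensor n C P z x) := by
    induction z using TensorProduct.induction_on with
    | zero => simp only [map_zero, Pi.zero_apply]
    | tmul r p =>
      rw [hΦt, map_mul, M.ev_f, hTp, evalTensor_tmul, map_smul,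
        Algebra.smul_def]
    | add z z' h h' => rw [map_add, map_add, h, h', map_add, Pi.add_apply, map_add]
  have hmem (z) : Φ z ∈ Algebra.adjoin ℝ (Set.range f ∪ Set.range g) := by
    induction z using TensorProduct.induction_on with
    | zero => rw [map_zero]; exact zero_mem _
    | tmul r p =>
      rw [hΦt]
      refine mul_mem (Algebra.subset_adjoin (.inl ⟨r, rfl⟩)) ?_
      have h1 : (Algebra.adjoin ℝ (Set.range ε)).map T ≤
          Algebra.adjoin ℝ (Set.range f ∪ Set.range g) := by
        rw [AlgHom.map_adjoin]
        refine Algebra.adjoin_mono ?_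
        rintro _ ⟨_, ⟨i, rfl⟩, rfl⟩
        exact .inr ⟨i, (hT i).symm⟩
      refine h1 ⟨p, ?_, rfl⟩
      rw [hε.adjoin_eq]
      trivial
    | add z z' h h' => rw [map_add]; exact add_mem h h'
  rw [eq_top_iff]
  intro a _
  have : Φ (κ a) = a := M.ev_inj _ _ fun x ↦ by rw [hΦ, hκ, M.proj_incl]
  rw [← this]
  exact hmem _

theorem g_eq (M : SectionModel ε f g q W) (j : I) : g j = ∑ i, f (q i j) * g i := by
  refine M.ev_inj _ _ fun x ↦ ?_
  have h1 := congr_arg (M.proj x) (M.incl_g x j)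
  rw [M.proj_incl, map_sum] at h1
  rw [h1, map_sum]
  refine Finset.sum_congr rfl fun i _ ↦ ?_
  rw [map_smul, map_mul, M.ev_f, M.ev_g, Algebra.smul_def]

variable [T2Space C] [IsManifold (𝓡 n) ∞ C]

/-- Composing `D` with the evaluation at `x` gives a point derivation with values in the fibre `W
x`, determined by its values on the tangent frame functions. -/
theorem der_eq (M : SectionModel ε f g q W) {J : Type*} [Fintype J]
    {h : J → C^∞⟮𝓡 n, C; 𝓘(ℝ, ℝ), ℝ⟯}
    {ξ : J → Cₛ^∞⟮𝓡 n; EuclideanSpace ℝ (Fin n), (TangentSpace (𝓡 n) : C → Type _)⟯}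
    (hξ : ∀ x (v : TangentSpace (𝓡 n) x), ∑ j, mvfderiv (𝓡 n) (fun y ↦ h j y) x v • ξ j x = v)
    {𝒜 : ℤ → Submodule ℝ A} (hf : ∀ r, f r ∈ 𝒜 0) {d : ℤ} {D : A →ₗ[ℝ] A}
    (hD : D ∈ gradedDer 𝒜 d) (r : C^∞⟮𝓡 n, C; 𝓘(ℝ, ℝ), ℝ⟯) :
    D (f r) = ∑ j, D (f (h j)) * f (vectorFieldDerivation (ξ j) r) := by
  refine M.ev_inj _ _ fun x ↦ ?_
  have h1 := pointDerivation_eq_sum_frame hξ (x := x)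
    (δ := (M.ev x).toLinearMap ∘ₗ D ∘ₗ f.toLinearMap) (fun r s ↦ by
      change M.ev x (D (f (r * s))) = _ • M.ev x (D (f s)) + _ • M.ev x (D (f r))
      rw [map_mul, hD.2 0 _ (hf r), mul_zero, koszul_zero, one_smul, ← M.f_comm s, map_add, map_mul,
        map_mul, M.ev_f, M.ev_f, ← Algebra.smul_def, ← Algebra.smul_def, add_comm]) r
  refine h1.trans ?_
  rw [map_sum]
  refine Finset.sum_congr rfl fun j _ ↦ ?_
  rw [← M.f_comm, map_mul, M.ev_f, Algebra.smul_def]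
  rfl

/-- Sections of a bundle of algebras with a model are an algebra with a frame. -/
def frameAlgebra (M : SectionModel ε f g q W) {e : ℤ} (hε : IsFreeOn.{u} ε (koszul e))
    (hq : q * q = q) {J : Type*} [Fintype J]
    {h : J → C^∞⟮𝓡 n, C; 𝓘(ℝ, ℝ), ℝ⟯}
    {ξ : J → Cₛ^∞⟮𝓡 n; EuclideanSpace ℝ (Fin n), (TangentSpace (𝓡 n) : C → Type _)⟯}
    (hξ : ∀ x (v : TangentSpace (𝓡 n) x), ∑ j, mvfderiv (𝓡 n) (fun y ↦ h j y) x v • ξ j x = v)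
    {𝒜 : ℤ → Submodule ℝ A} (hf : ∀ r, f r ∈ 𝒜 0) (hg : ∀ i, g i ∈ 𝒜 e) (hA : IsGradedComm 𝒜)
    (hgg : ∀ i j, g i * g j = koszul e • (g j * g i)) :
    FrameAlgebra 𝒜 e q (fun j ↦ vectorFieldDerivation (ξ j)) h where
  f := f
  g := g
  f_mem := hf
  g_mem := hg
  g_eq := M.g_eq
  q_mul := hq
  adjoin_eq := M.adjoin_eq hε hgg
  comm := hA
  lift S _ _ φ t := M.exists_lift hε S φ t
  der_eq _ _ hD := M.der_eq hξ hf hD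

end SectionModel

end Model

end

/-! ### The two algebras of sections as retracts over trivial bundles -/

noncomputable section

section

variable {n : ℕ} {C : Type*} [TopologicalSpace C] [ChartedSpace (EuclideanSpace ℝ (Fin n)) C]

namespace SmoothCoeffAt

variable {W : Type*} [AddCommGroup W] [Module ℝ W] {g : C → W} {x₀ : C}

theorem smul {c : C → ℝ} (hc : ContMDiffAt (𝓡 n) 𝓘(ℝ, ℝ) ∞ c x₀)
    (h : SmoothCoeffAt (n := n) g x₀) : SmoothCoeffAt (n := n) (fun y ↦ c y • g y) x₀ := by
  obtain ⟨k, w, d, hd, e⟩ := h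
  refine ⟨k, w, fun i y ↦ c y * d i y, fun i ↦ hc.mul (hd i), ?_⟩
  filter_upwards [e] with y hy
  simp only [hy, Finset.smul_sum, smul_smul]

theorem contMDiffAt {c : C → ℝ} (h : SmoothCoeffAt (n := n) c x₀) :
    ContMDiffAt (𝓡 n) 𝓘(ℝ, ℝ) ∞ c x₀ := by
  obtain ⟨k, w, d, hd, e⟩ := h
  exact (contMDiffAt_finsetSum fun j (_ : j ∈ Finset.univ) ↦ (hd j).mul
    (contMDiffAt_const (c := w j))).congr_of_eventuallyEq e

theorem linearMap_apply {W' : Type*} [AddCommGroup W'] [Module ℝ W'] {T : C → W →ₗ[ℝ] W'}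
    (hT : ∀ w, SmoothCoeffAt (n := n) (fun y ↦ T y w) x₀) (h : SmoothCoeffAt (n := n) g x₀) :
    SmoothCoeffAt (n := n) (fun y ↦ T y (g y)) x₀ := by
  obtain ⟨k, w, c, hc, e⟩ := h
  refine (SmoothCoeffAt.sum Finset.univ fun i _ ↦ (hT (w i)).smul (hc i)).congr ?_
  filter_upwards [e] with y hy
  simp only [hy, map_sum, map_smul]

theorem pi {I : Type*} [Fintype I] {g : C → I → ℝ}
    (h : ∀ i, ContMDiffAt (𝓡 n) 𝓘(ℝ, ℝ) ∞ (fun y ↦ g y i) x₀) : SmoothCoeffAt (n := n) g x₀ := by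
  classical
  exact (SmoothCoeffAt.sum Finset.univ fun i _ ↦
    const_smul_fun (Pi.single i (1 : ℝ) : I → ℝ) (h i)).congr
      (Filter.Eventually.of_forall fun y ↦ pi_eq_sum_single _)

theorem exteriorAlgebra_map {V V' : Type*} [AddCommGroup V] [Module ℝ V] [AddCommGroup V']
    [Module ℝ V'] {T : C → V →ₗ[ℝ] V'} (hT : ∀ v, SmoothCoeffAt (n := n) (fun y ↦ T y v) x₀)
    (w : ExteriorAlgebra ℝ V) :
    SmoothCoeffAt (n := n) (fun y ↦ ExteriorAlgebra.map (T y) w) x₀ := by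
  induction w using ExteriorAlgebra.induction with
  | algebraMap r =>
    simp only [Algebra.algebraMap_eq_smul_one, map_smul, map_one]
    exact const_smul_fun (n := n) (f := fun _ : C ↦ r) (1 : ExteriorAlgebra ℝ V')
      contMDiffAt_const
  | ι v => simpa using (hT v).map (ExteriorAlgebra.ι ℝ)
  | mul a b ha hb => simpa using ha.mul hb
  | add a b ha hb => simpa using ha.add hb

theorem symmetricAlgebra_lift {V V' : Type*} [AddCommGroup V] [Module ℝ V] [AddCommGroup V']
    [Module ℝ V'] {T : C → V →ₗ[ℝ] V'} (hT : ∀ v, SmoothCoeffAt (n := n) (fun y ↦ T y v) x₀)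
    (w : SymmetricAlgebra ℝ V) :
    SmoothCoeffAt (n := n)
      (fun y ↦ SymmetricAlgebra.lift (SymmetricAlgebra.ι ℝ V' ∘ₗ T y) w) x₀ := by
  induction w using SymmetricAlgebra.induction with
  | algebraMap r =>
    simp only [Algebra.algebraMap_eq_smul_one, map_smul, map_one]
    exact const_smul_fun (n := n) (f := fun _ : C ↦ r) (1 : SymmetricAlgebra ℝ V')
      contMDiffAt_const
  | ι v => simpa using (hT v).map (SymmetricAlgebra.ι ℝ V')
  | mul a b ha hb => simpa using ha.mul hb
  | add a b ha hb => simpa using ha.add hb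

end SmoothCoeffAt

theorem symDegreeLE_map {V V' : Type*} [AddCommGroup V] [Module ℝ V] [AddCommGroup V']
    [Module ℝ V'] (T : V →ₗ[ℝ] V') {d : ℕ} {w : SymmetricAlgebra ℝ V} (hw : w ∈ symDegreeLE V d) :
    SymmetricAlgebra.lift (SymmetricAlgebra.ι ℝ V' ∘ₗ T) w ∈ symDegreeLE V' d := by
  have h : (symDegreeLE V d).map
      (SymmetricAlgebra.lift (SymmetricAlgebra.ι ℝ V' ∘ₗ T)).toLinearMap ≤ symDegreeLE V' d := by
    rw [symDegreeLE, symDegreeLE, Submodule.map_pow, Submodule.map_sup, Submodule.map_one]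
    refine pow_le_pow_left' ?_ d
    refine sup_le_sup_left ?_ _
    rintro _ ⟨_, ⟨v, rfl⟩, rfl⟩
    exact ⟨T v, (SymmetricAlgebra.lift_ι_apply (SymmetricAlgebra.ι ℝ V' ∘ₗ T) v).symm⟩
  exact h ⟨w, hw, rfl⟩

theorem finiteDimensional_symDegreeLE (V : Type*) [AddCommGroup V] [Module ℝ V]
    [FiniteDimensional ℝ V] (d : ℕ) : FiniteDimensional ℝ (symDegreeLE V d) := by
  refine Module.Finite.iff_fg.2 (Submodule.FG.pow (Submodule.FG.sup ?_ ?_) d)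
  · rw [Submodule.one_eq_span]
    exact Submodule.fg_span_singleton 1
  · rw [LinearMap.range_eq_map]
    exact Module.Finite.fg_top.map _

theorem finiteDimensional_exteriorAlgebra (N : ℕ) :
    FiniteDimensional ℝ (ExteriorAlgebra ℝ (Fin N → ℝ)) :=
  Module.Finite.of_basis (Pi.basisFun ℝ (Fin N)).ExteriorAlgebra

end

section Frame

variable {n : ℕ} {C : Type*} [TopologicalSpace C] [T2Space C] [SigmaCompactSpace C]
    [ChartedSpace (EuclideanSpace ℝ (Fin n)) C] [IsManifold (𝓡 n) ∞ C]
    {F : Type*} [NormedAddCommGroup F] [NormedSpace ℝ F] [FiniteDimensional ℝ F]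
    {E : C → Type*} [∀ x, AddCommGroup (E x)] [∀ x, Module ℝ (E x)]
    [∀ x, TopologicalSpace (E x)] [TopologicalSpace (Bundle.TotalSpace F E)]
    [FiberBundle F E] [VectorBundle ℝ F E]

@[ext] theorem DualSection.ext {ψ ψ' : DualSection n F E} (h : ∀ x v, ψ.toFun x v = ψ'.toFun x v) :
    ψ = ψ' := by
  cases ψ; cases ψ'
  congr
  funext x
  exact LinearMap.ext (h x)

variable (n F E) in
/-- `extOfFun` as a morphism of algebras. -/
def extOfFunHom : C^∞⟮𝓡 n, C; 𝓘(ℝ, ℝ), ℝ⟯ →ₐ[ℝ] extSections n F E where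
  toFun := extOfFun n
  map_one' := Subtype.ext (funext fun _ ↦ map_one _)
  map_mul' _ _ := Subtype.ext (funext fun _ ↦ map_mul _ _ _)
  map_zero' := Subtype.ext (funext fun _ ↦ map_zero _)
  map_add' _ _ := Subtype.ext (funext fun _ ↦ map_add _ _ _)
  commutes' _ := rfl

variable (n F E) in
/-- `symOfFun` as a morphism of algebras. -/
def symOfFunHom : C^∞⟮𝓡 n, C; 𝓘(ℝ, ℝ), ℝ⟯ →ₐ[ℝ] symSections n F E where
  toFun := symOfFun n
  map_one' := Subtype.ext (funext fun _ ↦ map_one _)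
  map_mul' _ _ := Subtype.ext (funext fun _ ↦ map_mul _ _ _)
  map_zero' := Subtype.ext (funext fun _ ↦ map_zero _)
  map_add' _ _ := Subtype.ext (funext fun _ ↦ map_add _ _ _)
  commutes' _ := rfl

variable [ContMDiffVectorBundle ∞ F E (𝓡 n)]

/-- The function `⟨ψ, θ⟩`. -/
def dualPairing (ψ : DualSection n F E) (θ : Cₛ^∞⟮𝓡 n; F, E⟯) : C^∞⟮𝓡 n, C; 𝓘(ℝ, ℝ), ℝ⟯ :=
  ⟨fun x ↦ ψ.toFun x (θ x), fun x ↦ contMDiffAt_dual_apply (ψ.smooth x) (θ.contMDiff x)⟩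

variable {N : ℕ} (θ : Fin N → Cₛ^∞⟮𝓡 n; F, E⟯) (ψ : Fin N → DualSection n F E)

/-- The Gram matrix of the frames `θ` and `ψ`. -/
def pairingMatrix : Matrix (Fin N) (Fin N) C^∞⟮𝓡 n, C; 𝓘(ℝ, ℝ), ℝ⟯ :=
  fun i j ↦ dualPairing (ψ i) (θ j)

variable {θ ψ}

theorem dual_eq_sum (hfr : ∀ x v, ∑ i, (ψ i).toFun x v • θ i x = v) (x : C)
    (φ : Module.Dual ℝ (E x)) : ∑ i, φ (θ i x) • (ψ i).toFun x = φ := by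
  ext v
  conv_rhs => rw [← hfr x v]
  simp [mul_comm]

/-- Apply `ψ i` to the frame expansion of `θ j`. -/
theorem pairingMatrix_mul_self (hfr : ∀ x v, ∑ i, (ψ i).toFun x v • θ i x = v) :
    pairingMatrix θ ψ * pairingMatrix θ ψ = pairingMatrix θ ψ := by
  ext i j x
  have h := congr_arg ((ψ i).toFun x) (hfr x (θ j x))
  rw [map_sum] at h
  simp only [map_smul, smul_eq_mul] at h
  rw [Matrix.mul_apply]
  have h1 : (∑ k, pairingMatrix θ ψ i k * pairingMatrix θ ψ k j : C^∞⟮𝓡 n, C; 𝓘(ℝ, ℝ), ℝ⟯) x =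
      ∑ k, (ψ i).toFun x (θ k x) * (ψ k).toFun x (θ j x) :=
    map_sum (ContMDiffMap.evalRingHom x) _ _
  rw [h1]
  refine Eq.trans ?_ h
  exact Finset.sum_congr rfl fun k _ ↦ mul_comm _ _

/-- Sections of `⋀E` as a retract of the functions with values in the exterior algebra of `ℝ^N`. -/
def extModel (hfr : ∀ x v, ∑ i, (ψ i).toFun x v • θ i x = v) :
    SectionModel (fun i ↦ ExteriorAlgebra.ι ℝ (Pi.single i (1 : ℝ) : Fin N → ℝ))
      (extOfFunHom n F E) (fun i ↦ extOfSection n (θ i)) (pairingMatrix θ ψ)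
      (fun x ↦ ExteriorAlgebra ℝ (E x)) where
  ev x := (Pi.evalAlgHom ℝ _ x).comp (Subalgebra.val _)
  ev_inj a b h := Subtype.ext (funext h)
  ev_f x r := rfl
  incl x := ExteriorAlgebra.map (LinearMap.pi fun i ↦ (ψ i).toFun x)
  proj x := ExteriorAlgebra.map (Fintype.linearCombination ℝ fun i ↦ θ i x)
  proj_incl x w := by
    rw [← AlgHom.comp_apply, ExteriorAlgebra.map_comp_map]
    have : (Fintype.linearCombination ℝ fun i ↦ θ i x) ∘ₗ (LinearMap.pi fun i ↦ (ψ i).toFun x) =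
        LinearMap.id := by
      ext v
      simpa [Fintype.linearCombination_apply] using hfr x v
    rw [this, ExteriorAlgebra.map_id, AlgHom.id_apply]
  ev_g x i := by
    rw [ExteriorAlgebra.map_apply_ι, Fintype.linearCombination_apply_single, one_smul]
    rfl
  incl_g x j := by
    have : (extOfSection n (θ j)).1 x = ExteriorAlgebra.ι ℝ (θ j x) := rfl
    refine (ExteriorAlgebra.map_apply_ι _ _).trans ?_
    rw [pi_eq_sum_single (LinearMap.pi (fun i ↦ (ψ i).toFun x) (θ j x)), map_sum]
    simp only [map_smul]
    rfl
  smooth a x := by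
    have hT (v : F) : SmoothCoeffAt (n := n) (fun y ↦ ((LinearMap.pi fun i ↦ (ψ i).toFun y) ∘ₗ
        (trivializationAt F E x).symmₗ ℝ y) v) x :=
      SmoothCoeffAt.pi fun i ↦ (((ψ i).smooth x).map (LinearMap.applyₗ v)).contMDiffAt
    -- Near `x` the inclusion factors through the local trivialization, in which `a` is smooth by
    -- definition; the remaining factor is a smooth family of maps between fixed spaces.
    refine (SmoothCoeffAt.linearMap_apply (T := fun y ↦ (ExteriorAlgebra.map
      ((LinearMap.pi fun i ↦ (ψ i).toFun y) ∘ₗ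
        (trivializationAt F E x).symmₗ ℝ y)).toLinearMap)
      (SmoothCoeffAt.exteriorAlgebra_map hT) (a.2 x)).congr ?_
    filter_upwards [(trivializationAt F E x).open_baseSet.mem_nhds
      (FiberBundle.mem_baseSet_trivializationAt F E x)] with y hy
    rw [AlgHom.toLinearMap_apply, extTriv, ← AlgHom.comp_apply (ExteriorAlgebra.map _) (ExteriorAlgebra.map _),
      ExteriorAlgebra.map_comp_map, LinearMap.comp_assoc]
    have : (trivializationAt F E x).symmₗ ℝ y ∘ₗ (trivializationAt F E x).linearMapAt ℝ y =
        LinearMap.id :=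
      LinearMap.ext fun v ↦ (trivializationAt F E x).symmₗ_linearMapAt hy v
    rw [this, LinearMap.comp_id]
    rfl
  finite a := ⟨⊤, by
    have := finiteDimensional_exteriorAlgebra N
    infer_instance, fun _ ↦ trivial⟩

/-- Sections of `S(E*)` as a retract of the functions with values in the symmetric algebra
of `ℝ^N`. -/
def symModel (hfr : ∀ x v, ∑ i, (ψ i).toFun x v • θ i x = v) :
    SectionModel (fun i ↦ SymmetricAlgebra.ι ℝ (Fin N → ℝ) (Pi.single i (1 : ℝ)))
      (symOfFunHom n F E) (fun i ↦ symOfDual n (ψ i)) (pairingMatrix θ ψ).transpose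
      (fun x ↦ SymmetricAlgebra ℝ (Module.Dual ℝ (E x))) where
  ev x := (Pi.evalAlgHom ℝ _ x).comp (Subalgebra.val _)
  ev_inj a b h := Subtype.ext (funext h)
  ev_f x r := rfl
  incl x := SymmetricAlgebra.lift (SymmetricAlgebra.ι ℝ _ ∘ₗ
    LinearMap.pi fun i ↦ LinearMap.applyₗ (θ i x))
  proj x := SymmetricAlgebra.lift (SymmetricAlgebra.ι ℝ _ ∘ₗ
    Fintype.linearCombination ℝ fun i ↦ (ψ i).toFun x)
  proj_incl x w := by
    rw [← AlgHom.comp_apply]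
    conv_rhs => rw [← AlgHom.id_apply (R := ℝ) w]
    congr 1
    refine SymmetricAlgebra.algHom_ext (LinearMap.ext fun φ ↦ ?_)
    change SymmetricAlgebra.lift _ (SymmetricAlgebra.lift _ (SymmetricAlgebra.ι ℝ _ φ)) =
      SymmetricAlgebra.ι ℝ _ φ
    rw [SymmetricAlgebra.lift_ι_apply, LinearMap.comp_apply, SymmetricAlgebra.lift_ι_apply]
    exact congr_arg (SymmetricAlgebra.ι ℝ _) (dual_eq_sum hfr x φ)
  ev_g x i := by
    rw [SymmetricAlgebra.lift_ι_apply, LinearMap.comp_apply,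
      Fintype.linearCombination_apply_single, one_smul]
    rfl
  incl_g x j := by
    refine (SymmetricAlgebra.lift_ι_apply _ _).trans ?_
    rw [LinearMap.comp_apply,
      pi_eq_sum_single (LinearMap.pi (fun i ↦ LinearMap.applyₗ (θ i x)) ((ψ j).toFun x)), map_sum]
    simp only [map_smul]
    rfl
  smooth a x := by
    let t := trivializationAt F E x
    have hT (φ : Module.Dual ℝ F) : SmoothCoeffAt (n := n)
        (fun y ↦ ((LinearMap.pi fun i ↦ LinearMap.applyₗ (θ i y)) ∘ₗ (t.linearMapAt ℝ y).dualMap) φ)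
          x :=
      SmoothCoeffAt.pi fun i ↦ (LinearMap.toContinuousLinearMap φ).contMDiff.contMDiffAt.comp x
        (contMDiffAt_linearMapAt_section (FiberBundle.mem_baseSet_trivializationAt F E x)
          ((θ i).contMDiff x))
    refine (SmoothCoeffAt.linearMap_apply (T := fun y ↦ (SymmetricAlgebra.lift
      (SymmetricAlgebra.ι ℝ _ ∘ₗ (LinearMap.pi fun i ↦ LinearMap.applyₗ (θ i y)) ∘ₗ
        (t.linearMapAt ℝ y).dualMap)).toLinearMap)
      (SmoothCoeffAt.symmetricAlgebra_lift hT) (a.2.1 x)).congr ?_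
    filter_upwards [t.open_baseSet.mem_nhds
      (FiberBundle.mem_baseSet_trivializationAt F E x)] with y hy
    rw [AlgHom.toLinearMap_apply, symTriv, ← AlgHom.comp_apply (SymmetricAlgebra.lift _)
      (SymmetricAlgebra.lift _)]
    refine AlgHom.congr_fun (φ₁ := SymmetricAlgebra.lift _) ?_ (a.1 y)
    refine SymmetricAlgebra.algHom_ext (LinearMap.ext fun φ ↦ ?_)
    change SymmetricAlgebra.lift _ (SymmetricAlgebra.ι ℝ _ φ) =
      SymmetricAlgebra.lift _ (SymmetricAlgebra.lift _ (SymmetricAlgebra.ι ℝ _ φ))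
    rw [SymmetricAlgebra.lift_ι_apply, SymmetricAlgebra.lift_ι_apply, LinearMap.comp_apply,
      LinearMap.comp_apply, SymmetricAlgebra.lift_ι_apply]
    refine congr_arg (SymmetricAlgebra.ι ℝ _) (funext fun i ↦ ?_)
    exact congr_arg φ (t.symmₗ_linearMapAt hy (θ i y)).symm
  -- The bound on the fibre degree places all values in one finite-dimensional space.
  finite a := by
    obtain ⟨d, hd⟩ := a.2.2
    exact ⟨symDegreeLE _ d, finiteDimensional_symDegreeLE _ d, fun y ↦ symDegreeLE_map _ (hd y)⟩

end Frame

end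

/-! ### Gradings and frames of the two algebras of sections -/

noncomputable section

section Grading

variable {n : ℕ} {C : Type*} [TopologicalSpace C]
    [ChartedSpace (EuclideanSpace ℝ (Fin n)) C]
    {F : Type*} [NormedAddCommGroup F] [NormedSpace ℝ F]
    {E : C → Type*} [∀ x, AddCommGroup (E x)] [∀ x, Module ℝ (E x)]
    [∀ x, TopologicalSpace (E x)] [TopologicalSpace (Bundle.TotalSpace F E)]
    [FiberBundle F E] [VectorBundle ℝ F E]

variable (n F E) in
theorem extGrade_gradedMonoid : SetLike.GradedMonoid (extGrade n F E) where
  one_mem x := SetLike.GradedOne.one_mem (A := fun i : ℕ ↦ ⋀[ℝ]^i (E x))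
  mul_mem := by
    rintro (i | i) (j | j) a b ha hb
    · exact fun x ↦ SetLike.GradedMul.mul_mem (A := fun i : ℕ ↦ ⋀[ℝ]^i (E x)) (ha x) (hb x)
    · rw [(Submodule.mem_bot ℝ).1 hb, mul_zero]; exact zero_mem _
    · rw [(Submodule.mem_bot ℝ).1 ha, zero_mul]; exact zero_mem _
    · rw [(Submodule.mem_bot ℝ).1 ha, zero_mul]; exact zero_mem _

theorem extGrade_iSupIndep : iSupIndep (extGrade n F E) := by
  intro i
  rw [Submodule.disjoint_def]
  intro a ha hb
  match i with
  | .negSucc i => exact (Submodule.mem_bot ℝ).1 ha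
  | .ofNat i =>
    refine Subtype.ext (funext fun x ↦ ?_)
    let p := (GradedAlgebra.proj (fun i : ℕ ↦ ⋀[ℝ]^i (E x)) i) ∘ₗ
      ((Pi.evalAlgHom ℝ _ x).comp (extSections n F E).val).toLinearMap
    have hp : ⨆ j, ⨆ (_ : j ≠ Int.ofNat i), extGrade n F E j ≤ LinearMap.ker p := by
      refine iSup₂_le fun j hj b hb ↦ ?_
      match j with
      | .negSucc j => rw [(Submodule.mem_bot ℝ).1 hb]; exact zero_mem _
      | .ofNat j =>
        exact DirectSum.decompose_of_mem_ne (fun i : ℕ ↦ ⋀[ℝ]^i (E x)) (hb x)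
          (fun h ↦ hj (congr_arg _ h))
    have h1 : p a = 0 := hp hb
    exact (DirectSum.decompose_of_mem_same (fun i : ℕ ↦ ⋀[ℝ]^i (E x)) (ha x)).symm.trans h1

theorem extOfFun_mem (r : C^∞⟮𝓡 n, C; 𝓘(ℝ, ℝ), ℝ⟯) :
    (extOfFun n r : extSections n F E) ∈ extGrade n F E 0 := fun x ↦ by
  have := SetLike.algebraMap_mem_graded (fun i : ℕ ↦ ⋀[ℝ]^i (E x)) (r x)
  exact this

theorem extOfSection_mem [FiniteDimensional ℝ F] (θ : Cₛ^∞⟮𝓡 n; F, E⟯) :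
    extOfSection n θ ∈ extGrade n F E 1 := fun x ↦ by
  change ExteriorAlgebra.ι ℝ (θ x) ∈ LinearMap.range (ExteriorAlgebra.ι ℝ) ^ 1
  rw [pow_one]
  exact ⟨_, rfl⟩

theorem isInternal_of_adjoin_eq_top {A : Type*} [Ring A] [Algebra ℝ A] {𝒜 : ℤ → Submodule ℝ A}
    [SetLike.GradedMonoid 𝒜] (hind : iSupIndep 𝒜) {X : Set A} (hX : ∀ x ∈ X, ∃ k, x ∈ 𝒜 k)
    (hadj : Algebra.adjoin ℝ X = ⊤) : DirectSum.IsInternal 𝒜 := by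
  refine (DirectSum.isInternal_submodule_iff_iSupIndep_and_iSup_eq_top 𝒜).2 ⟨hind, ?_⟩
  rw [eq_top_iff]
  intro a _
  have ha : a ∈ Algebra.adjoin ℝ X := by rw [hadj]; trivial
  induction ha using Algebra.adjoin_induction with
  | mem x hx =>
    obtain ⟨k, hk⟩ := hX x hx
    exact Submodule.mem_iSup_of_mem k hk
  | algebraMap r => exact Submodule.mem_iSup_of_mem 0 (SetLike.algebraMap_mem_graded 𝒜 r)
  | add x y _ _ hx hy => exact add_mem (hx trivial) (hy trivial)
  | mul x y _ _ hx hy =>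
    refine Submodule.iSup_induction 𝒜 (motive := fun x ↦ x * y ∈ iSup 𝒜) (hx trivial)
      (fun i x hx ↦ ?_) (by rw [zero_mul]; exact zero_mem _)
      fun x x' h h' ↦ by rw [add_mul]; exact add_mem h h'
    refine Submodule.iSup_induction 𝒜 (motive := fun y ↦ x * y ∈ iSup 𝒜) (hy trivial)
      (fun j y hy ↦ Submodule.mem_iSup_of_mem (i + j) (SetLike.mul_mem_graded hx hy))
      (by rw [mul_zero]; exact zero_mem _)
      fun x x' h h' ↦ by rw [mul_add]; exact add_mem h h'

variable (n F E) in
theorem symGrade_gradedMonoid : SetLike.GradedMonoid (symGrade n F E) where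
  one_mem := by simp [symGrade]
  mul_mem i j a b ha hb := by
    simp only [symGrade] at ha hb ⊢
    split_ifs at ha hb ⊢ <;> simp_all

variable (n F E) in
theorem symGrade_isInternal : DirectSum.IsInternal (symGrade n F E) := by
  refine (DirectSum.isInternal_submodule_iff_iSupIndep_and_iSup_eq_top _).2 ⟨fun i ↦ ?_, ?_⟩
  · by_cases hi : i = 0
    · have : ⨆ j, ⨆ (_ : j ≠ i), symGrade n F E j = ⊥ := by
        refine le_bot_iff.1 (iSup₂_le fun j hj ↦ ?_)
        rw [symGrade, if_neg (hi ▸ hj)]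
      rw [this]
      exact disjoint_bot_right
    · rw [symGrade, if_neg hi]
      exact disjoint_bot_left
  · refine eq_top_iff.2 (le_trans ?_ (le_iSup _ 0))
    rw [symGrade, if_pos rfl]

variable (n F E) in
theorem symGrade_isGradedComm : IsGradedComm (symGrade n F E) := by
  intro i j a ha b hb
  by_cases hi : i = 0
  · subst hi
    rw [zero_mul, koszul_zero, one_smul]
    exact Subtype.ext (funext fun x ↦ mul_comm (a.1 x) (b.1 x))
  · rw [symGrade, if_neg hi] at ha
    rw [(Submodule.mem_bot ℝ).1 ha, zero_mul, mul_zero, smul_zero]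

theorem mem_symGrade_zero (b : symSections n F E) : b ∈ symGrade n F E 0 := by
  rw [symGrade, if_pos rfl]; trivial

end Grading

section Frame

variable {n : ℕ} {C : Type*} [TopologicalSpace C] [T2Space C] [SigmaCompactSpace C]
    [ChartedSpace (EuclideanSpace ℝ (Fin n)) C] [IsManifold (𝓡 n) ∞ C]
    {F : Type*} [NormedAddCommGroup F] [NormedSpace ℝ F] [FiniteDimensional ℝ F]
    {E : C → Type*} [∀ x, AddCommGroup (E x)] [∀ x, Module ℝ (E x)]
    [∀ x, TopologicalSpace (E x)] [TopologicalSpace (Bundle.TotalSpace F E)]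
    [FiberBundle F E] [VectorBundle ℝ F E]

theorem extOfSection_mul (θ θ' : Cₛ^∞⟮𝓡 n; F, E⟯) :
    extOfSection n θ * extOfSection n θ' =
      koszul 1 • (extOfSection n θ' * extOfSection n θ) := by
  rw [koszul_one, neg_smul, one_smul]
  refine Subtype.ext (funext fun x ↦ ?_)
  have := ExteriorAlgebra.ι_add_mul_swap (R := ℝ) (θ x) (θ' x)
  exact eq_neg_of_add_eq_zero_left this

variable [ContMDiffVectorBundle ∞ F E (𝓡 n)] {N : ℕ} {θ : Fin N → Cₛ^∞⟮𝓡 n; F, E⟯}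
  {ψ : Fin N → DualSection n F E}

theorem extSections_adjoin_eq (hfr : ∀ x v, ∑ i, (ψ i).toFun x v • θ i x = v) :
    Algebra.adjoin ℝ (Set.range (extOfFunHom n F E) ∪ Set.range fun i ↦ extOfSection n (θ i)) = ⊤ :=
  (extModel hfr).adjoin_eq exteriorAlgebra_isFreeOn fun i j ↦ extOfSection_mul (θ i) (θ j)

variable (n F E) in
-- The sum of the graded pieces is a subalgebra containing the generators of a frame, hence
-- everything; smoothness of the components of a section need not be checked.
theorem extGrade_isInternal : DirectSum.IsInternal (extGrade n F E) := by
  obtain ⟨N, θ, ψ, hfr⟩ := exists_finite_frame (n := n) F E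
  have := extGrade_gradedMonoid n F E
  refine isInternal_of_adjoin_eq_top extGrade_iSupIndep ?_ (extSections_adjoin_eq hfr)
  rintro _ (⟨r, rfl⟩ | ⟨i, rfl⟩)
  exacts [⟨0, extOfFun_mem r⟩, ⟨1, extOfSection_mem (θ i)⟩]

variable (n F E) in
/-- The grading of `Γ(C, ⋀E)`. -/
instance extGradedAlgebra : GradedAlgebra (extGrade n F E) :=
  { extGrade_gradedMonoid n F E, (extGrade_isInternal n F E).chooseDecomposition with }

variable (n F E) in
/-- The grading of `Γ(C, S(E*))`. -/
instance symGradedAlgebra : GradedAlgebra (symGrade n F E) :=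
  { symGrade_gradedMonoid n F E, (symGrade_isInternal n F E).chooseDecomposition with }

variable (n F E) in
theorem extGrade_isGradedComm : IsGradedComm (extGrade n F E) := by
  obtain ⟨N, θ, ψ, hfr⟩ := exists_finite_frame (n := n) F E
  have hc (r : C^∞⟮𝓡 n, C; 𝓘(ℝ, ℝ), ℝ⟯) (a) : extOfFunHom n F E r * a = a * extOfFunHom n F E r :=
    (extModel hfr).f_comm r a
  refine isGradedComm_of_generators _ (X := fun k ↦
    {x | (k = 0 ∧ x ∈ Set.range (extOfFunHom n F E)) ∨
      (k = 1 ∧ x ∈ Set.range fun i ↦ extOfSection n (θ i))}) ?_ ?_ ?_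
  · rintro k _ (⟨rfl, r, rfl⟩ | ⟨rfl, i, rfl⟩)
    exacts [extOfFun_mem r, extOfSection_mem (θ i)]
  · rw [eq_top_iff, ← extSections_adjoin_eq hfr]
    refine Algebra.adjoin_mono ?_
    rintro x (hx | hx)
    exacts [Set.mem_iUnion.2 ⟨0, .inl ⟨rfl, hx⟩⟩, Set.mem_iUnion.2 ⟨1, .inr ⟨rfl, hx⟩⟩]
  · rintro k l _ (⟨rfl, r, rfl⟩ | ⟨rfl, i, rfl⟩) _ (⟨rfl, s, rfl⟩ | ⟨rfl, j, rfl⟩)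
    · rw [zero_mul, koszul_zero, one_smul, hc]
    · rw [zero_mul, koszul_zero, one_smul, hc]
    · rw [mul_zero, koszul_zero, one_smul, hc]
    · rw [mul_one, extOfSection_mul]

variable {J : Type*} [Fintype J] {h : J → C^∞⟮𝓡 n, C; 𝓘(ℝ, ℝ), ℝ⟯}
    {ξ : J → Cₛ^∞⟮𝓡 n; EuclideanSpace ℝ (Fin n), (TangentSpace (𝓡 n) : C → Type _)⟯}

/-- The algebra `Γ(C, ⋀E)` with a frame. -/
def extFrame (hfr : ∀ x v, ∑ i, (ψ i).toFun x v • θ i x = v)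
    (hξ : ∀ x (v : TangentSpace (𝓡 n) x), ∑ j, mvfderiv (𝓡 n) (fun y ↦ h j y) x v • ξ j x = v) :
    FrameAlgebra (extGrade n F E) 1 (pairingMatrix θ ψ) (fun j ↦ vectorFieldDerivation (ξ j)) h :=
  (extModel hfr).frameAlgebra exteriorAlgebra_isFreeOn (pairingMatrix_mul_self hfr)
    hξ extOfFun_mem (fun i ↦ extOfSection_mem (θ i))
    (extGrade_isGradedComm n F E) fun i j ↦ extOfSection_mul (θ i) (θ j)

/-- The algebra `Γ(C, S(E*))` with a frame. -/
def symFrame (hfr : ∀ x v, ∑ i, (ψ i).toFun x v • θ i x = v)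
    (hξ : ∀ x (v : TangentSpace (𝓡 n) x), ∑ j, mvfderiv (𝓡 n) (fun y ↦ h j y) x v • ξ j x = v) :
    FrameAlgebra (symGrade n F E) 0 (pairingMatrix θ ψ).transpose
      (fun j ↦ vectorFieldDerivation (ξ j)) h :=
  (symModel hfr).frameAlgebra symmetricAlgebra_isFreeOn
    (by rw [← Matrix.transpose_mul, pairingMatrix_mul_self hfr])
    hξ (fun _ ↦ mem_symGrade_zero _) (fun _ ↦ mem_symGrade_zero _)
    (symGrade_isGradedComm n F E) fun i j ↦ by
      rw [koszul_zero, one_smul]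
      exact Subtype.ext (funext fun x ↦
        mul_comm ((symOfDual n (ψ i)).1 x) ((symOfDual n (ψ j)).1 x))

end Frame

end

/-! ### Existence of a smooth connection -/

noncomputable section

theorem contMDiffAt_smulRight {n : ℕ} {C V F : Type*} [TopologicalSpace C]
    [ChartedSpace (EuclideanSpace ℝ (Fin n)) C] [NormedAddCommGroup V] [NormedSpace ℝ V]
    [NormedAddCommGroup F] [NormedSpace ℝ F] {A : C → V →L[ℝ] ℝ} {t : C → F} {x : C}
    (hA : ContMDiffAt (𝓡 n) 𝓘(ℝ, V →L[ℝ] ℝ) ∞ A x) (ht : ContMDiffAt (𝓡 n) 𝓘(ℝ, F) ∞ t x) :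
    ContMDiffAt (𝓡 n) 𝓘(ℝ, V →L[ℝ] F) ∞ (fun y ↦ (A y).smulRight (t y)) x :=
  ((contDiff_fst (𝕜 := ℝ) (E := V →L[ℝ] ℝ) (F := F)).smulRight
    contDiff_snd).contMDiff.contMDiffAt.comp x (hA.prodMk_space ht)

section Connection

variable {n : ℕ} {C : Type*} [TopologicalSpace C] [T2Space C] [SigmaCompactSpace C]
    [ChartedSpace (EuclideanSpace ℝ (Fin n)) C] [IsManifold (𝓡 n) ∞ C]
    {F : Type*} [NormedAddCommGroup F] [NormedSpace ℝ F] [FiniteDimensional ℝ F]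
    {E : C → Type*} [∀ x, AddCommGroup (E x)] [∀ x, Module ℝ (E x)]
    [∀ x, TopologicalSpace (E x)] [TopologicalSpace (Bundle.TotalSpace F E)]
    [FiberBundle F E] [VectorBundle ℝ F E] [ContMDiffVectorBundle ∞ F E (𝓡 n)]

/-- The axioms of a covariant derivative concern sections that are merely differentiable at a point,
so smooth pairings do not suffice for `frameConnection`. -/
theorem mdifferentiableAt_dual_apply (ψ : DualSection n F E) {s : Π x, E x} {x₀ : C}
    (hs : MDifferentiableAt (𝓡 n) ((𝓡 n).prod 𝓘(ℝ, F)) (fun x ↦ Bundle.TotalSpace.mk' F x (s x)) x₀) :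
    MDifferentiableAt (𝓡 n) 𝓘(ℝ, ℝ) (fun y ↦ ψ.toFun y (s y)) x₀ := by
  obtain ⟨k, w, c, hc, e⟩ := ψ.smooth x₀
  have hx := FiberBundle.mem_baseSet_trivializationAt F E x₀
  have hs' := (mdifferentiableAt_section (𝓡 n) s).1 hs
  have h1 : MDifferentiableAt (𝓡 n) 𝓘(ℝ, ℝ) (fun y ↦ ∑ i, c i y *
      LinearMap.toContinuousLinearMap (w i) (trivializationAt F E x₀ ⟨y, s y⟩).2) x₀ := by
    have hi (i) : MDifferentiableAt (𝓡 n) 𝓘(ℝ, ℝ) (fun y ↦ c i y *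
      LinearMap.toContinuousLinearMap (w i) (trivializationAt F E x₀ ⟨y, s y⟩).2) x₀ :=
      ((hc i).mdifferentiableAt (by simp)).mul
        ((LinearMap.toContinuousLinearMap (w i)).mdifferentiableAt.comp x₀ hs')
    have h := MDifferentiableAt.sum (t := Finset.univ) fun i _ ↦ hi i
    exact h.congr_of_eventuallyEq (Filter.Eventually.of_forall fun y ↦ by simp)
  refine h1.congr_of_eventuallyEq ?_
  filter_upwards [e, (trivializationAt F E x₀).open_baseSet.mem_nhds hx] with y hy hy'
  have h2 := congr($hy ((trivializationAt F E x₀).linearMapAt ℝ y (s y)))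
  rw [dualTriv, LinearMap.dualMap_apply, (trivializationAt F E x₀).symmₗ_linearMapAt hy'] at h2
  rw [h2, Bundle.Trivialization.coe_linearMapAt_of_mem _ hy']
  simp

variable [∀ x, IsTopologicalAddGroup (E x)] [∀ x, ContinuousSMul ℝ (E x)]

theorem contMDiff_mvfderiv_smulRight {c : C → ℝ} (hc : ContMDiff (𝓡 n) 𝓘(ℝ, ℝ) ∞ c)
    (θ : Cₛ^∞⟮𝓡 n; F, E⟯) :
    ContMDiff (𝓡 n) ((𝓡 n).prod 𝓘(ℝ, EuclideanSpace ℝ (Fin n) →L[ℝ] F)) ∞ fun x ↦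
      Bundle.TotalSpace.mk' (EuclideanSpace ℝ (Fin n) →L[ℝ] F)
        (E := fun x ↦ TangentSpace (𝓡 n) x →L[ℝ] E x) x
        ((mvfderiv (𝓡 n) c x).smulRight (θ x)) := by
  intro x₀
  rw [contMDiffAt_hom_bundle]
  refine ⟨contMDiffAt_id, ?_⟩
  have h1 := (hc x₀).mfderiv_const (m := ∞) (by simp)
  have h2 := contMDiffAt_linearMapAt_section (FiberBundle.mem_baseSet_trivializationAt F E x₀)
    (θ.contMDiff x₀)
  have h3 := contMDiffAt_smulRight h1 h2
  refine h3.congr_of_eventuallyEq (Filter.Eventually.of_forall fun x ↦ ?_)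
  refine ContinuousLinearMap.ext fun v ↦ ?_
  simp [ContinuousLinearMap.inCoordinates, inTangentCoordinates]
  rfl

variable {N : ℕ} {θ : Fin N → Cₛ^∞⟮𝓡 n; F, E⟯} {ψ : Fin N → DualSection n F E}

/-- The connection induced by a frame. -/
def frameConnection (hfr : ∀ x v, ∑ i, (ψ i).toFun x v • θ i x = v) :
    CovariantDerivative (𝓡 n) F E where
  toFun s x := ∑ i, (mvfderiv (𝓡 n) (fun y ↦ (ψ i).toFun y (s y)) x).smulRight (θ i x)
  isCovariantDerivativeOnUniv :=
    { add := fun {s s' x} hs hs' _ ↦ by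
        rw [← Finset.sum_add_distrib]
        refine Finset.sum_congr rfl fun i _ ↦ ContinuousLinearMap.ext fun v ↦ ?_
        have h := mvfderiv_add (mdifferentiableAt_dual_apply (ψ i) hs)
          (mdifferentiableAt_dual_apply (ψ i) hs')
        have h' : (fun y ↦ (ψ i).toFun y ((s + s') y)) =
            (fun y ↦ (ψ i).toFun y (s y)) + fun y ↦ (ψ i).toFun y (s' y) :=
          funext fun y ↦ map_add _ _ _
        rw [h', h]
        simp [add_smul]
      leibniz := fun {s g x} hs hg _ ↦ by
        have hd (i) : mvfderiv (𝓡 n) (fun y ↦ (ψ i).toFun y ((g • s) y)) x =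
            g x • mvfderiv (𝓡 n) (fun y ↦ (ψ i).toFun y (s y)) x +
              (ψ i).toFun x (s x) • mvfderiv (𝓡 n) g x := by
          rw [← mvfderiv_mul hg (mdifferentiableAt_dual_apply (ψ i) hs)]
          congr 1
          exact funext fun y ↦ map_smul _ _ _
        refine ContinuousLinearMap.ext fun v ↦ ?_
        conv_rhs => rw [← hfr x (s x)]
        simp only [hd]
        simp [ContinuousLinearMap.sum_apply, add_smul, Finset.sum_add_distrib, Finset.smul_sum,
          smul_smul, mul_comm] }

theorem contMDiff_frameConnection (hfr : ∀ x v, ∑ i, (ψ i).toFun x v • θ i x = v) :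
    (frameConnection hfr).ContMDiffCovariantDerivative ∞ where
  contMDiff := ⟨fun {s} hs ↦ by
    have hs' : ContMDiff (𝓡 n) ((𝓡 n).prod 𝓘(ℝ, F)) ∞ fun x ↦ Bundle.TotalSpace.mk' F x (s x) :=
      contMDiffOn_univ.1 hs
    rw [contMDiffOn_univ]
    exact ContMDiff.sum_section (s := Finset.univ) fun i _ ↦ contMDiff_mvfderiv_smulRight
      (fun x ↦ contMDiffAt_dual_apply ((ψ i).smooth x) (hs' x)) (θ i)⟩

theorem exists_connection : ∃ cov : CovariantDerivative (𝓡 n) F E,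
    CovariantDerivative.ContMDiffCovariantDerivative cov ∞ := by
  obtain ⟨N, θ, ψ, hfr⟩ := exists_finite_frame (n := n) F E
  exact ⟨frameConnection hfr, contMDiff_frameConnection hfr⟩

end Connection

end

/-! ### Covariant derivatives and their duals in a frame -/

noncomputable section

universe u

namespace FrameAlgebra

variable {R : Type*} [CommRing R] [Algebra ℝ R] {I J : Type*} [Fintype I] [Fintype J]
  {A : Type u} [Ring A] [Algebra ℝ A] {𝒜 : ℤ → Submodule ℝ A} {e : ℤ}
  {q : Matrix I I R} {X : J → Derivation ℝ R R} {h : J → R} (F : FrameAlgebra 𝒜 e q X h)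
  [GradedAlgebra 𝒜]

/-- Derivations with prescribed compatible values. -/
theorem exists_der_of_compatible (d : ℤ) (Y : Derivation ℝ R R) (hd : d = 0 ∨ Y = 0) (y : I → A)
    (hy : ∀ i, y i ∈ 𝒜 (d + e))
    (hc : ∀ j, y j = ∑ i, (F.f (Y (q i j)) * F.g i + F.f (q i j) * y i)) :
    ∃ D ∈ gradedDer 𝒜 d, (∀ r, D (F.f r) = F.f (Y r)) ∧ ∀ j, D (F.g j) = y j := by
  obtain ⟨D, h1, h2, h3⟩ := F.exists_der d (F.f.toLinearMap ∘ₗ Y.toLinearMap)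
    (fun r ↦ by
      rcases hd with rfl | rfl
      · exact F.f_mem _
      · change F.f 0 ∈ _
        rw [map_zero]
        exact zero_mem _)
    (fun r s ↦ by
      change F.f (Y (r * s)) = F.f (Y r) * F.f s + F.f r * F.f (Y s)
      rw [← map_mul, ← map_mul, ← map_add, Y.leibniz, smul_eq_mul, smul_eq_mul, add_comm,
        mul_comm s]) y hy
  exact ⟨D, h1, h2, fun j ↦ (h3 j).trans (hc j).symm⟩

/-- A morphism is determined by its values on `F.f`, `F.g`, contractions and arbitrary lifts of the
derivations `X j`. -/
theorem algHom_ext_of_lifts {T : Type*} [Ring T] [Algebra ℝ T] {Φ Φ' : MultiDer 𝒜 →ₐ[ℝ] T}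
    (hf : ∀ r, Φ (MultiDer.fn 𝒜 (F.f r)) = Φ' (MultiDer.fn 𝒜 (F.f r)))
    (hg : ∀ i, Φ (MultiDer.fn 𝒜 (F.g i)) = Φ' (MultiDer.fn 𝒜 (F.g i)))
    (hc : ∀ i, Φ (MultiDer.der 𝒜 (-e) (F.contr i) (F.contr_mem i)) =
      Φ' (MultiDer.der 𝒜 (-e) (F.contr i) (F.contr_mem i)))
    (D : J → A →ₗ[ℝ] A) (hD : ∀ j, D j ∈ gradedDer 𝒜 0) (hDf : ∀ j r, D j (F.f r) = F.f (X j r))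
    (hn : ∀ j, Φ (MultiDer.der 𝒜 0 (D j) (hD j)) = Φ' (MultiDer.der 𝒜 0 (D j) (hD j))) :
    Φ = Φ' := by
  have hfn : Φ.comp (MultiDer.fnHom 𝒜) = Φ'.comp (MultiDer.fnHom 𝒜) := by
    refine AlgHom.ext_of_adjoin_eq_top F.adjoin_eq ?_
    rintro _ (⟨r, rfl⟩ | ⟨i, rfl⟩)
    exacts [hf r, hg i]
  have hfn' (a : A) : Φ (MultiDer.fn 𝒜 a) = Φ' (MultiDer.fn 𝒜 a) := AlgHom.congr_fun hfn a
  refine F.algHom_ext hf hg hc fun j ↦ ?_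
  have e1 := F.der_eq_sum (F.nabla_mem j)
  have e2 := F.der_eq_sum (hD j)
  simp only [F.nabla_f] at e1
  simp only [hDf] at e2
  -- `nabla j` and `D j` lift the same vector field, so they differ by a combination of contractions
  -- with coefficients in `A`.
  have e3 := e1.trans (congr_arg (· + _) (eq_sub_of_add_eq e2.symm))
  rw [e3]
  simp only [map_add, map_sub, map_sum, map_mul, hn, hc, hfn']

end FrameAlgebra

section Pairing

variable {n : ℕ} {C : Type*} [TopologicalSpace C] [T2Space C] [SigmaCompactSpace C]
    [ChartedSpace (EuclideanSpace ℝ (Fin n)) C] [IsManifold (𝓡 n) ∞ C]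
    {F : Type*} [NormedAddCommGroup F] [NormedSpace ℝ F] [FiniteDimensional ℝ F]
    {E : C → Type*} [∀ x, AddCommGroup (E x)] [∀ x, Module ℝ (E x)]
    [∀ x, TopologicalSpace (E x)] [TopologicalSpace (Bundle.TotalSpace F E)]
    [FiberBundle F E] [VectorBundle ℝ F E] [ContMDiffVectorBundle ∞ F E (𝓡 n)]
    {N : ℕ} {θ : Fin N → Cₛ^∞⟮𝓡 n; F, E⟯} {ψ : Fin N → DualSection n F E}

theorem smoothFun_sum_apply {ι : Type*} (s : Finset ι) (r : ι → C^∞⟮𝓡 n, C; 𝓘(ℝ, ℝ), ℝ⟯) (x : C) :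
    (∑ i ∈ s, r i) x = ∑ i ∈ s, r i x :=
  map_sum (ContMDiffMap.evalRingHom x) _ _

theorem extSections_sum_apply {ι : Type*} (s : Finset ι) (a : ι → extSections n F E) (x : C) :
    (∑ i ∈ s, a i).1 x = ∑ i ∈ s, (a i).1 x :=
  map_sum ((Pi.evalAlgHom ℝ (fun x ↦ ExteriorAlgebra ℝ (E x)) x).comp (extSections n F E).val) _ _

theorem symSections_sum_apply {ι : Type*} (s : Finset ι) (a : ι → symSections n F E) (x : C) :
    (∑ i ∈ s, a i).1 x = ∑ i ∈ s, (a i).1 x :=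
  map_sum ((Pi.evalAlgHom ℝ (fun x ↦ SymmetricAlgebra ℝ (Module.Dual ℝ (E x))) x).comp
    (symSections n F E).val) _ _

theorem extOfFun_mul_apply (r : C^∞⟮𝓡 n, C; 𝓘(ℝ, ℝ), ℝ⟯) (a : extSections n F E) (x : C) :
    (extOfFunHom n F E r * a).1 x = r x • a.1 x :=
  (Algebra.smul_def (r x) (a.1 x)).symm

theorem symOfFun_mul_apply (r : C^∞⟮𝓡 n, C; 𝓘(ℝ, ℝ), ℝ⟯) (a : symSections n F E) (x : C) :
    (symOfFunHom n F E r * a).1 x = r x • a.1 x :=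
  (Algebra.smul_def (r x) (a.1 x)).symm

theorem dualPairing_eq_sum (hfr : ∀ x v, ∑ i, (ψ i).toFun x v • θ i x = v)
    (φ : DualSection n F E) (s : Cₛ^∞⟮𝓡 n; F, E⟯) :
    dualPairing φ s = ∑ i, dualPairing φ (θ i) * dualPairing (ψ i) s := by
  ext x
  have h := congr_arg (φ.toFun x) (hfr x (s x))
  rw [map_sum] at h
  rw [smoothFun_sum_apply]
  refine h.symm.trans (Finset.sum_congr rfl fun i _ ↦ ?_)
  rw [map_smul, smul_eq_mul, mul_comm]
  rfl

theorem extOfSection_eq_sum (hfr : ∀ x v, ∑ i, (ψ i).toFun x v • θ i x = v)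
    (s : Cₛ^∞⟮𝓡 n; F, E⟯) : extOfSection n s =
      ∑ i, extOfFunHom n F E (dualPairing (ψ i) s) * extOfSection n (θ i) := by
  refine Subtype.ext (funext fun x ↦ ?_)
  rw [extSections_sum_apply]
  simp only [extOfFun_mul_apply]
  have h := congr_arg (ExteriorAlgebra.ι ℝ) (hfr x (s x))
  rw [map_sum] at h
  refine h.symm.trans (Finset.sum_congr rfl fun i _ ↦ ?_)
  rw [map_smul]
  rfl

theorem symOfDual_eq_sum (hfr : ∀ x v, ∑ i, (ψ i).toFun x v • θ i x = v)
    (φ : DualSection n F E) : symOfDual n φ =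
      ∑ i, symOfFunHom n F E (dualPairing φ (θ i)) * symOfDual n (ψ i) := by
  refine Subtype.ext (funext fun x ↦ ?_)
  rw [symSections_sum_apply]
  simp only [symOfFun_mul_apply]
  have h := congr_arg (SymmetricAlgebra.ι ℝ (Module.Dual ℝ (E x))) (dual_eq_sum hfr x (φ.toFun x))
  rw [map_sum] at h
  refine h.symm.trans (Finset.sum_congr rfl fun i _ ↦ ?_)
  rw [map_smul]
  rfl

theorem dualSection_ext (hfr : ∀ x v, ∑ i, (ψ i).toFun x v • θ i x = v)
    {φ φ' : DualSection n F E} (h : ∀ i, dualPairing φ (θ i) = dualPairing φ' (θ i)) : φ = φ' := by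
  refine DualSection.ext fun x v ↦ ?_
  rw [← hfr x v, map_sum, map_sum]
  refine Finset.sum_congr rfl fun i _ ↦ ?_
  rw [map_smul, map_smul]
  exact congr_arg _ (DFunLike.congr_fun (h i) x)

/-- Sections of the dual bundle are determined by their pairings with the frame, so identities in
`B` can be checked among smooth functions. -/
theorem symOfDual_eq_sum_of_pairing (hfr : ∀ x v, ∑ i, (ψ i).toFun x v • θ i x = v)
    {ι : Type*} [Fintype ι] {χ : DualSection n F E} {α β : ι → DualSection n F E}
    {a b : ι → C^∞⟮𝓡 n, C; 𝓘(ℝ, ℝ), ℝ⟯} (h : ∀ k, dualPairing χ (θ k) =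
      ∑ i, (a i * dualPairing (α i) (θ k) + b i * dualPairing (β i) (θ k))) :
    symOfDual n χ = ∑ i, (symOfFunHom n F E (a i) * symOfDual n (α i) +
      symOfFunHom n F E (b i) * symOfDual n (β i)) := by
  refine Subtype.ext (funext fun x ↦ ?_)
  have hx : χ.toFun x = ∑ i, (a i x • (α i).toFun x + b i x • (β i).toFun x) := by
    refine (dual_eq_sum hfr x _).symm.trans (Eq.trans (Finset.sum_congr rfl fun k _ ↦
      congr_arg (fun t : ℝ ↦ t • (ψ k).toFun x) ?_) (dual_eq_sum hfr x _))
    have hk := DFunLike.congr_fun (h k) x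
    rw [smoothFun_sum_apply] at hk
    rw [LinearMap.sum_apply]
    exact hk
  rw [symSections_sum_apply]
  have h1 := congr_arg (SymmetricAlgebra.ι ℝ (Module.Dual ℝ (E x))) hx
  rw [map_sum] at h1
  refine h1.trans (Finset.sum_congr rfl fun i _ ↦ ?_)
  rw [map_add, map_smul, map_smul]
  exact congr_arg₂ (· + ·) (symOfFun_mul_apply _ (symOfDual n (α i)) x).symm
    (symOfFun_mul_apply _ (symOfDual n (β i)) x).symm

/-- Combinations of sections of the dual bundle. -/
def dualCombination (r : Fin N → C^∞⟮𝓡 n, C; 𝓘(ℝ, ℝ), ℝ⟯) (ψ : Fin N → DualSection n F E) :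
    DualSection n F E where
  toFun x := ∑ i, r i x • (ψ i).toFun x
  smooth x := (SmoothCoeffAt.sum Finset.univ fun i _ ↦
    ((ψ i).smooth x).smul ((r i).contMDiff x)).congr (Filter.Eventually.of_forall fun y ↦ by
      rw [map_sum]
      simp only [map_smul])

theorem dualPairing_dualCombination (r : Fin N → C^∞⟮𝓡 n, C; 𝓘(ℝ, ℝ), ℝ⟯)
    (ψ : Fin N → DualSection n F E) (s : Cₛ^∞⟮𝓡 n; F, E⟯) :
    dualPairing (dualCombination r ψ) s = ∑ i, r i * dualPairing (ψ i) s := by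
  ext x
  rw [smoothFun_sum_apply]
  refine (LinearMap.sum_apply _ _ _).trans (Finset.sum_congr rfl fun i _ ↦ ?_)
  rfl

end Pairing

section Covariant

variable {n : ℕ} {C : Type*} [TopologicalSpace C] [T2Space C] [SigmaCompactSpace C]
    [ChartedSpace (EuclideanSpace ℝ (Fin n)) C] [IsManifold (𝓡 n) ∞ C]
    {F : Type*} [NormedAddCommGroup F] [NormedSpace ℝ F] [FiniteDimensional ℝ F]
    {E : C → Type*} [∀ x, AddCommGroup (E x)] [∀ x, Module ℝ (E x)]
    [∀ x, TopologicalSpace (E x)] [∀ x, IsTopologicalAddGroup (E x)]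
    [∀ x, ContinuousSMul ℝ (E x)] [TopologicalSpace (Bundle.TotalSpace F E)]
    [FiberBundle F E] [VectorBundle ℝ F E] [ContMDiffVectorBundle ∞ F E (𝓡 n)]

/-- The section `∇_ξ s`. -/
def covSection (cov : CovariantDerivative (𝓡 n) F E)
    (hcov : CovariantDerivative.ContMDiffCovariantDerivative cov ∞)
    (ξ : Cₛ^∞⟮𝓡 n; EuclideanSpace ℝ (Fin n), (TangentSpace (𝓡 n) : C → Type _)⟯)
    (s : Cₛ^∞⟮𝓡 n; F, E⟯) : Cₛ^∞⟮𝓡 n; F, E⟯ :=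
  ⟨fun x ↦ cov (fun y ↦ s y) x (ξ x), fun x ↦
    ContMDiffAt.clm_bundle_apply
      (contMDiffOn_univ.1 (hcov.contMDiff.contMDiff (σ := fun y ↦ s y)
        (contMDiffOn_univ.2 s.contMDiff)) x) (ξ.contMDiff x)⟩

theorem cov_sum_smul (cov : CovariantDerivative (𝓡 n) F E) {ι : Type*} (t : Finset ι)
    (r : ι → C^∞⟮𝓡 n, C; 𝓘(ℝ, ℝ), ℝ⟯) (θ : ι → Cₛ^∞⟮𝓡 n; F, E⟯) (x : C)
    (v : TangentSpace (𝓡 n) x) :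
    cov (fun y ↦ ∑ i ∈ t, r i y • θ i y) x v =
      ∑ i ∈ t, (r i x • cov (fun y ↦ θ i y) x v + mvfderiv (𝓡 n) (fun y ↦ r i y) x v • θ i x) := by
  classical
  have hsm (i : ι) : ContMDiff (𝓡 n) ((𝓡 n).prod 𝓘(ℝ, F)) ∞
      (fun y ↦ Bundle.TotalSpace.mk' F y (r i y • θ i y)) :=
    fun x ↦ ((r i).contMDiff x).smul_section ((θ i).contMDiff x)
  induction t using Finset.induction_on with
  | empty =>
    simp only [Finset.sum_empty]
    have := congr($(congr_fun cov.zero x) v)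
    exact this
  | insert i t hi ih =>
    have h1 : MDifferentiableAt (𝓡 n) ((𝓡 n).prod 𝓘(ℝ, F))
        (fun y ↦ Bundle.TotalSpace.mk' F y (∑ i ∈ t, r i y • θ i y)) x :=
      (ContMDiff.sum_section (s := t) fun i _ ↦ hsm i).mdifferentiableAt (by simp)
    have h2 := cov.isCovariantDerivativeOnUniv.add (σ := fun y ↦ r i y • θ i y)
      ((hsm i).mdifferentiableAt (x := x) (by simp)) h1
    have h3 := cov.isCovariantDerivativeOnUniv.leibniz (σ := fun y ↦ θ i y) (g := fun y ↦ r i y)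
      ((θ i).contMDiff.mdifferentiableAt (x := x) (by simp))
      ((r i).contMDiff.mdifferentiableAt (x := x) (by simp))
    simp only [Finset.sum_insert hi]
    have h4 := congr($h2 v)
    have h5 := congr($h3 v)
    rw [← ih]
    refine h4.trans (congr_arg (· + _) h5)

variable {N : ℕ} {θ : Fin N → Cₛ^∞⟮𝓡 n; F, E⟯} {ψ : Fin N → DualSection n F E}
  {cov : CovariantDerivative (𝓡 n) F E}
  (hcov : CovariantDerivative.ContMDiffCovariantDerivative cov ∞)
  (ξ : Cₛ^∞⟮𝓡 n; EuclideanSpace ℝ (Fin n), (TangentSpace (𝓡 n) : C → Type _)⟯)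

/-- The Leibniz rule applied to the expansion of `s` in the frame. -/
theorem covSection_apply_eq_sum (hfr : ∀ x v, ∑ i, (ψ i).toFun x v • θ i x = v)
    (s : Cₛ^∞⟮𝓡 n; F, E⟯) (x : C) : covSection cov hcov ξ s x =
      ∑ i, (vectorFieldDerivation ξ (dualPairing (ψ i) s) x • θ i x +
        dualPairing (ψ i) s x • covSection cov hcov ξ (θ i) x) := by
  have h := cov_sum_smul cov Finset.univ (fun i ↦ dualPairing (ψ i) s) θ x (ξ x)
  have h1 : (fun y ↦ ∑ i, dualPairing (ψ i) s y • θ i y) = fun y ↦ s y :=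
    funext fun y ↦ hfr y (s y)
  rw [h1] at h
  refine h.trans (Finset.sum_congr rfl fun i _ ↦ ?_)
  rw [add_comm]
  rfl

theorem extOfSection_covSection (hfr : ∀ x v, ∑ i, (ψ i).toFun x v • θ i x = v)
    (s : Cₛ^∞⟮𝓡 n; F, E⟯) : extOfSection n (covSection cov hcov ξ s) =
      ∑ i, (extOfFunHom n F E (vectorFieldDerivation ξ (dualPairing (ψ i) s)) * extOfSection n (θ i) +
        extOfFunHom n F E (dualPairing (ψ i) s) * extOfSection n (covSection cov hcov ξ (θ i))) := by
  refine Subtype.ext (funext fun x ↦ ?_)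
  rw [extSections_sum_apply]
  have h := congr_arg (ExteriorAlgebra.ι ℝ) (covSection_apply_eq_sum hcov ξ hfr s x)
  rw [map_sum] at h
  refine h.trans (Finset.sum_congr rfl fun i _ ↦ ?_)
  rw [map_add, map_smul, map_smul]
  exact congr_arg₂ (· + ·) (extOfFun_mul_apply _ (extOfSection n (θ i)) x).symm
    (extOfFun_mul_apply _ (extOfSection n (covSection cov hcov ξ (θ i))) x).symm

theorem dualPairing_covSection (hfr : ∀ x v, ∑ i, (ψ i).toFun x v • θ i x = v)
    (φ : DualSection n F E) (s : Cₛ^∞⟮𝓡 n; F, E⟯) : dualPairing φ (covSection cov hcov ξ s) =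
      ∑ i, (vectorFieldDerivation ξ (dualPairing (ψ i) s) * dualPairing φ (θ i) +
        dualPairing (ψ i) s * dualPairing φ (covSection cov hcov ξ (θ i))) := by
  ext x
  rw [smoothFun_sum_apply]
  have h := congr_arg (φ.toFun x) (covSection_apply_eq_sum hcov ξ hfr s x)
  rw [map_sum] at h
  refine h.trans (Finset.sum_congr rfl fun i _ ↦ ?_)
  rw [map_add, map_smul, map_smul]
  rfl

variable (θ ψ) in
/-- The dual connection, in a frame. -/
def dualCovSection (φ : DualSection n F E) : DualSection n F E :=
  dualCombination (fun i ↦ vectorFieldDerivation ξ (dualPairing φ (θ i)) -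
    dualPairing φ (covSection cov hcov ξ (θ i))) ψ

/-- The definition imposes the duality rule on the frame only; both sides are linear over functions
in `s`, since the derivatives of the coefficients cancel. -/
theorem dualPairing_dualCovSection (hfr : ∀ x v, ∑ i, (ψ i).toFun x v • θ i x = v)
    (φ : DualSection n F E) (s : Cₛ^∞⟮𝓡 n; F, E⟯) :
    dualPairing (dualCovSection θ ψ hcov ξ φ) s = vectorFieldDerivation ξ (dualPairing φ s) -
      dualPairing φ (covSection cov hcov ξ s) := by
  rw [dualCovSection, dualPairing_dualCombination, dualPairing_covSection hcov ξ hfr φ s,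
    dualPairing_eq_sum hfr φ s, map_sum, ← Finset.sum_sub_distrib]
  refine Finset.sum_congr rfl fun i _ ↦ ?_
  rw [Derivation.leibniz, smul_eq_mul, smul_eq_mul]
  ring

/-- For `φ = ψ j` this is the compatibility condition of `exists_der_of_compatible`, and for general
`φ` it identifies the resulting derivation. -/
theorem symOfDual_dualCovSection (hfr : ∀ x v, ∑ i, (ψ i).toFun x v • θ i x = v)
    (φ : DualSection n F E) : symOfDual n (dualCovSection θ ψ hcov ξ φ) =
      ∑ i, (symOfFunHom n F E (vectorFieldDerivation ξ (dualPairing φ (θ i))) * symOfDual n (ψ i) +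
        symOfFunHom n F E (dualPairing φ (θ i)) *
          symOfDual n (dualCovSection θ ψ hcov ξ (ψ i))) := by
  refine symOfDual_eq_sum_of_pairing hfr fun k ↦ ?_
  simp only [dualPairing_dualCovSection hcov ξ hfr]
  rw [dualPairing_eq_sum hfr φ (covSection cov hcov ξ (θ k)), dualPairing_eq_sum hfr φ (θ k),
    map_sum, ← Finset.sum_sub_distrib]
  refine Finset.sum_congr rfl fun i _ ↦ ?_
  rw [Derivation.leibniz, smul_eq_mul, smul_eq_mul]
  ring

end Covariant

end

/-! ### Contractions and covariant derivatives as derivations -/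

noncomputable section

section Derivations

variable {n : ℕ} {C : Type*} [TopologicalSpace C] [T2Space C] [SigmaCompactSpace C]
    [ChartedSpace (EuclideanSpace ℝ (Fin n)) C] [IsManifold (𝓡 n) ∞ C]
    {F : Type*} [NormedAddCommGroup F] [NormedSpace ℝ F] [FiniteDimensional ℝ F]
    {E : C → Type*} [∀ x, AddCommGroup (E x)] [∀ x, Module ℝ (E x)]
    [∀ x, TopologicalSpace (E x)] [TopologicalSpace (Bundle.TotalSpace F E)]
    [FiberBundle F E] [VectorBundle ℝ F E] [ContMDiffVectorBundle ∞ F E (𝓡 n)]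
    {N : ℕ} {θ : Fin N → Cₛ^∞⟮𝓡 n; F, E⟯} {ψ : Fin N → DualSection n F E}
    {J : Type*} [Fintype J] {h : J → C^∞⟮𝓡 n, C; 𝓘(ℝ, ℝ), ℝ⟯}
    {ξ : J → Cₛ^∞⟮𝓡 n; EuclideanSpace ℝ (Fin n), (TangentSpace (𝓡 n) : C → Type _)⟯}

theorem extFrame_f
    (hfr : ∀ x v, ∑ i, (ψ i).toFun x v • θ i x = v)
    (hξ : ∀ x (v : TangentSpace (𝓡 n) x), ∑ j, mvfderiv (𝓡 n) (fun y ↦ h j y) x v • ξ j x = v) :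
    (extFrame hfr hξ).f = extOfFunHom n F E := rfl

theorem extFrame_g
    (hfr : ∀ x v, ∑ i, (ψ i).toFun x v • θ i x = v)
    (hξ : ∀ x (v : TangentSpace (𝓡 n) x), ∑ j, mvfderiv (𝓡 n) (fun y ↦ h j y) x v • ξ j x = v)
    (i : Fin N) : (extFrame hfr hξ).g i = extOfSection n (θ i) := rfl

theorem symFrame_f
    (hfr : ∀ x v, ∑ i, (ψ i).toFun x v • θ i x = v)
    (hξ : ∀ x (v : TangentSpace (𝓡 n) x), ∑ j, mvfderiv (𝓡 n) (fun y ↦ h j y) x v • ξ j x = v) :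
    (symFrame hfr hξ).f = symOfFunHom n F E := rfl

theorem symFrame_g
    (hfr : ∀ x v, ∑ i, (ψ i).toFun x v • θ i x = v)
    (hξ : ∀ x (v : TangentSpace (𝓡 n) x), ∑ j, mvfderiv (𝓡 n) (fun y ↦ h j y) x v • ξ j x = v)
    (i : Fin N) : (symFrame hfr hξ).g i = symOfDual n (ψ i) := rfl

/-- Contraction with `φ` obeys the same rule as `D` under left multiplication by a function or by a
frame section, so the two agree by induction on words in the generators. -/
theorem isExtContraction_of_values
    (hfr : ∀ x v, ∑ i, (ψ i).toFun x v • θ i x = v)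
    (hξ : ∀ x (v : TangentSpace (𝓡 n) x), ∑ j, mvfderiv (𝓡 n) (fun y ↦ h j y) x v • ξ j x = v)
    {φ : DualSection n F E}
    {D : extSections n F E →ₗ[ℝ] extSections n F E} (hD : D ∈ gradedDer (extGrade n F E) (-1))
    (hf : ∀ r, D (extOfFunHom n F E r) = 0)
    (hg : ∀ i, D (extOfSection n (θ i)) = extOfFunHom n F E (dualPairing φ (θ i))) :
    IsExtContraction φ D := by
  have key : ∀ k, ∀ a ∈ extGrade n F E k, ∀ x,
      (D a).1 x = CliffordAlgebra.contractLeft (Q := 0) (φ.toFun x) (a.1 x) := by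
    refine homogeneous_induction _ (extFrame hfr hξ).mem_of_gens (extFrame hfr hξ).adjoin_gens
      (fun x ↦ ?_) (fun _ x ↦ ?_) (fun _ a b _ _ ha hb x ↦ ?_) (fun _ r a ha x ↦ ?_) ?_
    · have h1 : D 1 = 0 := by rw [← map_one (extOfFunHom n F E), hf]
      rw [h1]
      exact (CliffordAlgebra.contractLeft_one (Q := (0 : QuadraticForm ℝ (E x))) _).symm
    · rw [map_zero]
      exact (map_zero (CliffordAlgebra.contractLeft (Q := (0 : QuadraticForm ℝ (E x))) _)).symm
    · rw [map_add]
      refine (congr_arg₂ (· + ·) (ha x) (hb x)).trans ?_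
      exact (map_add (CliffordAlgebra.contractLeft (Q := (0 : QuadraticForm ℝ (E x))) _) _ _).symm
    · rw [map_smul]
      refine (congr_arg (r • ·) (ha x)).trans ?_
      exact (map_smul (CliffordAlgebra.contractLeft (Q := (0 : QuadraticForm ℝ (E x))) _) _ _).symm
    · rintro i k _ b (⟨rfl, r, rfl⟩ | ⟨rfl, j, rfl⟩) hb ih x
      · rw [extFrame_f, hD.2 0 (extOfFunHom n F E r) (extOfFun_mem r), hf, zero_mul, zero_add,
          mul_zero, koszul_zero, one_smul, extOfFun_mul_apply, extOfFun_mul_apply, ih]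
        exact (map_smul (CliffordAlgebra.contractLeft (Q := (0 : QuadraticForm ℝ (E x))) _) _ _).symm
      · rw [extFrame_g, hD.2 1 _ (extOfSection_mem (θ j)), hg, mul_one]
        have e1 : koszul (-1) = -1 := by simp [koszul]
        rw [e1, neg_smul, one_smul]
        refine Eq.trans ?_ (CliffordAlgebra.contractLeft_ι_mul
          (Q := (0 : QuadraticForm ℝ (E x))) _ _ _).symm
        rw [← ih x, sub_eq_add_neg]
        exact congr_arg (· + _) (extOfFun_mul_apply _ b x)
  refine ⟨hD, fun a ↦ ?_⟩
  induction a using DirectSum.Decomposition.inductionOn (extGrade n F E) with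
  | zero =>
    intro x
    rw [map_zero]
    exact (map_zero (CliffordAlgebra.contractLeft (Q := (0 : QuadraticForm ℝ (E x))) _)).symm
  | homogeneous a => exact key _ _ a.2
  | add a b ha hb =>
    intro x
    rw [map_add]
    refine (congr_arg₂ (· + ·) (ha x) (hb x)).trans ?_
    exact (map_add (CliffordAlgebra.contractLeft (Q := (0 : QuadraticForm ℝ (E x))) _) _ _).symm

theorem exists_extContraction
    (hfr : ∀ x v, ∑ i, (ψ i).toFun x v • θ i x = v)
    (hξ : ∀ x (v : TangentSpace (𝓡 n) x), ∑ j, mvfderiv (𝓡 n) (fun y ↦ h j y) x v • ξ j x = v)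
    (φ : DualSection n F E) : ∃ D, IsExtContraction φ D := by
  obtain ⟨D, hD, hf, hg⟩ := (extFrame hfr hξ).exists_der_of_compatible (-1) 0 (.inr rfl)
    (fun i ↦ extOfFunHom n F E (dualPairing φ (θ i))) (fun i ↦ extOfFun_mem _) (fun j ↦ by
      rw [dualPairing_eq_sum hfr φ (θ j), map_sum]
      refine Finset.sum_congr rfl fun i _ ↦ ?_
      rw [Derivation.zero_apply, map_zero, zero_mul, zero_add, mul_comm, map_mul]
      rfl)
  refine ⟨D, isExtContraction_of_values hfr hξ hD (fun r ↦ ?_) hg⟩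
  rw [← extFrame_f hfr hξ, hf, Derivation.zero_apply, map_zero]

theorem exists_symContraction
    (hfr : ∀ x v, ∑ i, (ψ i).toFun x v • θ i x = v)
    (hξ : ∀ x (v : TangentSpace (𝓡 n) x), ∑ j, mvfderiv (𝓡 n) (fun y ↦ h j y) x v • ξ j x = v)
    (s : Cₛ^∞⟮𝓡 n; F, E⟯) : ∃ D, IsSymContraction s D := by
  obtain ⟨D, hD, hf, hg⟩ := (symFrame hfr hξ).exists_der_of_compatible 0 0 (.inr rfl)
    (fun i ↦ symOfFunHom n F E (dualPairing (ψ i) s)) (fun i ↦ mem_symGrade_zero _) (fun j ↦ by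
      rw [dualPairing_eq_sum hfr (ψ j) s, map_sum]
      refine Finset.sum_congr rfl fun i _ ↦ ?_
      rw [Derivation.zero_apply, map_zero, zero_mul, zero_add, map_mul]
      rfl)
  have hf' (r) : D (symOfFunHom n F E r) = 0 := by
    rw [← symFrame_f hfr hξ, hf, Derivation.zero_apply, map_zero]
  refine ⟨D, hD, hf', fun φ x ↦ ?_⟩
  have h1 : D (symOfDual n φ) = symOfFunHom n F E (dualPairing φ s) := by
    rw [symOfDual_eq_sum hfr, map_sum, dualPairing_eq_sum hfr φ s, map_sum]
    refine Finset.sum_congr rfl fun i _ ↦ ?_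
    rw [hD.2 0 _ (mem_symGrade_zero _), hf', zero_mul, zero_add, mul_zero, koszul_zero, one_smul,
      map_mul, ← hg i]
    rfl
  rw [h1]
  rfl

theorem IsSymContraction.unique
    (hfr : ∀ x v, ∑ i, (ψ i).toFun x v • θ i x = v)
    (hξ : ∀ x (v : TangentSpace (𝓡 n) x), ∑ j, mvfderiv (𝓡 n) (fun y ↦ h j y) x v • ξ j x = v)
    {s : Cₛ^∞⟮𝓡 n; F, E⟯}
    {D D' : symSections n F E →ₗ[ℝ] symSections n F E} (hD : IsSymContraction s D)
    (hD' : IsSymContraction s D') : D = D' := by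
  refine (symFrame hfr hξ).ext hD.mem hD'.mem (fun r ↦ ?_) fun i ↦ ?_
  · exact (hD.map_fun r).trans (hD'.map_fun r).symm
  · exact Subtype.ext (funext fun x ↦ (hD.map_dual (ψ i) x).trans (hD'.map_dual (ψ i) x).symm)

variable [∀ x, IsTopologicalAddGroup (E x)] [∀ x, ContinuousSMul ℝ (E x)]
  {cov : CovariantDerivative (𝓡 n) F E}
  (η : Cₛ^∞⟮𝓡 n; EuclideanSpace ℝ (Fin n), (TangentSpace (𝓡 n) : C → Type _)⟯)

theorem exists_extCovariant
    (hfr : ∀ x v, ∑ i, (ψ i).toFun x v • θ i x = v)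
    (hξ : ∀ x (v : TangentSpace (𝓡 n) x), ∑ j, mvfderiv (𝓡 n) (fun y ↦ h j y) x v • ξ j x = v)
    (hcov : CovariantDerivative.ContMDiffCovariantDerivative cov ∞) :
    ∃ D, IsExtCovariant cov η D := by
  obtain ⟨D, hD, hf, hg⟩ := (extFrame hfr hξ).exists_der_of_compatible 0 (vectorFieldDerivation η)
    (.inl rfl) (fun i ↦ extOfSection n (covSection cov hcov η (θ i)))
    (fun i ↦ by rw [zero_add]; exact extOfSection_mem _)
    (fun j ↦ extOfSection_covSection hcov η hfr (θ j))
  refine ⟨D, hD, fun r x ↦ congr_fun (congr_arg Subtype.val (hf r)) x, fun s x ↦ ?_⟩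
  have h1 : D (extOfSection n s) = extOfSection n (covSection cov hcov η s) := by
    rw [extOfSection_eq_sum hfr, map_sum, extOfSection_covSection hcov η hfr]
    refine Finset.sum_congr rfl fun i _ ↦ ?_
    rw [hD.2 0 (extOfFunHom n F E _) (extOfFun_mem _), mul_zero, koszul_zero, one_smul]
    exact congr_arg₂ (· + ·) (congr_arg (· * _) (hf _)) (congr_arg (_ * ·) (hg i))
  rw [h1]
  rfl

theorem exists_symCovariant
    (hfr : ∀ x v, ∑ i, (ψ i).toFun x v • θ i x = v)
    (hξ : ∀ x (v : TangentSpace (𝓡 n) x), ∑ j, mvfderiv (𝓡 n) (fun y ↦ h j y) x v • ξ j x = v)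
    (hcov : CovariantDerivative.ContMDiffCovariantDerivative cov ∞) :
    ∃ D, IsSymCovariant cov η D := by
  obtain ⟨D, hD, hf, hg⟩ := (symFrame hfr hξ).exists_der_of_compatible 0 (vectorFieldDerivation η)
    (.inl rfl) (fun i ↦ symOfDual n (dualCovSection θ ψ hcov η (ψ i)))
    (fun i ↦ mem_symGrade_zero _)
    (fun j ↦ symOfDual_dualCovSection hcov η hfr (ψ j))
  refine ⟨D, hD, fun r x ↦ congr_fun (congr_arg Subtype.val (hf r)) x,
    fun φ ↦ ⟨dualCovSection θ ψ hcov η φ, ?_, fun s x ↦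
      DFunLike.congr_fun (dualPairing_dualCovSection hcov η hfr φ s) x⟩⟩
  rw [symOfDual_eq_sum hfr, map_sum, symOfDual_dualCovSection hcov η hfr]
  refine Finset.sum_congr rfl fun i _ ↦ ?_
  rw [hD.2 0 _ (mem_symGrade_zero _), mul_zero, koszul_zero, one_smul]
  exact congr_arg₂ (· + ·) (congr_arg (· * _) (hf _)) (congr_arg (_ * ·) (hg i))

/-- The matrices are `⟨ψ_k, ∇θ_l⟩` and `⟨∇*ψ_l, θ_k⟩`, and the required identity is the definition
of the dual connection. The connection enters the transform only here. -/
theorem IsExtCovariant.isDualPair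
    (hfr : ∀ x v, ∑ i, (ψ i).toFun x v • θ i x = v)
    (hξ : ∀ x (v : TangentSpace (𝓡 n) x), ∑ j, mvfderiv (𝓡 n) (fun y ↦ h j y) x v • ξ j x = v)
    (hcov : CovariantDerivative.ContMDiffCovariantDerivative cov ∞)
    {D : extSections n F E →ₗ[ℝ] extSections n F E}
    (hD : IsExtCovariant cov η D) {D' : symSections n F E →ₗ[ℝ] symSections n F E}
    (hD' : IsSymCovariant cov η D') :
    (extFrame (θ := θ) (ψ := ψ) (h := h) (ξ := ξ) hfr hξ).IsDualPair
      (symFrame (F := F) (E := E) (θ := θ) (ψ := ψ) (h := h) (ξ := ξ) hfr hξ)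
      (vectorFieldDerivation η) D D' where
  left_mem := hD.mem
  right_mem := hD'.mem
  left_f r := Subtype.ext (funext (hD.map_fun r))
  right_f r := Subtype.ext (funext (hD'.map_fun r))
  exists_matrix := by
    choose φ hφ hφ' using fun l ↦ hD'.map_dual (ψ l)
    refine ⟨Matrix.of fun k l ↦ dualPairing (ψ k) (covSection cov hcov η (θ l)),
      Matrix.of fun k l ↦ dualPairing (φ l) (θ k), fun l ↦ ?_, fun l ↦ ?_, ?_⟩
    · simp only [extFrame_f, extFrame_g]
      refine Eq.trans ?_ (extOfSection_eq_sum hfr (covSection cov hcov η (θ l)))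
      exact Subtype.ext (funext (hD.map_section (θ l)))
    · simp only [symFrame_f, symFrame_g]
      exact (hφ l).trans (symOfDual_eq_sum hfr (φ l))
    · ext1 a b
      have h1 : vectorFieldDerivation η (dualPairing (ψ a) (θ b)) =
          dualPairing (φ a) (θ b) + dualPairing (ψ a) (covSection cov hcov η (θ b)) := by
        ext x
        exact (eq_add_of_sub_eq (hφ' a (θ b) x).symm)
      rw [Matrix.map_apply, Matrix.add_apply, Matrix.mul_apply, Matrix.mul_apply]
      refine Eq.trans ?_ h1.symm
      rw [dualPairing_eq_sum hfr (φ a), dualPairing_eq_sum hfr (ψ a) (covSection cov hcov η (θ b))]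
      rfl

theorem IsExtCovariant.unique
    (hfr : ∀ x v, ∑ i, (ψ i).toFun x v • θ i x = v)
    (hξ : ∀ x (v : TangentSpace (𝓡 n) x), ∑ j, mvfderiv (𝓡 n) (fun y ↦ h j y) x v • ξ j x = v)
    {D D' : extSections n F E →ₗ[ℝ] extSections n F E}
    (hD : IsExtCovariant cov η D) (hD' : IsExtCovariant cov η D') : D = D' := by
  refine (extFrame hfr hξ).ext hD.mem hD'.mem (fun r ↦ ?_) fun i ↦ ?_
  · exact Subtype.ext (funext fun x ↦ (hD.map_fun r x).trans (hD'.map_fun r x).symm)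
  · exact Subtype.ext (funext fun x ↦ (hD.map_section (θ i) x).trans (hD'.map_section (θ i) x).symm)

theorem IsSymCovariant.unique
    (hfr : ∀ x v, ∑ i, (ψ i).toFun x v • θ i x = v)
    (hξ : ∀ x (v : TangentSpace (𝓡 n) x), ∑ j, mvfderiv (𝓡 n) (fun y ↦ h j y) x v • ξ j x = v)
    {D D' : symSections n F E →ₗ[ℝ] symSections n F E}
    (hD : IsSymCovariant cov η D) (hD' : IsSymCovariant cov η D') : D = D' := by
  refine (symFrame hfr hξ).ext hD.mem hD'.mem (fun r ↦ ?_) fun i ↦ ?_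
  · exact Subtype.ext (funext fun x ↦ (hD.map_fun r x).trans (hD'.map_fun r x).symm)
  · obtain ⟨φ, h1, h2⟩ := hD.map_dual (ψ i)
    obtain ⟨φ', h1', h2'⟩ := hD'.map_dual (ψ i)
    have : φ = φ' := dualSection_ext hfr fun k ↦ by
      ext x
      exact (h2 (θ k) x).trans (h2' (θ k) x).symm
    rw [symFrame_g, h1, h1', this]

end Derivations

end

/-! ### The transform for `Γ(⋀E)` and `Γ(S(E*))` -/

noncomputable section

universe u

theorem units_smul_eq {V : Type*} [AddCommGroup V] [Module ℝ V] (ε : ℤˣ) (v : V) :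
    ε • v = ((ε : ℤ) : ℝ) • v := by
  rw [Units.smul_def, Int.cast_smul_eq_zsmul]

theorem neg_units_smul_eq {V : Type*} [AddCommGroup V] [Module ℝ V] (ε : ℤˣ) (v : V) :
    -(ε • v) = (-((ε : ℤ) : ℝ)) • v := by
  rw [units_smul_eq, neg_smul]

namespace FrameAlgebra.IsFourier

open MultiDer

variable {R : Type*} [CommRing R] [Algebra ℝ R] {I J : Type*} [Fintype I] [Fintype J]
  {A B : Type u} [Ring A] [Algebra ℝ A] [Ring B] [Algebra ℝ B]
  {𝒜 : ℤ → Submodule ℝ A} {ℬ : ℤ → Submodule ℝ B} [GradedAlgebra 𝒜] [GradedAlgebra ℬ] {e e' : ℤ}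
  {q q' : Matrix I I R} {X : J → Derivation ℝ R R} {h : J → R}
  {FA : FrameAlgebra 𝒜 e q X h} {FB : FrameAlgebra ℬ e' q' X h} {s s' : ℝ}
  {Φ : MultiDer 𝒜 →ₐ[ℝ] MultiDer ℬ}

theorem map_sum_f_mul_g (hΦ : IsFourier FA FB s s' Φ) (a : I → R) :
    Φ (fn 𝒜 (∑ i, FA.f (a i) * FA.g i)) =
      s • ∑ i, fn ℬ (FB.f (a i)) * der ℬ (-e') (FB.contr i) (FB.contr_mem i) := by
  rw [← fnHom_apply, map_sum, map_sum, Finset.smul_sum]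
  refine Finset.sum_congr rfl fun i _ ↦ ?_
  rw [map_mul, map_mul, fnHom_apply, fnHom_apply, hΦ.map_f, hΦ.map_g, mul_smul_comm]

theorem map_sum_f_mul_contr (hΦ : IsFourier FA FB s s' Φ) (hq : ∀ i j, q' i j = q j i)
    (a : I → R) :
    Φ (∑ i, fn 𝒜 (FA.f (a i)) * der 𝒜 (-e) (FA.contr i) (FA.contr_mem i)) =
      s' • fn ℬ (∑ i, FB.f (a i) * FB.g i) := by
  rw [← fnHom_apply, map_sum, map_sum, Finset.smul_sum]
  refine Finset.sum_congr rfl fun i _ ↦ ?_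
  rw [map_mul, map_mul, fnHom_apply, fnHom_apply, hΦ.map_f, hΦ.map_contr hq, mul_smul_comm]

theorem map_fn_eq_neg_smul (hΦ : IsFourier FA FB s s' Φ) {ε : ℤˣ} (hε : s = -((ε : ℤ) : ℝ))
    (a : I → R) {x : A} (hx : x = ∑ i, FA.f (a i) * FA.g i) {y : MultiDer ℬ}
    (hy : y = ∑ i, fn ℬ (FB.f (a i)) * der ℬ (-e') (FB.contr i) (FB.contr_mem i)) :
    Φ (fn 𝒜 x) = -(ε • y) := by
  rw [hx, hΦ.map_sum_f_mul_g, ← hy, hε]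
  exact (neg_units_smul_eq ε y).symm

theorem map_eq_smul_fn (hΦ : IsFourier FA FB s s' Φ) (hq : ∀ i j, q' i j = q j i) {ε : ℤˣ}
    (hε : s' = ((ε : ℤ) : ℝ)) (a : I → R) {x : MultiDer 𝒜}
    (hx : x = ∑ i, fn 𝒜 (FA.f (a i)) * der 𝒜 (-e) (FA.contr i) (FA.contr_mem i)) {y : B}
    (hy : y = ∑ i, FB.f (a i) * FB.g i) : Φ x = ε • fn ℬ y := by
  rw [hx, hΦ.map_sum_f_mul_contr hq, ← hy, hε]
  exact (units_smul_eq ε (fn ℬ y)).symm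

end FrameAlgebra.IsFourier

theorem IsGerstenhaberIso.isGradedLieIso {G G' : Type*} [Ring G] [Algebra ℝ G] [Ring G']
    [Algebra ℝ G'] {𝒢 : ℤ → Submodule ℝ G} {br : G →ₗ[ℝ] G →ₗ[ℝ] G} {𝒢' : ℤ → Submodule ℝ G'}
    {br' : G' →ₗ[ℝ] G' →ₗ[ℝ] G'} {Φ : G ≃ₐ[ℝ] G'} (hΦ : IsGerstenhaberIso 𝒢 br 𝒢' br' Φ) :
    IsGradedLieIso (shift 𝒢 1) br (shift 𝒢' 1) br' Φ.toLinearEquiv :=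
  ⟨fun k ↦ hΦ.map_grade (1 + k), hΦ.map_bracket⟩

section Fourier

variable {n : ℕ} {C : Type*} [TopologicalSpace C] [T2Space C] [SigmaCompactSpace C]
    [ChartedSpace (EuclideanSpace ℝ (Fin n)) C] [IsManifold (𝓡 n) ∞ C]
    {F : Type*} [NormedAddCommGroup F] [NormedSpace ℝ F] [FiniteDimensional ℝ F]
    {E : C → Type*} [∀ x, AddCommGroup (E x)] [∀ x, Module ℝ (E x)]
    [∀ x, TopologicalSpace (E x)] [∀ x, IsTopologicalAddGroup (E x)]
    [∀ x, ContinuousSMul ℝ (E x)] [TopologicalSpace (Bundle.TotalSpace F E)]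
    [FiberBundle F E] [VectorBundle ℝ F E] [ContMDiffVectorBundle ∞ F E (𝓡 n)]
    {N : ℕ} {θ : Fin N → Cₛ^∞⟮𝓡 n; F, E⟯} {ψ : Fin N → DualSection n F E}
    {J : Type*} [Fintype J] {h : J → C^∞⟮𝓡 n, C; 𝓘(ℝ, ℝ), ℝ⟯}
    {ξ : J → Cₛ^∞⟮𝓡 n; EuclideanSpace ℝ (Fin n), (TangentSpace (𝓡 n) : C → Type _)⟯}

theorem IsExtContraction.unique {φ : DualSection n F E}
    {D D' : extSections n F E →ₗ[ℝ] extSections n F E} (hD : IsExtContraction φ D)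
    (hD' : IsExtContraction φ D') : D = D' :=
  LinearMap.ext fun a ↦ Subtype.ext (funext fun x ↦ (hD.apply a x).trans (hD'.apply a x).symm)

theorem IsExtContraction.map_fun {φ : DualSection n F E}
    {D : extSections n F E →ₗ[ℝ] extSections n F E} (hD : IsExtContraction φ D)
    (r : C^∞⟮𝓡 n, C; 𝓘(ℝ, ℝ), ℝ⟯) : D (extOfFunHom n F E r) = 0 :=
  Subtype.ext (funext fun x ↦ (hD.apply _ x).trans
    (CliffordAlgebra.contractLeft_algebraMap (Q := (0 : QuadraticForm ℝ (E x))) _ _))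

theorem IsExtContraction.map_section {φ : DualSection n F E}
    {D : extSections n F E →ₗ[ℝ] extSections n F E} (hD : IsExtContraction φ D)
    (s : Cₛ^∞⟮𝓡 n; F, E⟯) : D (extOfSection n s) = extOfFunHom n F E (dualPairing φ s) :=
  Subtype.ext (funext fun x ↦ (hD.apply _ x).trans
    (CliffordAlgebra.contractLeft_ι (Q := (0 : QuadraticForm ℝ (E x))) _ _))

theorem IsSymContraction.map_dual_eq {s : Cₛ^∞⟮𝓡 n; F, E⟯}
    {D : symSections n F E →ₗ[ℝ] symSections n F E} (hD : IsSymContraction s D)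
    (φ : DualSection n F E) : D (symOfDual n φ) = symOfFunHom n F E (dualPairing φ s) :=
  Subtype.ext (funext fun x ↦ hD.map_dual φ x)

variable
    (hfr : ∀ x v, ∑ i, (ψ i).toFun x v • θ i x = v)
    (hξ : ∀ x (v : TangentSpace (𝓡 n) x), ∑ j, mvfderiv (𝓡 n) (fun y ↦ h j y) x v • ξ j x = v)

theorem der_extContraction_eq_sum {φ : DualSection n F E}
    {D : extSections n F E →ₗ[ℝ] extSections n F E} (hD : IsExtContraction φ D) :
    MultiDer.der (extGrade n F E) (-1) D hD.mem =
      ∑ k, MultiDer.fn (extGrade n F E) (extOfFunHom n F E (dualPairing φ (θ k))) *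
        MultiDer.der (extGrade n F E) (-1) ((extFrame hfr hξ).contr k)
          ((extFrame hfr hξ).contr_mem k) := by
  rw [(extFrame hfr hξ).der_eq_sum hD.mem]
  simp only [extFrame_f, extFrame_g, hD.map_fun, hD.map_section]
  simp only [← MultiDer.fnHom_apply, map_zero, zero_mul, Finset.sum_const_zero, zero_add]

theorem der_symContraction_eq_sum {s : Cₛ^∞⟮𝓡 n; F, E⟯}
    {D : symSections n F E →ₗ[ℝ] symSections n F E} (hD : IsSymContraction s D) :
    MultiDer.der (symGrade n F E) 0 D hD.mem =
      ∑ k, MultiDer.fn (symGrade n F E) (symOfFunHom n F E (dualPairing (ψ k) s)) *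
        MultiDer.der (symGrade n F E) (-0) ((symFrame hfr hξ).contr k)
          ((symFrame hfr hξ).contr_mem k) := by
  rw [(symFrame hfr hξ).der_eq_sum hD.mem]
  have hf (r) : D (symOfFunHom n F E r) = 0 := hD.map_fun r
  simp only [symFrame_f, symFrame_g, hf, hD.map_dual_eq]
  simp only [← MultiDer.fnHom_apply, map_zero, zero_mul, Finset.sum_const_zero, zero_add]

/-- The abstract contractions of the frame are the inner multiplications by the `ψ i`, to which the
rules of the transform apply. -/
theorem contr_eq {φ : Fin N → (extSections n F E →ₗ[ℝ] extSections n F E)}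
    (hφ : ∀ i, IsExtContraction (ψ i) (φ i)) (i : Fin N) : (extFrame hfr hξ).contr i = φ i := by
  refine (extFrame hfr hξ).ext ((extFrame hfr hξ).contr_mem i) (hφ i).mem (fun r ↦ ?_) fun k ↦ ?_
  · rw [(extFrame hfr hξ).contr_f, extFrame_f, (hφ i).map_fun]
  · rw [(extFrame hfr hξ).contr_g, extFrame_f, extFrame_g, (hφ i).map_section]
    rfl

theorem map_theta_of_frame {ε : ℤˣ}
    {Φ : MultiDer (extGrade n F E) →ₐ[ℝ] MultiDer (symGrade n F E)}
    (hΦ : FrameAlgebra.IsFourier (extFrame (θ := θ) (ψ := ψ) (h := h) (ξ := ξ) hfr hξ)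
      (symFrame (F := F) (E := E) (θ := θ) (ψ := ψ) (h := h) (ξ := ξ) hfr hξ)
      (-((ε : ℤ) : ℝ)) ((ε : ℤ) : ℝ) Φ) {s : Cₛ^∞⟮𝓡 n; F, E⟯}
    {D : symSections n F E →ₗ[ℝ] symSections n F E} (hD : IsSymContraction s D) :
    Φ (MultiDer.fn (extGrade n F E) (extOfSection n s)) =
      -(ε • MultiDer.der (symGrade n F E) 0 D hD.mem) :=
  hΦ.map_fn_eq_neg_smul rfl (fun i ↦ dualPairing (ψ i) s) (extOfSection_eq_sum hfr s)
    (der_symContraction_eq_sum hfr hξ hD)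

theorem map_psi_of_frame {ε : ℤˣ}
    {Φ : MultiDer (extGrade n F E) →ₐ[ℝ] MultiDer (symGrade n F E)}
    (hΦ : FrameAlgebra.IsFourier (extFrame (θ := θ) (ψ := ψ) (h := h) (ξ := ξ) hfr hξ)
      (symFrame (F := F) (E := E) (θ := θ) (ψ := ψ) (h := h) (ξ := ξ) hfr hξ)
      (-((ε : ℤ) : ℝ)) ((ε : ℤ) : ℝ) Φ) {φ : DualSection n F E}
    {D : extSections n F E →ₗ[ℝ] extSections n F E} (hD : IsExtContraction φ D) :
    Φ (MultiDer.der (extGrade n F E) (-1) D hD.mem) =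
      ε • MultiDer.fn (symGrade n F E) (symOfDual n φ) :=
  hΦ.map_eq_smul_fn (fun _ _ ↦ rfl) rfl (fun i ↦ dualPairing φ (θ i))
    (der_extContraction_eq_sum hfr hξ hD) (symOfDual_eq_sum hfr φ)

theorem map_nabla_of_frame {ε : ℤˣ}
    {Φ : MultiDer (extGrade n F E) →ₐ[ℝ] MultiDer (symGrade n F E)}
    (hΦ : FrameAlgebra.IsFourier (extFrame (θ := θ) (ψ := ψ) (h := h) (ξ := ξ) hfr hξ)
      (symFrame (F := F) (E := E) (θ := θ) (ψ := ψ) (h := h) (ξ := ξ) hfr hξ)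
      (-((ε : ℤ) : ℝ)) ((ε : ℤ) : ℝ) Φ) (hε : -((ε : ℤ) : ℝ) * ((ε : ℤ) : ℝ) = -1)
    {cov : CovariantDerivative (𝓡 n) F E}
    (hcov : CovariantDerivative.ContMDiffCovariantDerivative cov ∞)
    (η : Cₛ^∞⟮𝓡 n; EuclideanSpace ℝ (Fin n), (TangentSpace (𝓡 n) : C → Type _)⟯)
    {D : extSections n F E →ₗ[ℝ] extSections n F E}
    {D' : symSections n F E →ₗ[ℝ] symSections n F E}
    (hD : IsExtCovariant cov η D) (hD' : IsSymCovariant cov η D') :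
    Φ (MultiDer.der (extGrade n F E) 0 D hD.mem) =
      MultiDer.der (symGrade n F E) 0 D' hD'.mem :=
  hΦ.map_isDualPair (fun _ _ ↦ rfl) (by norm_num) hε (hD.isDualPair η hfr hξ hcov hD')

/-- The Fourier transform of a frame follows the Fourier transform rules. -/
theorem isFourier_of_frame {ε : ℤˣ}
    {Φ : MultiDer (extGrade n F E) →ₐ[ℝ] MultiDer (symGrade n F E)}
    (hΦ : FrameAlgebra.IsFourier (extFrame (θ := θ) (ψ := ψ) (h := h) (ξ := ξ) hfr hξ)
      (symFrame (F := F) (E := E) (θ := θ) (ψ := ψ) (h := h) (ξ := ξ) hfr hξ)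
      (-((ε : ℤ) : ℝ)) ((ε : ℤ) : ℝ) Φ) (hε : -((ε : ℤ) : ℝ) * ((ε : ℤ) : ℝ) = -1)
    {cov : CovariantDerivative (𝓡 n) F E}
    (hcov : CovariantDerivative.ContMDiffCovariantDerivative cov ∞) : IsFourier ε cov Φ where
  map_fun r := hΦ.map_f r
  map_theta _ _ hD := map_theta_of_frame hfr hξ hΦ hD
  map_psi _ _ hD := map_psi_of_frame hfr hξ hΦ hD
  map_nabla η _ _ hD hD' := map_nabla_of_frame hfr hξ hΦ hε hcov η hD hD'

/-- The rules fix the morphism on functions, on the `θ i`, on the contractions by `ψ i` and on the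
`∇_ξ` for the tangent frame. These lifts, though not the `nabla j` of the frame, generate equally
well by `algHom_ext_of_lifts`. -/
theorem IsFourier.unique {ε : ℤˣ}
    {Φ Φ' : MultiDer (extGrade n F E) →ₐ[ℝ] MultiDer (symGrade n F E)}
    (hfr : ∀ x v, ∑ i, (ψ i).toFun x v • θ i x = v)
    (hξ : ∀ x (v : TangentSpace (𝓡 n) x), ∑ j, mvfderiv (𝓡 n) (fun y ↦ h j y) x v • ξ j x = v)
    {cov : CovariantDerivative (𝓡 n) F E}
    (hcov : CovariantDerivative.ContMDiffCovariantDerivative cov ∞)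
    (hΦ : IsFourier ε cov Φ) (hΦ' : IsFourier ε cov Φ') : Φ = Φ' := by
  choose T hT using fun i ↦ exists_symContraction hfr hξ (θ i)
  choose K hK using fun i ↦ exists_extContraction hfr hξ (ψ i)
  choose D hD using fun j ↦ exists_extCovariant (ξ j) hfr hξ hcov
  choose D' hD' using fun j ↦ exists_symCovariant (ξ j) hfr hξ hcov
  refine (extFrame hfr hξ).algHom_ext_of_lifts (fun r ↦ ?_) (fun i ↦ ?_) (fun i ↦ ?_) D
    (fun j ↦ (hD j).mem) (fun j r ↦ ?_) fun j ↦ ?_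
  · exact (hΦ.map_fun r).trans (hΦ'.map_fun r).symm
  · exact (hΦ.map_theta _ _ (hT i)).trans (hΦ'.map_theta _ _ (hT i)).symm
  · have h1 : MultiDer.der (extGrade n F E) (-1) ((extFrame hfr hξ).contr i)
        ((extFrame hfr hξ).contr_mem i) = MultiDer.der (extGrade n F E) (-1) (K i) (hK i).mem :=
      MultiDer.der_congr _ rfl (contr_eq hfr hξ hK i)
    rw [h1]
    exact (hΦ.map_psi _ _ (hK i)).trans (hΦ'.map_psi _ _ (hK i)).symm
  · exact Subtype.ext (funext ((hD j).map_fun r))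
  · exact (hΦ.map_nabla _ _ _ (hD j) (hD' j)).trans (hΦ'.map_nabla _ _ _ (hD j) (hD' j)).symm

/-- For each sign there is a Fourier transform, and it follows the rules of every connection. -/
theorem exists_fourierEquiv_sign
    (hfr : ∀ x v, ∑ i, (ψ i).toFun x v • θ i x = v)
    (hξ : ∀ x (v : TangentSpace (𝓡 n) x), ∑ j, mvfderiv (𝓡 n) (fun y ↦ h j y) x v • ξ j x = v)
    (ε : ℤˣ)
    {brA : MultiDer (extGrade n F E) →ₗ[ℝ] MultiDer (extGrade n F E) →ₗ[ℝ]
      MultiDer (extGrade n F E)} (hA : IsSchoutenBracket (extGrade n F E) brA)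
    {brB : MultiDer (symGrade n F E) →ₗ[ℝ] MultiDer (symGrade n F E) →ₗ[ℝ]
      MultiDer (symGrade n F E)} (hB : IsSchoutenBracket (symGrade n F E) brB) :
    ∃ Φ : MultiDer (extGrade n F E) ≃ₐ[ℝ] MultiDer (symGrade n F E),
      IsGerstenhaberIso (MultiDer.grade (extGrade n F E)) brA
        (MultiDer.grade (symGrade n F E)) brB Φ ∧
      ∀ cov : CovariantDerivative (𝓡 n) F E,
        CovariantDerivative.ContMDiffCovariantDerivative cov ∞ →
        IsFourier ε cov (Φ : MultiDer (extGrade n F E) →ₐ[ℝ] MultiDer (symGrade n F E)) := by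
  have h1 : ((ε : ℤ) : ℝ) * ((ε : ℤ) : ℝ) = 1 := by
    rcases Int.units_eq_one_or ε with rfl | rfl <;> norm_num
  have h2 : -((ε : ℤ) : ℝ) * -((ε : ℤ) : ℝ) = 1 := by rw [neg_mul_neg, h1]
  have h3 : -((ε : ℤ) : ℝ) * ((ε : ℤ) : ℝ) = -1 := by rw [neg_mul, h1]
  -- The signs are `s = -ε` and `s' = ε`, and the degrees of the frames are `e = 1`, `e' = 0`. The
  -- transform is built from the frames alone, before any connection is given.
  obtain ⟨Φ, hΦ, hΦ'⟩ := FrameAlgebra.exists_fourierEquiv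
    (extFrame (F := F) (E := E) (θ := θ) (ψ := ψ) (h := h) (ξ := ξ) hfr hξ)
    (symFrame (F := F) (E := E) (θ := θ) (ψ := ψ) (h := h) (ξ := ξ) hfr hξ) (fun _ _ ↦ rfl)
    (by norm_num) h2 h1 h3 hA hB
  exact ⟨Φ, hΦ, fun cov hcov ↦ isFourier_of_frame hfr hξ hΦ' h3 hcov⟩

theorem existsUnique_extContraction (φ : DualSection n F E) : ∃! D, IsExtContraction φ D := by
  obtain ⟨N, θ, ψ, hfr⟩ := exists_finite_frame (n := n) F E
  obtain ⟨J, _, h, ξ, hξ⟩ := exists_finite_tangent_frame (n := n) (C := C)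
  obtain ⟨D, hD⟩ := exists_extContraction hfr hξ φ
  exact ⟨D, hD, fun D' hD' ↦ IsExtContraction.unique hD' hD⟩

theorem existsUnique_symContraction (s : Cₛ^∞⟮𝓡 n; F, E⟯) : ∃! D, IsSymContraction s D := by
  obtain ⟨N, θ, ψ, hfr⟩ := exists_finite_frame (n := n) F E
  obtain ⟨J, _, h, ξ, hξ⟩ := exists_finite_tangent_frame (n := n) (C := C)
  obtain ⟨D, hD⟩ := exists_symContraction hfr hξ s
  exact ⟨D, hD, fun D' hD' ↦ IsSymContraction.unique hfr hξ hD' hD⟩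

theorem existsUnique_extCovariant
    (η : Cₛ^∞⟮𝓡 n; EuclideanSpace ℝ (Fin n), (TangentSpace (𝓡 n) : C → Type _)⟯)
    {cov : CovariantDerivative (𝓡 n) F E}
    (hcov : CovariantDerivative.ContMDiffCovariantDerivative cov ∞) :
    ∃! D, IsExtCovariant cov η D := by
  obtain ⟨N, θ, ψ, hfr⟩ := exists_finite_frame (n := n) F E
  obtain ⟨J, _, h, ξ, hξ⟩ := exists_finite_tangent_frame (n := n) (C := C)
  obtain ⟨D, hD⟩ := exists_extCovariant η hfr hξ hcov
  exact ⟨D, hD, fun D' hD' ↦ IsExtCovariant.unique η hfr hξ hD' hD⟩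

theorem existsUnique_symCovariant
    (η : Cₛ^∞⟮𝓡 n; EuclideanSpace ℝ (Fin n), (TangentSpace (𝓡 n) : C → Type _)⟯)
    {cov : CovariantDerivative (𝓡 n) F E}
    (hcov : CovariantDerivative.ContMDiffCovariantDerivative cov ∞) :
    ∃! D, IsSymCovariant cov η D := by
  obtain ⟨N, θ, ψ, hfr⟩ := exists_finite_frame (n := n) F E
  obtain ⟨J, _, h, ξ, hξ⟩ := exists_finite_tangent_frame (n := n) (C := C)
  obtain ⟨D, hD⟩ := exists_symCovariant η hfr hξ hcov
  exact ⟨D, hD, fun D' hD' ↦ IsSymCovariant.unique η hfr hξ hD' hD⟩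

/-- For each sign there is a Fourier transform, characterized by the rules of any connection. -/
theorem exists_fourierTransform (ε : ℤˣ)
    {brA : MultiDer (extGrade n F E) →ₗ[ℝ] MultiDer (extGrade n F E) →ₗ[ℝ]
      MultiDer (extGrade n F E)} (hA : IsSchoutenBracket (extGrade n F E) brA)
    {brB : MultiDer (symGrade n F E) →ₗ[ℝ] MultiDer (symGrade n F E) →ₗ[ℝ]
      MultiDer (symGrade n F E)} (hB : IsSchoutenBracket (symGrade n F E) brB) :
    ∃ Φ : MultiDer (extGrade n F E) ≃ₐ[ℝ] MultiDer (symGrade n F E),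
      IsGerstenhaberIso (MultiDer.grade (extGrade n F E)) brA
        (MultiDer.grade (symGrade n F E)) brB Φ ∧
      IsGradedLieIso (MultiDer.lieGrade (extGrade n F E)) brA
        (MultiDer.lieGrade (symGrade n F E)) brB Φ.toLinearEquiv ∧
      ∀ cov : CovariantDerivative (𝓡 n) F E,
        CovariantDerivative.ContMDiffCovariantDerivative cov ∞ →
        IsFourier ε cov (Φ : MultiDer (extGrade n F E) →ₐ[ℝ] MultiDer (symGrade n F E)) ∧
        ∀ Φ' : MultiDer (extGrade n F E) →ₐ[ℝ] MultiDer (symGrade n F E),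
          IsFourier ε cov Φ' → Φ' = Φ := by
  have h1 := exists_finite_frame (n := n) F E
  have h2 := exists_finite_tangent_frame (n := n) (C := C)
  have hfr := h1.choose_spec.choose_spec.choose_spec
  let _ : Fintype h2.choose := h2.choose_spec.choose
  have hξ := h2.choose_spec.choose_spec.choose_spec.choose_spec
  have hΦ := exists_fourierEquiv_sign hfr hξ ε hA hB
  exact ⟨hΦ.choose, hΦ.choose_spec.1, hΦ.choose_spec.1.isGradedLieIso,
    fun cov hcov ↦ ⟨hΦ.choose_spec.2 cov hcov,
      fun Φ' h' ↦ IsFourier.unique hfr hξ hcov h' (hΦ.choose_spec.2 cov hcov)⟩⟩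

end Fourier

end

theorem mainTheorem7 {n : ℕ} {C : Type*} [TopologicalSpace C] [T2Space C] [SigmaCompactSpace C]
    [ChartedSpace (EuclideanSpace ℝ (Fin n)) C] [IsManifold (𝓡 n) ∞ C]
    {F : Type*} [NormedAddCommGroup F] [NormedSpace ℝ F] [FiniteDimensional ℝ F]
    {E : C → Type*} [∀ x, AddCommGroup (E x)] [∀ x, Module ℝ (E x)]
    [∀ x, TopologicalSpace (E x)] [∀ x, IsTopologicalAddGroup (E x)]
    [∀ x, ContinuousSMul ℝ (E x)] [TopologicalSpace (Bundle.TotalSpace F E)]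
    [FiberBundle F E] [VectorBundle ℝ F E] [ContMDiffVectorBundle ∞ F E (𝓡 n)] :
    -- the Schouten brackets exist and are unique
    ∃ (brA : MultiDer (extGrade n F E) →ₗ[ℝ] MultiDer (extGrade n F E) →ₗ[ℝ]
          MultiDer (extGrade n F E))
      (brB : MultiDer (symGrade n F E) →ₗ[ℝ] MultiDer (symGrade n F E) →ₗ[ℝ]
          MultiDer (symGrade n F E)),
      (IsSchoutenBracket (extGrade n F E) brA ∧
        ∀ br, IsSchoutenBracket (extGrade n F E) br → br = brA) ∧
      (IsSchoutenBracket (symGrade n F E) brB ∧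
        ∀ br, IsSchoutenBracket (symGrade n F E) br → br = brB) ∧
      -- connections and the derivations they induce exist
      (∃ cov : CovariantDerivative (𝓡 n) F E, CovariantDerivative.ContMDiffCovariantDerivative cov ∞) ∧
      (∀ ψ : DualSection n F E, ∃! D, IsExtContraction ψ D) ∧
      (∀ θ : Cₛ^∞⟮𝓡 n; F, E⟯, ∃! D, IsSymContraction θ D) ∧
      (∀ cov : CovariantDerivative (𝓡 n) F E, CovariantDerivative.ContMDiffCovariantDerivative cov ∞ →
        ∀ ξ, (∃! D, IsExtCovariant cov ξ D) ∧ ∃! D, IsSymCovariant cov ξ D) ∧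
      -- for each sign, the Fourier transform, independent of the connection
      ∀ ε : ℤˣ, ∃ Φ : MultiDer (extGrade n F E) ≃ₐ[ℝ] MultiDer (symGrade n F E),
        IsGerstenhaberIso (MultiDer.grade (extGrade n F E)) brA
          (MultiDer.grade (symGrade n F E)) brB Φ ∧
        IsGradedLieIso (MultiDer.lieGrade (extGrade n F E)) brA
          (MultiDer.lieGrade (symGrade n F E)) brB Φ.toLinearEquiv ∧
        ∀ cov : CovariantDerivative (𝓡 n) F E, CovariantDerivative.ContMDiffCovariantDerivative cov ∞ →
          IsFourier ε cov (Φ : MultiDer (extGrade n F E) →ₐ[ℝ] MultiDer (symGrade n F E)) ∧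
          ∀ Φ' : MultiDer (extGrade n F E) →ₐ[ℝ] MultiDer (symGrade n F E),
            IsFourier ε cov Φ' → Φ' = Φ := by
  have hA := MultiDer.exists_isSchoutenBracket (extGrade_isGradedComm n F E)
  have hB := MultiDer.exists_isSchoutenBracket (symGrade_isGradedComm n F E)
  exact ⟨hA.choose, hB.choose,
    ⟨hA.choose_spec, fun br hbr ↦ IsSchoutenBracket.unique hbr hA.choose_spec⟩,
    ⟨hB.choose_spec, fun br hbr ↦ IsSchoutenBracket.unique hbr hB.choose_spec⟩,
    exists_connection, existsUnique_extContraction, existsUnique_symContraction,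
    fun cov hcov η ↦ ⟨existsUnique_extCovariant η hcov, existsUnique_symCovariant η hcov⟩,
    fun ε ↦ exists_fourierTransform ε hA.choose_spec hB.choose_spec⟩
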